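/- For an integer $k\ge 2$, the Unbalanced Supersaturation Conjecture for $C_{2k}$ states: there is a constant $c=c(k)>0$ such that every $m$-edge bipartite graph $G$ with vertex bipartition $A\sqcup B$ and with $m\ge 100k\left(|A|+|B|+(|A||B|)^{(k+1)/(2k)}\right)$ contains at least $c\,\frac{m^{2k}}{|A|^k|B|^k}$ copies of $C_{2k}$ (subgraphs isomorphic to the cycle on $2k$ vertices). Corollary. Let $k\ge 2$ be an integer and assume the Unbalanced Supersaturation Conjecture for $C_{2k}$. Then there is an algorithm that lists the $C_{2k}$'s of a graph in time $\widetilde O\left(t+\min(m^{2k/(k+1)},n^2)\right)$, where $n$, $m$ and $t$ are its numbers of vertices, edges and copies of $C_{2k}$. Precisely: there are a deterministic word-RAM program $P$ and constants $C$, $e$, $a$ (depending only on $k$) such that, for every simple graph $G$ on the vertex set $\{0,\dots,n-1\}$ with $m$ edges, $m\ge n\ge 1$, given as $n$, $m$ and a list of its edges in any order, and for every word length $w\ge a\log_2 n$, the program $P$ run with $w$-bit words halts after at most $$C\left(t+\min\left(m^{2k/(k+1)},n^2\right)\right)(\log_2 n)^{e}$$ unit-cost steps, having output every copy of $C_{2k}$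 in $G$ exactly once, each as the sequence of its $2k$ vertices in cyclic order. The value of $t$ is not given to the program. -/

import Mathlib

/-! ### The Unbalanced Supersaturation Conjecture -/

/-- The Unbalanced Supersaturation Conjecture for cycles of length `2 * k`: there is a constant
`c > 0` such that every bipartite graph `G` with vertex bipartition `A ⊔ B` and with
`m ≥ 100 k (|A| + |B| + (|A| |B|) ^ ((k + 1) / (2 k)))` edges contains at least
`c * m ^ (2 k) / (|A| ^ k |B| ^ k)` copies of `C_{2k}`. -/
def UnbalancedSupersaturation (k : ℕ) : Prop :=
  ∃ c : ℝ, 0 < c ∧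
    ∀ (V : Type) [Fintype V] [DecidableEq V] (G : SimpleGraph V) (A B : Finset V),
      A ∪ B = Finset.univ → G.IsBipartiteWith (A : Set V) (B : Set V) →
      100 * (k : ℝ) * ((A.card : ℝ) + (B.card : ℝ)
          + ((A.card : ℝ) * (B.card : ℝ)) ^ (((k : ℝ) + 1) / (2 * (k : ℝ))))
        ≤ (G.edgeSet.ncard : ℝ) →
      c * ((G.edgeSet.ncard : ℝ) ^ (2 * k) / ((A.card : ℝ) ^ k * (B.card : ℝ) ^ k))
        ≤ (G.copyCount (SimpleGraph.cycleGraph (2 * k)) : ℝ)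

/-! ### A word RAM with `w`-bit words and unit-cost instructions -/

namespace WordRAM

/-- The binary word operations. -/
inductive BinOp where
  | add | sub | mul | div | mod | and | or | xor | shl | shr

/-- All operations act on `w`-bit words; results are taken modulo `2 ^ w`
(division by zero gives zero, and the remainder modulo zero is the dividend). -/
def BinOp.eval (w : ℕ) : BinOp → ℕ → ℕ → ℕ
  | .add, a, b => (a + b) % 2 ^ w
  | .sub, a, b => (a + (2 ^ w - b)) % 2 ^ w
  | .mul, a, b => (a * b) % 2 ^ w
  | .div, a, b => (a / b) % 2 ^ w
  | .mod, a, b => (a % b) % 2 ^ w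
  | .and, a, b => (a &&& b) % 2 ^ w
  | .or, a, b => (a ||| b) % 2 ^ w
  | .xor, a, b => (a ^^^ b) % 2 ^ w
  | .shl, a, b => (a <<< b) % 2 ^ w
  | .shr, a, b => (a >>> b) % 2 ^ w

/-- Instructions. The numbers `dst`, `src`, `a`, `b`, `addr` name registers, and `l` is a position
in the program. `load` and `store` access the memory cell whose address is in register `addr`;
`output` appends the content of a register to the output. -/
inductive Instr where
  | const (dst val : ℕ)
  | op (o : BinOp) (dst a b : ℕ)
  | load (dst addr : ℕ)
  | store (addr src : ℕ)
  | jump (l : ℕ)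
  | jumpEq (a b l : ℕ)
  | jumpLt (a b l : ℕ)
  | output (src : ℕ)

/-- A program is a finite list of instructions; it mentions only finitely many registers. -/
abbrev Program := List Instr

/-- A machine configuration: program counter, registers, memory, and the output written so far. -/
structure Config where
  pc : ℕ
  reg : ℕ → ℕ
  mem : ℕ → ℕ
  out : List ℕ

/-- The effect of one instruction on a machine with `w`-bit words. -/
def Instr.exec (w : ℕ) (s : Config) : Instr → Config
  | .const dst val =>
      { s with pc := s.pc + 1, reg := Function.update s.reg dst (val % 2 ^ w) }
  | .op o dst a b =>
      { s with pc := s.pc + 1, reg := Function.update s.reg dst (o.eval w (s.reg a) (s.reg b)) }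
  | .load dst addr =>
      { s with pc := s.pc + 1, reg := Function.update s.reg dst (s.mem (s.reg addr)) }
  | .store addr src =>
      { s with pc := s.pc + 1, mem := Function.update s.mem (s.reg addr) (s.reg src) }
  | .jump l => { s with pc := l }
  | .jumpEq a b l => { s with pc := if s.reg a = s.reg b then l else s.pc + 1 }
  | .jumpLt a b l => { s with pc := if s.reg a < s.reg b then l else s.pc + 1 }
  | .output src => { s with pc := s.pc + 1, out := s.out ++ [s.reg src] }

/-- One step of the machine. The machine has halted once the program counter is outside the
program, and then its configuration does not change any more. -/
def step (w : ℕ) (P : Program) (s : Config) : Config :=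
  match P[s.pc]? with
  | none => s
  | some i => i.exec w s

/-- The initial configuration: the input words are in the first memory cells; all other memory
cells and all registers are zero. -/
def init (w : ℕ) (input : List ℕ) : Config where
  pc := 0
  reg := fun _ => 0
  mem := fun a => input.getD a 0 % 2 ^ w
  out := []

/-- On the given input, the program `P`, run with `w`-bit words, halts after at most `T` steps,
having written exactly `output`. -/
def HaltsWith (w : ℕ) (P : Program) (input : List ℕ) (T : ℕ) (output : List ℕ) : Prop :=
  P.length ≤ ((step w P)^[T] (init w input)).pc ∧ ((step w P)^[T] (init w input)).out = output

end WordRAM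

/-! ### Input and output of a cycle listing algorithm -/

/-- `E` lists every edge of `G` exactly once, in any order and with either orientation. -/
def IsEdgeListing {n : ℕ} (G : SimpleGraph (Fin n)) (E : List (Fin n × Fin n)) : Prop :=
  (E.map fun p => s(p.1, p.2)).Nodup ∧ ∀ e, e ∈ E.map (fun p => s(p.1, p.2)) ↔ e ∈ G.edgeSet

/-- The input words that describe a graph on `{0, …, n - 1}` by its list of edges:
`n, m, u₁, v₁, …, u_m, v_m`. -/
def graphInput (n : ℕ) (E : List (Fin n × Fin n)) : List ℕ :=
  n :: E.length :: E.flatMap fun p => [(p.1 : ℕ), (p.2 : ℕ)]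

/-- The words `ys` list the copies of `C_ℓ` in `G`: they are a concatenation of blocks of `ℓ`
words, each block giving the vertices of a copy of `C_ℓ` in cyclic order, and every subgraph of `G`
that is isomorphic to `C_ℓ` is given by exactly one block. -/
def ListsCycles {n : ℕ} (G : SimpleGraph (Fin n)) (ℓ : ℕ) (ys : List ℕ) : Prop :=
  ∃ cs : List (SimpleGraph.Copy (SimpleGraph.cycleGraph ℓ) G),
    ys = cs.flatMap (fun c => List.ofFn fun i : Fin ℓ => (c i : ℕ)) ∧
    (cs.map fun c => c.toSubgraph).Nodup ∧
    ∀ H : G.Subgraph, Nonempty (SimpleGraph.cycleGraph ℓ ≃g H.coe) →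
      ∃ c ∈ cs, c.toSubgraph = H

/-! The algorithm is colour coding combined with a two-sided search from the top vertex of each
cycle. Rank the vertices by degree, with ties broken by number. A copy of the cycle has a unique
vertex `v` of highest rank; cut it there and at the opposite vertex `u`. Given `2 * k` distinct
colours, the program computes, for every `v` of the first colour, `k` levels in the forward
direction and `k` levels in the backward direction. Each level contains only vertices of the
prescribed colour and of rank below `v`, and each vertex stores its neighbours in the previous
level. Descending from a common `u` of both last levels never gets stuck, so listing costs a
constant per closed walk found (`productive_steps`, `chainCost_le`), and distinct colours make each
closed walk a cycle (`exists_copy`). For fixed colours a cycle is found at most once, hence this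
part costs `O(t)` (`sum_foundAt_le`).

Colours are residues modulo small numbers `p`. For any `2 * k` distinct vertices some `p = O(k² log
n)` separates them, because the central binomial coefficient divides every nonzero number that is
divisible by all small moduli, and is too large to divide the product of the differences
(`exists_prime_pow_not_dvd`, `exists_modulus`). Only polylogarithmically many pairs of a modulus and
a colouring are tried. A cycle found for several of them is written once, since every written tuple
is marked in memory.

What remains is the cost of the search for one colouring: the sum, over the top vertices `v` and the
levels `i < k`, of the degrees in the level. Let `T` be the target bound up to logarithms and `τ = T
^ (1 / k)`. Then `t ≤ τ ^ k`, and `m ^ 2 ≤ τ ^ (k + 1)`: this is immediate if the minimum in the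
bound is `m ^ (2k / (k + 1))`, and otherwise follows from supersaturation for one of `log n`
bipartitions of the vertices by binary digits (`ncard_pow_le`). Top vertices of degree above `τ`
number at most `2m / τ` and cost at most `2m` per level, in all `4 m ^ 2 / τ ≤ 4 τ ^ k`.

For top vertices of degree at most `τ`, all vertices reached have degree at most `τ` as well,
because the rank is led by the degree. Supersaturation gives `e(A, B) ^ 2 ≤ C τ |A| |B|` for
disjoint sets of such vertices (`interedges_sq_le`). A dyadic decomposition turns this into a norm
bound for the adjacency form, with logarithmic loss (`form_sq_le`). Let `f i x` be the number of top
vertices in a class `W` with `x` in their `i`-th level. Then `f (i + 1)` is at most the adjacency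
operator applied to `f i`, so `‖f i‖² ≤ (polylog · τ) ^ i |W|` (`sum_mult_sq_le`). Cauchy–Schwarz
against the degrees, within a dyadic class of degrees of `v`, bounds the cost by `polylog · τ ^ k`
(`GraphBound.class_le`, `GraphBound.sum_lvl_le`).

The machine model is handled by a small structured language with a weakest precondition calculus.
Its compiler is correct with a constant factor in time (`Cmd.sound`, `Cmd.haltsWith`). Memory starts
as zero and every search uses its own region, so nothing has to be cleared; addresses stay
polynomial in `n`. The program and the combinatorics meet only in the hypothesis `CostLe`, which
bounds the cost for one colouring. -/

set_option linter.constructorNameAsVariable false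

/-! ### A structured language over the word RAM -/

namespace WordRAM

/-- Program variables. -/
inductive Var where
  | n | m | i | u | y | z | b | sz | L | p | pw | code | f | v | r | q | lo | hi | tl | jj | cd
  | c (a : ℕ) | x (a : ℕ) | j (a : ℕ)
  deriving DecidableEq

/-- The number of a variable. -/
def Var.enc : Var → ℕ
  | .n => 0 | .m => 1 | .i => 2 | .u => 3 | .y => 4 | .z => 5 | .b => 6 | .sz => 7 | .L => 8
  | .p => 9 | .pw => 10 | .code => 11 | .f => 12 | .v => 13 | .r => 14 | .q => 15 | .lo => 16
  | .hi => 17 | .tl => 18 | .jj => 19 | .cd => 20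
  | .c a => 3 * a + 21 | .x a => 3 * a + 22 | .j a => 3 * a + 23

theorem Var.enc_injective : Function.Injective Var.enc := by
  intro s t h
  cases s <;> cases t <;> simp only [Var.enc] at h <;> first | rfl | omega | (congr 1; omega)

/-- The registers of a variable, of a temporary, and of a loop. -/
abbrev regVar (x : Var) : ℕ := 3 * x.enc
-- The residue modulo 3 separates the three kinds of registers, so writing to one kind never
-- disturbs another.
abbrev regTmp (d : ℕ) : ℕ := 3 * d + 1
abbrev regLoop (d : ℕ) : ℕ := 3 * d + 2

/-- Expressions; `ld tag r x y` reads the memory cell of the array `tag` with indices `r, x, y`. -/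
inductive Ex where
  | lit (a : ℕ)
  | var (x : Var)
  | add (a b : Ex)
  | mul (a b : Ex)
  | div (a b : Ex)
  | mod (a b : Ex)
  | ld (tag : ℕ) (r x y : Ex)

/-- Commands. -/
inductive Cmd where
  | skip
  | set (x : Var) (e : Ex)
  | st (tag : ℕ) (r x y e : Ex)
  | out (e : Ex)
  | seq (c d : Cmd)
  | whenEq (a b : Ex) (c : Cmd)
  | whenLt (a b : Ex) (c : Cmd)
  | loop (x : Var) (a b : Ex) (c : Cmd)

/-- States of the structured language. -/
structure St where
  var : Var → ℕ
  mem : ℕ → ℕ → ℕ → ℕ → ℕ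
  out : List ℕ
  time : ℕ

namespace St

def set (s : St) (x : Var) (a : ℕ) : St := { s with var := Function.update s.var x a }

/-- Time counts executed commands and loop rounds, not machine instructions; compilation charges a
constant number of instructions to each tick. -/
def tick (s : St) : St := { s with time := s.time + 1 }

def store (s : St) (tag r x y a : ℕ) : St :=
  { s with mem := fun tag' r' x' y' =>
      if tag' = tag ∧ r' = r ∧ x' = x ∧ y' = y then a else s.mem tag' r' x' y' }

def put (s : St) (a : ℕ) : St := { s with out := s.out ++ [a] }

end St

/-- The address of the cell of the array `tag` with indices `r, x, y`. -/
def addr (N tag r x y : ℕ) : ℕ := ((r * 16 + tag) * N + x) * N + y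

/-- The address is a number in mixed radix with digits `y`, `x` in base `N` and `tag` in base 16.
The region `r` is the leading part and is unbounded. -/
theorem addr_inj {N tag r x y tag' r' x' y' : ℕ} (ht : tag < 16) (ht' : tag' < 16) (hx : x < N)
    (hx' : x' < N) (hy : y < N) (hy' : y' < N) (h : addr N tag r x y = addr N tag' r' x' y') :
    tag = tag' ∧ r = r' ∧ x = x' ∧ y = y' := by
  have key : ∀ {M a b a' b' : ℕ}, b < M → b' < M → a * M + b = a' * M + b' → a = a' ∧ b = b' := by
    intro M a b a' b' hb hb' h
    have h1 := congrArg (· / M) h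
    have hM : 0 < M := by omega
    simp only [mul_comm _ M, Nat.mul_add_div hM, Nat.div_eq_of_lt hb, Nat.div_eq_of_lt hb',
      add_zero] at h1
    subst h1
    exact ⟨rfl, by omega⟩
  obtain ⟨h1, h2⟩ := key hy hy' h
  obtain ⟨h3, h4⟩ := key hx hx' h1
  obtain ⟨h5, h6⟩ := key ht ht' h3
  exact ⟨h6, h5, h4, h2⟩

/-- The value of an expression. -/
def Ex.eval (s : St) : Ex → ℕ
  | .lit a => a
  | .var x => s.var x
  | .add a b => a.eval s + b.eval s
  | .mul a b => a.eval s * b.eval s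
  | .div a b => a.eval s / b.eval s
  | .mod a b => a.eval s % b.eval s
  | .ld tag r x y => s.mem tag (r.eval s) (x.eval s) (y.eval s)

/-- A memory access is legal: its indices are below the dimension `N`, and its address fits. -/
def Access (N B : ℕ) (s : St) (tag r x y : ℕ) : Prop :=
  s.var .n = N ∧ tag < 16 ∧ x < N ∧ y < N ∧ addr N tag r x y < B

/-- All intermediate results are smaller than `B`. -/
def Ex.fits (N B : ℕ) (s : St) : Ex → Prop
  | .lit a => a < B
  | .var _ => True
  | .add a b => a.fits N B s ∧ b.fits N B s ∧ a.eval s + b.eval s < B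
  | .mul a b => a.fits N B s ∧ b.fits N B s ∧ a.eval s * b.eval s < B
  | .div a b => a.fits N B s ∧ b.fits N B s ∧ a.eval s / b.eval s < B
  | .mod a b => a.fits N B s ∧ b.fits N B s ∧ a.eval s % b.eval s < B
  | .ld tag r x y => r.fits N B s ∧ x.fits N B s ∧ y.fits N B s ∧
      Access N B s tag (r.eval s) (x.eval s) (y.eval s)

/-- Weakest precondition: the command runs without overflow and ends in a state satisfying `Q`. -/
def wp (N B : ℕ) : Cmd → (St → Prop) → St → Prop
  | .skip, Q, s => Q s
  -- The variable `n` must never change: compiled address computations multiply by it.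
  | .set x e, Q, s => e.fits N B s ∧ e.eval s < B ∧ x ≠ .n ∧ Q (s.set x (e.eval s)).tick
  | .st tag r x y e, Q, s => r.fits N B s ∧ x.fits N B s ∧ y.fits N B s ∧ e.fits N B s ∧
      Access N B s tag (r.eval s) (x.eval s) (y.eval s) ∧
      Q (s.store tag (r.eval s) (x.eval s) (y.eval s) (e.eval s)).tick
  | .out e, Q, s => e.fits N B s ∧ Q (s.put (e.eval s)).tick
  | .seq c d, Q, s => wp N B c (wp N B d Q) s
  | .whenEq a b c, Q, s => a.fits N B s ∧ b.fits N B s ∧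
      (a.eval s = b.eval s → wp N B c Q s.tick) ∧ (a.eval s ≠ b.eval s → Q s.tick)
  | .whenLt a b c, Q, s => a.fits N B s ∧ b.fits N B s ∧
      (a.eval s < b.eval s → wp N B c Q s.tick) ∧ (¬ a.eval s < b.eval s → Q s.tick)
  -- Both bounds are evaluated once, on entry. The invariant is part of the precondition, which
  -- makes it a structural recursion on the command.
  | .loop x a b c, Q, s => a.fits N B s ∧ b.fits N B s ∧ a.eval s < B ∧ b.eval s < B ∧ x ≠ .n ∧
      a.eval s ≤ b.eval s ∧
      ∃ I : ℕ → St → Prop, I (a.eval s) s.tick ∧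
        (∀ j, a.eval s ≤ j → j < b.eval s → ∀ s', I j s' →
          wp N B c (I (j + 1)) (s'.set x j).tick) ∧
        ∀ s', I (b.eval s) s' → Q s'

/-! ### Compilation -/

/-- The register that holds the value of an expression evaluated at depth `d`. -/
def Ex.res (d : ℕ) : Ex → ℕ
  | .var x => regVar x
  | _ => regTmp d

/-- Instructions that put the address of a cell into the temporary `d`. -/
def addrCode (tag d : ℕ) (cr cx cy : List Instr) (rr rx ry : ℕ) : List Instr :=
  cr ++ [.const (regTmp (d + 1)) 16, .op .mul (regTmp d) rr (regTmp (d + 1)),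
    .const (regTmp (d + 1)) tag, .op .add (regTmp d) (regTmp d) (regTmp (d + 1)),
    .op .mul (regTmp d) (regTmp d) (regVar .n)] ++
  cx ++ [.op .add (regTmp d) (regTmp d) rx, .op .mul (regTmp d) (regTmp d) (regVar .n)] ++
  cy ++ [.op .add (regTmp d) (regTmp d) ry]

/-- Instructions that evaluate an expression with the temporaries from `d` on. -/
def Ex.compile : Ex → ℕ → List Instr
  | .lit a, d => [.const (regTmp d) a]
  | .var _, _ => []
  | .add a b, d => a.compile d ++ b.compile (d + 1) ++
      [.op .add (regTmp d) (a.res d) (b.res (d + 1))]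
  | .mul a b, d => a.compile d ++ b.compile (d + 1) ++
      [.op .mul (regTmp d) (a.res d) (b.res (d + 1))]
  | .div a b, d => a.compile d ++ b.compile (d + 1) ++
      [.op .div (regTmp d) (a.res d) (b.res (d + 1))]
  | .mod a b, d => a.compile d ++ b.compile (d + 1) ++
      [.op .mod (regTmp d) (a.res d) (b.res (d + 1))]
  | .ld tag r x y, d => addrCode tag d (r.compile d) (x.compile (d + 1)) (y.compile (d + 1))
      (r.res d) (x.res (d + 1)) (y.res (d + 1)) ++ [.load (regTmp d) (regTmp d)]

/-- Instructions without jumps. -/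
def Instr.Plain : Instr → Prop
  | .jump _ => False
  | .jumpEq _ _ _ => False
  | .jumpLt _ _ _ => False
  | _ => True

/-- The effect of a list of instructions without jumps. -/
def execs (w : ℕ) (l : List Instr) (s : Config) : Config := l.foldl (Instr.exec w) s

@[simp] theorem execs_nil (w : ℕ) (s : Config) : execs w [] s = s := rfl

@[simp] theorem execs_cons (w : ℕ) (i : Instr) (l : List Instr) (s : Config) :
    execs w (i :: l) s = execs w l (i.exec w s) := rfl

theorem execs_append (w : ℕ) (l l' : List Instr) (s : Config) :
    execs w (l ++ l') s = execs w l' (execs w l s) := by simp [execs]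

/-- The instructions `l` stand in the program `P` from position `a` on. -/
def CodeAt (P : Program) (a : ℕ) (l : List Instr) : Prop := ∀ i < l.length, P[a + i]? = l[i]?

theorem CodeAt.left {P : Program} {a : ℕ} {l l' : List Instr} (h : CodeAt P a (l ++ l')) :
    CodeAt P a l := fun i hi => by
  rw [h i (by simp; omega), List.getElem?_append_left hi]

theorem CodeAt.right {P : Program} {a : ℕ} {l l' : List Instr} (h : CodeAt P a (l ++ l')) :
    CodeAt P (a + l.length) l' := fun i hi => by
  rw [add_assoc, h (l.length + i) (by simp; omega), List.getElem?_append_right (by omega)]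
  simp

theorem CodeAt.head {P : Program} {a : ℕ} {i : Instr} {l : List Instr} (h : CodeAt P a (i :: l)) :
    P[a]? = some i := by simpa using h 0 (by simp)

theorem CodeAt.tail {P : Program} {a : ℕ} {i : Instr} {l : List Instr} (h : CodeAt P a (i :: l)) :
    CodeAt P (a + 1) l := by
  have : CodeAt P a ([i] ++ l) := h
  simpa using this.right

/-- `s'` is reached from `s` within `T` steps. -/
def Reach (w : ℕ) (P : Program) (T : ℕ) (s s' : Config) : Prop := ∃ t ≤ T, (step w P)^[t] s = s'

theorem Reach.refl {w : ℕ} {P : Program} (s : Config) : Reach w P 0 s s := ⟨0, le_rfl, rfl⟩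

theorem Reach.trans {w : ℕ} {P : Program} {T T' : ℕ} {s s' s'' : Config} (h : Reach w P T s s')
    (h' : Reach w P T' s' s'') : Reach w P (T + T') s s'' := by
  obtain ⟨t, ht, rfl⟩ := h
  obtain ⟨t', ht', rfl⟩ := h'
  exact ⟨t' + t, by omega, by rw [Function.iterate_add_apply]⟩

theorem Reach.mono {w : ℕ} {P : Program} {T T' : ℕ} {s s' : Config} (h : Reach w P T s s')
    (hT : T ≤ T') : Reach w P T' s s' := by
  obtain ⟨t, ht, rfl⟩ := h
  exact ⟨t, by omega, rfl⟩

theorem Reach.one {w : ℕ} {P : Program} {s : Config} {i : Instr} (h : P[s.pc]? = some i) :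
    Reach w P 1 s (i.exec w s) := ⟨1, le_rfl, by simp [step, h]⟩

theorem Instr.Plain.pc {i : Instr} (h : i.Plain) (w : ℕ) (s : Config) :
    (i.exec w s).pc = s.pc + 1 := by
  cases i <;> simp_all [Instr.Plain, Instr.exec]

theorem execs_pc {w : ℕ} {l : List Instr} (hl : ∀ i ∈ l, i.Plain) (s : Config) :
    (execs w l s).pc = s.pc + l.length := by
  induction l generalizing s with
  | nil => simp
  | cons i l ih =>
    rw [execs_cons, ih (fun i hi => hl i (by simp [hi])), (hl i (by simp)).pc]
    simp; omega

theorem reach_execs {w : ℕ} {P : Program} {l : List Instr} (hl : ∀ i ∈ l, i.Plain) {s : Config}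
    (h : CodeAt P s.pc l) : Reach w P l.length s (execs w l s) := by
  induction l generalizing s with
  | nil => exact Reach.refl s
  | cons i l ih =>
    have h1 := Reach.one (w := w) h.head
    have hpc := (hl i (by simp)).pc w s
    have h2 := ih (fun i hi => hl i (by simp [hi])) (s := i.exec w s) (by rw [hpc]; exact h.tail)
    refine (h1.trans h2).mono ?_
    simp; omega

/-! ### Simulation of states by machine configurations, and correctness of compiled expressions -/

/-- The registers and the memory of a machine represent a state. -/
structure Rep (N : ℕ) (s : St) (g : Config) : Prop where
  var : ∀ x, g.reg (regVar x) = s.var x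
  mem : ∀ tag < 16, ∀ r, ∀ x < N, ∀ y < N, g.mem (addr N tag r x y) = s.mem tag r x y
  out : g.out = s.out

/-- Only temporaries from `d` on have changed. -/
structure TmpEq (d : ℕ) (g g' : Config) : Prop where
  reg : ∀ a, (∀ d' ≥ d, a ≠ regTmp d') → g'.reg a = g.reg a
  mem : g'.mem = g.mem
  out : g'.out = g.out

theorem TmpEq.refl (d : ℕ) (g : Config) : TmpEq d g g := ⟨fun _ _ => rfl, rfl, rfl⟩

theorem TmpEq.trans {d : ℕ} {g g' g'' : Config} (h : TmpEq d g g') (h' : TmpEq d g' g'') :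
    TmpEq d g g'' :=
  ⟨fun a ha => (h'.reg a ha).trans (h.reg a ha), h'.mem.trans h.mem, h'.out.trans h.out⟩

theorem TmpEq.mono {d d' : ℕ} {g g' : Config} (h : TmpEq d' g g') (hd : d ≤ d') : TmpEq d g g' :=
  ⟨fun a ha => h.reg a fun e he => ha e (by omega), h.mem, h.out⟩

theorem TmpEq.rep {N d : ℕ} {s : St} {g g' : Config} (h : TmpEq d g g') (hr : Rep N s g) :
    Rep N s g' where
  var x := by rw [h.reg _ (fun d' _ => by simp only [regVar, regTmp]; omega), hr.var]
  mem tag ht r x hx y hy := by rw [h.mem, hr.mem tag ht r x hx y hy]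
  out := by rw [h.out, hr.out]

theorem TmpEq.update {d : ℕ} (g : Config) (pc a : ℕ) :
    TmpEq d g ⟨pc, Function.update g.reg (regTmp d) a, g.mem, g.out⟩ :=
  ⟨fun b hb => by simp [Function.update_of_ne (hb d le_rfl)], rfl, rfl⟩

/-- A first operand sits in a variable or in the temporary `d`, so evaluating the second one with
the temporaries from `d + 1` on does not destroy it. -/
theorem TmpEq.res {d : ℕ} {g g' : Config} (h : TmpEq (d + 1) g g') (e : Ex) :
    g'.reg (e.res d) = g.reg (e.res d) := by
  apply h.reg
  intro d' hd'
  cases e <;> simp only [Ex.res, regVar, regTmp] <;> omega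

theorem BinOp.eval_add {w a b : ℕ} (h : a + b < 2 ^ w) : BinOp.add.eval w a b = a + b :=
  Nat.mod_eq_of_lt h
theorem BinOp.eval_mul {w a b : ℕ} (h : a * b < 2 ^ w) : BinOp.mul.eval w a b = a * b :=
  Nat.mod_eq_of_lt h
theorem BinOp.eval_div {w a b : ℕ} (h : a / b < 2 ^ w) : BinOp.div.eval w a b = a / b :=
  Nat.mod_eq_of_lt h
theorem BinOp.eval_mod {w a b : ℕ} (h : a % b < 2 ^ w) : BinOp.mod.eval w a b = a % b :=
  Nat.mod_eq_of_lt h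

theorem addrCode_plain {tag d rr rx ry : ℕ} {cr cx cy : List Instr} (hr : ∀ i ∈ cr, i.Plain)
    (hx : ∀ i ∈ cx, i.Plain) (hy : ∀ i ∈ cy, i.Plain) :
    ∀ i ∈ addrCode tag d cr cx cy rr rx ry, i.Plain := by
  intro i hi
  simp only [addrCode, List.mem_append, List.mem_cons, List.not_mem_nil, or_false] at hi
  rcases hi with ((((hi | hi) | hi) | hi) | hi) | hi
  · exact hr i hi
  · rcases hi with rfl | rfl | rfl | rfl | rfl <;> trivial
  · exact hx i hi
  · rcases hi with rfl | rfl <;> trivial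
  · exact hy i hi
  · subst hi; trivial

theorem Ex.compile_plain (e : Ex) : ∀ d, ∀ i ∈ e.compile d, i.Plain := by
  induction e with
  | lit a => intro d i hi; simp only [Ex.compile, List.mem_singleton] at hi; subst hi; trivial
  | var x => intro d i hi; simp [Ex.compile] at hi
  | add a b iha ihb | mul a b iha ihb | div a b iha ihb | mod a b iha ihb =>
    intro d i hi
    simp only [Ex.compile, List.mem_append, List.mem_singleton] at hi
    rcases hi with (hi | hi) | rfl
    · exact iha d i hi
    · exact ihb _ i hi
    · trivial
  | ld tag r x y ihr ihx ihy =>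
    intro d i hi
    simp only [Ex.compile, List.mem_append, List.mem_singleton] at hi
    rcases hi with hi | rfl
    · exact addrCode_plain (ihr d) (ihx _) (ihy _) i hi
    · trivial

/-- What it means for code to evaluate an expression correctly. -/
def Ex.Correct (N w : ℕ) (e : Ex) : Prop :=
  ∀ (d : ℕ) (s : St) (g : Config), Rep N s g → e.fits N (2 ^ w) s →
    TmpEq d g (execs w (e.compile d) g) ∧
      (execs w (e.compile d) g).reg (e.res d) = e.eval s

theorem Ex.binop_correct {N w : ℕ} {a b : Ex} (iha : a.Correct N w) (ihb : b.Correct N w)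
    (o : BinOp) (d : ℕ) (s : St) (g : Config) (hr : Rep N s g)
    (fa : a.fits N (2 ^ w) s) (fb : b.fits N (2 ^ w) s) :
    TmpEq d g (execs w (a.compile d ++ b.compile (d + 1) ++
      [.op o (regTmp d) (a.res d) (b.res (d + 1))]) g) ∧
    (execs w (a.compile d ++ b.compile (d + 1) ++
      [.op o (regTmp d) (a.res d) (b.res (d + 1))]) g).reg (regTmp d) =
        o.eval w (a.eval s) (b.eval s) := by
  obtain ⟨h1, h2⟩ := iha d s g hr fa
  obtain ⟨h3, h4⟩ := ihb (d + 1) s _ (h1.rep hr) fb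
  simp only [execs_append, execs_cons, execs_nil, Instr.exec]
  refine ⟨(h1.trans (h3.mono (by omega))).trans (TmpEq.update _ _ _), ?_⟩
  rw [Function.update_self, h4, h3.res, h2]

theorem addrCode_correct {N w : ℕ} {r x y : Ex} (ihr : r.Correct N w) (ihx : x.Correct N w)
    (ihy : y.Correct N w) (tag d : ℕ) (s : St) (g : Config) (hr : Rep N s g)
    (fr : r.fits N (2 ^ w) s) (fx : x.fits N (2 ^ w) s) (fy : y.fits N (2 ^ w) s)
    (ha : Access N (2 ^ w) s tag (r.eval s) (x.eval s) (y.eval s)) (h16 : 16 < 2 ^ w) :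
    TmpEq d g (execs w (addrCode tag d (r.compile d) (x.compile (d + 1)) (y.compile (d + 1))
      (r.res d) (x.res (d + 1)) (y.res (d + 1))) g) ∧
    (execs w (addrCode tag d (r.compile d) (x.compile (d + 1)) (y.compile (d + 1))
      (r.res d) (x.res (d + 1)) (y.res (d + 1))) g).reg (regTmp d) =
        addr N tag (r.eval s) (x.eval s) (y.eval s) := by
  obtain ⟨hn, htag, hx, hy, hadd⟩ := ha
  obtain ⟨h1, h2⟩ := ihr d s g hr fr
  simp only [addrCode, execs_append]
  set g1 := execs w (r.compile d) g with hg1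
  set g2 := execs w [.const (regTmp (d + 1)) 16, .op .mul (regTmp d) (r.res d) (regTmp (d + 1)),
    .const (regTmp (d + 1)) tag, .op .add (regTmp d) (regTmp d) (regTmp (d + 1)),
    .op .mul (regTmp d) (regTmp d) (regVar .n)] g1 with hg2
  set R := r.eval s
  set X := x.eval s
  set Y := y.eval s
  have hN : 0 < N := by omega
  -- Only the final address is known to fit into a word. Since `N > 0`, the partial results of the
  -- Horner scheme are no larger, so no intermediate operation overflows.
  unfold addr at hadd
  have e3 : ((R * 16 + tag) * N + X) * N < 2 ^ w := by omega
  have e2' : (R * 16 + tag) * N + X < 2 ^ w :=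
    lt_of_le_of_lt (Nat.le_mul_of_pos_right _ hN) e3
  have e2 : (R * 16 + tag) * N < 2 ^ w := by omega
  have e1' : R * 16 + tag < 2 ^ w := lt_of_le_of_lt (Nat.le_mul_of_pos_right _ hN) e2
  have e1 : R * 16 < 2 ^ w := by omega
  have hrd : r.res d ≠ regTmp (d + 1) := by
    cases r <;> simp only [Ex.res, regVar, regTmp, ne_eq] <;> omega
  have hnd : regVar Var.n ≠ regTmp d := by simp only [regVar, regTmp]; omega
  have hnd' : regVar Var.n ≠ regTmp (d + 1) := by simp only [regVar, regTmp]; omega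
  have hdd : regTmp d ≠ regTmp (d + 1) := by simp only [regTmp]; omega
  have hreg2 : g2.reg (regTmp d) = (R * 16 + tag) * N := by
    simp only [hg2, execs_cons, execs_nil, Instr.exec, Function.update_self,
      Function.update_of_ne hdd, Function.update_of_ne hrd, Function.update_of_ne hnd,
      Function.update_of_ne hnd', (h1.rep hr).var, hn, h2, Nat.mod_eq_of_lt h16,
      Nat.mod_eq_of_lt (htag.trans h16), BinOp.eval_mul e1, BinOp.eval_add e1', BinOp.eval_mul e2]
  have ht2 : TmpEq d g1 g2 := by
    refine ⟨fun a ha => ?_, rfl, rfl⟩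
    have ha0 := ha d le_rfl
    have ha1 := ha (d + 1) (by omega)
    simp only [hg2, execs_cons, execs_nil, Instr.exec, Function.update_of_ne ha0,
      Function.update_of_ne ha1]
  have hg : TmpEq d g g2 := h1.trans ht2
  obtain ⟨h3, h4⟩ := ihx (d + 1) s g2 (hg.rep hr) fx
  set g3 := execs w (x.compile (d + 1)) g2 with hg3
  have h4 : g3.reg (x.res (d + 1)) = X := h4
  set g4 := execs w [.op .add (regTmp d) (regTmp d) (x.res (d + 1)),
    .op .mul (regTmp d) (regTmp d) (regVar .n)] g3 with hg4
  -- The literal is a dummy: an expression whose result register is the temporary `d`.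
  have h3d : g3.reg (regTmp d) = g2.reg (regTmp d) := h3.res (.lit 0)
  have hreg4 : g4.reg (regTmp d) = ((R * 16 + tag) * N + X) * N := by
    simp only [hg4, execs_cons, execs_nil, Instr.exec, Function.update_self,
      Function.update_of_ne hnd, h4, h3d, hreg2, ((h3.rep (hg.rep hr))).var, hn,
      BinOp.eval_add e2', BinOp.eval_mul e3]
  have ht4 : TmpEq d g3 g4 := by
    refine ⟨fun a ha => ?_, rfl, rfl⟩
    have ha0 := ha d le_rfl
    simp only [hg4, execs_cons, execs_nil, Instr.exec, Function.update_of_ne ha0]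
  have hh : TmpEq d g g4 := (hg.trans (h3.mono (by omega))).trans ht4
  obtain ⟨h5, h6⟩ := ihy (d + 1) s g4 (hh.rep hr) fy
  set g5 := execs w (y.compile (d + 1)) g4 with hg5
  have h5d : g5.reg (regTmp d) = g4.reg (regTmp d) := h5.res (.lit 0)
  simp only [execs_cons, execs_nil, Instr.exec]
  refine ⟨(hh.trans (h5.mono (by omega))).trans (TmpEq.update _ _ _), ?_⟩
  rw [Function.update_self, h5d, hreg4, h6, BinOp.eval_add hadd]
  rfl

theorem Ex.correct {N w : ℕ} (h16 : 16 < 2 ^ w) (e : Ex) : e.Correct N w := by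
  induction e with
  | lit a =>
    intro d s g hr hf
    refine ⟨TmpEq.update _ _ _, ?_⟩
    simp only [Ex.compile, execs_cons, execs_nil, Instr.exec, Ex.res, Function.update_self, Ex.eval]
    exact Nat.mod_eq_of_lt hf
  | var x => intro d s g hr hf; exact ⟨TmpEq.refl _ _, hr.var x⟩
  | add a b iha ihb =>
    intro d s g hr hf
    have := Ex.binop_correct iha ihb .add d s g hr hf.1 hf.2.1
    rwa [BinOp.eval_add hf.2.2] at this
  | mul a b iha ihb =>
    intro d s g hr hf
    have := Ex.binop_correct iha ihb .mul d s g hr hf.1 hf.2.1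
    rwa [BinOp.eval_mul hf.2.2] at this
  | div a b iha ihb =>
    intro d s g hr hf
    have := Ex.binop_correct iha ihb .div d s g hr hf.1 hf.2.1
    rwa [BinOp.eval_div hf.2.2] at this
  | mod a b iha ihb =>
    intro d s g hr hf
    have := Ex.binop_correct iha ihb .mod d s g hr hf.1 hf.2.1
    rwa [BinOp.eval_mod hf.2.2] at this
  | ld tag r x y ihr ihx ihy =>
    intro d s g hr hf
    obtain ⟨h1, h2⟩ := addrCode_correct ihr ihx ihy tag d s g hr hf.1 hf.2.1 hf.2.2.1 hf.2.2.2 h16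
    obtain ⟨_, htag, hx, hy, _⟩ := hf.2.2.2
    simp only [Ex.compile, execs_append, execs_cons, execs_nil, Instr.exec]
    refine ⟨h1.trans (TmpEq.update _ _ _), ?_⟩
    change Function.update _ (regTmp d) _ (regTmp d) = _
    rw [Function.update_self, h2, h1.mem, hr.mem _ htag _ _ hx _ hy]
    rfl

/-! ### Code of commands and its correctness -/

/-- The number of instructions of the code of a command. -/
def Cmd.size : Cmd → ℕ
  | .skip => 0
  | .set _ e => (e.compile 0).length + 1
  | .st tag r x y e => (addrCode tag 0 (r.compile 0) (x.compile 1) (y.compile 1)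
      (r.res 0) (x.res 1) (y.res 1)).length + (e.compile 1).length + 1
  | .out e => (e.compile 0).length + 1
  | .seq c d => c.size + d.size
  | .whenEq a b c => (a.compile 0).length + (b.compile 1).length + 2 + c.size
  | .whenLt a b c => (a.compile 0).length + (b.compile 1).length + 2 + c.size
  | .loop _ a b c => (a.compile 0).length + (b.compile 1).length + 8 + c.size

/-- The code of a command that starts at position `l` and stands inside `d` loops. -/
def Cmd.code : Cmd → (l d : ℕ) → List Instr
  | .skip, _, _ => []
  -- A bitwise or of a register with itself serves as a copy instruction.
  | .set x e, _, _ => e.compile 0 ++ [.op .or (regVar x) (e.res 0) (e.res 0)]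
  | .st tag r x y e, _, _ => addrCode tag 0 (r.compile 0) (x.compile 1) (y.compile 1)
      (r.res 0) (x.res 1) (y.res 1) ++ e.compile 1 ++ [.store (regTmp 0) (e.res 1)]
  | .out e, _, _ => e.compile 0 ++ [.output (e.res 0)]
  | .seq c c', l, d => c.code l d ++ c'.code (l + c.size) d
  | .whenEq a b c, l, d =>
      let h := l + (a.compile 0).length + (b.compile 1).length
      a.compile 0 ++ b.compile 1 ++
        ([.jumpEq (a.res 0) (b.res 1) (h + 2), .jump (h + 2 + c.size)] ++ c.code (h + 2) d)
  | .whenLt a b c, l, d =>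
      let h := l + (a.compile 0).length + (b.compile 1).length
      a.compile 0 ++ b.compile 1 ++
        ([.jumpLt (a.res 0) (b.res 1) (h + 2), .jump (h + 2 + c.size)] ++ c.code (h + 2) d)
  -- Counter and upper bound live in the loop registers `2 * d` and `2 * d + 1`, out of reach of the
  -- body, which may therefore change the variables in the bounds and even the loop variable.
  | .loop x a b c, l, d =>
      let h := l + (a.compile 0).length + (b.compile 1).length + 2
      a.compile 0 ++ b.compile 1 ++
        ([.op .or (regLoop (2 * d)) (a.res 0) (a.res 0),
          .op .or (regLoop (2 * d + 1)) (b.res 1) (b.res 1)] ++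
        ([.jumpLt (regLoop (2 * d)) (regLoop (2 * d + 1)) (h + 2), .jump (h + 6 + c.size),
          .op .or (regVar x) (regLoop (2 * d)) (regLoop (2 * d))] ++ (c.code (h + 3) (d + 1) ++
        [.const (regTmp 0) 1, .op .add (regLoop (2 * d)) (regLoop (2 * d)) (regTmp 0), .jump h])))

theorem Cmd.length_code (c : Cmd) : ∀ l d, (c.code l d).length = c.size := by
  induction c with
  | skip => intro l d; rfl
  | set x e => intro l d; simp [Cmd.code, Cmd.size]
  | st tag r x y e => intro l d; simp [Cmd.code, Cmd.size]; omega
  | out e => intro l d; simp [Cmd.code, Cmd.size]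
  | seq c c' ih ih' => intro l d; simp [Cmd.code, Cmd.size, ih, ih']
  | whenEq a b c ih => intro l d; simp [Cmd.code, Cmd.size, ih]; omega
  | whenLt a b c ih => intro l d; simp [Cmd.code, Cmd.size, ih]; omega
  | loop x a b c ih => intro l d; simp [Cmd.code, Cmd.size, ih]; omega

theorem BinOp.eval_or_self {w a : ℕ} (h : a < 2 ^ w) : BinOp.or.eval w a a = a := by
  simp [BinOp.eval, Nat.mod_eq_of_lt h]

theorem Rep.tick {N : ℕ} {s : St} {g : Config} (h : Rep N s g) : Rep N s.tick g :=
  ⟨h.var, h.mem, h.out⟩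

theorem Rep.pc {N : ℕ} {s : St} {g : Config} (h : Rep N s g) (a : ℕ) :
    Rep N s ⟨a, g.reg, g.mem, g.out⟩ := ⟨h.var, h.mem, h.out⟩

theorem Rep.updVar {N : ℕ} {s : St} {g : Config} (h : Rep N s g) (pc a : ℕ) (x : Var) :
    Rep N (s.set x a) ⟨pc, Function.update g.reg (regVar x) a, g.mem, g.out⟩ where
  var y := by
    by_cases hxy : y = x
    · subst hxy; simp [St.set]
    · have : regVar y ≠ regVar x := fun h' => hxy (Var.enc_injective (by
        simp only [regVar] at h'; omega))
      simp [St.set, Function.update_of_ne hxy, Function.update_of_ne this, h.var]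
  mem := h.mem
  out := h.out

theorem Rep.updOther {N : ℕ} {s : St} {g : Config} (h : Rep N s g) (pc a b : ℕ)
    (hb : ∀ x, regVar x ≠ b) : Rep N s ⟨pc, Function.update g.reg b a, g.mem, g.out⟩ where
  var y := by simp [Function.update_of_ne (hb y), h.var]
  mem := h.mem
  out := h.out

theorem Rep.store {N : ℕ} {s : St} {g : Config} (h : Rep N s g) {tag r x y : ℕ} (pc a : ℕ)
    (ht : tag < 16) (hx : x < N) (hy : y < N) : Rep N (s.store tag r x y a)
      ⟨pc, g.reg, Function.update g.mem (addr N tag r x y) a, g.out⟩ where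
  var := h.var
  mem tag' ht' r' x' hx' y' hy' := by
    by_cases e : tag' = tag ∧ r' = r ∧ x' = x ∧ y' = y
    · obtain ⟨rfl, rfl, rfl, rfl⟩ := e; simp [St.store]
    · have : addr N tag' r' x' y' ≠ addr N tag r x y := fun h' => e (by
        obtain ⟨h1, h2, h3, h4⟩ := addr_inj ht' ht hx' hx hy' hy h'
        exact ⟨h1, h2, h3, h4⟩)
      simp only [Function.update_of_ne this, St.store, if_neg e]
      exact h.mem tag' ht' r' x' hx' y' hy'
  out := h.out

theorem Rep.put {N : ℕ} {s : St} {g : Config} (h : Rep N s g) (pc a : ℕ) :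
    Rep N (s.put a) ⟨pc, g.reg, g.mem, g.out ++ [a]⟩ where
  var := h.var
  mem := h.mem
  out := by simp [St.put, h.out]

/-- The code of two expressions, one after the other. -/
theorem eval_two {N w : ℕ} (h16 : 16 < 2 ^ w) {a b : Ex} {s : St} {g : Config} (hr : Rep N s g)
    (fa : a.fits N (2 ^ w) s) (fb : b.fits N (2 ^ w) s) :
    TmpEq 0 g (execs w (a.compile 0 ++ b.compile 1) g) ∧
      (execs w (a.compile 0 ++ b.compile 1) g).reg (a.res 0) = a.eval s ∧
      (execs w (a.compile 0 ++ b.compile 1) g).reg (b.res 1) = b.eval s := by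
  obtain ⟨h1, h2⟩ := a.correct h16 0 s g hr fa
  obtain ⟨h3, h4⟩ := b.correct h16 1 s _ (h1.rep hr) fb
  rw [execs_append]
  exact ⟨h1.trans (h3.mono (by omega)), by rw [h3.res, h2], h4⟩

/-- What it means for the code of a command to be correct. -/
def Cmd.Sound (N w : ℕ) (P : Program) (K : ℕ) (c : Cmd) : Prop :=
  c.size ≤ K → ∀ (l d : ℕ) (Q : St → Prop) (s : St) (g : Config),
    CodeAt P l (c.code l d) → g.pc = l → Rep N s g → wp N (2 ^ w) c Q s →
    ∃ (s' : St) (g' : Config) (t : ℕ), Q s' ∧ Rep N s' g' ∧ g'.pc = l + c.size ∧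
      s'.time = s.time + t ∧ Reach w P (K * t) g g' ∧
      ∀ i < 2 * d, g'.reg (regLoop i) = g.reg (regLoop i)

theorem TmpEq.loop {d : ℕ} {g g' : Config} (h : TmpEq d g g') (i : ℕ) :
    g'.reg (regLoop i) = g.reg (regLoop i) :=
  h.reg _ fun d' _ => by simp only [regLoop, regTmp]; omega

theorem plain_two (o o' : BinOp) (a b c a' b' c' : ℕ) :
    ∀ i ∈ [Instr.op o a b c, Instr.op o' a' b' c'], i.Plain := by simp [Instr.Plain]

/-- Induction on the number of finished rounds. The test, the copy of the counter, the increment and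
the jump back are constantly many instructions, paid for by the tick of the round; the evaluation of
the bounds and the exit are paid for by the tick of the loop itself. -/
theorem Cmd.sound_loop {N w K : ℕ} {P : Program} (h16 : 16 < 2 ^ w) {c : Cmd} (x : Var) (a b : Ex)
    (ih : c.Sound N w P K) : (Cmd.loop x a b c).Sound N w P K := by
  intro hK l d Q s g hc hg hr ⟨fa, fb, ha, hb, _, hab, I, hI, hstep, hend⟩
  simp only [Cmd.size] at hK ⊢
  simp only [Cmd.code] at hc
  set h := l + (a.compile 0).length + (b.compile 1).length + 2 with hh
  have hlen : l + (a.compile 0 ++ b.compile 1).length + 2 = h := by simp [hh]; omega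
  have hc0 := hc.left
  have hc1 := hc.right.left
  have hc2 := hc.right.right.left
  have hc3 := hc.right.right.right.left
  have hc4 := hc.right.right.right.right
  simp only [List.length_cons, List.length_nil, Cmd.length_code, zero_add, Nat.reduceAdd]
    at hc1 hc2 hc3 hc4
  rw [hlen] at hc2 hc3 hc4
  have plain : ∀ i ∈ a.compile 0 ++ b.compile 1, i.Plain := by
    intro i hi
    rcases List.mem_append.1 hi with hi | hi
    exacts [a.compile_plain _ i hi, b.compile_plain _ i hi]
  obtain ⟨h1, h2, h3⟩ := eval_two h16 hr fa fb
  have r1 := reach_execs (w := w) plain (hg ▸ hc0)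
  have pc1 := execs_pc (w := w) plain g
  set g1 := execs w (a.compile 0 ++ b.compile 1) g with hg1
  set g2 := execs w [.op .or (regLoop (2 * d)) (a.res 0) (a.res 0),
          .op .or (regLoop (2 * d + 1)) (b.res 1) (b.res 1)] g1 with hg2
  have r2 : Reach w P 2 g1 g2 := reach_execs (w := w) (plain_two _ _ _ _ _ _ _ _)
    (by rw [pc1, hg]; exact hc1)
  have hne : regLoop (2 * d) ≠ regLoop (2 * d + 1) := by simp only [regLoop]; omega
  have hbne : b.res 1 ≠ regLoop (2 * d) := by
    cases b <;> simp only [Ex.res, regVar, regTmp, regLoop, ne_eq] <;> omega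
  have hvl : ∀ i (x : Var), regVar x ≠ regLoop i := by
    intro i x; simp only [regVar, regLoop]; omega
  have pc2 : g2.pc = h := by
    simp only [hg2, execs_cons, execs_nil, Instr.exec, pc1, hg]; rw [← hlen]
  have rep2 : Rep N s.tick g2 := by
    simp only [hg2, execs_cons, execs_nil, Instr.exec]
    exact (((h1.rep hr).updOther 0 _ _ (hvl _)).updOther _ _ _ (hvl _)).tick
  have lo2 : g2.reg (regLoop (2 * d)) = a.eval s := by
    simp only [hg2, execs_cons, execs_nil, Instr.exec, Function.update_of_ne hne,
      Function.update_self, h2]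
    exact BinOp.eval_or_self ha
  have hi2 : g2.reg (regLoop (2 * d + 1)) = b.eval s := by
    simp only [hg2, execs_cons, execs_nil, Instr.exec,
      Function.update_self, Function.update_of_ne hbne, h3]
    exact BinOp.eval_or_self hb
  have keep2 : ∀ i < 2 * d, g2.reg (regLoop i) = g.reg (regLoop i) := by
    intro i hi
    have e1 : regLoop i ≠ regLoop (2 * d) := by simp only [regLoop]; omega
    have e2 : regLoop i ≠ regLoop (2 * d + 1) := by simp only [regLoop]; omega
    simp only [hg2, execs_cons, execs_nil, Instr.exec, Function.update_of_ne e1,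
      Function.update_of_ne e2, h1.loop]
  -- The machine stands at the loop head after `k` rounds, with the counter `k` above its initial
  -- value and with the registers of the outer loops intact.
  have main : ∀ k, a.eval s + k ≤ b.eval s → ∃ (s' : St) (g' : Config) (t : ℕ),
      I (a.eval s + k) s' ∧ Rep N s' g' ∧ g'.pc = h ∧ s'.time = s.tick.time + t ∧
      Reach w P (K * t) g2 g' ∧ g'.reg (regLoop (2 * d)) = a.eval s + k ∧
      g'.reg (regLoop (2 * d + 1)) = b.eval s ∧
      ∀ i < 2 * d, g'.reg (regLoop i) = g.reg (regLoop i) := by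
    intro k
    induction k with
    | zero => intro _; exact ⟨s.tick, g2, 0, hI, rep2, pc2, rfl, Reach.refl _, lo2, hi2, keep2⟩
    | succ k ihk =>
      intro hk
      obtain ⟨s', g', t, hI', hr', hpc', ht', hre', hlo', hhi', hkeep'⟩ := ihk (by omega)
      have hw := hstep (a.eval s + k) (by omega) (by omega) s' hI'
      have q1 : Reach w P 1 g' { g' with pc := h + 2 } := by
        have := Reach.one (w := w) (s := g') (by rw [hpc']; exact hc2.head)
        simp only [Instr.exec, hlo', hhi'] at this
        rwa [if_pos (by omega)] at this
      set g3 : Config := ⟨h + 2 + 1, Function.update g'.reg (regVar x) (a.eval s + k), g'.mem,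
        g'.out⟩ with hg3
      have q2 : Reach w P 1 { g' with pc := h + 2 } g3 := by
        have := Reach.one (w := w) (s := { g' with pc := h + 2 }) hc2.tail.tail.head
        simp only [Instr.exec, hlo'] at this
        rwa [BinOp.eval_or_self (by omega)] at this
      have rep3 : Rep N (s'.set x (a.eval s + k)).tick g3 := (hr'.updVar _ _ _).tick
      obtain ⟨s4, g4, t4, hI4, rep4, pc4, ht4, hre4, hkeep4⟩ :=
        ih (by omega) (h + 3) (d + 1) _ _ g3 hc3 rfl rep3 hw
      set g5 := execs w [.const (regTmp 0) 1,
        .op .add (regLoop (2 * d)) (regLoop (2 * d)) (regTmp 0)] g4 with hg5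
      have hc4' := hc4
      rw [← pc4] at hc4'
      have q5 : Reach w P 2 g4 g5 := reach_execs (w := w) (by simp [Instr.Plain])
        (l := [.const (regTmp 0) 1, .op .add (regLoop (2 * d)) (regLoop (2 * d)) (regTmp 0)])
        (CodeAt.left (l' := [.jump h]) hc4')
      have pc5 : g5.pc = g4.pc + 2 := rfl
      have q6 : Reach w P 1 g5 { g5 with pc := h } := by
        have := Reach.one (w := w) (s := g5) (P := P) (i := .jump h)
          (by rw [pc5]; exact hc4'.tail.tail.head)
        exact this
      have hlv : ∀ i, regLoop i ≠ regVar x := fun i => (hvl i x).symm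
      have hlt : ∀ i, regLoop i ≠ regTmp 0 := by intro i; simp only [regLoop, regTmp]; omega
      have k4 : ∀ i < 2 * d + 2, g4.reg (regLoop i) = g'.reg (regLoop i) := by
        intro i hi
        rw [hkeep4 i (by omega), hg3]
        simp only [Function.update_of_ne (hlv i)]
      have h1w : 1 % 2 ^ w = 1 := Nat.mod_eq_of_lt (by omega)
      refine ⟨s4, { g5 with pc := h }, t + t4 + 1, hI4, ?_, rfl, ?_, ?_, ?_, ?_, ?_⟩
      · simp only [hg5, execs_cons, execs_nil, Instr.exec]
        exact ((rep4.updOther 0 _ _ (by intro x; simp only [regVar, regTmp]; omega)).updOther _ _ _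
          (hvl _))
      · simp only [St.tick, St.set] at ht4 ht' ⊢; omega
      · refine ((((hre'.trans q1).trans q2).trans hre4).trans (q5.trans q6)).mono ?_
        have : K * (t + t4 + 1) = K * t + K * t4 + K := by ring
        omega
      · simp only [hg5, execs_cons, execs_nil, Instr.exec, Function.update_self,
          Function.update_of_ne (hlt _), h1w, k4 (2 * d) (by omega), hlo']
        rw [BinOp.eval_add (by omega)]; omega
      · simp only [hg5, execs_cons, execs_nil, Instr.exec, Function.update_of_ne hne.symm,
          Function.update_of_ne (hlt _), k4 (2 * d + 1) (by omega), hhi']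
      · intro i hi
        have e1 : regLoop i ≠ regLoop (2 * d) := by simp only [regLoop]; omega
        simp only [hg5, execs_cons, execs_nil, Instr.exec, Function.update_of_ne e1,
          Function.update_of_ne (hlt _), k4 i (by omega), hkeep' i hi]
  obtain ⟨s', g', t, hI', hr', hpc', ht', hre', hlo', hhi', hkeep'⟩ :=
    main (b.eval s - a.eval s) (by omega)
  have e : a.eval s + (b.eval s - a.eval s) = b.eval s := by omega
  rw [e] at hI' hlo'
  have q1 : Reach w P 1 g' { g' with pc := h + 1 } := by
    have := Reach.one (w := w) (s := g') (by rw [hpc']; exact hc2.head)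
    simp only [Instr.exec, hlo', hhi', hpc'] at this
    rwa [if_neg (by omega)] at this
  have q2 : Reach w P 1 { g' with pc := h + 1 } { g' with pc := h + 6 + c.size } :=
    Reach.one (w := w) (s := { g' with pc := h + 1 }) hc2.tail.head
  refine ⟨s', { g' with pc := h + 6 + c.size }, t + 1, hend s' hI', hr'.pc _, ?_, ?_, ?_, hkeep'⟩
  · simp only [hh]; omega
  · simp only [St.tick] at ht'; omega
  · refine (((r1.trans r2).trans hre').trans (q1.trans q2)).mono ?_
    have : K * (t + 1) = K * t + K := by ring
    simp only [List.length_append]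
    omega

/-- One argument for both conditional jumps: the instruction `i` is only known to go to the body if
`cond` holds and to the next position otherwise. -/
theorem Cmd.sound_when {N w K : ℕ} {P : Program} (h16 : 16 < 2 ^ w) {c : Cmd} (a b : Ex)
    (ih : c.Sound N w P K) (hK : (a.compile 0).length + (b.compile 1).length + 2 + c.size ≤ K)
    {l d : ℕ} {Q : St → Prop} {s : St} {g : Config} {i : Instr} {cond : Prop}
    (hg : g.pc = l) (hr : Rep N s g) (fa : a.fits N (2 ^ w) s) (fb : b.fits N (2 ^ w) s)
    (hpos : cond → wp N (2 ^ w) c Q s.tick) (hneg : ¬ cond → Q s.tick)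
    (hi : ∀ g' : Config, g'.reg (a.res 0) = a.eval s → g'.reg (b.res 1) = b.eval s →
      (cond → i.exec w g' =
        { g' with pc := l + (a.compile 0).length + (b.compile 1).length + 2 }) ∧
      (¬ cond → i.exec w g' = { g' with pc := g'.pc + 1 }))
    (hc : CodeAt P l (a.compile 0 ++ b.compile 1 ++ ([i,
      .jump (l + (a.compile 0).length + (b.compile 1).length + 2 + c.size)] ++
        c.code (l + (a.compile 0).length + (b.compile 1).length + 2) d))) :
    ∃ (s' : St) (g' : Config) (t : ℕ), Q s' ∧ Rep N s' g' ∧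
      g'.pc = l + ((a.compile 0).length + (b.compile 1).length + 2 + c.size) ∧
      s'.time = s.time + t ∧ Reach w P (K * t) g g' ∧
      ∀ i < 2 * d, g'.reg (regLoop i) = g.reg (regLoop i) := by
  set h := l + (a.compile 0).length + (b.compile 1).length with hh
  have hlen : l + (a.compile 0 ++ b.compile 1).length = h := by simp [hh]; omega
  have plain : ∀ i ∈ a.compile 0 ++ b.compile 1, i.Plain := by
    intro i hi
    rcases List.mem_append.1 hi with hi | hi
    exacts [a.compile_plain _ i hi, b.compile_plain _ i hi]
  have hc0 := hc.left
  have hc1 := hc.right.left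
  have hc2 := hc.right.right
  rw [hlen] at hc1 hc2
  obtain ⟨h1, h2, h3⟩ := eval_two h16 hr fa fb
  have r1 := reach_execs (w := w) plain (hg ▸ hc0)
  have pc1 := execs_pc (w := w) plain g
  rw [hg, hlen] at pc1
  set g1 := execs w (a.compile 0 ++ b.compile 1) g with hg1
  obtain ⟨e1, e2⟩ := hi g1 h2 h3
  have q1 : Reach w P 1 g1 (i.exec w g1) := Reach.one (by rw [pc1]; exact hc1.head)
  by_cases hcond : cond
  · rw [e1 hcond] at q1
    obtain ⟨s4, g4, t4, hI4, rep4, pc4, ht4, hre4, hkeep4⟩ :=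
      ih (by omega) (h + 2) d _ _ { g1 with pc := h + 2 } hc2 rfl ((h1.rep hr).tick.pc _)
        (hpos hcond)
    refine ⟨s4, g4, t4 + 1, hI4, rep4, ?_, ?_, ?_, ?_⟩
    · rw [pc4]; omega
    · simp only [St.tick] at ht4; omega
    · refine ((r1.trans q1).trans hre4).mono ?_
      have : K * (t4 + 1) = K * t4 + K := by ring
      simp only [List.length_append]
      omega
    · intro i hi
      rw [hkeep4 i hi]
      exact h1.loop i
  · rw [e2 hcond, pc1] at q1
    have q2 : Reach w P 1 { g1 with pc := h + 1 } { g1 with pc := h + 2 + c.size } :=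
      Reach.one (w := w) (s := { g1 with pc := h + 1 }) hc1.tail.head
    refine ⟨s.tick, { g1 with pc := h + 2 + c.size }, 1, hneg hcond, (h1.rep hr).tick.pc _, ?_, rfl,
      ?_, fun i _ => h1.loop i⟩
    · simp only; omega
    · refine (r1.trans (q1.trans q2)).mono ?_
      simp only [List.length_append]
      omega

/-- Between two ticks the machine runs through a stretch of code without repetition, so any bound
`K` for the size of the command pays for it. The same `K` serves all subcommands, whose code is
shorter. -/
theorem Cmd.sound {N w K : ℕ} {P : Program} (h16 : 16 < 2 ^ w) (c : Cmd) : c.Sound N w P K := by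
  induction c with
  | skip =>
    intro hK l d Q s g hc hg hr hw
    exact ⟨s, g, 0, hw, hr, hg, rfl, Reach.refl _, fun _ _ => rfl⟩
  | set x e =>
    intro hK l d Q s g hc hg hr ⟨fe, he, _, hQ⟩
    obtain ⟨h1, h2⟩ := e.correct h16 0 s g hr fe
    have plain : ∀ i ∈ (Cmd.set x e).code l d, i.Plain := by
      intro i hi
      simp only [Cmd.code, List.mem_append, List.mem_singleton] at hi
      rcases hi with hi | rfl
      exacts [e.compile_plain _ i hi, trivial]
    have r1 := reach_execs (w := w) plain (hg ▸ hc)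
    have pc1 := execs_pc (w := w) plain g
    rw [Cmd.length_code] at r1 pc1
    refine ⟨_, _, 1, hQ, ?_, by rw [pc1, hg], rfl, r1.mono (by omega), ?_⟩
    · simp only [Cmd.code, execs_append, execs_cons, execs_nil, Instr.exec, h2,
        BinOp.eval_or_self he]
      exact ((h1.rep hr).updVar _ _ _).tick
    · intro i _
      have : regLoop i ≠ regVar x := by simp only [regVar, regLoop]; omega
      simp only [Cmd.code, execs_append, execs_cons, execs_nil, Instr.exec,
        Function.update_of_ne this, h1.loop]
  | st tag r x y e =>
    intro hK l d Q s g hc hg hr ⟨fr, fx, fy, fe, ha, hQ⟩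
    obtain ⟨h1, h2⟩ := addrCode_correct (r.correct h16) (x.correct h16) (y.correct h16) tag 0 s g
      hr fr fx fy ha h16
    have plain : ∀ i ∈ (Cmd.st tag r x y e).code l d, i.Plain := by
      intro i hi
      simp only [Cmd.code, List.mem_append, List.mem_singleton] at hi
      rcases hi with (hi | hi) | rfl
      exacts [addrCode_plain (r.compile_plain _) (x.compile_plain _) (y.compile_plain _) i hi,
        e.compile_plain _ i hi, trivial]
    have r1 := reach_execs (w := w) plain (hg ▸ hc)
    have pc1 := execs_pc (w := w) plain g
    rw [Cmd.length_code] at r1 pc1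
    simp only [zero_add] at h1 h2
    obtain ⟨h3, h4⟩ := e.correct h16 1 s _ (h1.rep hr) fe
    have h30 := (h3.res (.lit 0)).trans h2
    change _ = addr N tag (r.eval s) (x.eval s) (y.eval s) at h30
    refine ⟨_, _, 1, hQ, ?_, by rw [pc1, hg], rfl, r1.mono (by omega), ?_⟩
    · simp only [Cmd.code, execs_append, execs_cons, execs_nil, Instr.exec, h4]
      have := ((h3.rep (h1.rep hr)).store (r := r.eval s) 0 (e.eval s) ha.2.1 ha.2.2.1
        ha.2.2.2.1).tick
      rw [← h30] at this
      exact this.pc _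
    · intro i _
      simp only [Cmd.code, execs_append, execs_cons, execs_nil, Instr.exec, h3.loop, h1.loop]
  | out e =>
    intro hK l d Q s g hc hg hr ⟨fe, hQ⟩
    obtain ⟨h1, h2⟩ := e.correct h16 0 s g hr fe
    have plain : ∀ i ∈ (Cmd.out e).code l d, i.Plain := by
      intro i hi
      simp only [Cmd.code, List.mem_append, List.mem_singleton] at hi
      rcases hi with hi | rfl
      exacts [e.compile_plain _ i hi, trivial]
    have r1 := reach_execs (w := w) plain (hg ▸ hc)
    have pc1 := execs_pc (w := w) plain g
    rw [Cmd.length_code] at r1 pc1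
    refine ⟨_, _, 1, hQ, ?_, by rw [pc1, hg], rfl, r1.mono (by omega), ?_⟩
    · simp only [Cmd.code, execs_append, execs_cons, execs_nil, Instr.exec, h2]
      exact ((h1.rep hr).put _ _).tick
    · intro i _
      simp only [Cmd.code, execs_append, execs_cons, execs_nil, Instr.exec, h1.loop]
  | seq c c' ih ih' =>
    intro hK l d Q s g hc hg hr hw
    simp only [Cmd.size] at hK ⊢
    have hc1 := hc.left
    have hc2 := hc.right
    rw [Cmd.length_code] at hc2
    obtain ⟨s1, g1, t1, hw1, rep1, pc1, ht1, hre1, hkeep1⟩ := ih (by omega) l d _ s g hc1 hg hr hw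
    obtain ⟨s2, g2, t2, hw2, rep2, pc2, ht2, hre2, hkeep2⟩ :=
      ih' (by omega) (l + c.size) d _ s1 g1 hc2 pc1 rep1 hw1
    refine ⟨s2, g2, t1 + t2, hw2, rep2, by omega, by omega, (hre1.trans hre2).mono ?_, ?_⟩
    · rw [mul_add]
    · intro i hi; rw [hkeep2 i hi, hkeep1 i hi]
  | whenEq a b c ih =>
    intro hK l d Q s g hc hg hr ⟨fa, fb, hp, hn⟩
    refine Cmd.sound_when h16 a b ih hK hg hr fa fb hp hn ?_ hc
    intro g' e1 e2
    simp only [Instr.exec, e1, e2]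
    exact ⟨fun h => by rw [if_pos h], fun h => by rw [if_neg h]⟩
  | whenLt a b c ih =>
    intro hK l d Q s g hc hg hr ⟨fa, fb, hp, hn⟩
    refine Cmd.sound_when h16 a b ih hK hg hr fa fb hp hn ?_ hc
    intro g' e1 e2
    simp only [Instr.exec, e1, e2]
    exact ⟨fun h => by rw [if_pos h], fun h => by rw [if_neg h]⟩
  | loop x a b c ih => exact Cmd.sound_loop h16 x a b ih

/-! ### Complete programs -/

/-- The program of a command: it first loads the number `n` of vertices. -/
def Cmd.program (c : Cmd) : Program := .load (regVar .n) (regVar .n) :: c.code 1 0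

/-- The initial state of the structured language. -/
def initSt (N w : ℕ) (input : List ℕ) : St where
  var := Function.update (fun _ => 0) .n N
  mem tag r x y := if tag < 16 ∧ x < N ∧ y < N then input.getD (addr N tag r x y) 0 % 2 ^ w else 0
  out := []
  time := 0

theorem iterate_halted {w : ℕ} {P : Program} {s : Config} (h : P.length ≤ s.pc) (t : ℕ) :
    (step w P)^[t] s = s := by
  have : step w P s = s := by simp [step, List.getElem?_eq_none h]
  exact Function.iterate_fixed this t

/-- The additional step is the initial load of `n`: register and address are both zero at the start.
The machine may stop before the stated time, which is harmless since a halted configuration is a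
fixed point. -/
theorem Cmd.haltsWith {N w : ℕ} (h16 : 16 < 2 ^ w) (c : Cmd) (input : List ℕ)
    (hN : input.getD 0 0 % 2 ^ w = N) {Q : St → Prop}
    (h : wp N (2 ^ w) c Q (initSt N w input)) :
    ∃ s', Q s' ∧ HaltsWith w c.program input (c.size * s'.time + 1) s'.out := by
  set g0 := WordRAM.init w input with hg0
  set g1 : Config := ⟨1, Function.update (fun _ => 0) (regVar .n) N,
    fun a => input.getD a 0 % 2 ^ w, []⟩ with hg1
  have r1 : Reach w c.program 1 g0 g1 := by
    have h1 : c.program[g0.pc]? = some (.load (regVar .n) (regVar .n)) := rfl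
    have := Reach.one (w := w) h1
    have e : (Instr.load (regVar .n) (regVar .n)).exec w g0 = g1 := by
      simp only [Instr.exec, hg0, hg1, WordRAM.init, hN]
    rwa [e] at this
  have rep1 : Rep N (initSt N w input) g1 := by
    refine ⟨fun x => ?_, fun tag ht r x hx y hy => ?_, rfl⟩
    · by_cases hx : x = .n
      · subst hx; simp [hg1, initSt]
      · have : regVar x ≠ regVar .n := fun h' => hx (Var.enc_injective (by
          simp only [regVar] at h'; omega))
        simp [hg1, initSt, Function.update_of_ne hx, Function.update_of_ne this]
    · simp [hg1, initSt, ht, hx, hy]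
  have hcode : CodeAt c.program 1 (c.code 1 0) := by
    intro i hi
    rw [Cmd.program, add_comm, List.getElem?_cons_succ]
  obtain ⟨s', g', t, hQ, rep', pc', ht', hre', -⟩ :=
    c.sound h16 (K := c.size) le_rfl 1 0 Q _ g1 hcode rfl rep1 h
  refine ⟨s', hQ, ?_⟩
  have ht' : s'.time = t := by simpa [initSt] using ht'
  obtain ⟨T, hT, hT'⟩ := r1.trans hre'
  have hlen : c.program.length ≤ g'.pc := by
    rw [pc', Cmd.program, List.length_cons, Cmd.length_code]; omega
  have e : (step w c.program)^[c.size * s'.time + 1] g0 = g' := by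
    have : c.size * s'.time + 1 = (c.size * s'.time + 1 - T) + T := by rw [ht']; omega
    rw [this, Function.iterate_add_apply, hT', iterate_halted hlen]
  refine ⟨?_, ?_⟩
  · rw [e]; exact hlen
  · rw [e]; exact rep'.out

end WordRAM

/-! ### Rules for weakest preconditions -/

namespace WordRAM

@[simp] theorem St.set_var (s : St) (x y : Var) (a : ℕ) :
    (s.set x a).var y = if y = x then a else s.var y := by
  simp [St.set, Function.update_apply]
@[simp] theorem St.set_mem (s : St) (x : Var) (a : ℕ) : (s.set x a).mem = s.mem := rfl
@[simp] theorem St.set_out (s : St) (x : Var) (a : ℕ) : (s.set x a).out = s.out := rfl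
@[simp] theorem St.set_time (s : St) (x : Var) (a : ℕ) : (s.set x a).time = s.time := rfl
@[simp] theorem St.tick_var (s : St) : s.tick.var = s.var := rfl
@[simp] theorem St.tick_mem (s : St) : s.tick.mem = s.mem := rfl
@[simp] theorem St.tick_out (s : St) : s.tick.out = s.out := rfl
@[simp] theorem St.tick_time (s : St) : s.tick.time = s.time + 1 := rfl
@[simp] theorem St.store_var (s : St) (tag r x y a : ℕ) :
    (s.store tag r x y a).var = s.var := rfl
@[simp] theorem St.store_mem (s : St) (tag r x y a tag' r' x' y' : ℕ) :
    (s.store tag r x y a).mem tag' r' x' y' =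
      if tag' = tag ∧ r' = r ∧ x' = x ∧ y' = y then a else s.mem tag' r' x' y' := rfl
@[simp] theorem St.store_out (s : St) (tag r x y a : ℕ) :
    (s.store tag r x y a).out = s.out := rfl
@[simp] theorem St.store_time (s : St) (tag r x y a : ℕ) :
    (s.store tag r x y a).time = s.time := rfl
@[simp] theorem St.put_var (s : St) (a : ℕ) : (s.put a).var = s.var := rfl
@[simp] theorem St.put_mem (s : St) (a : ℕ) : (s.put a).mem = s.mem := rfl
@[simp] theorem St.put_out (s : St) (a : ℕ) : (s.put a).out = s.out ++ [a] := rfl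
@[simp] theorem St.put_time (s : St) (a : ℕ) : (s.put a).time = s.time := rfl

theorem wp_mono {N B : ℕ} (c : Cmd) : ∀ {Q Q' : St → Prop} {s : St}, wp N B c Q s →
    (∀ s', Q s' → Q' s') → wp N B c Q' s := by
  induction c with
  | skip => intro Q Q' s h hQ; exact hQ _ h
  | set x e => intro Q Q' s h hQ; exact ⟨h.1, h.2.1, h.2.2.1, hQ _ h.2.2.2⟩
  | st tag r x y e =>
    intro Q Q' s h hQ
    exact ⟨h.1, h.2.1, h.2.2.1, h.2.2.2.1, h.2.2.2.2.1, hQ _ h.2.2.2.2.2⟩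
  | out e => intro Q Q' s h hQ; exact ⟨h.1, hQ _ h.2⟩
  | seq c d ihc ihd => intro Q Q' s h hQ; exact ihc h fun s' h' => ihd h' hQ
  | whenEq a b c ih =>
    intro Q Q' s h hQ
    exact ⟨h.1, h.2.1, fun e => ih (h.2.2.1 e) hQ, fun e => hQ _ (h.2.2.2 e)⟩
  | whenLt a b c ih =>
    intro Q Q' s h hQ
    exact ⟨h.1, h.2.1, fun e => ih (h.2.2.1 e) hQ, fun e => hQ _ (h.2.2.2 e)⟩
  | loop x a b c ih =>
    intro Q Q' s ⟨h1, h2, h3, h4, h5, h6, I, h7, h8, h9⟩ hQ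
    exact ⟨h1, h2, h3, h4, h5, h6, I, h7, h8, fun s' h' => hQ _ (h9 s' h')⟩

/-- The variables that a command may change. -/
def Cmd.mods : Cmd → Var → Prop
  | .skip, _ => False
  | .set x _, y => y = x
  | .st _ _ _ _ _, _ => False
  | .out _, _ => False
  | .seq c d, y => c.mods y ∨ d.mods y
  | .whenEq _ _ c, y => c.mods y
  | .whenLt _ _ c, y => c.mods y
  | .loop x _ _ c, y => y = x ∨ c.mods y

/-- The arrays that a command may change. -/
def Cmd.tags : Cmd → ℕ → Prop
  | .skip, _ => False
  | .set _ _, _ => False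
  | .st tag _ _ _ _, t => t = tag
  | .out _, _ => False
  | .seq c d, t => c.tags t ∨ d.tags t
  | .whenEq _ _ c, t => c.tags t
  | .whenLt _ _ c, t => c.tags t
  | .loop _ _ _ c, t => c.tags t

/-- Whether a command may write output. -/
def Cmd.outs : Cmd → Prop
  | .skip => False
  | .set _ _ => False
  | .st _ _ _ _ _ => False
  | .out _ => True
  | .seq c d => c.outs ∨ d.outs
  | .whenEq _ _ c => c.outs
  | .whenLt _ _ c => c.outs
  | .loop _ _ _ c => c.outs

/-- Two states agree on all that a command cannot change. -/
structure Frame (c : Cmd) (s s' : St) : Prop where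
  var : ∀ x, ¬ c.mods x → s'.var x = s.var x
  mem : ∀ t, ¬ c.tags t → s'.mem t = s.mem t
  out : ¬ c.outs → s'.out = s.out

theorem Frame.refl (c : Cmd) (s : St) : Frame c s s := ⟨fun _ _ => rfl, fun _ _ => rfl, fun _ => rfl⟩

theorem Frame.trans {c : Cmd} {s s' s'' : St} (h : Frame c s s') (h' : Frame c s' s'') :
    Frame c s s'' :=
  ⟨fun x hx => (h'.var x hx).trans (h.var x hx), fun t ht => (h'.mem t ht).trans (h.mem t ht),
    fun ho => (h'.out ho).trans (h.out ho)⟩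

theorem Frame.tick_right {c : Cmd} {s s' : St} (h : Frame c s s') : Frame c s s'.tick :=
  ⟨h.var, h.mem, h.out⟩

theorem Frame.of {c c' : Cmd} {s s' : St} (h : Frame c s s') (h1 : ∀ x, c.mods x → c'.mods x)
    (h2 : ∀ t, c.tags t → c'.tags t) (h3 : c.outs → c'.outs) : Frame c' s s' :=
  ⟨fun x hx => h.var x fun e => hx (h1 x e), fun t ht => h.mem t fun e => ht (h2 t e),
    fun ho => h.out fun e => ho (h3 e)⟩

/-- Whatever a command cannot modify syntactically is preserved, for any postcondition. This keeps
loop invariants short: they need only mention what the loop changes. -/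
theorem wp_frame {N B : ℕ} (c : Cmd) : ∀ {Q : St → Prop} {s : St}, wp N B c Q s →
    wp N B c (fun s' => Q s' ∧ Frame c s s') s := by
  induction c with
  | skip => intro Q s h; exact ⟨h, Frame.refl _ _⟩
  | set x e =>
    intro Q s h
    refine ⟨h.1, h.2.1, h.2.2.1, h.2.2.2, ?_, fun _ _ => rfl, fun _ => rfl⟩
    intro y hy
    simp only [Cmd.mods] at hy
    simp [hy]
  | st tag r x y e =>
    intro Q s h
    refine ⟨h.1, h.2.1, h.2.2.1, h.2.2.2.1, h.2.2.2.2.1, h.2.2.2.2.2, fun _ _ => rfl, ?_,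
      fun _ => rfl⟩
    intro t ht
    simp only [Cmd.tags] at ht
    funext r' x' y'
    simp [ht]
  | out e =>
    intro Q s h
    exact ⟨h.1, h.2, fun _ _ => rfl, fun _ _ => rfl, fun ho => (ho trivial).elim⟩
  | seq c d ihc ihd =>
    intro Q s h
    refine wp_mono c (ihc h) ?_
    intro s' ⟨h', f'⟩
    refine wp_mono d (ihd h') ?_
    intro s'' ⟨h'', f''⟩
    exact ⟨h'', (f'.of (fun _ => Or.inl) (fun _ => Or.inl) Or.inl).trans
      (f''.of (fun _ => Or.inr) (fun _ => Or.inr) Or.inr)⟩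
  | whenEq a b c ih =>
    intro Q s h
    refine ⟨h.1, h.2.1, fun e => wp_mono c (ih (h.2.2.1 e)) ?_,
      fun e => ⟨h.2.2.2 e, (Frame.refl _ _).tick_right⟩⟩
    intro s' ⟨h', f'⟩
    exact ⟨h', f'.var, f'.mem, f'.out⟩
  | whenLt a b c ih =>
    intro Q s h
    refine ⟨h.1, h.2.1, fun e => wp_mono c (ih (h.2.2.1 e)) ?_,
      fun e => ⟨h.2.2.2 e, (Frame.refl _ _).tick_right⟩⟩
    intro s' ⟨h', f'⟩
    exact ⟨h', f'.var, f'.mem, f'.out⟩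
  | loop x a b c ih =>
    intro Q s ⟨h1, h2, h3, h4, h5, h6, I, h7, h8, h9⟩
    refine ⟨h1, h2, h3, h4, h5, h6, fun j s' => I j s' ∧ Frame (.loop x a b c) s s',
      ⟨h7, (Frame.refl _ _).tick_right⟩, ?_, fun s' h' => ⟨h9 s' h'.1, h'.2⟩⟩
    intro j hj1 hj2 s' ⟨hI, f⟩
    refine wp_mono c (ih (h8 j hj1 hj2 s' hI)) ?_
    intro s'' ⟨h', f'⟩
    refine ⟨h', f.trans (Frame.trans ?_ (f'.of (fun _ => Or.inr) (fun _ => id) id))⟩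
    refine ⟨fun y hy => ?_, fun _ _ => rfl, fun _ => rfl⟩
    have : y ≠ x := fun e => hy (Or.inl e)
    simp [this]

/-- The rule for loops; the loop invariant only has to speak about what the loop changes. -/
theorem wp_loop {N B : ℕ} {x : Var} {a b : Ex} {c : Cmd} {Q : St → Prop} {s : St}
    (I : ℕ → St → Prop) (fa : a.fits N B s) (fb : b.fits N B s) (hb : b.eval s < B) (hx : x ≠ .n)
    (hab : a.eval s ≤ b.eval s) (h0 : I (a.eval s) s.tick)
    (hstep : ∀ j, a.eval s ≤ j → j < b.eval s → ∀ s', I j s' → Frame (.loop x a b c) s s' →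
      wp N B c (I (j + 1)) (s'.set x j).tick)
    (hend : ∀ s', I (b.eval s) s' → Frame (.loop x a b c) s s' → Q s') :
    wp N B (.loop x a b c) Q s := by
  refine ⟨fa, fb, by omega, hb, hx, hab, fun j s' => I j s' ∧ Frame (.loop x a b c) s s',
    ⟨h0, (Frame.refl _ _).tick_right⟩, ?_, fun s' h => hend s' h.1 h.2⟩
  intro j hj1 hj2 s' ⟨hI, f⟩
  refine wp_mono c (wp_frame c (hstep j hj1 hj2 s' hI f)) ?_
  intro s'' ⟨h', f'⟩
  refine ⟨h', f.trans (Frame.trans ?_ (f'.of (fun _ => Or.inr) (fun _ => id) id))⟩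
  refine ⟨fun y hy => ?_, fun _ _ => rfl, fun _ => rfl⟩
  have : y ≠ x := fun e => hy (Or.inl e)
  simp [this]

theorem wp_seq {N B : ℕ} {c d : Cmd} {Q : St → Prop} {s : St} (R : St → Prop)
    (hc : wp N B c R s) (hd : ∀ s', R s' → Frame c s s' → wp N B d Q s') :
    wp N B (.seq c d) Q s :=
  wp_mono c (wp_frame c hc) fun s' h => hd s' h.1 h.2

end WordRAM

/-! ### Exploring a graph level by level -/

namespace WordRAM

/-- The expression for the rank of a vertex: its degree, with ties broken by the number. -/
def keyEx (x : Ex) : Ex := .add (.mul (.ld 1 (.lit 0) x (.lit 0)) (.var .n)) x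

/-- Visit the neighbour number `jj` of `y`. -/
def visitCmd (tb : ℕ) (cv : Var) : Cmd :=
  .seq (.set .z (.ld 2 (.lit 0) (.var .y) (.var .jj)))
  (.whenEq (.mod (.var .z) (.var .p)) (.var cv)
    (.whenLt (keyEx (.var .z)) (keyEx (.var .v))
      -- A zero count doubles as the test that `z` is new, so `z` enters the queue only on its first
      -- visit, and no separate array of visited vertices is needed.
      (.seq (.whenEq (.ld (tb + 1) (.var .r) (.var .z) (.lit 0)) (.lit 0)
        (.seq (.st tb (.var .r) (.lit 0) (.var .tl) (.var .z))
          (.set .tl (.add (.var .tl) (.lit 1)))))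
      (.seq (.st (tb + 2) (.var .r) (.var .z) (.ld (tb + 1) (.var .r) (.var .z) (.lit 0)) (.var .y))
      (.st (tb + 1) (.var .r) (.var .z) (.lit 0)
        (.add (.ld (tb + 1) (.var .r) (.var .z) (.lit 0)) (.lit 1)))))))

/-- Find the next level, whose vertices have the colour in the variable `cv`. -/
def stepCmd (tb : ℕ) (cv : Var) : Cmd :=
  .seq (.set .tl (.var .hi))
  (.seq (.loop .q (.var .lo) (.var .hi)
    (.seq (.set .y (.ld tb (.var .r) (.lit 0) (.var .q)))
      (.loop .jj (.lit 0) (.ld 1 (.lit 0) (.var .y) (.lit 0)) (visitCmd tb cv))))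
  (.seq (.set .lo (.var .hi)) (.set .hi (.var .tl))))

/-- Find the first `k` levels around the vertex `v`. -/
def exploreCmd (tb : ℕ) (cv : ℕ → Var) : ℕ → Cmd
  | 0 => .seq (.st tb (.var .r) (.lit 0) (.lit 0) (.var .v))
      (.seq (.set .lo (.lit 0)) (.set .hi (.lit 1)))
  | k + 1 => .seq (exploreCmd tb cv k) (stepCmd tb (cv (k + 1)))

/-- The arrays of degrees and of neighbours are those of the neighbour lists `nb`. -/
structure Env (N : ℕ) (nb : ℕ → List ℕ) (s : St) : Prop where
  n : s.var .n = N
  deg : ∀ x < N, s.mem 1 0 x 0 = (nb x).length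
  adj : ∀ x < N, ∀ j (h : j < (nb x).length), s.mem 2 0 x j = (nb x)[j]

/-- Neighbour lists of a graph on `{0, …, N - 1}`. -/
structure GoodNb (N : ℕ) (nb : ℕ → List ℕ) : Prop where
  nodup : ∀ x < N, (nb x).Nodup
  lt : ∀ x < N, ∀ y ∈ nb x, y < N

theorem length_le_of_nodup {N : ℕ} {l : List ℕ} (h : l.Nodup) (hl : ∀ x ∈ l, x < N) :
    l.length ≤ N := by
  rw [← List.toFinset_card_of_nodup h, ← Finset.card_range N]
  exact Finset.card_le_card fun x hx => by simpa using hl x (by simpa using hx)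

theorem GoodNb.length_le {N : ℕ} {nb : ℕ → List ℕ} (h : GoodNb N nb) {x : ℕ} (hx : x < N) :
    (nb x).length ≤ N := length_le_of_nodup (h.nodup x hx) (h.lt x hx)

theorem addr_lt {N tag r x y : ℕ} (ht : tag < 16) (hx : x < N) (hy : y < N) :
    addr N tag r x y < 16 * (r + 1) * N * N := by
  have h1 : r * 16 + tag + 1 ≤ 16 * (r + 1) := by omega
  have h2 : (r * 16 + tag) * N + x + 1 ≤ 16 * (r + 1) * N := by
    calc (r * 16 + tag) * N + x + 1 ≤ (r * 16 + tag + 1) * N := by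
          have : (r * 16 + tag + 1) * N = (r * 16 + tag) * N + N := by ring
          omega
      _ ≤ _ := Nat.mul_le_mul_right _ h1
  calc addr N tag r x y < ((r * 16 + tag) * N + x + 1) * N := by
        have : ((r * 16 + tag) * N + x + 1) * N = ((r * 16 + tag) * N + x) * N + N := by ring
        rw [addr]; omega
    _ ≤ _ := Nat.mul_le_mul_right _ h2

/-- The rank of a vertex. -/
def key (N : ℕ) (nb : ℕ → List ℕ) (x : ℕ) : ℕ := (nb x).length * N + x

theorem key_lt {N : ℕ} {nb : ℕ → List ℕ} (h : GoodNb N nb) {x : ℕ} (hx : x < N) :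
    key N nb x < 16 * N * N := by
  have := Nat.mul_le_mul_right N (h.length_le hx)
  have h1 : 0 < N := by omega
  have h2 : N ≤ N * N := Nat.le_mul_of_pos_left _ h1
  unfold key
  nlinarith

/-- The vertices that may be found in the next level. -/
abbrev Good (N : ℕ) (nb : ℕ → List ℕ) (p c v x : ℕ) : Prop :=
  x % p = c ∧ key N nb x < key N nb v

/-- The memory of an exploration in the region `r` holds the queue `Q` and the lists `K`. -/
structure Expl (N tb r : ℕ) (s0 : St) (Q : List ℕ) (K : ℕ → List ℕ) (s : St) : Prop where
  queue : ∀ j (h : j < Q.length), s.mem tb r 0 j = Q[j]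
  cnt : ∀ x < N, s.mem (tb + 1) r x 0 = (K x).length
  kid : ∀ x < N, ∀ j (h : j < (K x).length), s.mem (tb + 2) r x j = (K x)[j]
  other : ∀ t r', r' ≠ r → s.mem t r' = s0.mem t r'

theorem fits_keyEx {N B : ℕ} {nb : ℕ → List ℕ} (hnb : GoodNb N nb) (hB : 16 * N * N ≤ B) {s : St}
    (he : Env N nb s) {y : Var} (hy : s.var y < N) :
    (keyEx (.var y)).fits N B s ∧ (keyEx (.var y)).eval s = key N nb (s.var y) := by
  have h1 := key_lt hnb hy
  have h2 : addr N 1 0 (s.var y) 0 < B :=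
    lt_of_lt_of_le (addr_lt (by omega) hy (by omega)) (by simpa using hB)
  have h0 : 0 < B := by omega
  simp only [keyEx, Ex.fits, Ex.eval, he.n, he.deg _ hy, Access]
  unfold key at h1 ⊢
  refine ⟨⟨⟨⟨h0, trivial, h0, trivial, by omega, hy, by omega, h2⟩, trivial, by omega⟩, trivial,
    by omega⟩, rfl⟩

-- The hypotheses `hQN` and `hKN` say that the queue and the list of the visited vertex have a free
-- slot; they are needed only if the vertex is recorded. The longest branch executes eight commands.
set_option maxHeartbeats 1000000 in
theorem wp_visit {N B : ℕ} {nb : ℕ → List ℕ} (hnb : GoodNb N nb) {tb r v : ℕ} {cv : Var}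
    (htb : tb = 3 ∨ tb = 6) (hcv : ∃ a, cv = .c a) {s0 s : St} {Q : List ℕ} {K : ℕ → List ℕ}
    {y j : ℕ} (hN : 0 < N) (hB : 16 * (r + 1) * N * N ≤ B)
    (he : Env N nb s) (hx : Expl N tb r s0 Q K s) (hr : s.var .r = r) (hv : s.var .v = v)
    (hvN : v < N) (hy : s.var .y = y) (hyN : y < N) (hj : s.var .jj = j) (hjl : j < (nb y).length)
    (htl : s.var .tl = Q.length)
    (hQN : Good N nb (s.var .p) (s.var cv) v (nb y)[j] → K (nb y)[j] = [] → Q.length < N)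
    (hKN : Good N nb (s.var .p) (s.var cv) v (nb y)[j] → (K (nb y)[j]).length < N) :
    wp N B (visitCmd tb cv) (fun s' =>
      Expl N tb r s0
        (if Good N nb (s.var .p) (s.var cv) v (nb y)[j] ∧ K (nb y)[j] = []
          then Q ++ [(nb y)[j]] else Q)
        (if Good N nb (s.var .p) (s.var cv) v (nb y)[j]
          then Function.update K (nb y)[j] (K (nb y)[j] ++ [y]) else K) s' ∧
      s'.var .tl = (if Good N nb (s.var .p) (s.var cv) v (nb y)[j] ∧ K (nb y)[j] = []
          then Q ++ [(nb y)[j]] else Q).length ∧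
      s'.time ≤ s.time + 8) s := by
  obtain ⟨a, rfl⟩ := hcv
  have hz : (nb y)[j] < N := hnb.lt y hyN _ (List.getElem_mem hjl)
  have hadj := he.adj y hyN j hjl
  set z := (nb y)[j] with hzdef
  have hjN : j < N := lt_of_lt_of_le hjl (hnb.length_le hyN)
  have hB1 : 16 * N * N ≤ B := le_trans (by
    rw [mul_assoc, mul_assoc 16, mul_assoc, mul_assoc]
    exact Nat.mul_le_mul_left _ (by rw [← mul_assoc]; exact Nat.mul_le_mul_right _ (by nlinarith)))
    hB
  have hNB : N * N < B := by nlinarith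
  have hNB' : N < B := by nlinarith
  have hacc : ∀ {t x i : ℕ}, t < 16 → x < N → i < N → addr N t r x i < B := fun ht hx hi =>
    lt_of_lt_of_le (addr_lt ht hx hi) hB
  have hacc0 : ∀ {t x i : ℕ}, t < 16 → x < N → i < N → addr N t 0 x i < B := fun ht hx hi =>
    lt_of_lt_of_le (addr_lt ht hx hi) (by simpa using hB1)
  have ht3 : tb + 1 < 16 ∧ tb + 2 < 16 ∧ tb < 16 := by omega
  have h0B : 0 < B := by omega
  have h1B : 1 < B := by nlinarith
  unfold visitCmd
  refine wp_seq (fun s' => s' = (s.set .z z).tick) ?_ ?_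
  · simp only [wp, Ex.fits, Ex.eval, Access, hy, hj, he.n, hadj]
    exact ⟨⟨h0B, trivial, trivial, trivial, by omega, hyN, hjN, hacc0 (by omega) hyN hjN⟩, by omega,
      by simp, trivial⟩
  rintro s1 rfl -
  have he1 : Env N nb (s.set .z z).tick := ⟨by simp [he.n], he.deg, he.adj⟩
  obtain ⟨fz, ez⟩ := fits_keyEx hnb hB1 he1 (y := .z) (by simpa using hz)
  obtain ⟨fv, ev⟩ := fits_keyEx hnb hB1 he1 (y := .v) (by simpa [hv] using hvN)
  have hmod : z % s.var .p < B := lt_of_le_of_lt (Nat.mod_le _ _) (by omega)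
  simp only [wp]
  refine ⟨by simp [Ex.fits, Ex.eval, hmod], trivial, ?_, ?_⟩
  swap
  · intro hne
    have hne : ¬ z % s.var .p = s.var (.c a) := by simpa [Ex.eval] using hne
    simp only [Good, hne, false_and, if_false]
    exact ⟨⟨hx.queue, hx.cnt, hx.kid, hx.other⟩, by simpa using htl, by simp⟩
  intro hcol
  have hcol : z % s.var .p = s.var (.c a) := by simpa [Ex.eval] using hcol
  refine ⟨⟨fz.1, fz.2⟩, fv, ?_, ?_⟩
  swap
  · intro hne
    have e1 : (keyEx (.var .z)).eval ((s.set .z z).tick.tick) = key N nb z := by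
      rw [← show (s.set Var.z z).tick.var .z = z by simp, ← ez]; rfl
    have e2 : (keyEx (.var .v)).eval ((s.set .z z).tick.tick) = key N nb v := by
      rw [← show (s.set Var.z z).tick.var .v = v by simp [hv], ← ev]; rfl
    rw [e1, e2] at hne
    simp only [Good, hne, and_false, false_and, if_false]
    exact ⟨⟨hx.queue, hx.cnt, hx.kid, hx.other⟩, by simpa using htl, by simp⟩
  intro hlt
  have hgood : Good N nb (s.var .p) (s.var (.c a)) v z := by
    refine ⟨hcol, ?_⟩
    have e1 : (keyEx (.var .z)).eval ((s.set .z z).tick.tick) = key N nb z := by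
      rw [← show (s.set Var.z z).tick.var .z = z by simp, ← ez]; rfl
    have e2 : (keyEx (.var .v)).eval ((s.set .z z).tick.tick) = key N nb v := by
      rw [← show (s.set Var.z z).tick.var .v = v by simp [hv], ← ev]; rfl
    rwa [e1, e2] at hlt
  have hKz := hKN hgood
  simp only [eq_true hgood, true_and, if_true]
  have hcz := hx.cnt z hz
  simp only [Ex.fits, Ex.eval, Access, St.tick_var, St.set_var, St.tick_mem, St.set_mem, he.n, hr,
    hcz, htl, hy, St.store_var, St.store_mem, reduceCtorEq, if_false, if_true]
  have n1 : tb + 1 ≠ tb := by omega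
  have n2 : tb + 1 ≠ tb + 2 := by omega
  have n3 : tb + 2 ≠ tb := by omega
  have n4 : tb ≠ tb + 1 := by omega
  have n5 : tb ≠ tb + 2 := by omega
  have n6 : tb + 2 ≠ tb + 1 := by omega
  have a1 := hacc ht3.1 hz hN
  have a2 := fun h => hacc (x := z) (i := (K z).length) ht3.2.1 hz h
  have a2 := a2 hKz
  refine ⟨by simp [hz, hN, ht3, a1, h0B], h0B, ?_, ?_⟩
  · intro hl0
    have hnil : K z = [] := List.length_eq_zero_iff.1 hl0
    have hQ := hQN hgood hnil
    have a3 := hacc ht3.2.2 hN hQ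
    rw [hnil] at a2
    simp only [hnil, if_true, St.store_mem, n1, n2, false_and, if_false, hcz, St.tick_mem,
      St.set_mem, reduceCtorEq, List.length_nil, and_true, and_self, true_and, zero_add,
      ne_eq, not_false_eq_true] at a2 ⊢
    have hQB : Q.length + 1 < B := by omega
    and_intros
    any_goals first | trivial | assumption | exact ht3.1 | exact ht3.2.1 | exact ht3.2.2
    · refine ⟨?_, ?_, ?_, ?_⟩
      · intro i hi
        simp only [St.tick_mem, St.store_mem, n4, n5, false_and, if_false, St.set_mem, true_and]
        by_cases hi' : i = Q.length
        · subst hi'; simp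
        · have : i < Q.length := by simp at hi; omega
          rw [if_neg hi', hx.queue i this, List.getElem_append_left this]
      · intro x hxN
        by_cases hxz : x = z
        · subst hxz; simp
        · simp [hxz, n2, n1, Function.update_of_ne hxz, hx.cnt x hxN]
      · intro x hxN i hi
        by_cases hxz : x = z
        · subst hxz
          simp at hi
          subst hi
          simp [n6]
        · simp only [Function.update_of_ne hxz] at hi ⊢
          simp [hxz, n3, hx.kid x hxN i hi]
      · intro t r' hr'
        funext x i
        simp [hr', hx.other t r' hr']
    · simp
  · intro hl0
    have hnil : K z ≠ [] := fun e => hl0 (by simp [e])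
    have hKB : (K z).length + 1 < B := by omega
    simp only [hnil, if_false, St.store_mem, n1, n2, n6, false_and, hcz, true_and, 
      St.tick_mem, St.set_mem, reduceCtorEq]
    and_intros
    any_goals first | trivial | assumption | exact ht3.1 | exact ht3.2.1 | exact ht3.2.2
    · refine ⟨?_, ?_, ?_, ?_⟩
      · intro i hi
        simp [n4, n5, hx.queue i hi]
      · intro x hxN
        by_cases hxz : x = z
        · subst hxz; simp
        · simp [hxz, n2, Function.update_of_ne hxz, hx.cnt x hxN]
      · intro x hxN i hi
        by_cases hxz : x = z
        · subst hxz
          simp only [Function.update_self] at hi ⊢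
          by_cases hi' : i = (K z).length
          · subst hi'; simp [n6]
          · have : i < (K z).length := by simp at hi; omega
            simp [hi', hx.kid _ hz i this, List.getElem_append_left this, n3, n6]
        · simp only [Function.update_of_ne hxz] at hi ⊢
          simp [hxz, n3, hx.kid x hxN i hi]
      · intro t r' hr'
        funext x i
        simp [hr', hx.other t r' hr']
    · simp

end WordRAM

/-! ### The search for the next level -/

namespace WordRAM

theorem Env.of_frame {N : ℕ} {nb : ℕ → List ℕ} {c : Cmd} {s s' : St} (h : Env N nb s)
    (f : Frame c s s') (hn : ¬ c.mods .n) (h1 : ¬ c.tags 1) (h2 : ¬ c.tags 2) : Env N nb s' :=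
  ⟨(f.var _ hn).trans h.n, fun x hx => by rw [f.mem _ h1, h.deg x hx],
    fun x hx j hj => by rw [f.mem _ h2, h.adj x hx j hj]⟩

theorem Env.of_eq {N : ℕ} {nb : ℕ → List ℕ} {s s' : St} (h : Env N nb s)
    (hv : s'.var .n = s.var .n) (h1 : s'.mem = s.mem) : Env N nb s' :=
  ⟨hv.trans h.n, fun x hx => by rw [h1, h.deg x hx], fun x hx j hj => by rw [h1, h.adj x hx j hj]⟩

theorem Expl.of_mem {N tb r : ℕ} {s0 s s' : St} {Q : List ℕ} {K : ℕ → List ℕ}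
    (h : Expl N tb r s0 Q K s) (hm : s'.mem = s.mem) : Expl N tb r s0 Q K s' :=
  ⟨by rw [hm]; exact h.queue, by rw [hm]; exact h.cnt, by rw [hm]; exact h.kid,
    by rw [hm]; exact h.other⟩

/-- The lists `K` after the pairs `ps` have been visited. -/
def addKids (g : ℕ → Prop) [DecidablePred g] (K : ℕ → List ℕ) (ps : List (ℕ × ℕ)) (x : ℕ) :
    List ℕ := K x ++ (ps.filter fun e => e.2 = x ∧ g x).map Prod.fst

/-- One more pair changes the lists exactly as one run of `visitCmd` does. -/
theorem addKids_concat (g : ℕ → Prop) [DecidablePred g] (K : ℕ → List ℕ) (ps : List (ℕ × ℕ))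
    (y z : ℕ) : addKids g K (ps ++ [(y, z)]) =
      if g z then Function.update (addKids g K ps) z (addKids g K ps z ++ [y])
      else addKids g K ps := by
  funext x
  by_cases hg : g z
  · rw [if_pos hg]
    by_cases hx : x = z
    · subst hx; simp [addKids, hg]
    · have : ¬ z = x := fun e => hx e.symm
      simp [addKids, Function.update_of_ne hx, this]
  · rw [if_neg hg]
    by_cases hx : z = x
    · subst hx; simp [addKids, hg]
    · simp [addKids, hx]

/-- The pairs of a vertex in `F` and one of its neighbours. -/
def pairs (nb : ℕ → List ℕ) (F : List ℕ) : List (ℕ × ℕ) := F.flatMap fun y => (nb y).map (Prod.mk y)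

theorem mem_pairs {nb : ℕ → List ℕ} {F : List ℕ} {e : ℕ × ℕ} :
    e ∈ pairs nb F ↔ e.1 ∈ F ∧ e.2 ∈ nb e.1 := by
  obtain ⟨y, z⟩ := e
  simp only [pairs, List.mem_flatMap, List.mem_map, Prod.mk.injEq]
  constructor
  · rintro ⟨y', h1, z', h2, rfl, rfl⟩; exact ⟨h1, h2⟩
  · rintro ⟨h1, h2⟩; exact ⟨y, h1, z, h2, rfl, rfl⟩

theorem nodup_pairs {nb : ℕ → List ℕ} {F : List ℕ} (hF : F.Nodup) (h : ∀ y ∈ F, (nb y).Nodup) :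
    (pairs nb F).Nodup := by
  refine List.nodup_flatMap.2 ⟨fun y hy => (h y hy).map (Prod.mk_right_injective y), ?_⟩
  refine hF.imp ?_
  intro a b hab
  simp only [Function.onFun, List.disjoint_left, List.mem_map]
  rintro _ ⟨z, _, rfl⟩ ⟨z', _, h⟩
  exact hab (Prod.ext_iff.1 h).1.symm

theorem mem_addKids {g : ℕ → Prop} [DecidablePred g] {K : ℕ → List ℕ} {ps : List (ℕ × ℕ)}
    {x y : ℕ} : y ∈ addKids g K ps x ↔ y ∈ K x ∨ (g x ∧ (y, x) ∈ ps) := by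
  simp only [addKids, List.mem_append, List.mem_map, List.mem_filter, decide_eq_true_eq]
  constructor
  · rintro (h | ⟨⟨a, b⟩, ⟨h1, h2, h3⟩, rfl⟩)
    · exact Or.inl h
    · simp only at h2 ⊢; subst h2; exact Or.inr ⟨h3, h1⟩
  · rintro (h | ⟨h1, h2⟩)
    · exact Or.inl h
    · exact Or.inr ⟨(y, x), ⟨h2, rfl, h1⟩, rfl⟩

theorem nodup_addKids {g : ℕ → Prop} [DecidablePred g] {K : ℕ → List ℕ} {ps : List (ℕ × ℕ)}
    {x : ℕ} (hK : K x = []) (h : ps.Nodup) : (addKids g K ps x).Nodup := by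
  rw [addKids, hK, List.nil_append]
  refine (h.filter _).map_on ?_
  rintro ⟨a, b⟩ h1 ⟨a', b'⟩ h2 e
  simp only [List.mem_filter, decide_eq_true_eq] at h1 h2
  exact Prod.ext e (h1.2.1.trans h2.2.1.symm)

/-- The state of the search for the next level after the pairs `ps` have been visited. -/
structure StepInv (N tb r : ℕ) (s0 : St) (g : ℕ → Prop) [DecidablePred g] (K0 : ℕ → List ℕ)
    (Q0 : List ℕ) (ps : List (ℕ × ℕ)) (T : ℕ) (s : St) : Prop where
  found : ∃ new, Expl N tb r s0 (Q0 ++ new) (addKids g K0 ps) s ∧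
    s.var .tl = (Q0 ++ new).length ∧ new.Nodup ∧ ∀ x, x ∈ new ↔ g x ∧ ∃ e ∈ ps, e.2 = x
  time : s.time ≤ T

theorem StepInv.of_eq {N tb r : ℕ} {s0 : St} {g : ℕ → Prop} [DecidablePred g] {K0 : ℕ → List ℕ}
    {Q0 : List ℕ} {ps : List (ℕ × ℕ)} {T T' : ℕ} {s s' : St}
    (h : StepInv N tb r s0 g K0 Q0 ps T s) (hm : s'.mem = s.mem) (ht : s'.var .tl = s.var .tl)
    (hT : s'.time ≤ T') : StepInv N tb r s0 g K0 Q0 ps T' s' := by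
  obtain ⟨⟨new, h1, h2, h3, h4⟩, _⟩ := h
  exact ⟨⟨new, h1.of_mem hm, ht.trans h2, h3, h4⟩, hT⟩

/-- After a prefix of the pairs has been visited, the new part of the queue consists of the good
second components. This relies on `hQg` and `hK`: no vertex already in the queue is good for the
present colour, and good vertices start with empty lists. Each queue entry costs 3 commands besides
its neighbours, and each neighbour costs one loop round and at most eight commands. -/
theorem wp_step {N B : ℕ} {nb : ℕ → List ℕ} (hnb : GoodNb N nb) {tb r v p c : ℕ} {cv : Var}
    (htb : tb = 3 ∨ tb = 6) (hcv : ∃ a, cv = .c a) {s0 s : St} {Qa F : List ℕ} {K : ℕ → List ℕ}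
    (hN : 0 < N) (hB : 16 * (r + 1) * N * N ≤ B)
    (he : Env N nb s) (hx : Expl N tb r s0 (Qa ++ F) K s) (hr : s.var .r = r) (hv : s.var .v = v)
    (hp : s.var .p = p) (hc : s.var cv = c)
    (hvN : v < N) (hlo : s.var .lo = Qa.length) (hhi : s.var .hi = (Qa ++ F).length)
    (hQ : (Qa ++ F).Nodup) (hQN : ∀ x ∈ Qa ++ F, x < N) (hQg : ∀ x ∈ Qa ++ F, ¬ Good N nb p c v x)
    (hK : ∀ x, Good N nb p c v x → K x = []) :
    wp N B (stepCmd tb cv) (fun s' => ∃ new, Expl N tb r s0 (Qa ++ F ++ new)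
        (addKids (Good N nb p c v) K (pairs nb F)) s' ∧ s'.var .lo = (Qa ++ F).length ∧
        s'.var .hi = (Qa ++ F ++ new).length ∧ new.Nodup ∧
        (∀ x, x ∈ new ↔ Good N nb p c v x ∧ ∃ y ∈ F, x ∈ nb y) ∧
        s'.time ≤ s.time + 4 + (F.map fun y => 3 + 9 * (nb y).length).sum) s := by
  obtain ⟨a, rfl⟩ := hcv
  set Q0 := Qa ++ F with hQ0
  set g := Good N nb p c v with hg
  have hQlen := length_le_of_nodup hQ hQN
  have hNB : N < B := by nlinarith [Nat.zero_le r, Nat.mul_le_mul_left (16 * (r + 1)) hN]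
  have h0B : 0 < B := by omega
  have hacc : ∀ {t x i : ℕ}, t < 16 → x < N → i < N → addr N t r x i < B := fun ht hx hi =>
    lt_of_lt_of_le (addr_lt ht hx hi) hB
  have hacc0 : ∀ {t x i : ℕ}, t < 16 → x < N → i < N → addr N t 0 x i < B := fun ht hx hi =>
    lt_of_lt_of_le (addr_lt ht hx hi) (le_trans (by
      have : 16 * 1 ≤ 16 * (r + 1) := by omega
      exact Nat.mul_le_mul_right _ (Nat.mul_le_mul_right _ this)) hB)
  have hnd : (pairs nb F).Nodup := nodup_pairs (List.nodup_append.1 hQ).2.1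
    fun y hy => hnb.nodup y (hQN y (by simp [hQ0, hy]))
  have hQ0len : Q0.length = Qa.length + F.length := by simp [hQ0]
  have hn1 : ∀ x, ¬ (visitCmd tb (.c a)).mods x ↔ x ≠ .z ∧ x ≠ .tl := by
    intro x; simp [Cmd.mods, visitCmd, not_or]
  have ht1 : ∀ t, (visitCmd tb (.c a)).tags t ↔ t = tb ∨ t = tb + 2 ∨ t = tb + 1 := by
    intro x; simp [Cmd.tags, visitCmd]
  have hps : ∀ i (hi : i < F.length), pairs nb (F.take (i + 1)) =
      pairs nb (F.take i) ++ (nb F[i]).map (Prod.mk F[i]) := by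
    intro i hi
    rw [pairs, pairs, List.take_succ_eq_append_getElem hi, List.flatMap_append,
      List.flatMap_singleton]
  have hsum : ∀ i (hi : i < F.length), ((F.take (i + 1)).map fun y => 3 + 9 * (nb y).length).sum =
      ((F.take i).map fun y => 3 + 9 * (nb y).length).sum + (3 + 9 * (nb F[i]).length) := by
    intro i hi
    rw [List.take_succ_eq_append_getElem hi, List.map_append, List.sum_append, List.map_singleton,
      List.sum_singleton]
  have hsub : ∀ i, List.Sublist (pairs nb (F.take i)) (pairs nb F) := by
    intro i
    rw [← List.take_append_drop i F, pairs, pairs, List.flatMap_append, List.take_append_drop]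
    exact List.sublist_append_left _ _
  unfold stepCmd
  refine wp_seq (fun s' => s' = (s.set .tl Q0.length).tick) ?_ ?_
  · simp only [wp, Ex.fits, Ex.eval, hhi]
    exact ⟨trivial, by omega, by simp, trivial⟩
  rintro s1 rfl -
  refine wp_seq (StepInv N tb r s0 g K Q0 (pairs nb F)
    (s.time + 2 + (F.map fun y => 3 + 9 * (nb y).length).sum)) ?_ ?_
  · refine wp_loop (fun q s' => StepInv N tb r s0 g K Q0 (pairs nb (F.take (q - Qa.length)))
      (s.time + 2 + ((F.take (q - Qa.length)).map fun y => 3 + 9 * (nb y).length).sum) s')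
      trivial trivial ?_ (by simp) ?_ ?_ ?_ ?_
    · simp [Ex.eval, hhi]; omega
    · simp [Ex.eval, hlo, hhi]
      omega
    · refine ⟨⟨[], ?_, by simp [hQ0], by simp, ?_⟩, ?_⟩
      · have e : addKids g K (pairs nb (F.take ((Ex.eval (s.set .tl Q0.length).tick (.var .lo)) -
            Qa.length))) = K := by
          funext x; simp [Ex.eval, hlo, pairs, addKids]
        rw [e, List.append_nil]
        exact hx.of_mem rfl
      · simp [Ex.eval, hlo, pairs]
      · simp
    · intro q hq1 hq2 s' hI hf
      simp only [Ex.eval, St.tick_var, St.set_var, reduceCtorEq, if_false, hlo, hhi] at hq1 hq2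
      obtain ⟨i, rfl⟩ : ∃ i, q = Qa.length + i := ⟨q - Qa.length, by omega⟩
      have hi : i < F.length := by omega
      have hqi : Q0[Qa.length + i] = F[i] := by simp [hQ0]
      have hyN : F[i] < N := hQN _ (by simp [hQ0])
      have hydeg := hnb.length_le hyN
      simp only [Nat.add_sub_cancel_left, Nat.add_assoc Qa.length i 1, hps i hi, hsum i hi] at hI ⊢
      have hvar : ∀ x, x ≠ .q → x ≠ .y → x ≠ .jj → x ≠ .z → x ≠ .tl → s'.var x = s.var x := by
        intro x h1 h2 h3 h4 h5
        have := hf.var x (by simp [Cmd.mods, visitCmd, h1, h2, h3, h4, h5])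
        simpa [h5] using this
      have he' : Env N nb s' := by
        refine Env.of_frame (he.of_eq (s' := (s.set .tl Q0.length).tick) (by simp) rfl) hf ?_ ?_ ?_
        · simp [Cmd.mods, visitCmd]
        · simp [Cmd.tags, visitCmd]; omega
        · simp [Cmd.tags, visitCmd]; omega
      obtain ⟨⟨new, hx', htl', hnn, hmem⟩, htime⟩ := hI
      have hq : s'.mem tb r 0 (Qa.length + i) = F[i] := by
        rw [hx'.queue _ (by simp; omega), ← hqi]
        exact List.getElem_append_left (by omega)
      refine wp_seq (fun s2 => s2 = ((s'.set .q (Qa.length + i)).tick.set .y F[i]).tick) ?_ ?_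
      · have h3 : tb < 16 := by omega
        simp only [wp, Ex.fits, Ex.eval, Access, St.tick_var, St.set_var, reduceCtorEq, if_false,
          if_true, he'.n, hvar .r (by simp) (by simp) (by simp) (by simp) (by simp), hr,
          St.tick_mem, St.set_mem, hq]
        refine ⟨⟨trivial, h0B, trivial, trivial, h3, hN, by omega, hacc h3 hN (by omega)⟩, by omega,
          by simp, trivial⟩
      rintro s2 rfl -
      refine wp_loop (fun j s' => StepInv N tb r s0 g K Q0
        (pairs nb (F.take i) ++ ((nb F[i]).take j).map (Prod.mk F[i]))
        (s.time + 2 + ((F.take i).map fun y => 3 + 9 * (nb y).length).sum + 3 + 9 * j) s')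
        h0B ?_ ?_ (by simp) (by simp [Ex.eval]) ?_ ?_ ?_
      · simp only [Ex.fits, Ex.eval, Access, St.tick_var, St.set_var, reduceCtorEq, if_false,
          if_true, he'.n]
        exact ⟨h0B, trivial, h0B, trivial, by omega, hyN, hN, hacc0 (by omega) hyN hN⟩
      · simp [Ex.eval, he'.deg _ hyN]
        omega
      · simp only [Ex.eval, List.take_zero, List.map_nil, List.append_nil]
        refine StepInv.of_eq ⟨⟨new, hx', htl', hnn, hmem⟩, htime⟩ rfl (by simp) ?_
        simp only [St.tick_time, St.set_time]; omega
      · intro j _ hj2 t hI hf'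
        simp only [Ex.eval, St.tick_var, St.set_var, if_true, St.tick_mem, St.set_mem,
          he'.deg _ hyN] at hj2
        obtain ⟨⟨new', hxt, htl, hnn', hmem'⟩, htime'⟩ := hI
        set ps := pairs nb (F.take i) ++ ((nb F[i]).take j).map (Prod.mk F[i]) with hpsdef
        have htake : pairs nb (F.take i) ++ ((nb F[i]).take (j + 1)).map (Prod.mk F[i]) =
            ps ++ [(F[i], (nb F[i])[j])] := by
          rw [List.take_succ_eq_append_getElem hj2, hpsdef, List.map_append, List.append_assoc,
            List.map_singleton]
        have hsubl : List.Sublist (ps ++ [(F[i], (nb F[i])[j])]) (pairs nb F) := by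
          rw [← htake]
          refine List.Sublist.trans ?_ (hsub (i + 1))
          rw [hps i hi]
          exact List.Sublist.append_left ((List.take_sublist _ _).map _) _
        have hndps : (ps ++ [(F[i], (nb F[i])[j])]).Nodup := hsubl.nodup hnd
        have htv : ∀ x, x ≠ .q → x ≠ .y → x ≠ .jj → x ≠ .z → x ≠ .tl → t.var x = s.var x := by
          intro x h1 h2 h3 h4 h5
          have := hf'.var x (by simp [Cmd.mods, visitCmd, h3, h4, h5])
          rw [this, ← hvar x h1 h2 h3 h4 h5]
          simp [h1, h2]
        have hty : t.var .y = F[i] := by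
          rw [hf'.var .y (by simp [Cmd.mods, visitCmd])]; simp
        have het : Env N nb t := by
          refine Env.of_frame (he'.of_eq
            (s' := ((s'.set .q (Qa.length + i)).tick.set .y F[i]).tick) (by simp) rfl) hf' ?_ ?_ ?_
          · simp [Cmd.mods, visitCmd]
          · simp [Cmd.tags, visitCmd]; omega
          · simp [Cmd.tags, visitCmd]; omega
        have hp' : (t.set .jj j).tick.var .p = p := by
          simp [htv .p (by simp) (by simp) (by simp) (by simp) (by simp), hp]
        have hc' : (t.set .jj j).tick.var (.c a) = c := by
          simp [htv (.c a) (by simp) (by simp) (by simp) (by simp) (by simp), hc]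
        set z := (nb F[i])[j] with hz
        have hzN : z < N := hnb.lt _ hyN _ (List.getElem_mem _)
        -- An empty list characterizes the vertices not yet in the new level.
        have hnil : g z → (addKids g K ps z = [] ↔ z ∉ new') := by
          intro hgz
          rw [List.eq_nil_iff_forall_not_mem, hmem']
          simp only [mem_addKids, hK z hgz, hgz, true_and, List.not_mem_nil, false_or]
          constructor
          · rintro h ⟨e, he, he2⟩; exact h e.1 (by rw [← he2]; exact he)
          · intro h y hy; exact h ⟨_, hy, rfl⟩
        -- Adding `z` keeps the queue duplicate-free with entries below `N`, so there is room for
        -- it.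
        have hcat : g z → addKids g K ps z = [] → (Q0 ++ new' ++ [z]).Nodup ∧
            ∀ x ∈ Q0 ++ new' ++ [z], x < N := by
          intro hgz hz0
          have hz1 := (hnil hgz).1 hz0
          have hz2 : z ∉ Q0 := fun h => hQg z h hgz
          have hnQ : ∀ x ∈ new', x ∉ Q0 := fun x hx h => hQg x h ((hmem' x).1 hx).1
          refine ⟨?_, ?_⟩
          · rw [List.nodup_append, List.nodup_append]
            refine ⟨⟨hQ, hnn', fun a ha b hb e => hnQ b hb (e ▸ ha)⟩, by simp, ?_⟩
            intro x hx y hy e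
            simp only [List.mem_singleton] at hy
            subst hy; subst e
            rcases List.mem_append.1 hx with h | h
            exacts [hz2 h, hz1 h]
          · intro x hx
            simp only [List.mem_append, List.mem_singleton] at hx
            rcases hx with (h | h) | rfl
            · exact hQN x h
            · obtain ⟨_, e, he, rfl⟩ := (hmem' x).1 h
              have := mem_pairs.1 ((List.sublist_append_left _ _ |>.trans hsubl).subset he)
              exact hnb.lt _ (hQN _ (by simp [hQ0, this.1])) _ this.2
            · exact hzN
        have hv' := wp_visit (N := N) (B := B) hnb (tb := tb) (r := r) (v := v) (cv := .c a) htb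
          ⟨a, rfl⟩ (s0 := s0) (s := (t.set .jj j).tick) (Q := Q0 ++ new') (K := addKids g K ps)
          (y := F[i]) (j := j) hN hB (het.of_eq (by simp) rfl) (hxt.of_mem rfl)
          (by simp [htv .r (by simp) (by simp) (by simp) (by simp) (by simp), hr])
          (by simp [htv .v (by simp) (by simp) (by simp) (by simp) (by simp), hv])
          hvN (by simp [hty]) hyN (by simp) hj2 (by simp [htl])
          (by
            rw [hp', hc']
            intro hgz hz0
            obtain ⟨h1, h2⟩ := hcat hgz hz0
            have := length_le_of_nodup h1 h2
            simp at this ⊢; omega)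
          (by
            rw [hp', hc']
            intro hgz
            have h1 := nodup_addKids (g := g) (K := K) (x := z) (hK z hgz) hndps
            have h2 := length_le_of_nodup (N := N) h1 (by
              intro x hx
              rw [mem_addKids, hK z hgz] at hx
              rcases hx with hx | hx
              · simp at hx
              · have := mem_pairs.1 (hsubl.subset hx.2)
                exact hQN _ (by simp [hQ0, this.1]))
            rw [addKids_concat, if_pos hgz] at h2
            simp at h2
            exact h2)
        rw [hp', hc'] at hv'
        refine wp_mono _ hv' ?_
        rintro s3 ⟨h1, h2, h3⟩
        rw [htake]
        refine ⟨?_, ?_⟩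
        · by_cases hgz : g z
          · by_cases hz0 : addKids g K ps z = []
            · refine ⟨new' ++ [z], ?_, ?_, ?_, ?_⟩
              · rw [addKids_concat, if_pos hgz]
                rw [if_pos ⟨hgz, hz0⟩, if_pos hgz] at h1
                rwa [← List.append_assoc]
              · rw [h2, if_pos ⟨hgz, hz0⟩, ← List.append_assoc]
              · have := (hcat hgz hz0).1
                rw [List.append_assoc, List.nodup_append] at this
                exact this.2.1
              · intro x
                simp only [List.mem_append, List.mem_singleton, hmem']
                constructor
                · rintro (⟨h, e, he, rfl⟩ | rfl)
                  · exact ⟨h, e, Or.inl he, rfl⟩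
                  · exact ⟨hgz, _, Or.inr rfl, rfl⟩
                · rintro ⟨h, e, he | rfl, rfl⟩
                  · exact Or.inl ⟨h, e, he, rfl⟩
                  · exact Or.inr rfl
            · refine ⟨new', ?_, ?_, hnn', ?_⟩
              · rw [addKids_concat, if_pos hgz]
                rwa [if_neg (fun h => hz0 h.2), if_pos hgz] at h1
              · rw [h2, if_neg (fun h => hz0 h.2)]
              · intro x
                have hzn : z ∈ new' := by
                  by_contra h; exact hz0 ((hnil hgz).2 h)
                rw [hmem']
                simp only [List.mem_append, List.mem_singleton]
                constructor
                · rintro ⟨h, e, he, rfl⟩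
                  exact ⟨h, e, Or.inl he, rfl⟩
                · rintro ⟨h, e, he | rfl, rfl⟩
                  · exact ⟨h, e, he, rfl⟩
                  · exact (hmem' _).1 hzn
          · refine ⟨new', ?_, ?_, hnn', ?_⟩
            · rw [addKids_concat, if_neg hgz]
              rwa [if_neg (fun h => hgz h.1), if_neg hgz] at h1
            · rw [h2, if_neg (fun h => hgz h.1)]
            · intro x
              rw [hmem']
              simp only [List.mem_append, List.mem_singleton]
              constructor
              · rintro ⟨h, e, he, rfl⟩
                exact ⟨h, e, Or.inl he, rfl⟩
              · rintro ⟨h, e, he | rfl, rfl⟩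
                · exact ⟨h, e, he, rfl⟩
                · exact absurd h hgz
        · simp only [St.tick_time, St.set_time] at h3; omega
      · intro t hI hf'
        simp only [Ex.eval, St.tick_var, St.set_var, if_true, St.tick_mem, St.set_mem,
          he'.deg _ hyN, List.take_length] at hI
        exact hI.of_eq rfl rfl (by have := hI.time; omega)
    · intro s' hI hf
      have e : (Ex.var Var.hi).eval (s.set .tl Q0.length).tick - Qa.length = F.length := by
        simp [Ex.eval, hhi]; omega
      rw [e, List.take_length] at hI
      exact hI
  · intro s' ⟨⟨new, h1, h2, h3, h4⟩, h5⟩ hf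
    have hhi' : s'.var .hi = Q0.length := by
      rw [hf.var .hi (by simp [Cmd.mods, visitCmd])]; simpa using hhi
    have hlen : (Q0 ++ new).length ≤ N := by
      refine length_le_of_nodup (N := N) (List.nodup_append.2 ⟨hQ, h3, ?_⟩) ?_
      · intro x hx y hy e
        exact hQg x hx (e ▸ ((h4 y).1 hy).1)
      · intro x hx
        rcases List.mem_append.1 hx with h | h
        · exact hQN x h
        · obtain ⟨_, e, he, rfl⟩ := (h4 x).1 h
          have := mem_pairs.1 he
          exact hnb.lt _ (hQN _ (by simp [hQ0, this.1])) _ this.2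
    simp only [wp, Ex.fits, Ex.eval, hhi', h2, St.tick_var, St.set_var, reduceCtorEq, if_false]
    refine ⟨trivial, by omega, by simp, trivial, by omega, by simp, new, h1.of_mem rfl, by simp,
      by simp, h3, ?_, ?_⟩
    · intro x
      rw [h4]
      constructor
      · rintro ⟨h, e, he, rfl⟩
        exact ⟨h, e.1, mem_pairs.1 he⟩
      · rintro ⟨h, y, hy⟩
        exact ⟨h, (y, x), mem_pairs.2 hy, rfl⟩
    · simp only [St.tick_time, St.set_time]; omega

end WordRAM

/-! ### All levels around a vertex -/

namespace WordRAM

/-- The `i`-th level around `v`: vertices of colour `c i` and of smaller rank than `v`. -/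
def lvl (N : ℕ) (nb : ℕ → List ℕ) (p v : ℕ) (c : ℕ → ℕ) : ℕ → Finset ℕ
  | 0 => {v}
  | i + 1 => (Finset.range N).filter fun x =>
      Good N nb p (c (i + 1)) v x ∧ ∃ y ∈ lvl N nb p v c i, x ∈ nb y

/-- The cost of exploring `k` levels. -/
def exploreCost (N : ℕ) (nb : ℕ → List ℕ) (p v : ℕ) (c : ℕ → ℕ) (k : ℕ) : ℕ :=
  3 + ∑ i ∈ Finset.range k, (4 + ∑ y ∈ lvl N nb p v c i, (3 + 9 * (nb y).length))

/-- The lists `K` describe the edges between consecutive levels. -/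
structure LevelKids (N : ℕ) (nb : ℕ → List ℕ) (p v : ℕ) (c : ℕ → ℕ) (k : ℕ) (K : ℕ → List ℕ) :
    Prop where
  nil : ∀ x, (∀ i < k, x % p ≠ c (i + 1)) → K x = []
  nodup : ∀ i < k, ∀ x, x % p = c (i + 1) → (K x).Nodup
  mem : ∀ i < k, ∀ x, x % p = c (i + 1) → ∀ y, y ∈ K x ↔
    y ∈ lvl N nb p v c i ∧ x ∈ nb y ∧ Good N nb p (c (i + 1)) v x

/-- The result of exploring `k` levels from the state `s0`. -/
structure Explored (N : ℕ) (nb : ℕ → List ℕ) (tb r p v : ℕ) (c : ℕ → ℕ) (k : ℕ) (s0 s : St)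
    (Qa F : List ℕ) (K : ℕ → List ℕ) : Prop where
  expl : Expl N tb r s0 (Qa ++ F) K s
  lo : s.var .lo = Qa.length
  hi : s.var .hi = (Qa ++ F).length
  nodup : (Qa ++ F).Nodup
  lt : ∀ x ∈ Qa ++ F, x < N
  col : ∀ x ∈ Qa ++ F, ∃ i ≤ k, x % p = c i
  mem : ∀ x, x ∈ F ↔ x ∈ lvl N nb p v c k
  kids : LevelKids N nb p v c k K
  time : s.time ≤ s0.time + exploreCost N nb p v c k

theorem explore_mods {tb k : ℕ} {cv : ℕ → Var} {y : Var} (h : (exploreCmd tb cv k).mods y) :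
    y = .lo ∨ y = .hi ∨ y = .tl ∨ y = .q ∨ y = .y ∨ y = .jj ∨ y = .z := by
  induction k with
  | zero => simp [exploreCmd, Cmd.mods] at h; tauto
  | succ k ih =>
    simp only [exploreCmd, Cmd.mods] at h
    rcases h with h | h
    · exact ih h
    · simp [stepCmd, visitCmd, Cmd.mods] at h; tauto

theorem explore_tags {tb k : ℕ} {cv : ℕ → Var} {t : ℕ} (h : (exploreCmd tb cv k).tags t) :
    t = tb ∨ t = tb + 1 ∨ t = tb + 2 := by
  induction k with
  | zero => simp [exploreCmd, Cmd.tags] at h; tauto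
  | succ k ih =>
    simp only [exploreCmd, Cmd.tags] at h
    rcases h with h | h
    · exact ih h
    · simp [stepCmd, visitCmd, Cmd.tags] at h; tauto

theorem explore_outs {tb k : ℕ} {cv : ℕ → Var} : ¬ (exploreCmd tb cv k).outs := by
  induction k with
  | zero => simp [exploreCmd, Cmd.outs]
  | succ k ih => simp [exploreCmd, Cmd.outs, ih, stepCmd, visitCmd]

/-- As the colours are distinct, a vertex belongs to at most one level. Hence one queue, one array
of counts and one array of lists serve all levels, and the lists filled earlier are untouched by
later steps. The counts are zero at the start because the region is fresh. -/
theorem wp_explore {N B : ℕ} {nb : ℕ → List ℕ} (hnb : GoodNb N nb) {tb r v p : ℕ} {c : ℕ → ℕ}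
    {cv : ℕ → Var} (htb : tb = 3 ∨ tb = 6) (hcv : ∀ i, ∃ a, cv i = .c a) {s : St}
    (hN : 0 < N) (hB : 16 * (r + 1) * N * N ≤ B)
    (he : Env N nb s) (hr : s.var .r = r) (hv : s.var .v = v) (hp : s.var .p = p) (hvN : v < N)
    (hcv0 : v % p = c 0) (hfresh : ∀ x, s.mem (tb + 1) r x 0 = 0) (k : ℕ)
    (hc : ∀ i, 1 ≤ i → i ≤ k → s.var (cv i) = c i) (hinj : ∀ i ≤ k, ∀ j ≤ k, c i = c j → i = j) :
    wp N B (exploreCmd tb cv k) (fun s' => ∃ Qa F K, Explored N nb tb r p v c k s s' Qa F K) s := by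
  have hNB : N < B := by nlinarith [Nat.zero_le r, Nat.mul_le_mul_left (16 * (r + 1)) hN]
  induction k with
  | zero =>
    have ht : tb < 16 := by omega
    have ha : addr N tb r 0 0 < B := lt_of_lt_of_le (addr_lt ht hN hN) hB
    have h0B : 0 < B := by omega
    have h1B : 1 < B := by omega
    simp only [exploreCmd, wp, Ex.fits, Ex.eval, Access, St.tick_var, St.set_var, St.store_var,
      hr, hv, he.n]
    and_intros
    any_goals first | trivial | assumption | simp
    refine ⟨[], [v], fun _ => [], ⟨?_, ?_, ?_, ?_⟩, rfl, rfl, by simp, by simpa using hvN, ?_, ?_,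
      ⟨fun _ _ => rfl, by omega, by omega⟩, ?_⟩
    · intro j hj
      have : j = 0 := by simpa using hj
      subst this; simp
    · intro x hx
      have : tb + 1 ≠ tb := by omega
      simp [this, hfresh x]
    · intro x hx j hj; simp at hj
    · intro t r' hr'
      funext x y
      simp [hr']
    · intro x hx
      have : x = v := by simpa using hx
      subst this; exact ⟨0, le_rfl, hcv0⟩
    · simp [lvl]
    · simp [exploreCost]
  | succ k ih =>
    refine wp_seq _ (ih (fun i h1 h2 => hc i h1 (by omega))
      (fun i hi j hj => hinj i (by omega) j (by omega))) ?_
    rintro s1 ⟨Qa, F, K, hE⟩ hf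
    have hvar : ∀ x, (x ≠ .lo ∧ x ≠ .hi ∧ x ≠ .tl ∧ x ≠ .q ∧ x ≠ .y ∧ x ≠ .jj ∧ x ≠ .z) →
        s1.var x = s.var x := by
      intro x hx
      refine hf.var x fun h => ?_
      have := explore_mods h
      tauto
    have he1 : Env N nb s1 := by
      refine he.of_frame hf ?_ ?_ ?_
      · intro h; have := explore_mods h; simp at this
      · intro h; have := explore_tags h; omega
      · intro h; have := explore_tags h; omega
    have hcvk : s1.var (cv (k + 1)) = c (k + 1) := by
      obtain ⟨a, ha⟩ := hcv (k + 1)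
      rw [← hc (k + 1) (by omega) le_rfl, ha]
      exact hvar _ (by simp)
    -- A vertex with the colour of the new level has none of the earlier colours, so it is neither
    -- in the queue nor has a nonempty list.
    have hneq : ∀ x, x % p = c (k + 1) → ∀ i ≤ k, x % p ≠ c i := by
      intro x hx i hi h
      have := hinj (k + 1) le_rfl i (by omega) (hx.symm.trans h)
      omega
    have hstep := wp_step (N := N) (B := B) hnb (tb := tb) (r := r) (v := v) (p := p)
      (c := c (k + 1)) (cv := cv (k + 1)) htb (hcv _) (s0 := s) (s := s1) (Qa := Qa) (F := F)
      (K := K) hN hB he1 hE.expl (by rw [hvar _ (by simp), hr]) (by rw [hvar _ (by simp), hv])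
      (by rw [hvar _ (by simp), hp]) hcvk hvN hE.lo hE.hi hE.nodup hE.lt
      (by
        intro x hx hg
        obtain ⟨i, hi, h⟩ := hE.col x hx
        exact hneq x hg.1 i hi h)
      (by
        intro x hg
        exact hE.kids.nil x fun i hi => hneq x hg.1 (i + 1) (by omega))
    refine wp_mono _ hstep ?_
    rintro s2 ⟨new, h1, h2, h3, h4, h5, h6⟩
    have hnew : ∀ x, x ∈ new ↔ x ∈ lvl N nb p v c (k + 1) := by
      intro x
      simp only [h5, lvl, Finset.mem_filter, Finset.mem_range, hE.mem]
      constructor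
      · rintro ⟨hg, y, hy, hxy⟩
        exact ⟨hnb.lt y (hE.lt y (by simp [(hE.mem y).2 hy])) x hxy, hg, y, hy, hxy⟩
      · rintro ⟨_, hg, h⟩
        exact ⟨hg, h⟩
    refine ⟨Qa ++ F, new, _, h1, h2, h3, ?_, ?_, ?_, hnew, ⟨?_, ?_, ?_⟩, ?_⟩
    · refine List.nodup_append.2 ⟨hE.nodup, h4, ?_⟩
      intro x hx y hy e
      subst e
      obtain ⟨i, hi, h⟩ := hE.col x hx
      exact hneq x ((h5 x).1 hy).1.1 i hi h
    · intro x hx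
      rcases List.mem_append.1 hx with h | h
      · exact hE.lt x h
      · obtain ⟨_, y, hy, hxy⟩ := (h5 x).1 h
        exact hnb.lt y (hE.lt y (by simp [hy])) x hxy
    · intro x hx
      rcases List.mem_append.1 hx with h | h
      · obtain ⟨i, hi, h⟩ := hE.col x h
        exact ⟨i, by omega, h⟩
      · exact ⟨k + 1, le_rfl, ((h5 x).1 h).1.1⟩
    · intro x hx
      rw [addKids, hE.kids.nil x fun i hi => hx i (by omega)]
      simp only [List.nil_append, List.map_eq_nil_iff, List.filter_eq_nil_iff, decide_eq_true_eq]
      rintro e - ⟨-, h⟩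
      exact hx k (by omega) h.1
    · intro i hi x hx
      by_cases hik : i = k
      · subst hik
        exact nodup_addKids (hE.kids.nil x fun j hj => hneq x hx (j + 1) (by omega))
          (nodup_pairs (List.nodup_append.1 hE.nodup).2.1
            fun y hy => hnb.nodup y (hE.lt y (by simp [hy])))
      · have hng : ¬ Good N nb p (c (k + 1)) v x := fun h => hneq x h.1 (i + 1) (by omega) hx
        simp only [addKids, hng, and_false, decide_false, List.filter_false, List.map_nil,
          List.append_nil]
        exact hE.kids.nodup i (by omega) x hx
    · intro i hi x hx y
      rw [mem_addKids]
      by_cases hik : i = k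
      · subst hik
        rw [hE.kids.nil x fun j hj => hneq x hx (j + 1) (by omega), mem_pairs]
        simp only [List.not_mem_nil, false_or, hE.mem]
        tauto
      · have hng : ¬ Good N nb p (c (k + 1)) v x := fun h => hneq x h.1 (i + 1) (by omega) hx
        simp only [hng, false_and, or_false]
        exact hE.kids.mem i (by omega) x hx y
    · have hsum : (F.map fun y => 3 + 9 * (nb y).length).sum =
          ∑ y ∈ lvl N nb p v c k, (3 + 9 * (nb y).length) := by
        have : lvl N nb p v c k = F.toFinset := by ext x; simp [hE.mem]
        rw [this, List.sum_toFinset _ (List.nodup_append.1 hE.nodup).2.1]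
      have := hE.time
      simp only [exploreCost, Finset.sum_range_succ] at this ⊢
      omega

end WordRAM

/-! ### Listing the cycles of an exploration -/

namespace WordRAM

/-- The tuple of the first `k` values. -/
def tup (k : ℕ) (σ : ℕ → ℕ) : List ℕ := (List.range k).map σ

theorem tup_inj {k : ℕ} {σ σ' : ℕ → ℕ} : tup k σ = tup k σ' ↔ ∀ i < k, σ i = σ' i := by
  simp [tup]

/-- The number of a tuple, without its first two entries. -/
def codeOf (N : ℕ) (σ : ℕ → ℕ) : ℕ → ℕ
  | 0 => 0
  | i + 1 => codeOf N σ i * N + σ (i + 2)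

theorem codeOf_lt {N k : ℕ} {σ : ℕ → ℕ} (hσ : ∀ i < k + 2, σ i < N) : codeOf N σ k < N ^ k := by
  induction k with
  | zero => simp [codeOf]
  | succ k ih =>
    have h1 := ih fun i hi => hσ i (by omega)
    have h2 := hσ (k + 2) (by omega)
    have h3 := Nat.mul_le_mul_right N (Nat.succ_le_of_lt h1)
    simp only [codeOf, pow_succ, Nat.succ_eq_add_one, add_mul, one_mul] at h3 ⊢
    omega

theorem codeOf_inj {N k : ℕ} {σ σ' : ℕ → ℕ} (hσ : ∀ i < k + 2, σ i < N)
    (hσ' : ∀ i < k + 2, σ' i < N) (h : codeOf N σ k = codeOf N σ' k) :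
    ∀ i < k, σ (i + 2) = σ' (i + 2) := by
  induction k with
  | zero => simp
  | succ k ih =>
    have h2 := hσ (k + 2) (by omega)
    have h2' := hσ' (k + 2) (by omega)
    simp only [codeOf] at h
    have hN : 0 < N := by omega
    have h3 := congrArg (· / N) h
    simp only [mul_comm _ N, Nat.mul_add_div hN, Nat.div_eq_of_lt h2, Nat.div_eq_of_lt h2',
      add_zero] at h3
    rw [h3] at h
    intro i hi
    by_cases hik : i = k
    · subst hik; omega
    · exact ih (fun i hi => hσ i (by omega)) (fun i hi => hσ' i (by omega)) h3 i (by omega)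

/-- The output consists of the tuples in `A`, each of them once, and these are marked. -/
structure OutIs (N k : ℕ) (A : Set (List ℕ)) (s : St) : Prop where
  out : ∃ l : List (List ℕ), s.out = l.flatten ∧ l.Nodup ∧ ∀ t, t ∈ l ↔ t ∈ A
  mark : ∀ σ : ℕ → ℕ, (∀ i < k, σ i < N) →
    (tup k σ ∈ A → s.mem 9 (codeOf N σ (k - 2)) (σ 0) (σ 1) = 1) ∧
    (tup k σ ∉ A → s.mem 9 (codeOf N σ (k - 2)) (σ 0) (σ 1) = 0)

theorem OutIs.of_eq {N k : ℕ} {A : Set (List ℕ)} {s s' : St} (h : OutIs N k A s)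
    (ho : s'.out = s.out) (hm : s'.mem 9 = s.mem 9) : OutIs N k A s' :=
  ⟨by rw [ho]; exact h.out, by rw [hm]; exact h.mark⟩

def codeCmd : ℕ → Cmd
  | 0 => .set .cd (.lit 0)
  | i + 1 => .seq (codeCmd i) (.set .cd (.add (.mul (.var .cd) (.var .n)) (.var (.x (i + 2)))))

def outCmd : ℕ → Cmd
  | 0 => .skip
  | i + 1 => .seq (outCmd i) (.out (.var (.x i)))

/-- Output the tuple in the variables `x 0, …, x (k - 1)`, unless it has been output before. -/
def emitCmd (k : ℕ) : Cmd :=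
  .whenLt (.var (.x 1)) (.var (.x (k - 1))) (.seq (codeCmd (k - 2))
    (.whenEq (.ld 9 (.var .cd) (.var (.x 0)) (.var (.x 1))) (.lit 0)
      (.seq (.st 9 (.var .cd) (.var (.x 0)) (.var (.x 1)) (.lit 1)) (outCmd k))))

theorem wp_code {N B : ℕ} {s : St} (k : ℕ) (hB : N ^ k < B) (hn : s.var .n = N)
    (hσ : ∀ i < k + 2, s.var (.x i) < N) (hN : 0 < N) :
    wp N B (codeCmd k) (fun s' => s'.var .cd = codeOf N (fun i => s.var (.x i)) k ∧
      s'.out = s.out ∧ s'.mem = s.mem ∧ (∀ y, y ≠ .cd → s'.var y = s.var y) ∧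
      s'.time = s.time + k + 1) s := by
  induction k with
  | zero =>
    simp only [codeCmd, wp, Ex.fits, Ex.eval]
    refine ⟨by omega, by omega, by simp, by simp [codeOf], rfl, rfl, ?_, rfl⟩
    intro y hy; simp [hy]
  | succ k ih =>
    have hB' : N ^ k < B := lt_of_le_of_lt (Nat.pow_le_pow_right hN (by omega)) hB
    refine wp_seq _ (ih hB' fun i hi => hσ i (by omega)) ?_
    rintro s1 ⟨h1, h2, h3, h4, h5⟩ -
    have hlt := codeOf_lt (k := k + 1) hσ
    simp only [wp, Ex.fits, Ex.eval, h1, h4 .n (by simp), h4 (.x (k + 2)) (by simp), hn]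
    simp only [codeOf] at hlt
    refine ⟨⟨⟨trivial, trivial, by omega⟩, trivial, by omega⟩, by omega, by simp,
      by simp [codeOf], h2, h3, ?_, ?_⟩
    · intro y hy; simp [hy, h4 y hy]
    · simp only [St.tick_time, St.set_time, h5]; omega

theorem wp_out {N B : ℕ} {s : St} (k : ℕ) :
    wp N B (outCmd k) (fun s' => s'.out = s.out ++ tup k (fun i => s.var (.x i)) ∧
      s'.mem = s.mem ∧ s'.time = s.time + k) s := by
  suffices h : wp N B (outCmd k) (fun s' => (s'.out = s.out ++ tup k (fun i => s.var (.x i)) ∧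
      s'.mem = s.mem ∧ s'.time = s.time + k) ∧ s'.var = s.var) s from
    wp_mono _ h fun _ h => h.1
  induction k with
  | zero => simp [outCmd, wp, tup]
  | succ k ih =>
    refine wp_seq _ ih ?_
    rintro s1 ⟨⟨h1, h2, h3⟩, h4⟩ -
    simp [wp, Ex.fits, Ex.eval, h1, h2, h3, h4, tup, List.range_succ]
    omega

theorem code_mods {k : ℕ} {y : Var} (h : (codeCmd k).mods y) : y = .cd := by
  induction k with
  | zero => simpa [codeCmd, Cmd.mods] using h
  | succ k ih =>
    simp only [codeCmd, Cmd.mods] at h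
    exact h.elim ih id

theorem code_tags {k t : ℕ} : ¬ (codeCmd k).tags t := by
  induction k with
  | zero => simp [codeCmd, Cmd.tags]
  | succ k ih => simp [codeCmd, Cmd.tags, ih]

theorem out_mods {k : ℕ} {y : Var} : ¬ (outCmd k).mods y := by
  induction k with
  | zero => simp [outCmd, Cmd.mods]
  | succ k ih => simp [outCmd, Cmd.mods, ih]

theorem out_tags {k t : ℕ} : ¬ (outCmd k).tags t := by
  induction k with
  | zero => simp [outCmd, Cmd.tags]
  | succ k ih => simp [outCmd, Cmd.tags, ih]

theorem emit_mods {k : ℕ} {y : Var} (h : (emitCmd k).mods y) : y = .cd := by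
  simp only [emitCmd, Cmd.mods, out_mods, or_false, false_or] at h
  exact code_mods h

theorem emit_tags {k t : ℕ} (h : (emitCmd k).tags t) : t = 9 := by
  simpa [emitCmd, Cmd.tags, out_tags, code_tags] using h

/-- The first two entries of a tuple serve as indices and the rest, read in base `N`, as the region
of its mark. Thus every tuple has its own cell at an address below `16 * N ^ k`, and recognizing a
repetition takes `O(k)` commands. -/
theorem wp_emit {N B k : ℕ} {A : Set (List ℕ)} {s : St} (hk : 2 ≤ k) (hN : 0 < N)
    (hB : 16 * N ^ k < B) (hn : s.var .n = N) (hσ : ∀ i < k, s.var (.x i) < N)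
    (hA : OutIs N k A s) :
    wp N B (emitCmd k) (fun s' => OutIs N k (A ∪ {t | t = tup k (fun i => s.var (.x i)) ∧
      s.var (.x 1) < s.var (.x (k - 1))}) s' ∧ s'.time ≤ s.time + (2 * k + 4)) s := by
  obtain ⟨k, rfl⟩ : ∃ k', k = k' + 2 := ⟨k - 2, by omega⟩
  simp only [Nat.add_sub_cancel, Nat.add_succ_sub_one]
  set σ : ℕ → ℕ := fun i => s.var (.x i) with hσdef
  have hk1 : k + 2 - 1 = k + 1 := rfl
  simp only [emitCmd, wp, Ex.fits, Ex.eval, hk1, Nat.add_sub_cancel]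
  refine ⟨trivial, trivial, ?_, ?_⟩
  swap
  · intro hlt
    refine ⟨?_, by simp⟩
    have : A ∪ {t | t = tup (k + 2) σ ∧ s.var (.x 1) < s.var (.x (k + 1))} = A := by
      simp [hlt]
    rw [this]
    exact hA.of_eq rfl rfl
  intro hlt
  have hNk : N ^ k < B := by
    have : N ^ k ≤ N ^ (k + 2) := Nat.pow_le_pow_right hN (by omega)
    omega
  refine wp_mono _ (wp_code (s := s.tick) k hNk hn hσ hN) ?_
  rintro s1 ⟨h1, h2, h3, h4, h5⟩
  simp only [St.tick_var, St.tick_out, St.tick_mem, St.tick_time] at h1 h2 h3 h4 h5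
  have hx : ∀ i, s1.var (.x i) = σ i := fun i => h4 _ (by simp)
  have hcl := codeOf_lt (k := k) (σ := σ) hσ
  have hacc : addr N 9 (codeOf N σ k) (σ 0) (σ 1) < B := by
    refine lt_of_lt_of_le (addr_lt (by omega) (hσ 0 (by omega)) (hσ 1 (by omega))) ?_
    refine le_trans ?_ hB.le
    rw [pow_add, pow_two, ← mul_assoc, ← mul_assoc]
    exact Nat.mul_le_mul_right _ (Nat.mul_le_mul_right _ (Nat.mul_le_mul_left _ hcl))
  have hmark := hA.mark σ hσ
  simp only [Nat.add_sub_cancel] at hmark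
  have h9 : 9 < 16 := by omega
  have h0B : 0 < B := by omega
  have h1B : 1 < B := by have : 0 < N ^ (k + 2) := by positivity
                         omega
  simp only [Access, h1, hx, h4 .n (by simp), hn, h3, St.tick_var]
  refine ⟨⟨trivial, trivial, trivial, trivial, h9, hσ 0 (by omega), hσ 1 (by omega), hacc⟩, h0B,
    ?_, ?_⟩
  · intro h0
    have htA : tup (k + 2) σ ∉ A := fun h => by
      rw [hmark.1 h] at h0; omega
    refine ⟨trivial, trivial, trivial, h1B, ⟨trivial, h9, hσ 0 (by omega), hσ 1 (by omega), hacc⟩, ?_⟩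
    refine wp_mono _ (wp_out (k + 2)) ?_
    rintro s2 ⟨h6, h7, h8⟩
    simp only [St.tick_var, St.store_var, hx, St.tick_out, St.store_out, h2] at h6
    refine ⟨⟨?_, ?_⟩, ?_⟩
    · obtain ⟨l, hl1, hl2, hl3⟩ := hA.out
      refine ⟨l ++ [tup (k + 2) σ], ?_, ?_, ?_⟩
      · rw [h6, hl1]; simp
      · refine List.nodup_append.2 ⟨hl2, by simp, ?_⟩
        intro a ha b hb e
        simp only [List.mem_singleton] at hb
        subst hb; subst e
        exact htA ((hl3 _).1 ha)
      · intro t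
        simp only [List.mem_append, hl3, List.mem_singleton, Set.mem_union, Set.mem_ofPred_eq, hlt,
          and_true]
    · intro σ' hσ'
      simp only [Nat.add_sub_cancel, Set.mem_union, Set.mem_ofPred_eq, hlt, and_true, h7,
        St.tick_mem, St.store_mem, true_and, h3]
      have hiff : (codeOf N σ' k = codeOf N σ k ∧ σ' 0 = σ 0 ∧ σ' 1 = σ 1) ↔
          tup (k + 2) σ' = tup (k + 2) σ := by
        rw [tup_inj]
        constructor
        · rintro ⟨e1, e2, e3⟩ i hi
          rcases i with _ | _ | i
          · exact e2
          · exact e3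
          · exact codeOf_inj hσ' hσ e1 i (by omega)
        · intro e
          refine ⟨?_, e 0 (by omega), e 1 (by omega)⟩
          have : ∀ j ≤ k, codeOf N σ' j = codeOf N σ j := by
            intro j hj
            induction j with
            | zero => rfl
            | succ j ih => simp only [codeOf, ih (by omega), e (j + 2) (by omega)]
          exact this k le_rfl
      have hm' := hA.mark σ' hσ'
      simp only [Nat.add_sub_cancel] at hm'
      by_cases ht : tup (k + 2) σ' = tup (k + 2) σ
      · rw [if_pos (hiff.2 ht)]
        exact ⟨fun _ => rfl, fun h => (h (Or.inr ht)).elim⟩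
      · rw [if_neg (fun h => ht (hiff.1 h))]
        exact ⟨fun h => hm'.1 (h.resolve_right ht), fun h => hm'.2 fun h' => h (Or.inl h')⟩
    · simp only [St.tick_time, St.store_time] at h8; omega
  · intro h0
    have htA : tup (k + 2) σ ∈ A := by
      by_contra h; exact h0 (hmark.2 h)
    refine ⟨?_, by simp only [St.tick_time]; omega⟩
    have : A ∪ {t | t = tup (k + 2) σ ∧ s.var (.x 1) < s.var (.x (k + 1))} = A := by
      refine Set.union_eq_self_of_subset_right ?_
      rintro t ⟨rfl, -⟩
      exact htA
    change OutIs N (k + 2) (A ∪ {t | t = tup (k + 2) σ ∧ s.var (.x 1) < s.var (.x (k + 1))}) _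
    rw [this]
    exact hA.of_eq (by simp [h2]) (by simp [h3])

/-- Nested loops: for every `(tb, a, b)` in the list, `x b` runs through the list of `x a`. -/
def chainCmd (body : Cmd) : List (ℕ × ℕ × ℕ) → Cmd
  | [] => body
  | (tb, a, b) :: l => .loop (.j b) (.lit 0) (.ld (tb + 1) (.var .r) (.var (.x a)) (.lit 0))
      (.seq (.set (.x b) (.ld (tb + 2) (.var .r) (.var (.x a)) (.var (.j b)))) (chainCmd body l))

/-- The assignments for which the body of the nested loops is executed. -/
def sols (K : ℕ → ℕ → List ℕ) : List (ℕ × ℕ × ℕ) → (ℕ → ℕ) → List (ℕ → ℕ)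
  | [], σ => [σ]
  | (tb, a, b) :: l, σ => (K tb (σ a)).flatMap fun z => sols K l (Function.update σ b z)

/-- The cost of the nested loops. -/
def chainCost (K : ℕ → ℕ → List ℕ) (C : ℕ) : List (ℕ × ℕ × ℕ) → (ℕ → ℕ) → ℕ
  | [], _ => C
  | (tb, a, b) :: l, σ =>
      1 + ((K tb (σ a)).map fun z => 2 + chainCost K C l (Function.update σ b z)).sum

/-- The variables that are bound by nested loops. -/
def dsts (l : List (ℕ × ℕ × ℕ)) : List ℕ := l.map fun e => e.2.2

/-- Nested loops only refer to variables that have a value. -/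
def ChainOk (k : ℕ) : List (ℕ × ℕ × ℕ) → Prop
  | [] => True
  | (tb, a, b) :: l => (tb = 3 ∨ tb = 6) ∧ a < k ∧ b < k ∧ a ∉ b :: dsts l ∧ ChainOk k l

/-- The lists `K` are in the memory. -/
def HasKids (N r : ℕ) (K : ℕ → ℕ → List ℕ) (s : St) : Prop :=
  ∀ tb, tb = 3 ∨ tb = 6 → ∀ x < N, s.mem (tb + 1) r x 0 = (K tb x).length ∧
    ∀ j (h : j < (K tb x).length), s.mem (tb + 2) r x j = (K tb x)[j]

theorem chain_mods {k : ℕ} {l : List (ℕ × ℕ × ℕ)} {y : Var} (h : (chainCmd (emitCmd k) l).mods y) :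
    y = .cd ∨ (∃ b, y = .j b) ∨ ∃ b ∈ dsts l, y = .x b := by
  induction l with
  | nil => exact Or.inl (emit_mods h)
  | cons e l ih =>
    obtain ⟨tb, a, b⟩ := e
    simp only [chainCmd, Cmd.mods] at h
    rcases h with rfl | rfl | h
    · exact Or.inr (Or.inl ⟨b, rfl⟩)
    · exact Or.inr (Or.inr ⟨b, by simp [dsts], rfl⟩)
    · rcases ih h with h | h | ⟨b', hb', rfl⟩
      · exact Or.inl h
      · exact Or.inr (Or.inl h)
      · exact Or.inr (Or.inr ⟨b', by simp only [dsts, List.map_cons, List.mem_cons]; exact Or.inr hb',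
          rfl⟩)

theorem chain_tags {k : ℕ} {l : List (ℕ × ℕ × ℕ)} {t : ℕ} (h : (chainCmd (emitCmd k) l).tags t) :
    t = 9 := by
  induction l with
  | nil => exact emit_tags h
  | cons e l ih =>
    obtain ⟨tb, a, b⟩ := e
    simp only [chainCmd, Cmd.tags, false_or] at h
    exact ih h

/-- The tuples that are output for a list of assignments. -/
def emitted (k : ℕ) (l : List (ℕ → ℕ)) : Set (List ℕ) :=
  {t | ∃ σ ∈ l, t = tup k σ ∧ σ 1 < σ (k - 1)}

theorem emitted_append (k : ℕ) (l l' : List (ℕ → ℕ)) :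
    emitted k (l ++ l') = emitted k l ∪ emitted k l' := by
  ext t
  simp only [emitted, Set.mem_ofPred_eq, List.mem_append, Set.mem_union]
  constructor
  · rintro ⟨σ, h | h, h'⟩
    exacts [Or.inl ⟨σ, h, h'⟩, Or.inr ⟨σ, h, h'⟩]
  · rintro (⟨σ, h, h'⟩ | ⟨σ, h, h'⟩)
    exacts [⟨σ, Or.inl h, h'⟩, ⟨σ, Or.inr h, h'⟩]

/-- The loops run through the recursion tree of `sols`. The state has to agree with `σ` only on the
variables that will not be assigned later, which is what survives from one round of an outer loop to
the next. -/
theorem wp_chain {N B k r : ℕ} (hk : 2 ≤ k) (hN : 0 < N) (hB : 16 * N ^ k < B)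
    (hBr : 16 * (r + 1) * N * N ≤ B) {K : ℕ → ℕ → List ℕ} (hKlt : ∀ tb x, ∀ y ∈ K tb x, y < N)
    (hKlen : ∀ tb x, (K tb x).length ≤ N) (l : List (ℕ × ℕ × ℕ)) :
    ∀ {A : Set (List ℕ)} {s : St} {σ : ℕ → ℕ}, ChainOk k l → s.var .n = N → s.var .r = r →
      HasKids N r K s → (∀ i < k, σ i < N) → (∀ i < k, i ∉ dsts l → s.var (.x i) = σ i) →
      OutIs N k A s →
      wp N B (chainCmd (emitCmd k) l) (fun s' => OutIs N k (A ∪ emitted k (sols K l σ)) s' ∧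
        s'.time ≤ s.time + chainCost K (2 * k + 4) l σ) s := by
  have hNB : N < B := by nlinarith [Nat.zero_le r, Nat.mul_le_mul_left (16 * (r + 1)) hN]
  induction l with
  | nil =>
    intro A s σ _ hn hr hK hσ hag hA
    have hag' : ∀ i < k, s.var (.x i) = σ i := fun i hi => hag i hi (by simp [dsts])
    refine wp_mono _ (wp_emit hk hN hB hn (fun i hi => by rw [hag' i hi]; exact hσ i hi) hA) ?_
    rintro s' ⟨h1, h2⟩
    refine ⟨?_, h2⟩
    convert h1 using 2
    ext t
    simp only [emitted, sols, List.mem_singleton, exists_eq_left, Set.mem_ofPred_eq,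
      hag' 1 (by omega), hag' (k - 1) (by omega)]
    have : tup k σ = tup k fun i => s.var (.x i) := tup_inj.2 fun i hi => (hag' i hi).symm
    rw [this]
  | cons e l ih =>
    obtain ⟨tb, a, b⟩ := e
    intro A s σ ⟨htb, hak, hbk, hadst, hok⟩ hn hr hK hσ hag hA
    have hxa : s.var (.x a) = σ a := hag a hak hadst
    have haN := hσ a hak
    obtain ⟨hcnt, hkid⟩ := hK tb htb (σ a) haN
    set L := K tb (σ a) with hL
    have hLN : L.length ≤ N := hKlen tb (σ a)
    have hacc : ∀ {t x i : ℕ}, t < 16 → x < N → i < N → addr N t r x i < B := fun ht hx hi =>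
      lt_of_lt_of_le (addr_lt ht hx hi) hBr
    have h0B : 0 < B := by omega
    have ht1 : tb + 1 < 16 := by omega
    have ht2 : tb + 2 < 16 := by omega
    have hbnd : (Ex.ld (tb + 1) (.var .r) (.var (.x a)) (.lit 0)).eval s = L.length := by
      simp only [Ex.eval, hr, hxa, hcnt]
    refine wp_loop (fun j s' => OutIs N k (A ∪ emitted k ((L.take j).flatMap fun z =>
        sols K l (Function.update σ b z))) s' ∧ s'.time ≤ s.time + 1 +
        ((L.take j).map fun z => 2 + chainCost K (2 * k + 4) l (Function.update σ b z)).sum)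
      h0B ?_ ?_ (by simp) (by simp [Ex.eval]) ?_ ?_ ?_
    · simp only [Ex.fits, Ex.eval, Access, hn, hr, hxa]
      exact ⟨trivial, trivial, h0B, trivial, ht1, haN, hN, hacc ht1 haN hN⟩
    · rw [hbnd]; omega
    · refine ⟨?_, by simp [Ex.eval]⟩
      have e : emitted k ((L.take ((Ex.lit 0).eval s)).flatMap fun z =>
          sols K l (Function.update σ b z)) = ∅ := by simp [Ex.eval, emitted]
      rw [e, Set.union_empty]
      exact hA.of_eq rfl rfl
    · intro j _ hj s' ⟨hA', ht'⟩ hf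
      rw [hbnd] at hj
      have hv : ∀ y, y ≠ .cd → (∀ b, y ≠ .j b) → (∀ i ∈ b :: dsts l, y ≠ .x i) →
          s'.var y = s.var y := by
        intro y h1 h2 h3
        refine hf.var y fun h => ?_
        simp only [Cmd.mods] at h
        rcases h with rfl | rfl | h
        · exact h2 b rfl
        · exact h3 b (by simp) rfl
        · rcases chain_mods h with h | ⟨b, h⟩ | ⟨i, hi, h⟩
          exacts [h1 h, h2 b h, h3 i (by simp [hi]) h]
      have hm : ∀ t, t ≠ 9 → s'.mem t = s.mem t := by
        intro t ht
        refine hf.mem t fun h => ht ?_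
        simp only [Cmd.tags, false_or] at h
        exact chain_tags h
      have hn' : s'.var .n = N := (hv _ (by simp) (by simp) (by simp)).trans hn
      have hr' : s'.var .r = r := (hv _ (by simp) (by simp) (by simp)).trans hr
      have hxa' : s'.var (.x a) = σ a := by
        rw [hv _ (by simp) (by simp) ?_, hxa]
        intro i hi h
        simp only [Var.x.injEq] at h
        exact hadst (h ▸ hi)
      have hLj : L[j] < N := hKlt tb (σ a) _ (List.getElem_mem hj)
      have hld : s'.mem (tb + 2) r (σ a) j = L[j] := by
        rw [hm _ (by omega), hkid j hj]
      have hjN : j < N := by omega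
      refine wp_seq (fun s2 => s2 = ((s'.set (.j b) j).tick.set (.x b) L[j]).tick) ?_ ?_
      · simp only [wp, Ex.fits, Ex.eval, Access, St.tick_var, St.set_var, reduceCtorEq, if_false,
          if_true, hn', hr', hxa', St.tick_mem, St.set_mem, hld]
        exact ⟨⟨trivial, trivial, trivial, trivial, ht2, haN, hjN, hacc ht2 haN hjN⟩, by omega,
          by simp, trivial⟩
      rintro s2 rfl -
      have hsum : ((L.take (j + 1)).map fun z =>
          2 + chainCost K (2 * k + 4) l (Function.update σ b z)).sum = ((L.take j).map fun z =>
          2 + chainCost K (2 * k + 4) l (Function.update σ b z)).sum +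
          (2 + chainCost K (2 * k + 4) l (Function.update σ b L[j])) := by
        rw [List.take_succ_eq_append_getElem hj, List.map_append, List.sum_append,
          List.map_singleton, List.sum_singleton]
      have hflat : ((L.take (j + 1)).flatMap fun z => sols K l (Function.update σ b z)) =
          ((L.take j).flatMap fun z => sols K l (Function.update σ b z)) ++
          sols K l (Function.update σ b L[j]) := by
        rw [List.take_succ_eq_append_getElem hj, List.flatMap_append, List.flatMap_singleton]
      refine wp_mono _ (ih (A := A ∪ emitted k ((L.take j).flatMap fun z =>
        sols K l (Function.update σ b z))) (σ := Function.update σ b L[j]) hok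
        (by simp [hn']) (by simp [hr']) ?_ ?_ ?_ (hA'.of_eq rfl rfl)) ?_
      · intro tb' htb' x hx
        simp only [St.tick_mem, St.set_mem]
        rw [hm _ (by omega), hm _ (by omega)]
        exact hK tb' htb' x hx
      · intro i hi
        by_cases hib : i = b
        · subst hib; simpa using hLj
        · rw [Function.update_of_ne hib]; exact hσ i hi
      · intro i hi hid
        by_cases hib : i = b
        · subst hib; simp
        · have hne : i ∉ b :: dsts l := by simp [hib, hid]
          rw [Function.update_of_ne hib, ← hag i hi hne]
          simp only [St.tick_var, St.set_var, Var.x.injEq, hib, reduceCtorEq, if_false]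
          refine hv _ (by simp) (by simp) ?_
          intro i' hi' h
          simp only [Var.x.injEq] at h
          exact hne (h ▸ hi')
      · rintro s3 ⟨h1, h2⟩
        rw [hflat, emitted_append, ← Set.union_assoc, hsum]
        refine ⟨h1, ?_⟩
        simp only [St.tick_time, St.set_time] at h2
        omega
    · intro s' ⟨h1, h2⟩ _
      rw [hbnd, List.take_length] at h1 h2
      refine ⟨h1, ?_⟩
      simp only [chainCost, ← hL]
      omega

end WordRAM

/-! ### Nested loops: cost and set of solutions -/

namespace WordRAM

/-- Nested loops in which the tuples never get stuck after the first step. -/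
def Productive (K : ℕ → ℕ → List ℕ) : List (ℕ × ℕ × ℕ) → (ℕ → ℕ) → Prop
  | [], _ => True
  | (tb, a, b) :: l, σ => ∀ z ∈ K tb (σ a),
      sols K l (Function.update σ b z) ≠ [] ∧ Productive K l (Function.update σ b z)

/-- In the recursion tree every node below the root lies above a solution, so each depth has at most
as many nodes as there are solutions. The summand 1 pays for the root, which alone may be a dead
end. -/
theorem chainCost_le {K : ℕ → ℕ → List ℕ} {C : ℕ} {l : List (ℕ × ℕ × ℕ)} {σ : ℕ → ℕ}
    (h : Productive K l σ) :
    chainCost K C l σ ≤ 1 + (C + 3 * l.length) * (sols K l σ).length := by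
  induction l generalizing σ with
  | nil => simp [chainCost, sols]
  | cons e l ih =>
    obtain ⟨tb, a, b⟩ := e
    simp only [chainCost, sols, List.length_flatMap, List.length_cons]
    refine Nat.add_le_add_left ?_ _
    rw [← List.sum_map_mul_left]
    refine List.sum_le_sum fun z hz => ?_
    obtain ⟨h1, h2⟩ := h z hz
    have h3 := ih h2
    have h4 : 1 ≤ (sols K l (Function.update σ b z)).length := List.length_pos_of_ne_nil h1
    nlinarith

/-- Nested loops bind different variables, in terms of variables that are not bound later. -/
def Proper : List (ℕ × ℕ × ℕ) → Prop
  | [] => True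
  | (_, a, b) :: l => a ∉ b :: dsts l ∧ b ∉ dsts l ∧ Proper l

/-- A variable read or bound by a loop is not assigned again later, so the conditions of the loops
may be tested on the final assignment. -/
theorem mem_sols {K : ℕ → ℕ → List ℕ} {l : List (ℕ × ℕ × ℕ)} (hl : Proper l) {σ σ' : ℕ → ℕ} :
    σ' ∈ sols K l σ ↔ (∀ i, i ∉ dsts l → σ' i = σ i) ∧ ∀ e ∈ l, σ' e.2.2 ∈ K e.1 (σ' e.2.1) := by
  induction l generalizing σ with
  | nil =>
    simp only [sols, List.mem_singleton, dsts, List.map_nil, List.not_mem_nil, not_false_eq_true,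
      forall_const, IsEmpty.forall_iff, and_true]
    exact funext_iff
  | cons e l ih =>
    obtain ⟨tb, a, b⟩ := e
    obtain ⟨h1, h2, h3⟩ := hl
    simp only [sols, List.mem_flatMap, ih h3, List.forall_mem_cons]
    have hd : dsts ((tb, a, b) :: l) = b :: dsts l := rfl
    rw [hd]
    constructor
    · rintro ⟨z, hz, h4, h5⟩
      have hb : σ' b = z := by rw [h4 b h2]; simp
      have ha : σ' a = σ a := by
        simp only [List.mem_cons, not_or] at h1
        rw [h4 a h1.2, Function.update_of_ne h1.1]
      refine ⟨fun i hi => ?_, ?_, h5⟩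
      · simp only [List.mem_cons, not_or] at hi
        rw [h4 i hi.2, Function.update_of_ne hi.1]
      · rw [hb, ha]; exact hz
    · rintro ⟨h4, h5, h6⟩
      refine ⟨σ' b, ?_, fun i hi => ?_, h6⟩
      · rw [← h4 a h1]; exact h5
      · by_cases hib : i = b
        · subst hib; simp
        · rw [Function.update_of_ne hib]
          exact h4 i (by simp [hib, hi])

theorem nodup_sols {K : ℕ → ℕ → List ℕ} (hK : ∀ tb x, (K tb x).Nodup) {l : List (ℕ × ℕ × ℕ)}
    (hl : Proper l) {σ : ℕ → ℕ} : (sols K l σ).Nodup := by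
  induction l generalizing σ with
  | nil => simp [sols]
  | cons e l ih =>
    obtain ⟨tb, a, b⟩ := e
    obtain ⟨h1, h2, h3⟩ := hl
    refine List.nodup_flatMap.2 ⟨fun z _ => ih h3, (hK _ _).imp ?_⟩
    intro z z' hz
    simp only [Function.onFun, List.disjoint_left]
    intro σ' h4 h5
    have e1 := ((mem_sols h3).1 h4).1 b h2
    have e2 := ((mem_sols h3).1 h5).1 b h2
    simp only [Function.update_self] at e1 e2
    exact hz (e1.symm.trans e2)

/-- Loops from the level `j + 1` down to the level `1`. -/
def down (tb : ℕ) (idx : ℕ → ℕ) : ℕ → List (ℕ × ℕ × ℕ)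
  | 0 => []
  | j + 1 => (tb, idx (j + 2), idx (j + 1)) :: down tb idx j

theorem mem_down {tb : ℕ} {idx : ℕ → ℕ} {j : ℕ} {e : ℕ × ℕ × ℕ} :
    e ∈ down tb idx j ↔ ∃ i, 1 ≤ i ∧ i ≤ j ∧ e = (tb, idx (i + 1), idx i) := by
  induction j with
  | zero =>
    simp only [down, List.not_mem_nil, false_iff, not_exists]
    intro i h; omega
  | succ j ih =>
    simp only [down, List.mem_cons, ih]
    constructor
    · rintro (rfl | ⟨i, h1, h2, rfl⟩)
      · exact ⟨j + 1, by omega, le_rfl, rfl⟩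
      · exact ⟨i, h1, by omega, rfl⟩
    · rintro ⟨i, h1, h2, rfl⟩
      by_cases h : i = j + 1
      · subst h; exact Or.inl rfl
      · exact Or.inr ⟨i, h1, by omega, rfl⟩

theorem length_down {tb : ℕ} {idx : ℕ → ℕ} {j : ℕ} : (down tb idx j).length = j := by
  induction j with
  | zero => rfl
  | succ j ih => simp [down, ih]

theorem mem_dsts_down {tb : ℕ} {idx : ℕ → ℕ} {j x : ℕ} :
    x ∈ dsts (down tb idx j) ↔ ∃ i, 1 ≤ i ∧ i ≤ j ∧ x = idx i := by
  simp only [dsts, List.mem_map, mem_down]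
  constructor
  · rintro ⟨_, ⟨i, h1, h2, rfl⟩, rfl⟩; exact ⟨i, h1, h2, rfl⟩
  · rintro ⟨i, h1, h2, rfl⟩; exact ⟨_, ⟨i, h1, h2, rfl⟩, rfl⟩

theorem dsts_append (l l' : List (ℕ × ℕ × ℕ)) : dsts (l ++ l') = dsts l ++ dsts l' := by
  simp [dsts]

theorem proper_down {tb : ℕ} {idx : ℕ → ℕ} {j : ℕ} {l : List (ℕ × ℕ × ℕ)} (hl : Proper l)
    (hinj : ∀ i i', 1 ≤ i → i ≤ j + 1 → 1 ≤ i' → i' ≤ j + 1 → idx i = idx i' → i = i')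
    (hdis : ∀ i, 1 ≤ i → i ≤ j + 1 → idx i ∉ dsts l) : Proper (down tb idx j ++ l) := by
  induction j with
  | zero => simpa [down] using hl
  | succ j ih =>
    change idx (j + 2) ∉ idx (j + 1) :: dsts (down tb idx j ++ l) ∧
      idx (j + 1) ∉ dsts (down tb idx j ++ l) ∧ Proper (down tb idx j ++ l)
    refine ⟨?_, ?_, ih (fun i i' h1 h2 h3 h4 => hinj i i' h1 (by omega) h3 (by omega))
      (fun i h1 h2 => hdis i h1 (by omega))⟩
    · simp only [dsts_append, List.mem_cons, List.mem_append, mem_dsts_down, not_or]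
      refine ⟨fun h => ?_, ?_, hdis _ (by omega) (by omega)⟩
      · have := hinj _ _ (by omega) (by omega) (by omega) (by omega) h; omega
      · rintro ⟨i, h1, h2, h3⟩
        have := hinj _ _ (by omega) (by omega) (by omega) (by omega) h3; omega
    · simp only [dsts_append, List.mem_append, mem_dsts_down, not_or]
      refine ⟨?_, hdis _ (by omega) (by omega)⟩
      rintro ⟨i, h1, h2, h3⟩
      have := hinj _ _ (by omega) (by omega) (by omega) (by omega) h3; omega

theorem chainOk_down {k tb : ℕ} {idx : ℕ → ℕ} {j : ℕ} {l : List (ℕ × ℕ × ℕ)} (hl : ChainOk k l)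
    (htb : tb = 3 ∨ tb = 6) (hlt : ∀ i, 1 ≤ i → i ≤ j + 1 → idx i < k)
    (hp : Proper (down tb idx j ++ l)) : ChainOk k (down tb idx j ++ l) := by
  induction j with
  | zero => simpa [down] using hl
  | succ j ih =>
    obtain ⟨h1, h2, h3⟩ := hp
    exact ⟨htb, hlt _ (by omega) (by omega), hlt _ (by omega) (by omega), h1,
      ih (fun i h1 h2 => hlt i h1 (by omega)) h3⟩

/-! ### Levels and descending paths -/

section levels

variable {N : ℕ} {nb : ℕ → List ℕ} {p v : ℕ} {c : ℕ → ℕ} {k : ℕ} {K : ℕ → List ℕ}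

theorem LevelKids.nodup' (h : LevelKids N nb p v c k K) (x : ℕ) : (K x).Nodup := by
  by_cases hx : ∃ i < k, x % p = c (i + 1)
  · obtain ⟨i, hi, hx⟩ := hx; exact h.nodup i hi x hx
  · push Not at hx
    rw [h.nil x hx]; simp

theorem lvl_lt (hv : v < N) {i x : ℕ} (h : x ∈ lvl N nb p v c i) : x < N := by
  cases i with
  | zero => simp only [lvl, Finset.mem_singleton] at h; omega
  | succ i => simp only [lvl, Finset.mem_filter, Finset.mem_range] at h; exact h.1

theorem mem_lvl_succ {i x : ℕ} : x ∈ lvl N nb p v c (i + 1) ↔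
    x < N ∧ Good N nb p (c (i + 1)) v x ∧ ∃ y ∈ lvl N nb p v c i, x ∈ nb y := by
  simp only [lvl, Finset.mem_filter, Finset.mem_range]

theorem LevelKids.mem' (h : LevelKids N nb p v c k K) (hv : v < N) (hnb : GoodNb N nb) {x y : ℕ} :
    y ∈ K x ↔ ∃ i < k, y ∈ lvl N nb p v c i ∧ x ∈ nb y ∧ x ∈ lvl N nb p v c (i + 1) := by
  constructor
  · intro hy
    by_cases hx : ∃ i < k, x % p = c (i + 1)
    · obtain ⟨i, hi, hx⟩ := hx
      obtain ⟨h1, h2, h3⟩ := (h.mem i hi x hx y).1 hy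
      exact ⟨i, hi, h1, h2, mem_lvl_succ.2 ⟨hnb.lt y (lvl_lt hv h1) x h2, h3, y, h1, h2⟩⟩
    · push Not at hx
      rw [h.nil x hx] at hy
      simp at hy
  · rintro ⟨i, hi, h1, h2, h3⟩
    have h4 := (mem_lvl_succ.1 h3).2.1
    exact (h.mem i hi x h4.1 y).2 ⟨h1, h2, h4⟩

theorem LevelKids.ne_nil (h : LevelKids N nb p v c k K) (hv : v < N) (hnb : GoodNb N nb) {i x : ℕ}
    (hi : i < k) (hx : x ∈ lvl N nb p v c (i + 1)) : K x ≠ [] := by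
  obtain ⟨_, _, y, hy, hxy⟩ := mem_lvl_succ.1 hx
  exact List.ne_nil_of_mem ((h.mem' hv hnb).2 ⟨i, hi, hy, hxy, hx⟩)

/-- Levels with different numbers are disjoint. -/
theorem lvl_inj (hv : v % p = c 0) (hinj : ∀ i ≤ k, ∀ j ≤ k, c i = c j → i = j) {i j x : ℕ}
    (hi : i ≤ k) (hj : j ≤ k) (h1 : x ∈ lvl N nb p v c i) (h2 : x ∈ lvl N nb p v c j) : i = j := by
  have key : ∀ i, x ∈ lvl N nb p v c i → x % p = c i := by
    intro i h
    cases i with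
    | zero => simp only [lvl, Finset.mem_singleton] at h; rw [h, hv]
    | succ i => exact (mem_lvl_succ.1 h).2.1.1
  exact hinj i hi j hj ((key i h1).symm.trans (key j h2))

/-- Going down along the lists `K` is the same as following levels backwards. -/
theorem LevelKids.path_iff (h : LevelKids N nb p v c k K) (hv : v < N) (hnb : GoodNb N nb)
    (hv0 : v % p = c 0) (hinj : ∀ i ≤ k, ∀ j ≤ k, c i = c j → i = j) (hk : 2 ≤ k) {τ : ℕ → ℕ}
    (hcol : τ k % p = c k) (h0 : τ 0 = v) :
    (∀ i, 1 ≤ i → i ≤ k - 1 → τ i ∈ K (τ (i + 1))) ↔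
      ∀ i < k, τ (i + 1) ∈ nb (τ i) ∧ τ (i + 1) < N ∧ Good N nb p (c (i + 1)) v (τ (i + 1)) := by
  have hcl : ∀ {i x}, x ∈ lvl N nb p v c (i + 1) → x % p = c (i + 1) :=
    fun hx => (mem_lvl_succ.1 hx).2.1.1
  constructor
  · intro hK
    -- The lists do not say which level they belong to; the colour of `τ (i + 1)` determines it, and
    -- this propagates downwards from the colour of `τ k`.
    have step : ∀ i, 1 ≤ i → i ≤ k - 1 → τ (i + 1) % p = c (i + 1) →
        τ i ∈ lvl N nb p v c i ∧ τ (i + 1) ∈ nb (τ i) ∧ τ (i + 1) ∈ lvl N nb p v c (i + 1) := by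
      intro i h1 h2 hc
      obtain ⟨i', hi', h3, h4, h5⟩ := (h.mem' hv hnb).1 (hK i h1 h2)
      have : i + 1 = i' + 1 := hinj _ (by omega) _ (by omega) (hc.symm.trans (hcl h5))
      have : i' = i := by omega
      subst this
      exact ⟨h3, h4, h5⟩
    have all : ∀ d, d ≤ k - 2 → τ (k - 1 - d) ∈ lvl N nb p v c (k - 1 - d) ∧
        τ (k - 1 - d + 1) ∈ nb (τ (k - 1 - d)) ∧
        τ (k - 1 - d + 1) ∈ lvl N nb p v c (k - 1 - d + 1) := by
      intro d
      induction d with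
      | zero =>
        intro _
        have e : k - 1 + 1 = k := by omega
        have := step (k - 1) (by omega) le_rfl (by rw [e]; exact hcol)
        simpa using this
      | succ d ih =>
        intro hd
        have h1 := (ih (by omega)).1
        have e : k - 1 - (d + 1) + 1 = k - 1 - d := by omega
        refine step (k - 1 - (d + 1)) (by omega) (by omega) ?_
        rw [e]
        obtain ⟨m, hm⟩ : ∃ m, k - 1 - d = m + 1 := ⟨k - 1 - d - 1, by omega⟩
        rw [hm] at h1 ⊢
        exact hcl h1
    intro i hi
    rcases Nat.eq_zero_or_pos i with rfl | hpos
    -- The lists only lead down to level 1. The last edge comes for free, since level 0 is `{v}`.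
    · have h1 := (all (k - 2) le_rfl).1
      have e : k - 1 - (k - 2) = 0 + 1 := by omega
      rw [e] at h1
      obtain ⟨h2, h3, y, hy, hxy⟩ := mem_lvl_succ.1 h1
      simp only [lvl, Finset.mem_singleton] at hy
      subst hy
      exact ⟨by rw [h0]; exact hxy, h2, h3⟩
    · have h1 := all (k - 1 - i) (by omega)
      have e : k - 1 - (k - 1 - i) = i := by omega
      rw [e] at h1
      obtain ⟨h2, h3, -⟩ := mem_lvl_succ.1 h1.2.2
      exact ⟨h1.2.1, h2, h3⟩
  · intro hP
    have all : ∀ i ≤ k, τ i ∈ lvl N nb p v c i := by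
      intro i
      induction i with
      | zero => intro _; simp [lvl, h0]
      | succ i ih =>
        intro hi
        obtain ⟨h1, h2, h3⟩ := hP i (by omega)
        exact mem_lvl_succ.2 ⟨h2, h3, τ i, ih (by omega), h1⟩
    intro i h1 h2
    exact (h.mem' hv hnb).2 ⟨i, by omega, all i (by omega), (hP i (by omega)).1,
      all (i + 1) (by omega)⟩

theorem LevelKids.lvl_of_path {τ : ℕ → ℕ} (h0 : τ 0 = v) (hP : ∀ i < k, τ (i + 1) ∈ nb (τ i) ∧
    τ (i + 1) < N ∧ Good N nb p (c (i + 1)) v (τ (i + 1))) : τ k ∈ lvl N nb p v c k := by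
  have all : ∀ i ≤ k, τ i ∈ lvl N nb p v c i := by
    intro i
    induction i with
    | zero => intro _; simp [lvl, h0]
    | succ i ih =>
      intro hi
      obtain ⟨h1, h2, h3⟩ := hP i (by omega)
      exact mem_lvl_succ.2 ⟨h2, h3, τ i, ih (by omega), h1⟩
  exact all k le_rfl

/-- Every vertex of level `i + 1` was discovered from a vertex of level `i`, so its list is nonempty
and the descent cannot get stuck. The list `l` stands for the loops that follow the descent. -/
theorem productive_down {tb : ℕ} {Ks : ℕ → ℕ → List ℕ} (h : LevelKids N nb p v c k (Ks tb))
    (hv : v < N) (hnb : GoodNb N nb) (hv0 : v % p = c 0)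
    (hinj : ∀ i ≤ k, ∀ j ≤ k, c i = c j → i = j) {idx : ℕ → ℕ} {l : List (ℕ × ℕ × ℕ)} {j : ℕ}
    (hj : j < k) : ∀ {σ : ℕ → ℕ}, σ (idx (j + 1)) ∈ lvl N nb p v c (j + 1) →
      (∀ σ', (∀ x, (∀ i, 1 ≤ i → i ≤ j → x ≠ idx i) → σ' x = σ x) →
        sols Ks l σ' ≠ [] ∧ Productive Ks l σ') →
      sols Ks (down tb idx j ++ l) σ ≠ [] ∧ Productive Ks (down tb idx j ++ l) σ := by
  induction j with
  | zero => intro σ _ hl; exact hl σ fun _ _ => rfl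
  | succ j ih =>
    intro σ hσ hl
    have main : ∀ z ∈ Ks tb (σ (idx (j + 2))),
        sols Ks (down tb idx j ++ l) (Function.update σ (idx (j + 1)) z) ≠ [] ∧
        Productive Ks (down tb idx j ++ l) (Function.update σ (idx (j + 1)) z) := by
      intro z hz
      obtain ⟨i, hi, h1, h2, h3⟩ := (h.mem' hv hnb).1 hz
      have : i + 1 = j + 2 := lvl_inj hv0 hinj (by omega) (by omega) h3 hσ
      have : i = j + 1 := by omega
      subst this
      refine ih (by omega) (by simpa using h1) ?_
      intro σ' hσ'
      refine hl σ' fun x hx => ?_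
      rw [hσ' x fun i h1 h2 => hx i h1 (by omega), Function.update_of_ne (hx (j + 1) (by omega) le_rfl)]
    obtain ⟨z, hz⟩ := List.exists_mem_of_ne_nil _ (h.ne_nil hv hnb (by omega) hσ)
    refine ⟨?_, main⟩
    obtain ⟨σ', hσ'⟩ := List.exists_mem_of_ne_nil _ (main z hz).1
    exact List.ne_nil_of_mem (List.mem_flatMap.2 ⟨z, hz, hσ'⟩)

/-- The last level is never scanned itself, but each of its vertices is met while the level before
it is scanned. -/
theorem card_lvl_le_exploreCost (hk : 1 ≤ k) :
    (lvl N nb p v c k).card ≤ exploreCost N nb p v c k := by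
  obtain ⟨k, rfl⟩ : ∃ k', k = k' + 1 := ⟨k - 1, by omega⟩
  have h1 : lvl N nb p v c (k + 1) ⊆ (lvl N nb p v c k).biUnion fun y => (nb y).toFinset := by
    intro x hx
    obtain ⟨-, -, y, hy, hxy⟩ := mem_lvl_succ.1 hx
    simp only [Finset.mem_biUnion, List.mem_toFinset]
    exact ⟨y, hy, hxy⟩
  refine (Finset.card_le_card h1).trans (Finset.card_biUnion_le.trans ?_)
  have h2 : ∑ y ∈ lvl N nb p v c k, (nb y).toFinset.card ≤
      ∑ y ∈ lvl N nb p v c k, (3 + 9 * (nb y).length) :=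
    Finset.sum_le_sum fun y _ => by have := (nb y).toFinset_card_le; omega
  rw [exploreCost, Finset.sum_range_succ]
  omega

end levels

/-- The colours of the levels in the backward direction. -/
def back (k : ℕ) (i : ℕ) : ℕ := if i = 0 then 0 else 2 * k - i

/-- A closed walk of length `2 * k` whose vertices have the colours `col` and whose first vertex
has the highest rank. -/
structure LCyc (N : ℕ) (nb : ℕ → List ℕ) (p k : ℕ) (col : ℕ → ℕ) (σ : ℕ → ℕ) : Prop where
  lt : ∀ i < 2 * k, σ i < N
  col : ∀ i < 2 * k, σ i % p = col i
  adj : ∀ i, i + 1 < 2 * k → σ (i + 1) ∈ nb (σ i)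
  close : σ 0 ∈ nb (σ (2 * k - 1))
  key : ∀ i, 0 < i → i < 2 * k → key N nb (σ i) < key N nb (σ 0)

/-- The nested loops that list the cycles. -/
def steps (k : ℕ) : List (ℕ × ℕ × ℕ) := down 6 (back k) (k - 1) ++ (down 3 id (k - 1) ++ [])

theorem proper_steps {k : ℕ} : Proper (steps k) := by
  refine proper_down (proper_down trivial ?_ ?_) ?_ ?_
  · intro i i' _ _ _ _ h; exact h
  · intro i _ _; simp [dsts]
  · intro i i' h1 h2 h3 h4 h
    simp only [back] at h
    split_ifs at h <;> omega
  · intro i h1 h2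
    rw [List.append_nil, mem_dsts_down]
    rintro ⟨i', h3, h4, h5⟩
    simp only [back, id] at h5
    split_ifs at h5 <;> omega

theorem chainOk_steps {k : ℕ} : ChainOk (2 * k) (steps k) := by
  rcases Nat.eq_zero_or_pos k with rfl | hk
  · trivial
  have h2 : Proper (down 3 id (k - 1) ++ []) :=
    proper_down trivial (fun i i' _ _ _ _ h => h) (fun i _ _ => by simp [dsts])
  refine chainOk_down (chainOk_down trivial (Or.inl rfl) ?_ h2) (Or.inr rfl) ?_ proper_steps
  · intro i h1 h2; simp only [id]; omega
  · intro i h1 h2; simp only [back]; split_ifs <;> omega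

theorem mem_dsts_steps {k i : ℕ} : i ∈ dsts (steps k) ↔ 0 < i ∧ i < 2 * k ∧ i ≠ k := by
  simp only [steps, dsts_append, List.mem_append, mem_dsts_down, List.append_nil]
  constructor
  · rintro (⟨j, h1, h2, rfl⟩ | ⟨j, h1, h2, rfl⟩)
    · simp only [back]; split_ifs <;> omega
    · omega
  · rintro ⟨h1, h2, h3⟩
    by_cases h : i < k
    · exact Or.inr ⟨i, h1, by omega, rfl⟩
    · refine Or.inl ⟨2 * k - i, by omega, by omega, ?_⟩
      simp only [back]; split_ifs <;> omega

/-- The tuples found at the vertex `u` of the last level. -/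
def start (k v u : ℕ) : ℕ → ℕ := Function.update (Function.update (fun _ => 0) 0 v) k u

/-! ### Joining forward and backward paths -/

section cycles

variable {N : ℕ} {nb : ℕ → List ℕ} {p v : ℕ} {col : ℕ → ℕ} {k : ℕ} {Ks : ℕ → ℕ → List ℕ}

/-- A forward path through the positions `0, 1, …, k` and a backward path through `0, 2k - 1, …, k`
with the same last vertex `u` form a closed walk. Both descriptions are reduced to conditions on
edges by `LevelKids.path_iff`; symmetry of the graph reverses the backward half. -/
theorem mem_sols_steps (hnb : GoodNb N nb) (hsymm : ∀ x < N, ∀ y < N, y ∈ nb x ↔ x ∈ nb y)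
    (hk : 2 ≤ k) (hv : v < N) (hv0 : v % p = col 0)
    (hinj : ∀ i < 2 * k, ∀ j < 2 * k, col i = col j → i = j)
    (hf : LevelKids N nb p v col k (Ks 3)) (hb : LevelKids N nb p v (col ∘ back k) k (Ks 6))
    {u : ℕ} (hu : u % p = col k) {σ : ℕ → ℕ} :
    σ ∈ sols Ks (steps k) (start k v u) ↔
      LCyc N nb p k col σ ∧ σ 0 = v ∧ σ k = u ∧ ∀ i, 2 * k ≤ i → σ i = 0 := by
  have hbinj : ∀ i ≤ k, ∀ j ≤ k, (col ∘ back k) i = (col ∘ back k) j → i = j := by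
    intro i hi j hj h
    have := hinj (back k i) (by simp only [back]; split_ifs <;> omega) (back k j)
      (by simp only [back]; split_ifs <;> omega) h
    simp only [back] at this
    split_ifs at this <;> omega
  have hfinj : ∀ i ≤ k, ∀ j ≤ k, col i = col j → i = j :=
    fun i hi j hj h => hinj i (by omega) j (by omega) h
  have hbk : back k k = k := by simp only [back]; split_ifs <;> omega
  have hb0 : back k 0 = 0 := rfl
  have hbs : ∀ i, 0 < i → back k i = 2 * k - i := fun i hi => by
    simp only [back]; rw [if_neg (by omega)]
  rw [mem_sols proper_steps]
  have hagree : (∀ i, i ∉ dsts (steps k) → σ i = start k v u i) ↔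
      σ 0 = v ∧ σ k = u ∧ ∀ i, 2 * k ≤ i → σ i = 0 := by
    simp only [mem_dsts_steps]
    constructor
    · intro h
      refine ⟨?_, ?_, fun i hi => ?_⟩
      · rw [h 0 (by omega), start, Function.update_of_ne (by omega), Function.update_self]
      · rw [h k (by omega), start, Function.update_self]
      · rw [h i (by omega), start, Function.update_of_ne (by omega),
          Function.update_of_ne (by omega)]
    · rintro ⟨h1, h2, h3⟩ i hi
      by_cases hi0 : i = 0
      · subst hi0; rw [h1, start, Function.update_of_ne (by omega), Function.update_self]
      · by_cases hik : i = k
        · subst hik; rw [h2, start, Function.update_self]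
        · rw [h3 i (by omega), start, Function.update_of_ne (by omega),
            Function.update_of_ne (by omega)]
  rw [hagree]
  have hsteps : (∀ e ∈ steps k, σ e.2.2 ∈ Ks e.1 (σ e.2.1)) ↔
      (∀ i, 1 ≤ i → i ≤ k - 1 → (σ ∘ back k) i ∈ Ks 6 ((σ ∘ back k) (i + 1))) ∧
      (∀ i, 1 ≤ i → i ≤ k - 1 → σ i ∈ Ks 3 (σ (i + 1))) := by
    simp only [steps, List.append_nil, List.mem_append, mem_down]
    constructor
    · intro h
      exact ⟨fun i h1 h2 => h _ (Or.inl ⟨i, h1, h2, rfl⟩),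
        fun i h1 h2 => h _ (Or.inr ⟨i, h1, h2, rfl⟩)⟩
    · rintro ⟨h1, h2⟩ e (⟨i, h3, h4, rfl⟩ | ⟨i, h3, h4, rfl⟩)
      exacts [h1 i h3 h4, h2 i h3 h4]
  rw [hsteps]
  constructor
  · rintro ⟨⟨h0, hku, hbig⟩, h1, h2⟩
    rw [hb.path_iff hv hnb hv0 hbinj hk (by simp only [Function.comp, hbk, hku]; exact hu)
      (by simpa [hb0] using h0)] at h1
    rw [hf.path_iff hv hnb hv0 hfinj hk (by rw [hku]; exact hu) h0] at h2
    simp only [Function.comp] at h1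
    have hlow : ∀ i, 0 < i → i ≤ k → σ i < N ∧ Good N nb p (col i) v (σ i) := by
      intro i h3 h4
      obtain ⟨i, rfl⟩ : ∃ i', i = i' + 1 := ⟨i - 1, by omega⟩
      exact (h2 i (by omega)).2
    have hhigh : ∀ i, k ≤ i → i < 2 * k → σ i < N ∧ Good N nb p (col i) v (σ i) := by
      intro i h3 h4
      have := (h1 (2 * k - i - 1) (by omega)).2
      rw [hbs _ (by omega), show 2 * k - (2 * k - i - 1 + 1) = i by omega] at this
      exact this
    have hall : ∀ i, 0 < i → i < 2 * k → σ i < N ∧ Good N nb p (col i) v (σ i) := by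
      intro i h3 h4
      by_cases h : i ≤ k
      exacts [hlow i h3 h, hhigh i (by omega) h4]
    have hlt : ∀ i < 2 * k, σ i < N := by
      intro i hi
      rcases Nat.eq_zero_or_pos i with rfl | hpos
      · rw [h0]; exact hv
      · exact (hall i hpos hi).1
    refine ⟨⟨hlt, ?_, ?_, ?_, ?_⟩, h0, hku, hbig⟩
    · intro i hi
      rcases Nat.eq_zero_or_pos i with rfl | hpos
      · rw [h0]; exact hv0
      · exact (hall i hpos hi).2.1
    · intro i hi
      by_cases h : i < k
      · exact (h2 i h).1
      · have := (h1 (2 * k - (i + 1)) (by omega)).1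
        rw [hbs _ (by omega), hbs _ (by omega),
          show 2 * k - (2 * k - (i + 1) + 1) = i by omega,
          show 2 * k - (2 * k - (i + 1)) = i + 1 by omega] at this
        exact (hsymm _ (hlt _ (by omega)) _ (hlt _ (by omega))).1 this
    · have := (h1 0 (by omega)).1
      rw [hb0, hbs _ (by omega)] at this
      exact (hsymm _ (hlt _ (by omega)) _ (hlt _ (by omega))).1 this
    · intro i h3 h4
      rw [h0]; exact (hall i h3 h4).2.2
  · rintro ⟨hL, h0, hku, hbig⟩
    have hg : ∀ i, 0 < i → i < 2 * k → Good N nb p (col i) v (σ i) := fun i h3 h4 =>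
      ⟨hL.col i h4, by rw [← h0]; exact hL.key i h3 h4⟩
    refine ⟨⟨h0, hku, hbig⟩, ?_, ?_⟩
    · rw [hb.path_iff hv hnb hv0 hbinj hk (by simp only [Function.comp, hbk, hku]; exact hu)
        (by simpa [hb0] using h0)]
      intro i hi
      simp only [Function.comp]
      rw [hbs (i + 1) (by omega)]
      refine ⟨?_, hL.lt _ (by omega), hg _ (by omega) (by omega)⟩
      rw [hsymm _ (hL.lt _ (by simp only [back]; split_ifs <;> omega)) _ (hL.lt _ (by omega))]
      rcases Nat.eq_zero_or_pos i with rfl | hpos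
      · exact hL.close
      · rw [hbs i hpos]
        have := hL.adj (2 * k - (i + 1)) (by omega)
        rwa [show 2 * k - (i + 1) + 1 = 2 * k - i by omega] at this
    · rw [hf.path_iff hv hnb hv0 hfinj hk (by rw [hku]; exact hu) h0]
      intro i hi
      exact ⟨hL.adj i (by omega), hL.lt _ (by omega), hg _ (by omega) (by omega)⟩

/-- The vertex `u` comes from the forward search, so the forward descent succeeds. If `u` is missing
from the last backward level, its backward list is empty and the outermost loop ends at once. This
is why the backward loops are the outer ones. -/
theorem productive_steps (hnb : GoodNb N nb) (hk : 2 ≤ k) (hv : v < N) (hv0 : v % p = col 0)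
    (hinj : ∀ i < 2 * k, ∀ j < 2 * k, col i = col j → i = j)
    (hf : LevelKids N nb p v col k (Ks 3)) (hb : LevelKids N nb p v (col ∘ back k) k (Ks 6))
    {u : ℕ} (hu : u ∈ lvl N nb p v col k) : Productive Ks (steps k) (start k v u) := by
  have hbinj : ∀ i ≤ k, ∀ j ≤ k, (col ∘ back k) i = (col ∘ back k) j → i = j := by
    intro i hi j hj h
    have := hinj (back k i) (by simp only [back]; split_ifs <;> omega) (back k j)
      (by simp only [back]; split_ifs <;> omega) h
    simp only [back] at this
    split_ifs at this <;> omega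
  have hfinj : ∀ i ≤ k, ∀ j ≤ k, col i = col j → i = j :=
    fun i hi j hj h => hinj i (by omega) j (by omega) h
  have hbk : back k k = k := by simp only [back]; split_ifs <;> omega
  obtain ⟨k, rfl⟩ : ∃ k', k = k' + 1 := ⟨k - 1, by omega⟩
  have huc : u % p = col (k + 1) := (mem_lvl_succ.1 hu).2.1.1
  have hst : start (k + 1) v u (k + 1) = u := by simp [start]
  by_cases hub : u ∈ lvl N nb p v (col ∘ back (k + 1)) (k + 1)
  · refine (productive_down (l := down 3 id k ++ []) hb hv hnb hv0 hbinj (idx := back (k + 1))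
      (j := k) (by omega) (by rw [hbk, hst]; exact hub) ?_).2
    intro σ hσ
    have hσk : σ (k + 1) = u := by
      rw [hσ, hst]
      intro i h1 h2
      simp only [back]; split_ifs <;> omega
    refine productive_down hf hv hnb hv0 hfinj (idx := id) (j := k) (by omega)
      (by simpa [hσk] using hu) ?_
    intro σ' _
    exact ⟨by simp [sols], trivial⟩
  · obtain ⟨k, rfl⟩ : ∃ k', k = k' + 1 := ⟨k - 1, by omega⟩
    intro z hz
    change z ∈ Ks 6 (start (k + 1 + 1) v u (back (k + 1 + 1) (k + 2))) at hz
    rw [show k + 2 = k + 1 + 1 from rfl, hbk, hst] at hz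
    obtain ⟨i, hi, h1, h2, h3⟩ := (hb.mem' hv hnb).1 hz
    have h4 := (mem_lvl_succ.1 h3).2.1.1
    have : i + 1 = k + 1 + 1 := hbinj _ (by omega) _ le_rfl (by
      rw [← h4, huc, Function.comp, hbk])
    rw [this] at h3
    exact (hub h3).elim

/-- The list of the tuples found from `v`. -/
theorem exists_found (hnb : GoodNb N nb) (hsymm : ∀ x < N, ∀ y < N, y ∈ nb x ↔ x ∈ nb y)
    (hk : 2 ≤ k) (hv : v < N) (hv0 : v % p = col 0)
    (hinj : ∀ i < 2 * k, ∀ j < 2 * k, col i = col j → i = j)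
    (hf : LevelKids N nb p v col k (Ks 3)) (hb : LevelKids N nb p v (col ∘ back k) k (Ks 6))
    (hK : ∀ tb x, (Ks tb x).Nodup) {F : List ℕ} (hF : F.Nodup)
    (hmem : ∀ x, x ∈ F ↔ x ∈ lvl N nb p v col k) :
    (F.flatMap fun u => (sols Ks (steps k) (start k v u)).map (tup (2 * k))).Nodup ∧
    ∀ t, t ∈ (F.flatMap fun u => (sols Ks (steps k) (start k v u)).map (tup (2 * k))) ↔
      ∃ σ, t = tup (2 * k) σ ∧ LCyc N nb p k col σ ∧ σ 0 = v := by
  have hcol : ∀ u ∈ F, u % p = col k := by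
    intro u hu
    obtain ⟨k, rfl⟩ : ∃ k', k = k' + 1 := ⟨k - 1, by omega⟩
    exact (mem_lvl_succ.1 ((hmem u).1 hu)).2.1.1
  have hms := fun u (hu : u ∈ F) σ => mem_sols_steps hnb hsymm hk hv hv0 hinj hf hb (hcol u hu)
    (σ := σ)
  refine ⟨List.nodup_flatMap.2 ⟨?_, ?_⟩, ?_⟩
  · intro u hu
    refine (nodup_sols hK proper_steps).map_on ?_
    intro σ h σ' h' e
    obtain ⟨-, -, -, h1⟩ := (hms u hu σ).1 h
    obtain ⟨-, -, -, h2⟩ := (hms u hu σ').1 h'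
    funext i
    by_cases hi : i < 2 * k
    · exact tup_inj.1 e i hi
    · rw [h1 i (by omega), h2 i (by omega)]
  · refine hF.imp_of_mem ?_
    intro u u' hu hu' hne
    simp only [Function.onFun, List.disjoint_left, List.mem_map]
    rintro _ ⟨σ, h, rfl⟩ ⟨σ', h', e⟩
    obtain ⟨-, -, h1, -⟩ := (hms u hu σ).1 h
    obtain ⟨-, -, h2, -⟩ := (hms u' hu' σ').1 h'
    exact hne (by rw [← h1, ← h2]; exact (tup_inj.1 e k (by omega)).symm)
  · intro t
    simp only [List.mem_flatMap, List.mem_map]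
    constructor
    · rintro ⟨u, hu, σ, h, rfl⟩
      obtain ⟨h1, h2, -, -⟩ := (hms u hu σ).1 h
      exact ⟨σ, rfl, h1, h2⟩
    · rintro ⟨σ, rfl, h1, h2⟩
      -- The assignments produced by the loops vanish from position `2 * k` on, so an arbitrary `σ`
      -- is normalized first.
      set σ' : ℕ → ℕ := fun i => if i < 2 * k then σ i else 0 with hσ'
      have e : ∀ i < 2 * k, σ' i = σ i := fun i hi => by simp [hσ', hi]
      have hL : LCyc N nb p k col σ' := by
        refine ⟨?_, ?_, ?_, ?_, ?_⟩
        · intro i hi; rw [e i hi]; exact h1.lt i hi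
        · intro i hi; rw [e i hi]; exact h1.col i hi
        · intro i hi; rw [e _ hi, e i (by omega)]; exact h1.adj i hi
        · rw [e 0 (by omega), e _ (by omega)]; exact h1.close
        · intro i h3 h4; rw [e i h4, e 0 (by omega)]; exact h1.key i h3 h4
      have hu : σ k ∈ F := by
        rw [hmem]
        refine LevelKids.lvl_of_path h2 fun i hi => ⟨h1.adj i (by omega), h1.lt _ (by omega),
          h1.col _ (by omega), ?_⟩
        rw [← h2]; exact h1.key _ (by omega) (by omega)
      refine ⟨σ k, hu, σ', (hms _ hu σ').2 ⟨hL, ?_, e k (by omega), ?_⟩, tup_inj.2 e⟩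
      · rw [e 0 (by omega), h2]
      · intro i hi; simp [hσ']; omega

end cycles

end WordRAM

/-! ### All cycles with a given top vertex and given colours -/

namespace WordRAM

/-- List the cycles whose vertex of highest rank is `v`. -/
def runCmd (k : ℕ) : Cmd :=
  .seq (.set (.x 0) (.var .v))
  -- The backward search comes first, so that afterwards `lo` and `hi` delimit the last level of the
  -- forward search.
  (.seq (exploreCmd 6 (fun i => .c (2 * k - i)) k)
  (.seq (exploreCmd 3 (fun i => .c i) k)
  (.seq (.loop .q (.var .lo) (.var .hi)
    (.seq (.set (.x k) (.ld 3 (.var .r) (.lit 0) (.var .q)))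
      (chainCmd (emitCmd (2 * k)) (steps k))))
  -- The next vertex gets a fresh region, which makes clearing the arrays unnecessary.
  (.set .r (.add (.var .r) (.lit 1))))))

/-- The regions from `r` on have not been used. -/
def Fresh (r : ℕ) (s : St) : Prop := ∀ t, t = 4 ∨ t = 7 → ∀ r', r ≤ r' → ∀ x, s.mem t r' x 0 = 0

theorem Env.of_tags {N : ℕ} {nb : ℕ → List ℕ} {s s' : St} (h : Env N nb s)
    (hv : s'.var .n = s.var .n) (h1 : s'.mem 1 = s.mem 1) (h2 : s'.mem 2 = s.mem 2) :
    Env N nb s' :=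
  ⟨hv.trans h.n, fun x hx => by rw [h1, h.deg x hx], fun x hx j hj => by rw [h2, h.adj x hx j hj]⟩

/-- Memory says nothing about lists at indices outside the graph. Making them empty yields lists
that are bounded for all arguments, as the analysis of the nested loops wants. -/
theorem LevelKids.trunc {N : ℕ} {nb : ℕ → List ℕ} {p v k : ℕ} {c : ℕ → ℕ} {K : ℕ → List ℕ}
    (h : LevelKids N nb p v c k K) (hv : v < N) (hnb : GoodNb N nb) :
    LevelKids N nb p v c k (fun x => if x < N then K x else []) := by
  refine ⟨fun x hx => ?_, fun i hi x hx => ?_, fun i hi x hx y => ?_⟩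
  · simp only [h.nil x hx, ite_self]
  · split_ifs
    exacts [h.nodup i hi x hx, List.nodup_nil]
  · split_ifs with hxN
    · exact h.mem i hi x hx y
    · simp only [List.not_mem_nil, false_iff]
      rintro ⟨h1, h2, -⟩
      exact hxN (hnb.lt y (lvl_lt hv h1) x h2)

theorem loop_mods {k : ℕ} {y : Var} (h : (Cmd.loop .q (.var .lo) (.var .hi)
    (.seq (.set (.x k) (.ld 3 (.var .r) (.lit 0) (.var .q)))
      (chainCmd (emitCmd (2 * k)) (steps k)))).mods y) :
    y = .q ∨ y = .x k ∨ y = .cd ∨ (∃ b, y = .j b) ∨ ∃ b ∈ dsts (steps k), y = .x b := by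
  simp only [Cmd.mods] at h
  rcases h with h | h | h
  · exact Or.inl h
  · exact Or.inr (Or.inl h)
  · exact Or.inr (Or.inr (chain_mods h))

theorem loop_tags {k t : ℕ} (h : (Cmd.loop .q (.var .lo) (.var .hi)
    (.seq (.set (.x k) (.ld 3 (.var .r) (.lit 0) (.var .q)))
      (chainCmd (emitCmd (2 * k)) (steps k)))).tags t) : t = 9 := by
  simp only [Cmd.tags, false_or] at h
  exact chain_tags h

theorem wp_list {N B k r v : ℕ} (hk : 2 ≤ k) (hN : 0 < N) (hB : 16 * N ^ (2 * k) < B)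
    (hBr : 16 * (r + 1) * N * N ≤ B) {K : ℕ → ℕ → List ℕ} (hKlt : ∀ tb x, ∀ y ∈ K tb x, y < N)
    (hKlen : ∀ tb x, (K tb x).length ≤ N) {A : Set (List ℕ)} {s : St} {Qa F : List ℕ}
    (hn : s.var .n = N) (hr : s.var .r = r) (hlo : s.var .lo = Qa.length)
    (hhi : s.var .hi = (Qa ++ F).length) (hx0 : s.var (.x 0) = v) (hv : v < N)
    (hQ : ∀ j (h : j < (Qa ++ F).length), s.mem 3 r 0 j = (Qa ++ F)[j])
    (hQlt : ∀ x ∈ Qa ++ F, x < N) (hQl : (Qa ++ F).length ≤ N) (hK : HasKids N r K s)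
    (hA : OutIs N (2 * k) A s) :
    wp N B (.loop .q (.var .lo) (.var .hi)
      (.seq (.set (.x k) (.ld 3 (.var .r) (.lit 0) (.var .q)))
        (chainCmd (emitCmd (2 * k)) (steps k)))) (fun s' =>
      OutIs N (2 * k) (A ∪ emitted (2 * k) (F.flatMap fun u => sols K (steps k) (start k v u))) s' ∧
      s'.time ≤ s.time + 1 + (F.map fun u =>
        2 + chainCost K (2 * (2 * k) + 4) (steps k) (start k v u)).sum) s := by
  have hNB : N < B := by nlinarith [Nat.zero_le r, Nat.mul_le_mul_left (16 * (r + 1)) hN]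
  have hacc : ∀ {t x i : ℕ}, t < 16 → x < N → i < N → addr N t r x i < B := fun ht hx hi =>
    lt_of_lt_of_le (addr_lt ht hx hi) hBr
  refine wp_loop (fun j s' =>
    OutIs N (2 * k) (A ∪ emitted (2 * k) ((F.take (j - Qa.length)).flatMap fun u =>
      sols K (steps k) (start k v u))) s' ∧
    s'.time ≤ s.time + 1 + ((F.take (j - Qa.length)).map fun u =>
        2 + chainCost K (2 * (2 * k) + 4) (steps k) (start k v u)).sum) trivial trivial ?_ (by simp)
    ?_ ?_ ?_ ?_
  · simp only [Ex.eval, hhi]; omega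
  · simp only [Ex.eval, hhi, hlo, List.length_append]; omega
  · simp only [Ex.eval, hlo, Nat.sub_self, List.take_zero, List.flatMap_nil, List.map_nil,
      List.sum_nil]
    refine ⟨?_, by simp⟩
    have : emitted (2 * k) [] = ∅ := by
      ext t; simp [emitted]
    rw [this, Set.union_empty]
    exact hA.of_eq rfl rfl
  · intro j hj1 hj2 s' ⟨hA', ht'⟩ hf
    simp only [Ex.eval, hlo, hhi] at hj1 hj2
    obtain ⟨d, rfl⟩ : ∃ d, j = Qa.length + d := ⟨j - Qa.length, by omega⟩
    have hd : d < F.length := by simp at hj2; omega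
    simp only [Nat.add_sub_cancel_left, show Qa.length + d + 1 - Qa.length = d + 1 by omega]
      at hA' ht' ⊢
    have hvar : ∀ y, y ≠ .q → y ≠ .x k → y ≠ .cd → (∀ b, y ≠ .j b) →
        (∀ b ∈ dsts (steps k), y ≠ .x b) → s'.var y = s.var y := by
      intro y h1 h2 h3 h4 h5
      refine hf.var y fun h => ?_
      rcases loop_mods h with h | h | h | ⟨b, h⟩ | ⟨b, hb, h⟩
      exacts [h1 h, h2 h, h3 h, h4 b h, h5 b hb h]
    have hm : ∀ t, t ≠ 9 → s'.mem t = s.mem t := fun t h => hf.mem t fun h' => h (loop_tags h')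
    have hn' : s'.var .n = N := (hvar _ (by simp) (by simp) (by simp) (by simp) (by simp)).trans hn
    have hr' : s'.var .r = r := (hvar _ (by simp) (by simp) (by simp) (by simp) (by simp)).trans hr
    have hget : (Qa ++ F)[Qa.length + d] = F[d] := by simp
    have hld : s'.mem 3 r 0 (Qa.length + d) = F[d] := by
      rw [hm 3 (by omega), hQ _ hj2, hget]
    have hu : F[d] < N := hQlt _ (by simp)
    have hx0' : s'.var (.x 0) = v := by
      refine (hvar _ (by simp) ?_ (by simp) (by simp) ?_).trans hx0
      · simp only [ne_eq, Var.x.injEq]; omega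
      · intro b hb h
        simp only [Var.x.injEq] at h
        have := mem_dsts_steps.1 hb
        omega
    have hqN : Qa.length + d < N := by omega
    refine wp_seq (fun s2 => s2 = ((s'.set .q (Qa.length + d)).tick.set (.x k) F[d]).tick) ?_ ?_
    · simp only [wp, Ex.fits, Ex.eval, Access, St.tick_var, St.set_var, reduceCtorEq, if_false,
        if_true, hn', hr', St.tick_mem, St.set_mem, hld]
      exact ⟨⟨trivial, by omega, trivial, trivial, by omega, hN, hqN, hacc (by omega) hN hqN⟩,
        by omega, by simp, trivial⟩
    rintro s2 rfl -
    refine wp_mono _ (wp_chain (N := N) (B := B) (k := 2 * k) (r := r) (by omega) hN hB hBr hKlt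
      hKlen (steps k) (A := A ∪ emitted (2 * k) ((F.take d).flatMap fun u =>
        sols K (steps k) (start k v u))) (σ := start k v F[d]) chainOk_steps (by simp [hn'])
      (by simp [hr']) ?_ ?_ ?_ (hA'.of_eq rfl rfl)) ?_
    · intro tb' htb' x hx
      simp only [St.tick_mem, St.set_mem]
      rw [hm _ (by omega), hm _ (by omega)]
      exact hK tb' htb' x hx
    · intro i hi
      simp only [start, Function.update_apply]
      split_ifs
      exacts [hu, hv, hN]
    · intro i hi hid
      rw [mem_dsts_steps] at hid
      by_cases hik : i = k
      · subst hik; simp [start]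
      · have : i = 0 := by omega
        subst this
        simp only [start, Function.update_apply, St.tick_var, St.set_var, Var.x.injEq, hik,
          if_false, if_true, reduceCtorEq, hx0']
    · rintro s3 ⟨h1, h2⟩
      rw [List.take_succ_eq_append_getElem hd, List.flatMap_append, List.flatMap_singleton,
        emitted_append, ← Set.union_assoc, List.map_append, List.sum_append, List.map_singleton,
        List.sum_singleton]
      refine ⟨h1, ?_⟩
      simp only [St.tick_time, St.set_time] at h2
      omega
  · intro s' ⟨h1, h2⟩ _
    simp only [Ex.eval, hhi, List.length_append, Nat.add_sub_cancel_left, List.take_length] at h1 h2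
    exact ⟨h1, h2⟩

theorem length_steps {k : ℕ} : (steps k).length = (k - 1) + (k - 1) := by
  simp [steps, length_down]

/-- The cost is measured by all closed walks at `v`, including those not written because of their
orientation or because they are already marked. -/
theorem wp_run {N B : ℕ} {nb : ℕ → List ℕ} (hnb : GoodNb N nb)
    (hsymm : ∀ x < N, ∀ y < N, y ∈ nb x ↔ x ∈ nb y) {k r v p : ℕ} {col : ℕ → ℕ} (hk : 2 ≤ k)
    (hN : 0 < N) (hB : 16 * N ^ (2 * k) < B) (hBr : 16 * (r + 1) * N * N ≤ B) {s : St}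
    (he : Env N nb s) (hr : s.var .r = r) (hv : s.var .v = v) (hp : s.var .p = p) (hvN : v < N)
    (hcol0 : v % p = col 0) (hc : ∀ i < 2 * k, s.var (.c i) = col i)
    (hinj : ∀ i < 2 * k, ∀ j < 2 * k, col i = col j → i = j) {A : Set (List ℕ)}
    (hA : OutIs N (2 * k) A s) (hfr : Fresh r s) :
    wp N B (runCmd k) (fun s' =>
      OutIs N (2 * k) (A ∪ {t | ∃ σ, t = tup (2 * k) σ ∧ LCyc N nb p k col σ ∧ σ 0 = v ∧
        σ 1 < σ (2 * k - 1)}) s' ∧ Fresh (r + 1) s' ∧ s'.var .r = r + 1 ∧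
      ∃ l : List (List ℕ), l.Nodup ∧
        (∀ t, t ∈ l ↔ ∃ σ, t = tup (2 * k) σ ∧ LCyc N nb p k col σ ∧ σ 0 = v) ∧
        s'.time ≤ s.time + 3 + exploreCost N nb p v (col ∘ back k) k +
          4 * exploreCost N nb p v col k + 10 * k * l.length) s := by
  have hNB : N < B := by nlinarith [Nat.zero_le r, Nat.mul_le_mul_left (16 * (r + 1)) hN]
  have hrB : r + 1 < B := by
    have : 1 ≤ N * N := Nat.mul_pos hN hN
    have := Nat.mul_le_mul_left (16 * (r + 1)) this
    rw [← mul_assoc] at this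
    omega
  have hbinj : ∀ i ≤ k, ∀ j ≤ k, (col ∘ back k) i = (col ∘ back k) j → i = j := by
    intro i hi j hj h
    have := hinj (back k i) (by simp only [back]; split_ifs <;> omega) (back k j)
      (by simp only [back]; split_ifs <;> omega) h
    simp only [back] at this
    split_ifs at this <;> omega
  unfold runCmd
  refine wp_seq (fun s' => s' = (s.set (.x 0) v).tick) ?_ ?_
  · simp only [wp, Ex.fits, Ex.eval, hv]
    exact ⟨trivial, by omega, by simp, trivial⟩
  rintro s1 rfl -
  set s1 := (s.set (.x 0) v).tick with hs1
  have hv1 : ∀ y, y ≠ .x 0 → s1.var y = s.var y := fun y hy => by simp [hs1, hy]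
  have hx1 : s1.var (.x 0) = v := by simp [hs1]
  have hm1 : s1.mem = s.mem := rfl
  have ht1 : s1.time = s.time + 1 := rfl
  have ho1 : s1.out = s.out := rfl
  clear_value s1
  have he1 : Env N nb s1 := he.of_tags (hv1 _ (by simp)) (by rw [hm1]) (by rw [hm1])
  refine wp_seq _ (wp_explore hnb (tb := 6) (r := r) (v := v) (p := p) (c := col ∘ back k)
    (Or.inr rfl) (fun i => ⟨_, rfl⟩) hN hBr he1 (by rw [hv1 _ (by simp), hr])
    (by rw [hv1 _ (by simp), hv]) (by rw [hv1 _ (by simp), hp]) hvN hcol0 (fun x => by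
      rw [hm1]; exact hfr 7 (Or.inr rfl) r le_rfl x) k (fun i h1 h2 => by
      rw [hv1 _ (by simp), hc _ (by omega)]
      simp only [Function.comp, back]
      rw [if_neg (by omega)]) hbinj) ?_
  rintro s2 ⟨Qb, Fb, Kb, hEb⟩ hf2
  have hv2 : ∀ y, y ≠ .lo ∧ y ≠ .hi ∧ y ≠ .tl ∧ y ≠ .q ∧ y ≠ .y ∧ y ≠ .jj ∧ y ≠ .z →
      s2.var y = s1.var y := by
    intro x hx
    refine hf2.var x fun h => ?_
    have := explore_mods h
    tauto
  have hm2 : ∀ t, t ≠ 6 → t ≠ 7 → t ≠ 8 → s2.mem t = s1.mem t := by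
    intro t h1 h2 h3
    refine hf2.mem t fun h => ?_
    have := explore_tags h
    omega
  have he2 : Env N nb s2 := he1.of_tags (hv2 _ (by simp)) (hm2 1 (by omega) (by omega) (by omega))
    (hm2 2 (by omega) (by omega) (by omega))
  refine wp_seq _ (wp_explore hnb (tb := 3) (r := r) (v := v) (p := p) (c := col)
    (Or.inl rfl) (fun i => ⟨_, rfl⟩) hN hBr he2 (by rw [hv2 _ (by simp), hv1 _ (by simp), hr])
    (by rw [hv2 _ (by simp), hv1 _ (by simp), hv]) (by rw [hv2 _ (by simp), hv1 _ (by simp), hp])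
    hvN hcol0 (fun x => by
      rw [hm2 _ (by omega) (by omega) (by omega), hm1]; exact hfr 4 (Or.inl rfl) r le_rfl x) k
      (fun i h1 h2 => by
      rw [hv2 _ (by simp), hv1 _ (by simp), hc _ (by omega)])
      fun i hi j hj h => hinj i (by omega) j (by omega) h) ?_
  rintro s3 ⟨Qa, F, Kf, hEf⟩ hf3
  have hv3 : ∀ y, y ≠ .lo ∧ y ≠ .hi ∧ y ≠ .tl ∧ y ≠ .q ∧ y ≠ .y ∧ y ≠ .jj ∧ y ≠ .z →
      s3.var y = s2.var y := by
    intro x hx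
    refine hf3.var x fun h => ?_
    have := explore_mods h
    tauto
  have hm3 : ∀ t, t ≠ 3 → t ≠ 4 → t ≠ 5 → s3.mem t = s2.mem t := by
    intro t h1 h2 h3
    refine hf3.mem t fun h => ?_
    have := explore_tags h
    omega
  have hr3 : s3.var .r = r := by rw [hv3 _ (by simp), hv2 _ (by simp), hv1 _ (by simp), hr]
  have hQN : (Qa ++ F).length ≤ N := length_le_of_nodup hEf.nodup hEf.lt
  set K : ℕ → ℕ → List ℕ := fun tb x =>
    if x < N then (if tb = 3 then Kf x else if tb = 6 then Kb x else []) else [] with hK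
  have hKf : LevelKids N nb p v col k (K 3) := by
    simpa [hK] using hEf.kids.trunc hvN hnb
  have hKb : LevelKids N nb p v (col ∘ back k) k (K 6) := by
    simpa [hK] using hEb.kids.trunc hvN hnb
  have hKother : ∀ tb, tb ≠ 3 → tb ≠ 6 → ∀ x, K tb x = [] := by
    intro tb h1 h2 x
    simp [hK, h1, h2]
  have hKnd : ∀ tb x, (K tb x).Nodup := by
    intro tb x
    by_cases h3 : tb = 3
    · subst h3; exact hKf.nodup' x
    by_cases h6 : tb = 6
    · subst h6; exact hKb.nodup' x
    rw [hKother tb h3 h6]; exact List.nodup_nil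
  have hKlt : ∀ tb x, ∀ y ∈ K tb x, y < N := by
    intro tb x y hy
    by_cases h3 : tb = 3
    · subst h3
      obtain ⟨i, _, h, _⟩ := (hKf.mem' hvN hnb).1 hy
      exact lvl_lt hvN h
    by_cases h6 : tb = 6
    · subst h6
      obtain ⟨i, _, h, _⟩ := (hKb.mem' hvN hnb).1 hy
      exact lvl_lt hvN h
    rw [hKother tb h3 h6] at hy
    simp at hy
  have hhas : HasKids N r K s3 := by
    rintro tb (rfl | rfl) x hx
    · have e : K 3 x = Kf x := by simp [hK, hx]
      rw [e]
      exact ⟨hEf.expl.cnt x hx, hEf.expl.kid x hx⟩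
    · have e : K 6 x = Kb x := by simp [hK, hx]
      rw [e, hm3 7 (by omega) (by omega) (by omega), hm3 8 (by omega) (by omega) (by omega)]
      exact ⟨hEb.expl.cnt x hx, hEb.expl.kid x hx⟩
  have hA3 : OutIs N (2 * k) A s3 := by
    refine hA.of_eq ?_ ?_
    · rw [hf3.out explore_outs, hf2.out explore_outs, ho1]
    · rw [hm3 9 (by omega) (by omega) (by omega), hm2 9 (by omega) (by omega) (by omega), hm1]
  refine wp_seq _ (wp_list (N := N) (B := B) (v := v) hk hN hB hBr hKlt
    (fun tb x => length_le_of_nodup (hKnd tb x) (hKlt tb x))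
    (by rw [hv3 _ (by simp)]; exact he2.n) hr3
    hEf.lo hEf.hi (by rw [hv3 _ (by simp), hv2 _ (by simp), hx1]) hvN hEf.expl.queue hEf.lt hQN hhas
    hA3) ?_
  rintro s4 ⟨hA4, ht4⟩ hf4
  have hr4 : s4.var .r = r := by
    rw [hf4.var .r fun h => ?_, hr3]
    have := loop_mods h
    simp at this
  simp only [wp, Ex.fits, Ex.eval, hr4]
  obtain ⟨hnd, hmem⟩ := exists_found hnb hsymm hk hvN hcol0 hinj hKf hKb hKnd
    (List.nodup_append.1 hEf.nodup).2.1 hEf.mem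
  refine ⟨⟨trivial, by omega, hrB⟩, hrB, by simp, ?_, ?_, by simp, _, hnd, hmem, ?_⟩
  · have : {t | ∃ σ, t = tup (2 * k) σ ∧ LCyc N nb p k col σ ∧ σ 0 = v ∧ σ 1 < σ (2 * k - 1)} =
        emitted (2 * k) (F.flatMap fun u => sols K (steps k) (start k v u)) := by
      ext t
      simp only [emitted, Set.mem_ofPred_eq, List.mem_flatMap]
      have hm := hmem t
      simp only [List.mem_flatMap, List.mem_map] at hm
      constructor
      · rintro ⟨σ, rfl, h1, h2, h3⟩
        obtain ⟨u, hu, σ', h4, h5⟩ := hm.2 ⟨σ, rfl, h1, h2⟩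
        have h6 := tup_inj.1 h5
        exact ⟨σ', ⟨u, hu, h4⟩, h5.symm, by rwa [h6 1 (by omega), h6 (2 * k - 1) (by omega)]⟩
      · rintro ⟨σ, ⟨u, hu, h4⟩, rfl, h5⟩
        obtain ⟨σ', h1, h2, h3⟩ := hm.1 ⟨u, hu, σ, h4, rfl⟩
        have h6 := tup_inj.1 h1
        exact ⟨σ', h1, h2, h3, by rwa [← h6 1 (by omega), ← h6 (2 * k - 1) (by omega)]⟩
    rw [this]
    exact hA4.of_eq rfl rfl
  · intro t ht r' hr' x
    simp only [St.tick_mem, St.set_mem]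
    have h9 : s4.mem t = s3.mem t := hf4.mem t fun h => by have := loop_tags h; omega
    rw [h9]
    rcases ht with rfl | rfl
    · rw [hEf.expl.other 4 r' (by omega), hm2 4 (by omega) (by omega) (by omega), hm1]
      exact hfr 4 (Or.inl rfl) r' (by omega) x
    · rw [hm3 7 (by omega) (by omega) (by omega), hEb.expl.other 7 r' (by omega), hm1]
      exact hfr 7 (Or.inr rfl) r' (by omega) x
  -- Each `u` costs 2 commands for itself and 1 for the outermost loop, and each solution `4k + 4`
  -- for the output and 3 for each of the `2k - 2` loops. The `3 * F.length` is absorbed by three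
  -- extra forward exploration costs.
  · have hsum : (F.map fun u =>
        2 + chainCost K (2 * (2 * k) + 4) (steps k) (start k v u)).sum ≤ 3 * F.length +
        10 * k * (F.flatMap fun u => (sols K (steps k) (start k v u)).map (tup (2 * k))).length := by
      rw [List.length_flatMap, ← List.sum_map_mul_left,
        show 3 * F.length = (F.map fun _ => 3).sum by simp [mul_comm], ← List.sum_map_add]
      refine List.sum_le_sum fun u hu => ?_
      have h1 := chainCost_le (C := 2 * (2 * k) + 4)
        (productive_steps hnb hk hvN hcol0 hinj hKf hKb ((hEf.mem u).1 hu))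
      rw [List.length_map]
      have h2 : 2 * (2 * k) + 4 + 3 * (steps k).length ≤ 10 * k := by rw [length_steps]; omega
      have h3 := Nat.mul_le_mul_right (sols K (steps k) (start k v u)).length h2
      omega
    have hF : F.length ≤ exploreCost N nb p v col k := by
      refine le_trans ?_ (card_lvl_le_exploreCost (by omega))
      rw [← List.toFinset_card_of_nodup (List.nodup_append.1 hEf.nodup).2.1]
      refine Finset.card_le_card fun x hx => ?_
      exact (hEf.mem x).1 (by simpa using hx)
    have h2 := hEb.time
    have h3 := hEf.time
    simp only [St.tick_time, St.set_time]
    omega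

end WordRAM

/-! ### Colours as digits, and the loop over the top vertices -/

namespace WordRAM

/-- The digits of a number in base `p`. -/
def dig (p code i : ℕ) : ℕ := code / p ^ i % p

def powCmd : ℕ → Cmd
  | 0 => .set .pw (.lit 1)
  | i + 1 => .seq (powCmd i) (.set .pw (.mul (.var .pw) (.var .p)))

def digitsCmd : ℕ → Cmd
  | 0 => .set .z (.var .code)
  | i + 1 => .seq (digitsCmd i) (.seq (.set (.c i) (.mod (.var .z) (.var .p)))
      (.set .z (.div (.var .z) (.var .p))))

/-- Set `f` to `0` if and only if the colours are different for all pairs in the list. -/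
def distinctCmd : List (ℕ × ℕ) → Cmd
  | [] => .set .f (.lit 0)
  | (a, b) :: l => .seq (distinctCmd l) (.whenEq (.var (.c a)) (.var (.c b)) (.set .f (.lit 1)))

/-- All pairs `(i, j)` with `i < j < k`. -/
def pairsBelow (k : ℕ) : List (ℕ × ℕ) :=
  (List.range k).flatMap fun j => (List.range j).map fun i => (i, j)

theorem mem_pairsBelow {k : ℕ} {e : ℕ × ℕ} : e ∈ pairsBelow k ↔ e.1 < e.2 ∧ e.2 < k := by
  obtain ⟨a, b⟩ := e
  simp only [pairsBelow, List.mem_flatMap, List.mem_range, List.mem_map, Prod.mk.injEq]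
  constructor
  · rintro ⟨j, hj, i, hi, rfl, rfl⟩; exact ⟨hi, hj⟩
  · rintro ⟨h1, h2⟩; exact ⟨b, h2, a, h1, rfl, rfl⟩

theorem length_pairsBelow (k : ℕ) : (pairsBelow k).length ≤ k * k := by
  rw [pairsBelow, List.length_flatMap]
  refine (List.sum_le_card_nsmul _ k ?_).trans (by simp)
  simp only [List.length_map, List.length_range, List.mem_map, List.mem_range]
  rintro x ⟨j, hj, rfl⟩; omega

theorem wp_pow {N B p : ℕ} {s : St} (hp : s.var .p = p) (hp1 : 1 ≤ p) (k : ℕ) (hB : p ^ k < B) :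
    wp N B (powCmd k) (fun s' => s'.var .pw = p ^ k ∧ (∀ y, y ≠ .pw → s'.var y = s.var y) ∧
      s'.mem = s.mem ∧ s'.out = s.out ∧ s'.time = s.time + k + 1) s := by
  induction k with
  | zero =>
    have h1B : 1 < B := by simpa using hB
    simp only [powCmd, wp, Ex.fits, Ex.eval]
    refine ⟨h1B, h1B, by simp, by simp, fun y hy => by simp [hy], rfl, rfl, rfl⟩
  | succ k ih =>
    refine wp_seq _ (ih (lt_of_le_of_lt (Nat.pow_le_pow_right hp1 (by omega)) hB)) ?_
    rintro s1 ⟨h1, h2, h3, h4, h5⟩ -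
    have e : s1.var .p = p := (h2 _ (by simp)).trans hp
    have hB' : p ^ k * p < B := by rwa [← pow_succ]
    simp only [wp, Ex.fits, Ex.eval, h1, e]
    refine ⟨⟨trivial, trivial, hB'⟩, hB', by simp, by simp [pow_succ], fun y hy => ?_, h3, h4, ?_⟩
    · simp [hy, h2 y hy]
    · simp only [St.tick_time, St.set_time, h5]; omega

theorem wp_digits {N B p code : ℕ} {s : St} (hp : s.var .p = p) (hc : s.var .code = code)
    (hB : code < B) (k : ℕ) :
    wp N B (digitsCmd k) (fun s' => s'.var .z = code / p ^ k ∧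
      (∀ i < k, s'.var (.c i) = dig p code i) ∧
      (∀ y, y ≠ .z → (∀ i, y ≠ .c i) → s'.var y = s.var y) ∧
      s'.mem = s.mem ∧ s'.out = s.out ∧ s'.time = s.time + 2 * k + 1) s := by
  induction k with
  | zero =>
    simp only [digitsCmd, wp, Ex.fits, Ex.eval, hc]
    refine ⟨trivial, hB, by simp, by simp, by simp, fun y hy _ => by simp [hy], rfl, rfl, rfl⟩
  | succ k ih =>
    refine wp_seq _ ih ?_
    rintro s1 ⟨h1, h2, h3, h4, h5, h6⟩ -
    have e : s1.var .p = p := (h3 _ (by simp) (by simp)).trans hp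
    have b1 : code / p ^ k < B := lt_of_le_of_lt (Nat.div_le_self _ _) hB
    have b2 : code / p ^ k % p < B := lt_of_le_of_lt (Nat.mod_le _ _) b1
    have b3 : code / p ^ k / p < B := lt_of_le_of_lt (Nat.div_le_self _ _) b1
    simp only [wp, Ex.fits, Ex.eval, h1, e, St.tick_var, St.set_var, reduceCtorEq, if_false]
    refine ⟨⟨trivial, trivial, b2⟩, b2, by simp, ⟨trivial, trivial, b3⟩, b3, by simp, ?_, ?_, ?_, h4,
      h5, ?_⟩
    · simp [Nat.div_div_eq_div_mul, pow_succ]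
    · intro i hi
      by_cases hik : i = k
      · subst hik; simp [dig]
      · simp [hik, h2 i (by omega)]
    · intro y hy hy'
      simp [hy, hy', h3 y hy hy']
    · simp only [St.tick_time, St.set_time, h6]; omega

theorem wp_distinct {N B : ℕ} {s : St} (hB : 1 < B) (l : List (ℕ × ℕ)) :
    wp N B (distinctCmd l) (fun s' =>
      (s'.var .f = 0 ↔ ∀ e ∈ l, s.var (.c e.1) ≠ s.var (.c e.2)) ∧
      (∀ y, y ≠ .f → s'.var y = s.var y) ∧
      s'.mem = s.mem ∧ s'.out = s.out ∧ s'.time ≤ s.time + 2 * l.length + 1) s := by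
  induction l with
  | nil =>
    simp only [distinctCmd, wp, Ex.fits, Ex.eval]
    refine ⟨by omega, by omega, by simp, by simp, fun y hy => by simp [hy], rfl, rfl, by simp⟩
  | cons e l ih =>
    obtain ⟨a, b⟩ := e
    refine wp_seq _ ih ?_
    rintro s1 ⟨h1, h2, h3, h4, h5⟩ -
    simp only [wp, Ex.fits, Ex.eval, h2 (.c _) (by simp), List.forall_mem_cons, List.length_cons,
      ne_eq, reduceCtorEq, not_false_eq_true]
    refine ⟨trivial, trivial, fun h => ⟨hB, hB, trivial, ?_, ?_, h3, h4, ?_⟩,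
      fun h => ⟨?_, ?_, h3, h4, ?_⟩⟩
    · simp [h]
    · intro y hy; simp [hy, h2 y hy]
    · simp only [St.tick_time, St.set_time]; omega
    · simp only [h, not_false_eq_true, true_and, St.tick_var]; exact h1
    · intro y hy; simp [h2 y hy]
    · simp only [St.tick_time]; omega

/-- The cycles that are found for a modulus and colours. -/
def Found (N : ℕ) (nb : ℕ → List ℕ) (k p : ℕ) (col : ℕ → ℕ) : Set (List ℕ) :=
  {t | ∃ σ, t = tup (2 * k) σ ∧ LCyc N nb p k col σ ∧ σ 1 < σ (2 * k - 1)}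

/-- The closed walks that are found at the vertex `v`. -/
def FoundAt (N : ℕ) (nb : ℕ → List ℕ) (k p : ℕ) (col : ℕ → ℕ) (v : ℕ) : Set (List ℕ) :=
  {t | ∃ σ, t = tup (2 * k) σ ∧ LCyc N nb p k col σ ∧ σ 0 = v}

/-- The cost of treating the vertex `v`. -/
noncomputable def vertexCost (N : ℕ) (nb : ℕ → List ℕ) (k p : ℕ) (col : ℕ → ℕ) (v : ℕ) : ℕ :=
  exploreCost N nb p v (col ∘ back k) k + 4 * exploreCost N nb p v col k +
    10 * k * (FoundAt N nb k p col v).ncard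

/-- Invariant of the outer loops: the output is `A`, at most `R` regions are used, and the time is
at most `T`. -/
structure Inv (N : ℕ) (nb : ℕ → List ℕ) (k : ℕ) (A : Set (List ℕ)) (R T : ℕ) (s : St) : Prop where
  env : Env N nb s
  out : OutIs N (2 * k) A s
  reg : ∃ r ≤ R, s.var .r = r ∧ Fresh r s
  time : s.time ≤ T

theorem Inv.of_eq {N : ℕ} {nb : ℕ → List ℕ} {k : ℕ} {A : Set (List ℕ)} {R T R' T' : ℕ} {s s' : St}
    (h : Inv N nb k A R T s) (hm : s'.mem = s.mem) (ho : s'.out = s.out)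
    (hn : s'.var .n = s.var .n) (hr : s'.var .r = s.var .r) (hR : R ≤ R') (hT : s'.time ≤ T') :
    Inv N nb k A R' T' s' := by
  obtain ⟨r, h1, h2, h3⟩ := h.reg
  refine ⟨h.env.of_eq hn hm, h.out.of_eq ho (by rw [hm]), ⟨r, h1.trans hR, hr.trans h2, ?_⟩, hT⟩
  intro t ht r' hr' x
  rw [hm]; exact h3 t ht r' hr' x

theorem Inv.congr {N : ℕ} {nb : ℕ → List ℕ} {k : ℕ} {A A' : Set (List ℕ)} {R T R' T' : ℕ} {s : St}
    (h : Inv N nb k A R T s) (hA : A = A') (hR : R ≤ R') (hT : T ≤ T') :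
    Inv N nb k A' R' T' s := by
  subst hA
  exact h.of_eq rfl rfl rfl rfl hR (h.time.trans hT)

theorem run_mods {k : ℕ} {y : Var} (h : (runCmd k).mods y) :
    y ≠ .n ∧ y ≠ .p ∧ y ≠ .pw ∧ y ≠ .code ∧ y ≠ .v ∧ (∀ i, y ≠ .c i) ∧ y ≠ .L ∧ y ≠ .f := by
  simp only [runCmd, Cmd.mods] at h
  rcases h with rfl | h | h | h | rfl
  · simp
  · rcases explore_mods h with rfl | rfl | rfl | rfl | rfl | rfl | rfl <;> simp
  · rcases explore_mods h with rfl | rfl | rfl | rfl | rfl | rfl | rfl <;> simp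
  · rcases loop_mods h with rfl | rfl | rfl | ⟨b, rfl⟩ | ⟨b, _, rfl⟩ <;> simp
  · simp

theorem run_tags {k t : ℕ} (h : (runCmd k).tags t) : t ≠ 1 ∧ t ≠ 2 := by
  simp only [runCmd, Cmd.tags, false_or, or_false] at h
  rcases h with h | h | h
  · have := explore_tags h; omega
  · have := explore_tags h; omega
  · have := chain_tags h; omega

def vertexLoop (k : ℕ) : Cmd :=
  .loop .v (.lit 0) (.var .n) (.whenEq (.mod (.var .v) (.var .p)) (.var (.c 0)) (runCmd k))

/-- Every closed walk is found at its own first vertex `σ 0`, so the union over `v` is all of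
`Found`. One region per vertex suffices. The `5 * N` counts the loop round, the test of the colour
and the three remaining commands of a run. -/
theorem wp_vertexLoop {N B : ℕ} {nb : ℕ → List ℕ} (hnb : GoodNb N nb)
    (hsymm : ∀ x < N, ∀ y < N, y ∈ nb x ↔ x ∈ nb y) {k p R T : ℕ} {col : ℕ → ℕ} (hk : 2 ≤ k)
    (hN : 0 < N) (hB : 16 * N ^ (2 * k) < B) (hBr : 16 * (R + N) * N * N ≤ B) {s : St}
    {A : Set (List ℕ)} (hI : Inv N nb k A R T s) (hp : s.var .p = p)
    (hc : ∀ i < 2 * k, s.var (.c i) = col i)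
    (hinj : ∀ i < 2 * k, ∀ j < 2 * k, col i = col j → i = j) {D : ℕ}
    (hD : ∑ v ∈ (Finset.range N).filter (fun v => v % p = col 0), vertexCost N nb k p col v ≤ D) :
    wp N B (vertexLoop k)
      (Inv N nb k (A ∪ Found N nb k p col) (R + N) (T + 1 + 5 * N + D)) s := by
  have hNB : N < B := by nlinarith [Nat.mul_le_mul_left (16 * (R + N)) hN, Nat.zero_le R]
  have hn := hI.env.n
  refine wp_loop (fun j s' => Inv N nb k (A ∪ {t | ∃ v < j, v % p = col 0 ∧ ∃ σ, t = tup (2 * k) σ ∧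
      LCyc N nb p k col σ ∧ σ 0 = v ∧ σ 1 < σ (2 * k - 1)}) (R + j)
      (T + 1 + 5 * j + ∑ v ∈ (Finset.range j).filter (fun v => v % p = col 0),
        vertexCost N nb k p col v) s')
    (by simp only [Ex.fits]; omega) trivial ?_ (by simp) ?_ ?_ ?_ ?_
  · simp only [Ex.eval, hn]; exact hNB
  · simp only [Ex.eval, hn]; omega
  · simp only [Ex.eval]
    refine (hI.of_eq (s' := s.tick) rfl rfl rfl rfl le_rfl (T' := T + 1)
      (Nat.succ_le_succ hI.time)).congr ?_ le_rfl ?_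
    · simp
    · simp
  · intro j hj1 hj2 s' hI' hf
    simp only [Ex.eval, hn] at hj1 hj2
    have hvar : ∀ y, y ≠ .v → ¬ (runCmd k).mods y → s'.var y = s.var y := by
      intro y h1 h2
      refine hf.var y ?_
      simp only [Cmd.mods, not_or]; exact ⟨h1, h2⟩
    have hp' : s'.var .p = p := (hvar _ (by simp) fun h => (run_mods h).2.1 rfl).trans hp
    have hc' : ∀ i < 2 * k, s'.var (.c i) = col i := fun i hi =>
      (hvar _ (by simp) fun h => (run_mods h).2.2.2.2.2.1 i rfl).trans (hc i hi)
    simp only [wp, Ex.fits, Ex.eval, St.tick_var, St.set_var, reduceCtorEq, if_false, if_true, hp',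
      hc' 0 (by omega)]
    have hI1 : Inv N nb k (A ∪ {t | ∃ v < j, v % p = col 0 ∧ ∃ σ, t = tup (2 * k) σ ∧
        LCyc N nb p k col σ ∧ σ 0 = v ∧ σ 1 < σ (2 * k - 1)}) (R + j) (T + 1 + 5 * j +
        ∑ v ∈ (Finset.range j).filter (fun v => v % p = col 0), vertexCost N nb k p col v + 2)
        (s'.set .v j).tick.tick :=
      hI'.of_eq rfl rfl (by simp) (by simp) le_rfl (by
        simp only [St.tick_time, St.set_time]; have := hI'.time; omega)
    have hset : j % p = col 0 → {t | ∃ v < j + 1, v % p = col 0 ∧ ∃ σ, t = tup (2 * k) σ ∧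
        LCyc N nb p k col σ ∧ σ 0 = v ∧ σ 1 < σ (2 * k - 1)} = {t | ∃ v < j, v % p = col 0 ∧
        ∃ σ, t = tup (2 * k) σ ∧ LCyc N nb p k col σ ∧ σ 0 = v ∧ σ 1 < σ (2 * k - 1)} ∪
        {t | ∃ σ, t = tup (2 * k) σ ∧ LCyc N nb p k col σ ∧ σ 0 = j ∧ σ 1 < σ (2 * k - 1)} := by
      intro hj
      ext t
      simp only [Set.mem_ofPred_eq, Set.mem_union]
      constructor
      · rintro ⟨v, hv, hv', h⟩
        rcases Nat.lt_succ_iff_lt_or_eq.1 hv with h1 | rfl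
        · exact Or.inl ⟨v, h1, hv', h⟩
        · exact Or.inr h
      · rintro (⟨v, hv, h⟩ | h)
        · exact ⟨v, by omega, h⟩
        · exact ⟨j, by omega, hj, h⟩
    refine ⟨⟨trivial, trivial, lt_of_le_of_lt (Nat.mod_le _ _) (by omega)⟩, trivial, fun hj => ?_,
      fun hj => ?_⟩
    · obtain ⟨r, hr1, hr2, hr3⟩ := hI1.reg
      have hBr' : 16 * (r + 1) * N * N ≤ B := by
        refine le_trans (Nat.mul_le_mul_right _ (Nat.mul_le_mul_right _ (Nat.mul_le_mul_left _ ?_)))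
          hBr
        omega
      refine wp_mono _ (wp_frame _ (wp_run hnb hsymm hk hN hB hBr' hI1.env hr2 (v := j) (p := p)
        (col := col) (by simp) (by simp [hp']) hj2 hj (fun i hi => by simp [hc' i hi]) hinj hI1.out
        hr3)) ?_
      rintro s2 ⟨⟨h1, h2, h3, l, hl1, hl2, hl3⟩, hf2⟩
      refine ⟨?_, ?_, ⟨r + 1, by omega, h3, h2⟩, ?_⟩
      · exact hI1.env.of_tags (hf2.var _ fun h => (run_mods h).1 rfl)
          (hf2.mem _ fun h => (run_tags h).1 rfl) (hf2.mem _ fun h => (run_tags h).2 rfl)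
      · rw [hset hj, ← Set.union_assoc]; exact h1
      · have hlen : l.length = (FoundAt N nb k p col j).ncard := by
          rw [← List.toFinset_card_of_nodup hl1, ← Set.ncard_coe_finset]
          congr 1
          ext t
          simp only [List.coe_toFinset, Set.mem_ofPred_eq, hl2, FoundAt]
        rw [Finset.range_add_one, Finset.filter_insert, if_pos hj, Finset.sum_insert (by simp)]
        have := hI1.time
        rw [hlen] at hl3
        simp only [vertexCost]
        simp only [vertexCost] at this
        omega
    · refine hI1.congr ?_ (by omega) ?_
      · congr 1
        ext t
        simp only [Set.mem_ofPred_eq]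
        constructor
        · rintro ⟨v, hv, h⟩; exact ⟨v, by omega, h⟩
        · rintro ⟨v, hv, h1, h⟩
          refine ⟨v, ?_, h1, h⟩
          rcases Nat.lt_succ_iff_lt_or_eq.1 hv with h2 | rfl
          exacts [h2, (hj h1).elim]
      · rw [Finset.range_add_one, Finset.filter_insert, if_neg hj]; omega
  · intro s' hI' _
    simp only [Ex.eval, hn] at hI'
    refine hI'.congr ?_ le_rfl (by omega)
    congr 1
    ext t
    simp only [Set.mem_ofPred_eq, Found]
    constructor
    · rintro ⟨v, _, _, σ, h1, h2, _, h3⟩; exact ⟨σ, h1, h2, h3⟩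
    · rintro ⟨σ, h1, h2, h3⟩
      exact ⟨σ 0, h2.lt 0 (by omega), h2.col 0 (by omega), σ, h1, h2, rfl, h3⟩

end WordRAM

/-! ### The loops over colourings and moduli -/

namespace WordRAM

theorem digits_mods {k : ℕ} {y : Var} (h : (digitsCmd k).mods y) : y = .z ∨ ∃ i, y = .c i := by
  induction k with
  | zero => exact Or.inl h
  | succ k ih =>
    simp only [digitsCmd, Cmd.mods] at h
    rcases h with h | h | h
    exacts [ih h, Or.inr ⟨k, h⟩, Or.inl h]

theorem distinct_mods {l : List (ℕ × ℕ)} {y : Var} (h : (distinctCmd l).mods y) : y = .f := by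
  induction l with
  | nil => exact h
  | cons e l ih =>
    simp only [distinctCmd, Cmd.mods] at h
    exact h.elim ih id

/-- List the cycles with the colours given by the number `code`. -/
def colourCmd (k : ℕ) : Cmd :=
  .seq (digitsCmd (2 * k)) (.seq (distinctCmd (pairsBelow (2 * k)))
    (.whenEq (.var .f) (.lit 0) (vertexLoop k)))

theorem colour_mods {k : ℕ} {y : Var} (h : (colourCmd k).mods y) :
    y ≠ .n ∧ y ≠ .p ∧ y ≠ .pw ∧ y ≠ .code ∧ y ≠ .L := by
  simp only [colourCmd, vertexLoop, Cmd.mods] at h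
  rcases h with h | h | rfl | h
  · rcases digits_mods h with rfl | ⟨i, rfl⟩ <;> simp
  · rcases distinct_mods h with rfl; simp
  · simp
  · have := run_mods h; tauto

/-- The cycles that are found for the colours given by the number `code`. -/
def FoundCode (N : ℕ) (nb : ℕ → List ℕ) (k p code : ℕ) : Set (List ℕ) :=
  {t | (∀ i < 2 * k, ∀ j < 2 * k, dig p code i = dig p code j → i = j) ∧
    t ∈ Found N nb k p (dig p code)}

/-- The sum of the vertex costs is at most `D` for all colours. -/
def CostLe (N : ℕ) (nb : ℕ → List ℕ) (k D : ℕ) : Prop :=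
  ∀ p col, 1 ≤ p → (∀ i < 2 * k, ∀ j < 2 * k, col i = col j → i = j) →
    ∑ v ∈ (Finset.range N).filter (fun v => v % p = col 0), vertexCost N nb k p col v ≤ D

theorem wp_colour {N B : ℕ} {nb : ℕ → List ℕ} (hnb : GoodNb N nb)
    (hsymm : ∀ x < N, ∀ y < N, y ∈ nb x ↔ x ∈ nb y) {k p code R T : ℕ} (hk : 2 ≤ k)
    (hN : 0 < N) (hB : 16 * N ^ (2 * k) < B) (hBr : 16 * (R + N) * N * N ≤ B) {s : St}
    {A : Set (List ℕ)} (hI : Inv N nb k A R T s) (hp : s.var .p = p) (hp1 : 1 ≤ p)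
    (hcode : s.var .code = code) (hcB : code < B) {D : ℕ} (hD : CostLe N nb k D) :
    wp N B (colourCmd k)
      (Inv N nb k (A ∪ FoundCode N nb k p code) (R + N)
        (T + (8 * k * k + 4 * k + 4 + 5 * N + D))) s := by
  have h1B : 1 < B := by
    have : 0 < N ^ (2 * k) := by positivity
    omega
  refine wp_seq _ (wp_digits hp hcode hcB (2 * k)) ?_
  rintro s1 ⟨-, h2, h3, h4, h5, h6⟩ -
  refine wp_seq _ (wp_distinct h1B (pairsBelow (2 * k))) ?_
  rintro s2 ⟨g1, g2, g3, g4, g5⟩ -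
  have hlen := length_pairsBelow (2 * k)
  have hinj : s2.var .f = 0 ↔
      ∀ i < 2 * k, ∀ j < 2 * k, dig p code i = dig p code j → i = j := by
    rw [g1]
    constructor
    · intro h i hi j hj e
      by_contra hne
      rcases Nat.lt_or_gt_of_ne hne with hlt | hlt
      · refine h (i, j) (mem_pairsBelow.2 ⟨hlt, hj⟩) ?_
        rw [h2 i hi, h2 j hj, e]
      · refine h (j, i) (mem_pairsBelow.2 ⟨hlt, hi⟩) ?_
        rw [h2 i hi, h2 j hj, e]
    · intro h e he heq
      obtain ⟨h7, h8⟩ := mem_pairsBelow.1 he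
      rw [h2 _ (by omega), h2 _ h8] at heq
      have := h _ (by omega) _ h8 heq
      omega
  have hkk : 2 * k * (2 * k) = 4 * k * k := by ring
  have ht2 : s2.tick.time ≤ T + (8 * k * k + 4 * k + 3) := by
    have := hI.time
    simp only [St.tick_time]
    have : 8 * k * k = 2 * (4 * k * k) := by ring
    omega
  have hI2 : Inv N nb k A R (T + (8 * k * k + 4 * k + 3)) s2.tick :=
    hI.of_eq (g3.trans h4) (g4.trans h5)
      ((g2 _ (by simp)).trans (h3 _ (by simp) (by simp)))
      ((g2 _ (by simp)).trans (h3 _ (by simp) (by simp))) le_rfl ht2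
  simp only [wp, Ex.fits, Ex.eval]
  refine ⟨trivial, by omega, fun hf => ?_, fun hf => ?_⟩
  · refine wp_mono _ (wp_vertexLoop hnb hsymm hk hN hB hBr hI2
      (p := p) (col := dig p code) ?_ ?_ (hinj.1 hf) (hD p _ hp1 (hinj.1 hf))) ?_
    · exact ((g2 _ (by simp)).trans (h3 _ (by simp) (by simp))).trans hp
    · intro i hi
      exact (g2 _ (by simp)).trans (h2 i hi)
    · intro s' h
      refine h.congr ?_ le_rfl (by omega)
      congr 1
      ext t
      simp only [FoundCode, Set.mem_ofPred_eq]
      exact ⟨fun h => ⟨hinj.1 hf, h⟩, fun h => h.2⟩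
  · refine hI2.congr ?_ (by omega) (by omega)
    have : FoundCode N nb k p code = ∅ := by
      ext t
      simp only [FoundCode, Set.mem_ofPred_eq, Set.mem_empty_iff_false, iff_false]
      exact fun h => hf (hinj.2 h.1)
    rw [this, Set.union_empty]

/-- Try all colours for the modulus `p`. -/
def modulusCmd (k : ℕ) : Cmd :=
  .seq (powCmd (2 * k)) (.loop .code (.lit 0) (.var .pw) (colourCmd k))

/-- The cost of trying all colours for a modulus. -/
def colourCost (N k D : ℕ) : ℕ := 8 * k * k + 4 * k + 6 + 5 * N + D

theorem wp_modulus {N B : ℕ} {nb : ℕ → List ℕ} (hnb : GoodNb N nb)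
    (hsymm : ∀ x < N, ∀ y < N, y ∈ nb x ↔ x ∈ nb y) {k p R T : ℕ} (hk : 2 ≤ k)
    (hN : 0 < N) (hB : 16 * N ^ (2 * k) < B) (hBr : 16 * (R + p ^ (2 * k) * N) * N * N ≤ B)
    {s : St} {A : Set (List ℕ)} (hI : Inv N nb k A R T s) (hp : s.var .p = p) (hp1 : 1 ≤ p)
    (hpB : p ^ (2 * k) < B) {D : ℕ} (hD : CostLe N nb k D) :
    wp N B (modulusCmd k)
      (Inv N nb k (A ∪ {t | ∃ code < p ^ (2 * k), t ∈ FoundCode N nb k p code})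
        (R + p ^ (2 * k) * N) (T + (2 * k + 2) + p ^ (2 * k) * colourCost N k D)) s := by
  have h1B : 0 < B := by omega
  refine wp_seq _ (wp_pow hp hp1 (2 * k) hpB) ?_
  rintro s1 ⟨h1, h2, h3, h4, h5⟩ -
  have hI1 : Inv N nb k A R (T + (2 * k + 2)) s1.tick :=
    hI.of_eq h3 h4 (h2 _ (by simp)) (h2 _ (by simp)) le_rfl (by
      have := hI.time; simp only [St.tick_time]; omega)
  refine wp_loop (fun j s' => Inv N nb k (A ∪ {t | ∃ code < j, t ∈ FoundCode N nb k p code})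
    (R + j * N) (T + (2 * k + 2) + j * colourCost N k D) s')
    (by simpa only [Ex.fits] using h1B) trivial ?_ (by simp) ?_ ?_ ?_ ?_
  · simpa only [Ex.eval, h1] using hpB
  · simp only [Ex.eval]; omega
  · simp only [Ex.eval]
    refine hI1.congr ?_ (by omega) (by omega)
    simp
  · intro j hj1 hj2 s' hI' hf
    simp only [Ex.eval, h1] at hj1 hj2
    have hp' : s'.var .p = p := by
      rw [hf.var .p fun h => ?_, h2 _ (by simp), hp]
      simp only [Cmd.mods, reduceCtorEq, false_or] at h
      exact (colour_mods h).2.1 rfl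
    have hjN : j * N + N ≤ p ^ (2 * k) * N := by
      have := Nat.mul_le_mul_right N (Nat.succ_le_of_lt hj2)
      rwa [Nat.succ_mul] at this
    have hI2 := hI'.of_eq (s' := (s'.set .code j).tick)
      (T' := T + (2 * k + 2) + j * colourCost N k D + 1) (R' := R + j * N) rfl rfl (by simp)
      (by simp) le_rfl (by have := hI'.time; simp only [St.tick_time, St.set_time]; omega)
    refine wp_mono _ (wp_colour hnb hsymm hk hN hB ?_ hI2 (p := p) (code := j) (by simp [hp'])
      hp1 (by simp) (by omega) hD) ?_
    · refine le_trans (Nat.mul_le_mul_right _ (Nat.mul_le_mul_right _ (Nat.mul_le_mul_left _ ?_)))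
        hBr
      omega
    · intro s2 h
      refine h.congr ?_ (by rw [Nat.add_mul]; omega) ?_
      · rw [Set.union_assoc]
        congr 1
        ext t
        simp only [Set.mem_ofPred_eq, Set.mem_union]
        constructor
        · rintro (⟨c, hc, h⟩ | h)
          exacts [⟨c, by omega, h⟩, ⟨j, by omega, h⟩]
        · rintro ⟨c, hc, ht⟩
          rcases Nat.lt_succ_iff_lt_or_eq.1 hc with h' | rfl
          exacts [Or.inl ⟨c, h', ht⟩, Or.inr ht]
      · rw [Nat.add_mul, one_mul]
        have : colourCost N k D = 1 + (8 * k * k + 4 * k + 4 + 5 * N + D) + 1 := by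
          unfold colourCost; omega
        omega
  · intro s' hI' _
    simp only [Ex.eval, h1] at hI'
    exact hI'

/-- All cycles that are found for the moduli below `L`. -/
def FoundBelow (N : ℕ) (nb : ℕ → List ℕ) (k L : ℕ) : Set (List ℕ) :=
  {t | ∃ p, 1 ≤ p ∧ p < L ∧ ∃ code < p ^ (2 * k), t ∈ FoundCode N nb k p code}

def searchCmd (k : ℕ) : Cmd := .loop .p (.lit 1) (.var .L) (modulusCmd k)

/-- There are fewer than `L` moduli, at most `L ^ (2 * k)` colourings for each and at most `N`
regions per colouring; `hBr` says that their addresses fit into a word. -/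
theorem wp_search {N B : ℕ} {nb : ℕ → List ℕ} (hnb : GoodNb N nb)
    (hsymm : ∀ x < N, ∀ y < N, y ∈ nb x ↔ x ∈ nb y) {k L T : ℕ} (hk : 2 ≤ k)
    (hN : 0 < N) (hB : 16 * N ^ (2 * k) < B) (hBr : 16 * (L * L ^ (2 * k) * N) * N * N ≤ B)
    {s : St} (hI : Inv N nb k ∅ 0 T s) (hL : s.var .L = L) (hL1 : 1 ≤ L)
    {D : ℕ} (hD : CostLe N nb k D) :
    wp N B (searchCmd k) (fun s' => OutIs N (2 * k) (FoundBelow N nb k L) s' ∧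
      s'.time ≤ T + 1 + L * (2 * k + 3 + L ^ (2 * k) * colourCost N k D)) s := by
  have hLL : L ≤ L * L ^ (2 * k) := Nat.le_mul_of_pos_right _ (by positivity)
  have hbig : L * L ^ (2 * k) < B := by
    have h1 : L * L ^ (2 * k) ≤ L * L ^ (2 * k) * (N * N * N) :=
      Nat.le_mul_of_pos_right _ (by positivity)
    have h2 : 0 < L * L ^ (2 * k) := by positivity
    have h3 : 16 * (L * L ^ (2 * k) * N) * N * N = 16 * (L * L ^ (2 * k) * (N * N * N)) := by ring
    omega
  have hpw : L ^ (2 * k) ≤ L * L ^ (2 * k) := Nat.le_mul_of_pos_left _ hL1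
  have h1B : 1 < B := by omega
  set W := 2 * k + 3 + L ^ (2 * k) * colourCost N k D with hW
  refine wp_loop (fun j s' => Inv N nb k (FoundBelow N nb k j) (j * L ^ (2 * k) * N)
    (T + 1 + j * W) s') (by simpa only [Ex.fits] using h1B) trivial ?_ (by simp) ?_ ?_ ?_ ?_
  · simp only [Ex.eval, hL]; omega
  · simpa only [Ex.eval, hL] using hL1
  · simp only [Ex.eval]
    refine (hI.of_eq (s' := s.tick) (R' := 0) (T' := T + 1) rfl rfl rfl rfl le_rfl
      (Nat.succ_le_succ hI.time)).congr ?_ (by omega) (by omega)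
    ext t
    simp only [FoundBelow, Set.mem_ofPred_eq, Set.mem_empty_iff_false, false_iff, not_exists]
    intro p hp
    omega
  · intro j hj1 hj2 s' hI' hf
    simp only [Ex.eval, hL] at hj1 hj2
    have hjL : j ^ (2 * k) ≤ L ^ (2 * k) := Nat.pow_le_pow_left hj2.le _
    have hreg : j * L ^ (2 * k) * N + j ^ (2 * k) * N ≤ (j + 1) * L ^ (2 * k) * N := by
      rw [← Nat.add_mul]
      refine Nat.mul_le_mul_right _ ?_
      rw [Nat.add_mul, one_mul]
      omega
    have hI2 := hI'.of_eq (s' := (s'.set .p j).tick) (T' := T + 1 + j * W + 1)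
      (R' := j * L ^ (2 * k) * N) rfl rfl (by simp)
      (by simp) le_rfl (by have := hI'.time; simp only [St.tick_time, St.set_time]; omega)
    refine wp_mono _ (wp_modulus hnb hsymm hk hN hB ?_ hI2 (p := j) (by simp) hj1
      (by omega) hD) ?_
    · refine le_trans (Nat.mul_le_mul_right _ (Nat.mul_le_mul_right _ (Nat.mul_le_mul_left _ ?_)))
        hBr
      refine hreg.trans (Nat.mul_le_mul_right _ (Nat.mul_le_mul_right _ hj2))
    · intro s2 h
      refine h.congr ?_ hreg ?_
      · ext t
        simp only [FoundBelow, Set.mem_ofPred_eq, Set.mem_union]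
        constructor
        · rintro (⟨p, h1, h2, h⟩ | h)
          exacts [⟨p, h1, by omega, h⟩, ⟨j, hj1, by omega, h⟩]
        · rintro ⟨p, h1, h2, ht⟩
          rcases Nat.lt_succ_iff_lt_or_eq.1 h2 with h' | rfl
          exacts [Or.inl ⟨p, h1, h', ht⟩, Or.inr ht]
      · have := Nat.mul_le_mul_right (colourCost N k D) hjL
        rw [Nat.add_mul, one_mul]
        omega
  · intro s' hI' _
    simp only [Ex.eval, hL] at hI'
    exact ⟨hI'.out, hI'.time⟩

end WordRAM

/-! ### Reading the graph, and the whole program -/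

namespace WordRAM

/-- The neighbour lists of a list of edges. -/
def nbOf (es : List (ℕ × ℕ)) (x : ℕ) : List ℕ :=
  es.flatMap fun e => (if x = e.1 then [e.2] else []) ++ (if x = e.2 then [e.1] else [])

theorem mem_nbOf {es : List (ℕ × ℕ)} {x y : ℕ} : y ∈ nbOf es x ↔ (x, y) ∈ es ∨ (y, x) ∈ es := by
  simp only [nbOf, List.mem_flatMap, List.mem_append]
  constructor
  · rintro ⟨⟨a, b⟩, he, h | h⟩
    · dsimp only at h
      split_ifs at h with hx
      · simp only [List.mem_singleton] at h; subst h; subst hx; exact Or.inl he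
      · simp at h
    · dsimp only at h
      split_ifs at h with hx
      · simp only [List.mem_singleton] at h; subst h; subst hx; exact Or.inr he
      · simp at h
  · rintro (h | h)
    · exact ⟨_, h, Or.inl (by simp)⟩
    · exact ⟨_, h, Or.inr (by simp)⟩

theorem nbOf_append (es es' : List (ℕ × ℕ)) (x : ℕ) :
    nbOf (es ++ es') x = nbOf es x ++ nbOf es' x := by
  simp [nbOf]

/-- A list of edges of a simple graph on `{0, …, N - 1}`. -/
structure GoodEdges (N : ℕ) (es : List (ℕ × ℕ)) : Prop where
  nodup : (es.map fun e => s(e.1, e.2)).Nodup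
  lt : ∀ e ∈ es, e.1 < N ∧ e.2 < N ∧ e.1 ≠ e.2

theorem GoodEdges.goodNb {N : ℕ} {es : List (ℕ × ℕ)} (h : GoodEdges N es) :
    GoodNb N (nbOf es) := by
  refine ⟨fun x _ => ?_, fun x _ y hy => ?_⟩
  · refine List.nodup_flatMap.2 ⟨fun e he => ?_, ?_⟩
    · have := (h.lt e he).2.2
      by_cases h1 : x = e.1
      · have h2 : x ≠ e.2 := fun h2 => this (h1.symm.trans h2)
        rw [if_pos h1, if_neg h2]; simp
      · rw [if_neg h1]; split_ifs <;> simp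
    · have h1 := List.pairwise_map.1 h.nodup
      refine h1.imp ?_
      intro e e' hne
      simp only [Function.onFun, List.disjoint_left]
      intro y hy hy'
      apply hne
      have key : ∀ e : ℕ × ℕ, y ∈ (if x = e.1 then [e.2] else []) ++
          (if x = e.2 then [e.1] else []) → s(e.1, e.2) = s(x, y) := by
        intro e hy
        rcases List.mem_append.1 hy with hy | hy
        · split_ifs at hy with hx
          · simp only [List.mem_singleton] at hy; rw [hx, hy]
          · simp at hy
        · split_ifs at hy with hx
          · simp only [List.mem_singleton] at hy; rw [hx, hy]; exact Sym2.eq_swap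
          · simp at hy
      rw [key e hy, key e' hy']
  · rcases mem_nbOf.1 hy with hy | hy
    exacts [(h.lt _ hy).2.1, (h.lt _ hy).1]

theorem GoodEdges.sublist {N : ℕ} {es es' : List (ℕ × ℕ)} (h : GoodEdges N es)
    (hs : es'.Sublist es) : GoodEdges N es' :=
  ⟨h.nodup.sublist (hs.map _), fun e he => h.lt e (hs.subset he)⟩

/-- The input word with a given number. -/
def inpEx (e : Ex) : Ex := .ld 0 (.lit 0) (.div e (.var .n)) (.mod e (.var .n))

/-- The input is the array 0 of region 0: writing a position below `N * N` as quotient and remainder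
by `N` gives indices whose address is the position itself. -/
theorem inpEx_spec {N B : ℕ} {s : St} {e : Ex} (hN : 0 < N) (hNB : N * N ≤ B) (hn : s.var .n = N)
    (he : e.fits N B s) (hlt : e.eval s < N * N) :
    (inpEx e).fits N B s ∧ (inpEx e).eval s = s.mem 0 0 (e.eval s / N) (e.eval s % N) := by
  have h1 : e.eval s / N < N := Nat.div_lt_of_lt_mul hlt
  have h2 : e.eval s % N < N := Nat.mod_lt _ hN
  have h3 : N ≤ N * N := Nat.le_mul_of_pos_left _ hN
  simp only [inpEx, Ex.fits, Ex.eval, hn, Access]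
  refine ⟨⟨by omega, ⟨he, trivial, by omega⟩, ⟨he, trivial, by omega⟩, trivial, by omega, h1, h2,
    ?_⟩, trivial⟩
  have : addr N 0 0 (e.eval s / N) (e.eval s % N) = e.eval s := by
    rw [addr, mul_comm]
    simp only [zero_mul, zero_add]
    exact Nat.div_add_mod _ _
  omega

/-- Append a vertex to a list of neighbours. -/
def pushCmd (a b : Var) : Cmd :=
  .seq (.st 2 (.lit 0) (.var a) (.ld 1 (.lit 0) (.var a) (.lit 0)) (.var b))
    (.st 1 (.lit 0) (.var a) (.lit 0) (.add (.ld 1 (.lit 0) (.var a) (.lit 0)) (.lit 1)))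

theorem wp_push {N B : ℕ} {nb : ℕ → List ℕ} {s : St} {a b : Var} (hN : 0 < N)
    (hB : 16 * N * N ≤ B) (he : Env N nb s) (ha : s.var a < N)
    (hlen : (nb (s.var a)).length < N) :
    wp N B (pushCmd a b) (fun s' =>
      Env N (fun x => nb x ++ if x = s.var a then [s.var b] else []) s' ∧ s'.var = s.var ∧
      (∀ t, t ≠ 1 → t ≠ 2 → s'.mem t = s.mem t) ∧ s'.out = s.out ∧ s'.time = s.time + 2) s := by
  have hacc : ∀ {t x i : ℕ}, t < 16 → x < N → i < N → addr N t 0 x i < B := fun ht hx hi =>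
    lt_of_lt_of_le (addr_lt ht hx hi) (by simpa using hB)
  have hNB : N + 1 < B := by nlinarith
  have hd := he.deg _ ha
  simp only [pushCmd, wp, Ex.fits, Ex.eval, Access, he.n, hd, St.tick_var, St.store_var,
    St.tick_mem, St.store_mem]
  have h1B : 1 < B := by omega
  have h0B : 0 < B := by omega
  have hl1 : (nb (s.var a)).length + 1 < B := by omega
  have a1 := hacc (t := 1) (by omega) ha hN
  have a2 := hacc (t := 2) (by omega) ha hlen
  simp only [show ¬ (1 : ℕ) = 2 by omega, false_and, if_false, hd]
  have h16 : 1 < 16 ∧ 2 < 16 := by omega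
  and_intros
  any_goals first | trivial | assumption | exact h16.1 | exact h16.2
  · refine ⟨he.n, fun x hx => ?_, fun x hx j hj => ?_⟩
    · by_cases hxa : x = s.var a
      · subst hxa; simp
      · simp [hxa, he.deg x hx]
    · by_cases hxa : x = s.var a
      · subst hxa
        by_cases hj' : j = (nb (s.var a)).length
        · subst hj'; simp
        · have : j < (nb (s.var a)).length := by simp at hj; omega
          simp [hj', he.adj _ hx j this, List.getElem_append_left this]
      · have hj' : j < (nb x).length := by simpa [hxa] using hj
        simp [hxa, he.adj x hx j hj']
  · intro t h1 h2
    funext r x y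
    simp [h1, h2]

/-- Read the edges. -/
def parseCmd : Cmd :=
  .loop .i (.lit 0) (.var .m)
    (.seq (.set .u (inpEx (.add (.mul (.lit 2) (.var .i)) (.lit 2))))
    (.seq (.set .y (inpEx (.add (.mul (.lit 2) (.var .i)) (.lit 3))))
    (.seq (pushCmd .u .y) (pushCmd .y .u))))

/-- The edges are in the input array. -/
structure HasEdges (N : ℕ) (es : List (ℕ × ℕ)) (s : St) : Prop where
  fst : ∀ i (h : i < es.length), s.mem 0 0 ((2 * i + 2) / N) ((2 * i + 2) % N) = (es[i]).1
  snd : ∀ i (h : i < es.length), s.mem 0 0 ((2 * i + 3) / N) ((2 * i + 3) % N) = (es[i]).2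

/-- After `j` rounds the arrays describe the graph of the first `j` edges. A round consists of the
loop tick, two reads and two pushes of two stores each, seven in all. -/
theorem wp_parse {N B : ℕ} {es : List (ℕ × ℕ)} {s : St} (hN : 0 < N) (hB : 16 * N * N ≤ B)
    (hes : GoodEdges N es) (hlen : 2 * es.length + 2 ≤ N * N) (hn : s.var .n = N)
    (hm : s.var .m = es.length) (hE : HasEdges N es s) (h1 : ∀ r x y, s.mem 1 r x y = 0) :
    wp N B parseCmd (fun s' => Env N (nbOf es) s' ∧ (∀ t, t ≠ 1 → t ≠ 2 → s'.mem t = s.mem t) ∧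
      s'.out = s.out ∧ s'.time = s.time + 1 + 7 * es.length) s := by
  have hNN : N ≤ N * N := Nat.le_mul_of_pos_left _ hN
  have hB' : 16 * (N * N) ≤ B := by rwa [← mul_assoc]
  refine wp_loop (fun j s' => Env N (nbOf (es.take j)) s' ∧
      (∀ t, t ≠ 1 → t ≠ 2 → s'.mem t = s.mem t) ∧
      s'.out = s.out ∧ s'.time = s.time + 1 + 7 * j)
    (by simp only [Ex.fits]; omega) trivial ?_ (by simp) ?_ ?_ ?_ ?_
  · simp only [Ex.eval, hm]; omega
  · simp only [Ex.eval, hm]; omega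
  · simp only [Ex.eval]
    refine ⟨⟨hn, fun x _ => ?_, fun x _ j hj => ?_⟩, fun _ _ _ => rfl, rfl, by simp⟩
    · simp [nbOf, h1]
    · simp [nbOf] at hj
  · rintro j hj1 hj2 s' ⟨he, hmem, hout, ht⟩ -
    simp only [Ex.eval, hm] at hj1 hj2
    have hlt := hes.lt _ (List.getElem_mem hj2)
    have hn' := he.n
    have hfst := hE.fst j hj2
    have hsnd := hE.snd j hj2
    set a := (es[j]).1 with ha
    set b := (es[j]).2 with hb
    have f1 : (Ex.add (.mul (.lit 2) (.var .i)) (.lit 2)).fits N B (s'.set .i j).tick := by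
      simp only [Ex.fits, Ex.eval, St.tick_var, St.set_var, if_true]
      refine ⟨⟨?_, trivial, ?_⟩, ?_, ?_⟩ <;> omega
    have f2 : ∀ z, (Ex.add (.mul (.lit 2) (.var .i)) (.lit 3)).fits N B
        ((s'.set .i j).tick.set .u z).tick := by
      intro z
      simp only [Ex.fits, Ex.eval, St.tick_var, St.set_var, if_true, reduceCtorEq, if_false]
      refine ⟨⟨?_, trivial, ?_⟩, ?_, ?_⟩ <;> omega
    obtain ⟨g1, e1⟩ := inpEx_spec (N := N) (B := B) hN (by omega) (by simp [hn']) f1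
      (by simp only [Ex.eval, St.tick_var, St.set_var, if_true]; omega)
    refine wp_seq (fun s2 => s2 = ((s'.set .i j).tick.set .u a).tick) ?_ ?_
    · have : (inpEx (.add (.mul (.lit 2) (.var .i)) (.lit 2))).eval (s'.set .i j).tick = a := by
        rw [e1]
        simp only [Ex.eval, St.tick_var, St.set_var, if_true, St.tick_mem, St.set_mem]
        rw [hmem 0 (by omega) (by omega)]; exact hfst
      simp only [wp, this]
      exact ⟨g1, by omega, by simp, trivial⟩
    rintro s2 rfl -
    obtain ⟨g2, e2⟩ := inpEx_spec (N := N) (B := B) hN (by omega) (by simp [hn']) (f2 a)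
      (by simp only [Ex.eval, St.tick_var, St.set_var, if_true, reduceCtorEq, if_false]; omega)
    refine wp_seq (fun s3 => s3 = (((s'.set .i j).tick.set .u a).tick.set .y b).tick) ?_ ?_
    · have : (inpEx (.add (.mul (.lit 2) (.var .i)) (.lit 3))).eval
          ((s'.set .i j).tick.set .u a).tick = b := by
        rw [e2]
        simp only [Ex.eval, St.tick_var, St.set_var, if_true, reduceCtorEq, if_false, St.tick_mem,
          St.set_mem]
        rw [hmem 0 (by omega) (by omega)]; exact hsnd
      simp only [wp, this]
      exact ⟨g2, by omega, by simp, trivial⟩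
    rintro s3 rfl -
    have htake : es.take (j + 1) = es.take j ++ [(a, b)] := by
      rw [List.take_succ_eq_append_getElem hj2]
    have hgood := (hes.sublist (List.take_sublist (j + 1) es)).goodNb
    rw [htake] at hgood
    have hnb1 : ∀ x, nbOf (es.take j ++ [(a, b)]) x = nbOf (es.take j) x ++
        ((if x = a then [b] else []) ++ (if x = b then [a] else [])) := by
      intro x; rw [nbOf_append]; simp [nbOf]
    -- The lists after this edge are still duplicate-free lists of vertices, hence of length at most
    -- `N`; so there is a free slot before each push.
    have hlenb : ∀ x < N, (nbOf (es.take j) x).length +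
        ((if x = a then [b] else []) ++ (if x = b then [a] else [])).length ≤ N := by
      intro x hx
      have := hgood.length_le hx
      rwa [hnb1, List.length_append] at this
    have hab := hlt.2.2
    refine wp_seq _ (wp_push (nb := nbOf (es.take j)) (a := .u) (b := .y) hN hB ?_ ?_ ?_) ?_
    · exact he.of_eq (by simp) rfl
    · simpa using hlt.1
    · have := hlenb a hlt.1
      simp only [if_true, List.length_append, List.length_singleton] at this
      simp only [St.tick_var, St.set_var, reduceCtorEq, if_false, if_true]
      omega
    rintro s4 ⟨h4e, h4v, h4m, h4o, h4t⟩ -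
    have hu4 : s4.var .u = a := by rw [h4v]; simp
    have hy4 : s4.var .y = b := by rw [h4v]; simp
    refine wp_mono _ (wp_push (a := .y) (b := .u) hN hB h4e (by rw [hy4]; exact hlt.2.1) ?_) ?_
    · rw [hy4]
      have := hlenb b hlt.2.1
      have hba : b ≠ a := fun h => hab h.symm
      simp only [if_true, List.length_append, List.length_singleton, hba, if_false,
        List.length_nil, zero_add] at this
      simp only [St.tick_var, St.set_var, reduceCtorEq, if_false, if_true, hba, List.append_nil]
      omega
    rintro s5 ⟨h5e, h5v, h5m, h5o, h5t⟩
    refine ⟨?_, fun t ht1 ht2 => ?_, ?_, ?_⟩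
    · rw [htake]
      convert h5e using 1
      funext x
      rw [hnb1, hy4, hu4]
      simp only [St.tick_var, St.set_var, reduceCtorEq, if_false, if_true, List.append_assoc]
    · rw [h5m t ht1 ht2, h4m t ht1 ht2]; exact hmem t ht1 ht2
    · rw [h5o, h4o]; exact hout
    · rw [h5t, h4t]; simp only [St.tick_time, St.set_time, ht]; omega
  · rintro s' ⟨h1, h2, h3, h4⟩ -
    simp only [Ex.eval, hm, List.take_length] at h1 h4
    exact ⟨h1, h2, h3, h4⟩

/-- Set `b` to the number of binary digits of `n`. -/
def bitsCmd : Cmd :=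
  .seq (.set .b (.lit 0)) (.seq (.set .sz (.lit 1))
    (.loop .i (.lit 0) (.var .n) (.whenLt (.var .sz) (.add (.var .n) (.lit 1))
      (.seq (.set .b (.add (.var .b) (.lit 1))) (.set .sz (.mul (.lit 2) (.var .sz)))))))

/-- The language only has counting loops. `N` rounds suffice because `Nat.log 2 N < N`, and once
`sz` exceeds `N` the remaining rounds do nothing. -/
theorem wp_bits {N B : ℕ} {s : St} (hN : 0 < N) (hB : 2 * N + 2 < B) (hn : s.var .n = N) :
    wp N B bitsCmd (fun s' => s'.var .b = Nat.log 2 N + 1 ∧ s'.var .n = N ∧ s'.mem = s.mem ∧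
      s'.out = s.out ∧ s'.time ≤ s.time + 3 + 4 * N) s := by
  refine wp_seq (fun s2 => s2 = (s.set .b 0).tick) ?_ ?_
  · simp only [wp, Ex.fits, Ex.eval]
    exact ⟨by omega, by omega, by simp, trivial⟩
  rintro s2 rfl -
  refine wp_seq (fun s2 => s2 = ((s.set .b 0).tick.set .sz 1).tick) ?_ ?_
  · simp only [wp, Ex.fits, Ex.eval]
    exact ⟨by omega, by omega, by simp, trivial⟩
  rintro s2 rfl -
  have hl : Nat.log 2 N < N := Nat.log_lt_self 2 (by omega)
  refine wp_loop (fun j s' => s'.var .b = min j (Nat.log 2 N + 1) ∧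
    s'.var .sz = 2 ^ min j (Nat.log 2 N + 1) ∧ s'.var .n = N ∧ s'.mem = s.mem ∧ s'.out = s.out ∧
    s'.time ≤ s.time + 3 + 4 * j) (by simp only [Ex.fits]; omega) trivial ?_ (by simp) ?_ ?_ ?_ ?_
  · simp [Ex.eval, hn]; omega
  · simp [Ex.eval]
  · simp [Ex.eval, hn]
  · rintro j hj1 hj2 s' ⟨h1, h2, h3, h4, h5, h6⟩ -
    simp only [wp, Ex.fits, Ex.eval, St.tick_var, St.set_var, reduceCtorEq, if_false, if_true,
      h1, h2, h3]
    have hjN : j < N := by simpa [Ex.eval, hn] using hj2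
    refine ⟨trivial, ⟨trivial, by omega, by omega⟩, fun hlt => ?_, fun hlt => ?_⟩
    · have h7 := Nat.lt_succ_iff.1 hlt
      have h8 := (Nat.le_log_iff_pow_le (by omega) (by omega)).2 h7
      have h9 : min j (Nat.log 2 N + 1) = j := by omega
      have h10 : min (j + 1) (Nat.log 2 N + 1) = j + 1 := by omega
      rw [h9] at h7 ⊢
      rw [h10]
      refine ⟨⟨trivial, by omega, by omega⟩, by omega, by simp, ⟨by omega, trivial, by omega⟩,
        by omega, by simp, rfl, ?_, trivial, h4, h5, ?_⟩
      · rw [pow_succ, mul_comm]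
      · simp only [St.tick_time, St.set_time]; omega
    · have h7 : N < 2 ^ min j (Nat.log 2 N + 1) := by omega
      have h8 : Nat.log 2 N < min j (Nat.log 2 N + 1) := by
        rw [← not_le, Nat.le_log_iff_pow_le (by omega) (by omega)]; omega
      have h9 : min (j + 1) (Nat.log 2 N + 1) = min j (Nat.log 2 N + 1) := by omega
      rw [h9]
      refine ⟨rfl, rfl, trivial, h4, h5, ?_⟩
      simp only [St.tick_time, St.set_time]; omega
  · rintro s' ⟨h1, h2, h3, h4, h5, h6⟩ -
    simp only [Ex.eval, St.tick_var, St.set_var, reduceCtorEq, if_false, hn] at h1 h6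
    refine ⟨by omega, h3, h4, h5, h6⟩

/-- The largest modulus. -/
def modBound (k N : ℕ) : ℕ := 8 * k * k * (Nat.log 2 N + 1) + 1

/-- List all cycles of length `2 * k`. -/
def listCmd (k : ℕ) : Cmd :=
  .seq (.set .m (inpEx (.lit 1)))
  (.seq parseCmd
  (.seq bitsCmd
  (.seq (.set .L (.add (.mul (.lit (8 * k * k)) (.var .b)) (.lit 1)))
  (.seq (.set .r (.lit 0)) (searchCmd k)))))

theorem wp_list_all {N B k : ℕ} {es : List (ℕ × ℕ)} {s : St} (hk : 2 ≤ k) (hN : 2 ≤ N)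
    (hB : 16 * N ^ (2 * k) < B)
    (hBr : 16 * (modBound k N * modBound k N ^ (2 * k) * N) * N * N ≤ B)
    (hes : GoodEdges N es) (hlen : 2 * es.length + 2 ≤ N * N) (hn : s.var .n = N)
    (hm : s.mem 0 0 (1 / N) (1 % N) = es.length) (hE : HasEdges N es s)
    (h0 : ∀ t r x y, t ≠ 0 → s.mem t r x y = 0) (hout : s.out = []) (htime : s.time = 0) {D : ℕ}
    (hD : CostLe N (nbOf es) k D) :
    wp N B (listCmd k) (fun s' => OutIs N (2 * k) (FoundBelow N (nbOf es) k (modBound k N)) s' ∧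
      s'.time ≤ 10 + 4 * N + 7 * es.length + modBound k N * (2 * k + 3 +
        modBound k N ^ (2 * k) * colourCost N k D)) s := by
  set L := modBound k N with hL
  have hL1 : 1 ≤ L := by simp [hL, modBound]
  have hNN : N ≤ N * N := Nat.le_mul_of_pos_left _ (by omega)
  have hLL : L ≤ L * L ^ (2 * k) := Nat.le_mul_of_pos_right _ (by positivity)
  have hbig : 16 * (L * (N * N)) ≤ B := by
    refine le_trans ?_ hBr
    have h1 : 16 * (L * L ^ (2 * k) * N) * N * N = 16 * ((L * L ^ (2 * k)) * (N * N) * N) := by ring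
    rw [h1]
    refine Nat.mul_le_mul_left _ ?_
    exact (Nat.mul_le_mul_right _ hLL).trans (Nat.le_mul_of_pos_right _ (by omega))
  have hB16 : 16 * (N * N) ≤ B :=
    le_trans (Nat.mul_le_mul_left _ (Nat.le_mul_of_pos_left _ hL1)) hbig
  have hB1 : 16 * N * N ≤ B := by rwa [mul_assoc]
  have hLB : 16 * L ≤ B := by
    refine le_trans (Nat.mul_le_mul_left _ (Nat.le_mul_of_pos_right _ ?_)) hbig
    positivity
  obtain ⟨g1, e1⟩ := inpEx_spec (N := N) (B := B) (s := s) (e := .lit 1) (by omega) (by omega) hn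
    (by simp only [Ex.fits]; omega) (by simp only [Ex.eval]; omega)
  have e1' : (inpEx (.lit 1)).eval s = es.length := by rw [e1]; exact hm
  refine wp_seq (fun s2 => s2 = (s.set .m es.length).tick) ?_ ?_
  · simp only [wp, e1']
    exact ⟨g1, by omega, by simp, trivial⟩
  rintro s1 rfl -
  refine wp_seq _ (wp_parse (by omega) hB1 hes hlen (by simp [hn]) (by simp)
    ⟨fun i hi => hE.fst i hi, fun i hi => hE.snd i hi⟩ (fun r x y => h0 1 r x y (by omega))) ?_
  rintro s2 ⟨a1, a2, a3, a4⟩ -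
  refine wp_seq _ (wp_bits (by omega) (by nlinarith) a1.n) ?_
  rintro s3 ⟨b1, b2, b3, b4, b5⟩ -
  have hLe : 8 * k * k * (Nat.log 2 N + 1) + 1 = L := rfl
  have h8 : 8 * k * k ≤ 8 * k * k * (Nat.log 2 N + 1) := Nat.le_mul_of_pos_right _ (by omega)
  refine wp_seq (fun s4 => s4 = (s3.set .L L).tick) ?_ ?_
  · simp only [wp, Ex.fits, Ex.eval, b1, hLe]
    refine ⟨⟨⟨?_, trivial, ?_⟩, ?_, ?_⟩, ?_, by simp, trivial⟩ <;> omega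
  rintro s4 rfl -
  refine wp_seq (fun s4 => s4 = ((s3.set .L L).tick.set .r 0).tick) ?_ ?_
  · simp only [wp, Ex.fits, Ex.eval]
    exact ⟨by omega, by omega, by simp, trivial⟩
  rintro s4 rfl -
  have hmem : ∀ t, t ≠ 0 → t ≠ 1 → t ≠ 2 → ∀ r x y, s3.mem t r x y = 0 := by
    intro t h1 h2 h3 r x y
    rw [b3, a2 t h2 h3]
    exact h0 t r x y h1
  have hsym : ∀ x < N, ∀ y < N, y ∈ nbOf es x ↔ x ∈ nbOf es y := by
    intro x _ y _
    rw [mem_nbOf, mem_nbOf, or_comm]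
  refine wp_mono _ (wp_search (T := s3.time + 2) hes.goodNb hsym hk (by omega) hB hBr (L := L)
    ⟨?_, ⟨⟨[], ?_, List.nodup_nil, by simp⟩, fun σ _ => ⟨fun h => h.elim, fun _ => ?_⟩⟩,
      ⟨0, le_rfl, by simp, ?_⟩, ?_⟩ (by simp) hL1 hD) ?_
  · exact a1.of_eq (by simp [b2, a1.n]) b3
  · simp [b4, a3, hout]
  · exact hmem 9 (by omega) (by omega) (by omega) _ _ _
  · rintro t (rfl | rfl) r' _ x
    exacts [hmem 4 (by omega) (by omega) (by omega) _ _ _,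
      hmem 7 (by omega) (by omega) (by omega) _ _ _]
  · simp
  · rintro s' ⟨h1, h2⟩
    refine ⟨h1, h2.trans ?_⟩
    simp only [St.tick_time, St.set_time, htime] at a4
    omega

end WordRAM

/-! ### Consequences of the supersaturation conjecture -/

namespace SimpleGraph

theorem Subgraph.map_injective' {V W : Type*} {G : SimpleGraph V} {H : SimpleGraph W} {f : G →g H}
    (hf : Function.Injective f) : Function.Injective (Subgraph.map f) := by
  intro G₁ G₂ h
  have hv : ∀ x, x ∈ G₁.verts ↔ x ∈ G₂.verts := by
    intro x
    have := congrArg (fun K => f x ∈ K.verts) h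
    simpa [hf.eq_iff] using this
  ext x y
  · exact hv x
  · have := congrArg (fun K => K.Adj (f x) (f y)) h
    simpa [Relation.map_apply_apply hf hf] using this

/-- The image of a subgraph under an injective homomorphism is isomorphic to it and determines it.
-/
theorem copyCount_le_of_copy {V W U : Type*} [Fintype V] [Fintype W] {G : SimpleGraph V}
    {H : SimpleGraph W} (f : Copy G H) (F : SimpleGraph U) : G.copyCount F ≤ H.copyCount F := by
  classical
  rw [copyCount, copyCount]
  refine Finset.card_le_card_of_injOn (Subgraph.map f.toHom) ?_
    (Subgraph.map_injective' f.injective).injOn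
  intro K hK
  simp only [Finset.coe_filter, Finset.mem_univ, true_and, Set.mem_ofPred_eq] at hK ⊢
  obtain ⟨e⟩ := hK
  exact ⟨e.trans (f.isoSubgraphMap K)⟩

end SimpleGraph

-- The conjecture speaks of a whole bipartite graph with no further vertices. It is applied to the
-- graph on `A ∪ B` with the edges between `A` and `B`, whose cycles are cycles of `G`. The constant
-- `c` is kept outside so that it is the same for all applications.
open SimpleGraph in
theorem UnbalancedSupersaturation.interedges {k : ℕ} {c : ℝ}
    (hc : ∀ (V : Type) [Fintype V] [DecidableEq V] (G : SimpleGraph V) (A B : Finset V),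
      A ∪ B = Finset.univ → G.IsBipartiteWith (A : Set V) (B : Set V) →
      100 * (k : ℝ) * ((A.card : ℝ) + (B.card : ℝ)
          + ((A.card : ℝ) * (B.card : ℝ)) ^ (((k : ℝ) + 1) / (2 * (k : ℝ))))
        ≤ (G.edgeSet.ncard : ℝ) →
      c * ((G.edgeSet.ncard : ℝ) ^ (2 * k) / ((A.card : ℝ) ^ k * (B.card : ℝ) ^ k))
        ≤ (G.copyCount (cycleGraph (2 * k)) : ℝ))
    {V : Type} [Fintype V] [DecidableEq V] (G : SimpleGraph V) [DecidableRel G.Adj]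
    {A B : Finset V} (hAB : Disjoint A B)
    (h : 100 * (k : ℝ) * ((A.card : ℝ) + (B.card : ℝ)
          + ((A.card : ℝ) * (B.card : ℝ)) ^ (((k : ℝ) + 1) / (2 * (k : ℝ))))
        ≤ ((G.interedges A B).card : ℝ)) :
    c * (((G.interedges A B).card : ℝ) ^ (2 * k) / ((A.card : ℝ) ^ k * (B.card : ℝ) ^ k))
        ≤ (G.copyCount (cycleGraph (2 * k)) : ℝ) := by
  set H : SimpleGraph {x // x ∈ A ∪ B} := (G.between A B).comap Subtype.val with hH
  have hadj : ∀ x y, H.Adj x y ↔ G.Adj x y ∧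
      ((x : V) ∈ A ∧ (y : V) ∈ B ∨ (x : V) ∈ B ∧ (y : V) ∈ A) := by
    intro x y
    simp only [hH, comap_adj, between_adj, Finset.mem_coe]
  have hcopy : H.copyCount (cycleGraph (2 * k)) ≤ G.copyCount (cycleGraph (2 * k)) :=
    copyCount_le_of_copy ⟨⟨Subtype.val, fun h => ((hadj _ _).1 h).1⟩, Subtype.val_injective⟩ _
  set A' : Finset {x // x ∈ A ∪ B} := A.subtype _ with hA'
  set B' : Finset {x // x ∈ A ∪ B} := B.subtype _ with hB'
  have cA : A'.card = A.card := by
    rw [hA', Finset.card_subtype, Finset.filter_true_of_mem]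
    intro x hx; exact Finset.mem_union_left _ hx
  have cB : B'.card = B.card := by
    rw [hB', Finset.card_subtype, Finset.filter_true_of_mem]
    intro x hx; exact Finset.mem_union_right _ hx
  have hE : H.edgeSet.ncard = (G.interedges A B).card := by
    rw [← Set.ncard_coe_finset]
    symm
    refine Set.ncard_congr (fun e he => s(⟨e.1, ?_⟩, ⟨e.2, ?_⟩)) ?_ ?_ ?_
    · exact Finset.mem_union_left _ ((mem_interedges_iff G).1 (Finset.mem_coe.1 he)).1
    · exact Finset.mem_union_right _ ((mem_interedges_iff G).1 (Finset.mem_coe.1 he)).2.1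
    · intro e he
      obtain ⟨h1, h2, h3⟩ := (mem_interedges_iff G).1 (Finset.mem_coe.1 he)
      rw [mem_edgeSet, hadj]
      exact ⟨h3, Or.inl ⟨h1, h2⟩⟩
    · rintro ⟨a, b⟩ ⟨a', b'⟩ he he' heq
      obtain ⟨h1, h2, -⟩ := (mem_interedges_iff G).1 (Finset.mem_coe.1 he)
      obtain ⟨h1', h2', -⟩ := (mem_interedges_iff G).1 (Finset.mem_coe.1 he')
      simp only [Sym2.eq_iff, Subtype.mk.injEq] at heq
      rcases heq with ⟨h3, h4⟩ | ⟨h3, h4⟩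
      · rw [h3, h4]
      · rw [h3] at h1
        exact (Finset.disjoint_left.1 hAB h1 h2').elim
    · intro e
      induction e using Sym2.ind with
      | _ x y =>
        intro he
        rw [mem_edgeSet, hadj] at he
        obtain ⟨h1, ⟨h2, h3⟩ | ⟨h2, h3⟩⟩ := he
        · exact ⟨(x, y), Finset.mem_coe.2 ((mem_interedges_iff G).2 ⟨h2, h3, h1⟩), rfl⟩
        · exact ⟨(y, x), Finset.mem_coe.2 ((mem_interedges_iff G).2 ⟨h3, h2, h1.symm⟩), Sym2.eq_swap⟩
  have key := hc _ H A' B' ?_ ?_ ?_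
  · rw [hE, cA, cB] at key
    exact key.trans (by exact_mod_cast hcopy)
  · ext ⟨x, hx⟩
    simpa [hA', hB'] using hx
  · refine ⟨?_, ?_⟩
    · rw [Finset.disjoint_coe, Finset.disjoint_left]
      intro x hx hx'
      rw [hA', Finset.mem_subtype] at hx
      rw [hB', Finset.mem_subtype] at hx'
      exact Finset.disjoint_left.1 hAB hx hx'
    · intro x y hxy
      have := ((hadj _ _).1 hxy).2
      simpa [hA', hB'] using this
  · rw [hE, cA, cB]; exact h

/-- The number of edges between two disjoint sets of vertices of degree at most `τ`. -/
theorem interedges_sq_le {k : ℕ} (hk : 2 ≤ k) {c : ℝ} (hc0 : 0 < c) {V : Type} [Fintype V]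
    [DecidableEq V] (G : SimpleGraph V) [DecidableRel G.Adj] {A B : Finset V} {t m τ : ℝ}
    (hc : 100 * (k : ℝ) * ((A.card : ℝ) + (B.card : ℝ)
          + ((A.card : ℝ) * (B.card : ℝ)) ^ (((k : ℝ) + 1) / (2 * (k : ℝ))))
        ≤ ((G.interedges A B).card : ℝ) →
      c * (((G.interedges A B).card : ℝ) ^ (2 * k) / ((A.card : ℝ) ^ k * (B.card : ℝ) ^ k)) ≤ t)
    (hτ : 0 ≤ τ) (ht : t ≤ τ ^ k) (hm : ((G.interedges A B).card : ℝ) ≤ m)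
    (hmτ : m ^ 2 ≤ τ ^ (k + 1)) (hA : ∀ x ∈ A, (G.degree x : ℝ) ≤ τ)
    (hB : ∀ x ∈ B, (G.degree x : ℝ) ≤ τ) :
    ((G.interedges A B).card : ℝ) ^ 2 ≤
      (1 + 1 / c + (300 * k) ^ 2) * τ * (A.card * B.card) := by
  set e : ℝ := ((G.interedges A B).card : ℝ) with he
  have he0 : 0 ≤ e := Nat.cast_nonneg _
  have hkr : (2 : ℝ) ≤ k := by exact_mod_cast hk
  set a : ℝ := (A.card : ℝ) with ha
  set b : ℝ := (B.card : ℝ) with hb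
  have ha0 : 0 ≤ a := Nat.cast_nonneg _
  have hb0 : 0 ≤ b := Nat.cast_nonneg _
  have hc1 : 0 ≤ 1 / c := by positivity
  set Λ := 1 + 1 / c + (300 * (k : ℝ)) ^ 2 with hΛ
  have hK : (1 : ℝ) ≤ 300 * k := by linarith
  have hKΛ : (300 * (k : ℝ)) ^ 2 ≤ Λ := by rw [hΛ]; linarith
  have hKΛ' : 300 * (k : ℝ) ≤ Λ := le_trans (by nlinarith) hKΛ
  have hΛ0 : 0 ≤ Λ := by linarith
  have heA : e ≤ a * τ := by
    rw [he, SimpleGraph.interedges_def, Finset.card_filter, Finset.sum_product]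
    push_cast
    rw [ha, ← nsmul_eq_mul]
    refine Finset.sum_le_card_nsmul _ _ _ fun x hx => le_trans ?_ (hA x hx)
    rw [Finset.sum_boole, Nat.cast_le, ← SimpleGraph.card_neighborFinset_eq_degree]
    exact Finset.card_le_card fun y hy => by simpa using (Finset.mem_filter.1 hy).2
  have heB : e ≤ b * τ := by
    rw [he, SimpleGraph.interedges_def, Finset.card_filter, Finset.sum_product_right]
    push_cast
    rw [hb, ← nsmul_eq_mul]
    refine Finset.sum_le_card_nsmul _ _ _ fun x hx => le_trans ?_ (hB x hx)
    rw [Finset.sum_boole, Nat.cast_le, ← SimpleGraph.card_neighborFinset_eq_degree]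
    exact Finset.card_le_card fun y hy => by simpa using ((Finset.mem_filter.1 hy).2).symm
  rcases eq_or_lt_of_le he0 with h0 | hpos
  · rw [← h0, zero_pow two_ne_zero]; positivity
  have hapos : 0 < a := by
    by_contra h
    have : a = 0 := le_antisymm (not_lt.1 h) ha0
    rw [this, zero_mul] at heA; linarith
  have hbpos : 0 < b := by
    by_contra h
    have : b = 0 := le_antisymm (not_lt.1 h) hb0
    rw [this, zero_mul] at heB; linarith
  by_cases hd : 100 * (k : ℝ) * (a + b + (a * b) ^ (((k : ℝ) + 1) / (2 * (k : ℝ)))) ≤ e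
  -- Dense case: `c * e ^ (2k) ≤ t * (a * b) ^ k ≤ (τ * a * b) ^ k`, followed by a `k`-th root. As
  -- `1 + 1 / c ≥ 1`, its `k`-th power still dominates `1 / c`.
  · have h1 := (hc hd).trans ht
    have h2 : (e ^ 2) ^ k ≤ ((1 + 1 / c) * τ * (a * b)) ^ k := by
      have h3 : e ^ (2 * k) ≤ 1 / c * τ ^ k * (a ^ k * b ^ k) := by
        rw [← mul_div_assoc, div_le_iff₀ (by positivity)] at h1
        rw [div_mul_eq_mul_div, one_mul, div_mul_eq_mul_div, le_div_iff₀ hc0]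
        linarith
      rw [← pow_mul, mul_pow, mul_pow, mul_pow]
      refine h3.trans ?_
      gcongr
      refine le_trans ?_ (le_self_pow₀ (by linarith) (by omega : k ≠ 0))
      linarith
    have h3 := le_of_pow_le_pow_left₀ (by omega) (by positivity) h2
    refine h3.trans ?_
    gcongr
    rw [hΛ]; nlinarith
  · push Not at hd
    set X := (a * b) ^ (((k : ℝ) + 1) / (2 * (k : ℝ))) with hX
    have hX0 : 0 ≤ X := by positivity
    -- Sparse case: one of the three terms of the threshold accounts for a third of it. If it is `a`
    -- or `b`, multiplying with the degree bound for the other side, `e ≤ b * τ` or `e ≤ a * τ`,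
    -- suffices.
    have hmax : e ≤ 300 * k * a ∨ e ≤ 300 * k * b ∨ e ≤ 300 * k * X := by
      by_contra hcon
      push Not at hcon
      obtain ⟨h1, h2, h3⟩ := hcon
      nlinarith
    rcases hmax with h | h | h
    · calc e ^ 2 = e * e := sq e
        _ ≤ (300 * k * a) * (b * τ) := by gcongr
        _ = (300 * k) * τ * (a * b) := by ring
        _ ≤ _ := by gcongr
    · calc e ^ 2 = e * e := sq e
        _ ≤ (300 * k * b) * (a * τ) := by gcongr
        _ = (300 * k) * τ * (a * b) := by ring
        _ ≤ _ := by gcongr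
    -- If `X` dominates, `2k` of the `2k + 2` factors `e` are bounded by `X`, which gives `(a * b) ^
    -- (k + 1)`. The other two are bounded by `m`, and `m ^ 2 ≤ τ ^ (k + 1)`.
    · have hXp : X ^ (2 * k) = (a * b) ^ (k + 1) := by
        rw [hX, ← Real.rpow_natCast, ← Real.rpow_mul (by positivity), ← Real.rpow_natCast]
        congr 1
        push_cast
        field_simp
      have h1 : (e ^ 2) ^ (k + 1) ≤ ((300 * k) ^ 2 * τ * (a * b)) ^ (k + 1) := by
        calc (e ^ 2) ^ (k + 1) = e ^ (2 * k) * e ^ 2 := by rw [← pow_mul, ← pow_add]; ring_nf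
          _ ≤ (300 * k * X) ^ (2 * k) * m ^ 2 := by gcongr
          _ ≤ (300 * k * X) ^ (2 * k) * τ ^ (k + 1) := by gcongr
          _ = (300 * k) ^ (2 * k) * τ ^ (k + 1) * (a * b) ^ (k + 1) := by
            rw [mul_pow, hXp]; ring
          _ ≤ (300 * k) ^ (2 * (k + 1)) * τ ^ (k + 1) * (a * b) ^ (k + 1) := by
            have := pow_le_pow_right₀ hK (show 2 * k ≤ 2 * (k + 1) by omega)
            gcongr
          _ = ((300 * k) ^ 2 * τ * (a * b)) ^ (k + 1) := by
            rw [mul_pow ((300 * (k : ℝ)) ^ 2 * τ) (a * b), mul_pow ((300 * (k : ℝ)) ^ 2) τ, ← pow_mul]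
      have h3 := le_of_pow_le_pow_left₀ (by omega) (by positivity) h1
      exact h3.trans (mul_le_mul_of_nonneg_right (mul_le_mul_of_nonneg_right hKΛ hτ) (by positivity))

/-! ### From edge counts to a norm bound for the adjacency form -/

namespace WordRAM

/-- The number of edges from `A` to `B`. -/
def edgesBetween (nb : ℕ → List ℕ) (A B : Finset ℕ) : ℕ :=
  ((A ×ˢ B).filter fun e => e.2 ∈ nb e.1).card

/-- Two disjoint sets of vertices of degree at most `τ` span few edges. -/
def EdgeBound (N : ℕ) (nb : ℕ → List ℕ) (τ Λ : ℝ) : Prop :=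
  ∀ A B : Finset ℕ, A ⊆ Finset.range N → B ⊆ Finset.range N → Disjoint A B →
    (∀ x ∈ A, ((nb x).length : ℝ) ≤ τ) → (∀ x ∈ B, ((nb x).length : ℝ) ≤ τ) →
    (edgesBetween nb A B : ℝ) ^ 2 ≤ Λ * (A.card * B.card)

/-- The vertices at which the value of `f` has `a + 1` binary digits. -/
def dyadic (N : ℕ) (f : ℕ → ℕ) (a : ℕ) : Finset ℕ :=
  (Finset.range N).filter fun x => f x ≠ 0 ∧ Nat.log 2 (f x) = a

/-- Cauchy–Schwarz over the `S` classes, which are disjoint. The factor 4 is the square of the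
rounding error in `2 ^ (a + 1) ≤ 2 * f x`. -/
theorem sum_dyadic_sq_le {N S : ℕ} {f : ℕ → ℕ} :
    (∑ a ∈ Finset.range S, (2 : ℝ) ^ (a + 1) * √((dyadic N f a).card : ℝ)) ^ 2 ≤
      4 * S * ∑ x ∈ Finset.range N, (f x : ℝ) ^ 2 := by
  refine sq_sum_le_card_mul_sum_sq.trans ?_
  rw [Finset.card_range, mul_comm 4, mul_assoc]
  refine mul_le_mul_of_nonneg_left ?_ (Nat.cast_nonneg _)
  rw [Finset.mul_sum]
  have h1 : ∀ a ∈ Finset.range S, ((2 : ℝ) ^ (a + 1) * √((dyadic N f a).card : ℝ)) ^ 2 ≤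
      ∑ x ∈ dyadic N f a, 4 * (f x : ℝ) ^ 2 := by
    intro a _
    rw [mul_pow, Real.sq_sqrt (Nat.cast_nonneg _), mul_comm, ← nsmul_eq_mul]
    refine Finset.card_nsmul_le_sum _ _ _ fun x hx => ?_
    obtain ⟨-, h2, h3⟩ := Finset.mem_filter.1 hx
    have h4 : 2 ^ a ≤ f x := by rw [← h3]; exact Nat.pow_log_le_self 2 h2
    have h5 : (2 : ℝ) ^ a ≤ f x := by exact_mod_cast h4
    calc ((2 : ℝ) ^ (a + 1)) ^ 2 = 4 * (2 ^ a) ^ 2 := by ring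
      _ ≤ 4 * (f x : ℝ) ^ 2 := by gcongr
  refine (Finset.sum_le_sum h1).trans ?_
  rw [← Finset.sum_biUnion]
  · refine Finset.sum_le_sum_of_subset_of_nonneg ?_ fun _ _ _ => by positivity
    intro x hx
    obtain ⟨a, -, h⟩ := Finset.mem_biUnion.1 hx
    exact (Finset.mem_filter.1 h).1
  · intro a _ b _ hab
    rw [Function.onFun, Finset.disjoint_left]
    intro x hx hx'
    exact hab ((Finset.mem_filter.1 hx).2.2.symm.trans (Finset.mem_filter.1 hx').2.2)

/-- Round `f x` up to the next power of two; the classes below `S` exhaust all nonzero values. -/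
theorem le_sum_dyadic {N S : ℕ} {f : ℕ → ℕ} (hS : ∀ x, f x < 2 ^ S) {x : ℕ} (hx : x < N) :
    (f x : ℝ) ≤ ∑ a ∈ Finset.range S, if x ∈ dyadic N f a then (2 : ℝ) ^ (a + 1) else 0 := by
  by_cases h0 : f x = 0
  · rw [h0, Nat.cast_zero]
    refine Finset.sum_nonneg fun a _ => ?_
    split_ifs <;> positivity
  · have h1 : x ∈ dyadic N f (Nat.log 2 (f x)) :=
      Finset.mem_filter.2 ⟨Finset.mem_range.2 hx, h0, rfl⟩
    have h2 : Nat.log 2 (f x) ∈ Finset.range S :=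
      Finset.mem_range.2 (Nat.log_lt_of_lt_pow h0 (hS x))
    refine le_trans ?_ (Finset.single_le_sum (fun a _ => ?_) h2)
    · rw [if_pos h1]
      exact_mod_cast (Nat.lt_pow_succ_log_self (by omega) (f x)).le
    · split_ifs <;> positivity

/-- The bilinear form of the adjacency matrix. -/
noncomputable def form (N : ℕ) (nb : ℕ → List ℕ) (f g : ℕ → ℕ) : ℝ :=
  ∑ x ∈ Finset.range N, ∑ y ∈ Finset.range N, if y ∈ nb x then (f x : ℝ) * g y else 0

theorem form_le_dyadic {N S : ℕ} {nb : ℕ → List ℕ} {f g : ℕ → ℕ} (hfS : ∀ x, f x < 2 ^ S)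
    (hgS : ∀ x, g x < 2 ^ S) : form N nb f g ≤ ∑ a ∈ Finset.range S, ∑ b ∈ Finset.range S,
      (2 : ℝ) ^ (a + 1) * 2 ^ (b + 1) * edgesBetween nb (dyadic N f a) (dyadic N g b) := by
  have e1 : ∀ a b, (2 : ℝ) ^ (a + 1) * 2 ^ (b + 1) *
      edgesBetween nb (dyadic N f a) (dyadic N g b) =
      ∑ x ∈ Finset.range N, ∑ y ∈ Finset.range N, if y ∈ nb x then
        (if x ∈ dyadic N f a then (2 : ℝ) ^ (a + 1) else 0) *
        (if y ∈ dyadic N g b then (2 : ℝ) ^ (b + 1) else 0) else 0 := by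
    intro a b
    have hsub : (dyadic N f a ×ˢ dyadic N g b).filter (fun e => e.2 ∈ nb e.1) =
        (Finset.range N ×ˢ Finset.range N).filter (fun e => e.1 ∈ dyadic N f a ∧
          e.2 ∈ dyadic N g b ∧ e.2 ∈ nb e.1) := by
      ext ⟨x, y⟩
      simp only [Finset.mem_filter, Finset.mem_product]
      constructor
      · rintro ⟨⟨h1, h2⟩, h3⟩
        exact ⟨⟨(Finset.mem_filter.1 h1).1, (Finset.mem_filter.1 h2).1⟩, h1, h2, h3⟩
      · rintro ⟨-, h1, h2, h3⟩; exact ⟨⟨h1, h2⟩, h3⟩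
    rw [edgesBetween, hsub, Finset.card_filter, Finset.sum_product, Nat.cast_sum, Finset.mul_sum]
    refine Finset.sum_congr rfl fun x _ => ?_
    rw [Nat.cast_sum, Finset.mul_sum]
    refine Finset.sum_congr rfl fun y _ => ?_
    by_cases h1 : x ∈ dyadic N f a <;> by_cases h2 : y ∈ dyadic N g b <;>
      by_cases h3 : y ∈ nb x <;> simp [h1, h2, h3]
  simp only [e1]
  have e2 : ∑ a ∈ Finset.range S, ∑ b ∈ Finset.range S, ∑ x ∈ Finset.range N,
      ∑ y ∈ Finset.range N, (if y ∈ nb x then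
        (if x ∈ dyadic N f a then (2 : ℝ) ^ (a + 1) else 0) *
        (if y ∈ dyadic N g b then (2 : ℝ) ^ (b + 1) else 0) else 0) =
      ∑ x ∈ Finset.range N, ∑ y ∈ Finset.range N, if y ∈ nb x then
        (∑ a ∈ Finset.range S, if x ∈ dyadic N f a then (2 : ℝ) ^ (a + 1) else 0) *
        (∑ b ∈ Finset.range S, if y ∈ dyadic N g b then (2 : ℝ) ^ (b + 1) else 0) else 0 := by
    rw [Finset.sum_congr rfl fun a _ => Finset.sum_comm, Finset.sum_comm]
    refine Finset.sum_congr rfl fun x _ => ?_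
    rw [Finset.sum_congr rfl fun a _ => Finset.sum_comm, Finset.sum_comm]
    refine Finset.sum_congr rfl fun y _ => ?_
    by_cases h3 : y ∈ nb x
    · simp only [if_pos h3, Finset.sum_mul_sum]
    · simp [h3]
  rw [e2, form]
  refine Finset.sum_le_sum fun x hx => Finset.sum_le_sum fun y hy => ?_
  split_ifs
  · exact mul_le_mul (le_sum_dyadic hfS (Finset.mem_range.1 hx))
      (le_sum_dyadic hgS (Finset.mem_range.1 hy)) (Nat.cast_nonneg _)
      (Finset.sum_nonneg fun a _ => by split_ifs <;> positivity)
  · exact le_rfl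

/-- A bound for edge counts between sets is a bound for the form on indicator functions. Splitting
`f` and `g` into their dyadic level sets extends it to all functions, at the price of the factor `S
^ 2`. The hypothesis `hfg` makes the level sets of `f` and `g` disjoint, as `EdgeBound` requires. -/
theorem form_sq_le {N S : ℕ} {nb : ℕ → List ℕ} {τ Λ : ℝ} (hΛ : 0 ≤ Λ) (hE : EdgeBound N nb τ Λ)
    {f g : ℕ → ℕ} (hfS : ∀ x, f x < 2 ^ S) (hgS : ∀ x, g x < 2 ^ S)
    (hf : ∀ x, f x ≠ 0 → ((nb x).length : ℝ) ≤ τ) (hg : ∀ x, g x ≠ 0 → ((nb x).length : ℝ) ≤ τ)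
    (hfg : ∀ x, f x ≠ 0 → g x = 0) :
    form N nb f g ^ 2 ≤ 16 * S ^ 2 * Λ * (∑ x ∈ Finset.range N, (f x : ℝ) ^ 2) *
      ∑ x ∈ Finset.range N, (g x : ℝ) ^ 2 := by
  have h0 : 0 ≤ form N nb f g :=
    Finset.sum_nonneg fun x _ => Finset.sum_nonneg fun y _ => by split_ifs <;> positivity
  have h1 : form N nb f g ≤ ∑ a ∈ Finset.range S, ∑ b ∈ Finset.range S,
      (2 : ℝ) ^ (a + 1) * 2 ^ (b + 1) * edgesBetween nb (dyadic N f a) (dyadic N g b) := form_le_dyadic hfS hgS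
  have h2 : ∀ a b, (edgesBetween nb (dyadic N f a) (dyadic N g b) : ℝ) ≤
      √Λ * (√((dyadic N f a).card : ℝ) * √((dyadic N g b).card : ℝ)) := by
    intro a b
    rw [← Real.sqrt_mul (Nat.cast_nonneg _), ← Real.sqrt_mul hΛ]
    refine Real.le_sqrt_of_sq_le (hE _ _ (Finset.filter_subset _ _) (Finset.filter_subset _ _) ?_
      (fun x hx => hf x (Finset.mem_filter.1 hx).2.1)
      (fun x hx => hg x (Finset.mem_filter.1 hx).2.1))
    rw [Finset.disjoint_left]
    intro x hx hx'
    exact (Finset.mem_filter.1 hx').2.1 (hfg x (Finset.mem_filter.1 hx).2.1)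
  set F := ∑ a ∈ Finset.range S, (2 : ℝ) ^ (a + 1) * √((dyadic N f a).card : ℝ) with hF
  set H := ∑ a ∈ Finset.range S, (2 : ℝ) ^ (a + 1) * √((dyadic N g a).card : ℝ) with hH
  have h3 : form N nb f g ≤ √Λ * (F * H) := by
    refine h1.trans ?_
    rw [hF, hH, Finset.sum_mul_sum, Finset.mul_sum]
    refine Finset.sum_le_sum fun a _ => ?_
    rw [Finset.mul_sum]
    refine Finset.sum_le_sum fun b _ => ?_
    refine (mul_le_mul_of_nonneg_left (h2 a b) (by positivity)).trans (le_of_eq ?_)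
    ring
  have hF2 := sum_dyadic_sq_le (N := N) (S := S) (f := f)
  have hH2 := sum_dyadic_sq_le (N := N) (S := S) (f := g)
  rw [← hF] at hF2
  rw [← hH] at hH2
  clear_value F H
  set f2 := ∑ x ∈ Finset.range N, (f x : ℝ) ^ 2
  set g2 := ∑ x ∈ Finset.range N, (g x : ℝ) ^ 2
  clear_value f2 g2
  calc form N nb f g ^ 2 ≤ (√Λ * (F * H)) ^ 2 := pow_le_pow_left₀ h0 h3 2
    _ = Λ * (F ^ 2 * H ^ 2) := by rw [mul_pow, Real.sq_sqrt hΛ, mul_pow]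
    _ ≤ Λ * ((4 * S * f2) * (4 * S * g2)) :=
      mul_le_mul_of_nonneg_left (mul_le_mul hF2 hH2 (sq_nonneg _) ((sq_nonneg _).trans hF2)) hΛ
    _ = _ := by ring

/-! ### Second moments of the level multiplicities -/

section levels

variable {N p k S : ℕ} {nb : ℕ → List ℕ} {c : ℕ → ℕ} {W : Finset ℕ}

/-- The number of vertices of `W` around which `x` is in the `i`-th level. -/
def mult (N : ℕ) (nb : ℕ → List ℕ) (p : ℕ) (c : ℕ → ℕ) (W : Finset ℕ) (i x : ℕ) : ℕ :=
  (W.filter fun v => x ∈ lvl N nb p v c i).card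

/-- This is what the rank is designed for: a search from `v` only meets vertices whose degree is at
most that of `v`. -/
theorem length_le_of_key_lt {x v : ℕ} (hv : v < N) (h : key N nb x < key N nb v) :
    (nb x).length ≤ (nb v).length := by
  by_contra hcon
  push Not at hcon
  have := Nat.mul_le_mul_right N (Nat.succ_le_of_lt hcon)
  rw [Nat.succ_mul] at this
  unfold key at h
  omega

theorem length_le_of_mem_lvl {x v i : ℕ} (hv : v < N) (h : x ∈ lvl N nb p v c i) :
    (nb x).length ≤ (nb v).length := by
  cases i with
  | zero => simp only [lvl, Finset.mem_singleton] at h; rw [h]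
  | succ i => exact length_le_of_key_lt hv (mem_lvl_succ.1 h).2.1.2

theorem mult_pos {i x : ℕ} (h : mult N nb p c W i x ≠ 0) : ∃ v ∈ W, x ∈ lvl N nb p v c i := by
  obtain ⟨v, hv⟩ := Finset.card_pos.1 (Nat.pos_of_ne_zero h)
  exact ⟨v, Finset.mem_filter.1 hv⟩

/-- A union bound over the neighbours `y` of `x` in the previous level. -/
theorem mult_succ_le (hW : ∀ v ∈ W, v < N) {i x : ℕ} : mult N nb p c W (i + 1) x ≤
    ∑ y ∈ Finset.range N, if x ∈ nb y then mult N nb p c W i y else 0 := by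
  rw [← Finset.sum_filter]
  refine le_trans (Finset.card_le_card ?_) Finset.card_biUnion_le
  intro v hv
  obtain ⟨hvW, hx⟩ := Finset.mem_filter.1 hv
  obtain ⟨-, -, y, hy, hxy⟩ := mem_lvl_succ.1 hx
  exact Finset.mem_biUnion.2 ⟨y, Finset.mem_filter.2
    ⟨Finset.mem_range.2 (lvl_lt (hW v hvW) hy), hxy⟩, Finset.mem_filter.2 ⟨hvW, hy⟩⟩

/-- One step of the recursion multiplies the squared norm by at most `16 * S ^ 2 * Λ`. For `g = mult
(i + 1)` and `f = mult i`, `mult_succ_le` gives `‖g‖² ≤ form f g`, and `form_sq_le` bounds the right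
side by a multiple of `‖f‖ * ‖g‖`, so one factor `‖g‖` cancels. Different colours give `f` and `g`
disjoint supports. -/
theorem sum_mult_sq_le {τ Λ : ℝ} (hΛ : 0 ≤ Λ) (hE : EdgeBound N nb τ Λ) (hNS : N < 2 ^ S)
    (hW : ∀ v ∈ W, v < N) (hWc : ∀ v ∈ W, v % p = c 0)
    (hWτ : ∀ v ∈ W, ((nb v).length : ℝ) ≤ τ)
    (hinj : ∀ i ≤ k, ∀ j ≤ k, c i = c j → i = j) {i : ℕ} (hi : i ≤ k) :
    ∑ x ∈ Finset.range N, (mult N nb p c W i x : ℝ) ^ 2 ≤ (16 * S ^ 2 * Λ) ^ i * W.card := by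
  have hWN : W.card ≤ N := by
    have : W ⊆ Finset.range N := fun v hv => Finset.mem_range.2 (hW v hv)
    simpa using Finset.card_le_card this
  have hS : ∀ i x, mult N nb p c W i x < 2 ^ S := fun i x =>
    lt_of_le_of_lt ((Finset.card_filter_le _ _).trans hWN) hNS
  have hτ : ∀ i x, mult N nb p c W i x ≠ 0 → ((nb x).length : ℝ) ≤ τ := by
    intro i x h
    obtain ⟨v, hv, hx⟩ := mult_pos h
    exact le_trans (by exact_mod_cast length_le_of_mem_lvl (hW v hv) hx) (hWτ v hv)
  induction i with
  | zero =>
    have h1 : ∀ x, mult N nb p c W 0 x = if x ∈ W then 1 else 0 := by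
      intro x
      simp only [mult, lvl, Finset.mem_singleton, Finset.filter_eq]
      split_ifs <;> simp
    simp only [h1, pow_zero, one_mul]
    rw [show (W.card : ℝ) = ∑ x ∈ W, (1 : ℝ) by simp, ← Finset.sum_filter_add_sum_filter_not
      (Finset.range N) (fun x => x ∈ W)]
    rw [Finset.sum_eq_zero (s := (Finset.range N).filter fun x => x ∉ W), add_zero]
    · refine le_of_eq ?_
      have : (Finset.range N).filter (fun x => x ∈ W) = W := by
        ext x
        simp only [Finset.mem_filter, Finset.mem_range]
        exact ⟨fun h => h.2, fun h => ⟨hW x h, h⟩⟩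
      rw [this]
      refine Finset.sum_congr rfl fun x hx => ?_
      simp [hx]
    · intro x hx
      simp [(Finset.mem_filter.1 hx).2]
  | succ i ih =>
    have ih := ih (by omega)
    set q := ∑ x ∈ Finset.range N, (mult N nb p c W (i + 1) x : ℝ) ^ 2 with hq
    set r := ∑ x ∈ Finset.range N, (mult N nb p c W i x : ℝ) ^ 2 with hr
    have hq0 : 0 ≤ q := Finset.sum_nonneg fun _ _ => by positivity
    have h1 : q ≤ form N nb (mult N nb p c W i) (mult N nb p c W (i + 1)) := by
      rw [hq, form, Finset.sum_comm]
      refine Finset.sum_le_sum fun x _ => ?_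
      have h2 : (mult N nb p c W (i + 1) x : ℝ) ≤
          ∑ y ∈ Finset.range N, if x ∈ nb y then (mult N nb p c W i y : ℝ) else 0 := by
        exact_mod_cast mult_succ_le hW
      rw [sq]
      refine (mul_le_mul_of_nonneg_right h2 (Nat.cast_nonneg _)).trans (le_of_eq ?_)
      rw [Finset.sum_mul]
      refine Finset.sum_congr rfl fun y _ => ?_
      split_ifs <;> simp
    have hcol : ∀ i x, mult N nb p c W i x ≠ 0 → x % p = c i := by
      intro i x h
      obtain ⟨v, hv, hx⟩ := mult_pos h
      cases i with
      | zero => simp only [lvl, Finset.mem_singleton] at hx; rw [hx]; exact hWc v hv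
      | succ i => exact (mem_lvl_succ.1 hx).2.1.1
    have h2 := form_sq_le hΛ hE (hS i) (hS (i + 1)) (hτ i) (hτ (i + 1)) (by
      intro x hx
      by_contra hx'
      have := hinj _ (by omega) _ hi ((hcol i x hx).symm.trans (hcol (i + 1) x hx'))
      omega)
    rw [← hr, ← hq] at h2
    have h3 : q ^ 2 ≤ 16 * S ^ 2 * Λ * r * q := le_trans (by gcongr) h2
    have h4 : q ≤ 16 * S ^ 2 * Λ * r := by
      rcases eq_or_lt_of_le hq0 with h | h
      · rw [← h]
        have : 0 ≤ r := Finset.sum_nonneg fun _ _ => by positivity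
        positivity
      · rw [sq] at h3
        exact le_of_mul_le_mul_right h3 h
    calc q ≤ 16 * S ^ 2 * Λ * r := h4
      _ ≤ 16 * S ^ 2 * Λ * ((16 * S ^ 2 * Λ) ^ i * W.card) := by gcongr
      _ = _ := by ring

end levels

end WordRAM

/-! ### The cost of all searches for one colouring -/

namespace WordRAM

section cost

variable {N p k S m : ℕ} {nb : ℕ → List ℕ} {c : ℕ → ℕ}

theorem lvl_subset {v i : ℕ} (hv : v < N) : lvl N nb p v c i ⊆ Finset.range N := fun _ hx =>
  Finset.mem_range.2 (lvl_lt hv hx)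

theorem sum_length_lvl_eq {W : Finset ℕ} (hW : ∀ v ∈ W, v < N) (i : ℕ) :
    ∑ v ∈ W, ∑ x ∈ lvl N nb p v c i, (nb x).length =
      ∑ x ∈ Finset.range N, mult N nb p c W i x * (nb x).length := by
  have h1 : ∀ v ∈ W, ∑ x ∈ lvl N nb p v c i, (nb x).length =
      ∑ x ∈ Finset.range N, if x ∈ lvl N nb p v c i then (nb x).length else 0 := by
    intro v hv
    rw [← Finset.sum_filter, Finset.filter_mem_eq_inter,
      Finset.inter_eq_right.2 (lvl_subset (hW v hv))]
  rw [Finset.sum_congr rfl h1, Finset.sum_comm]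
  refine Finset.sum_congr rfl fun x _ => ?_
  rw [← Finset.sum_filter, Finset.sum_const, smul_eq_mul, mult]

/-- Double counting, then Cauchy–Schwarz between the multiplicities and the degrees. Only degrees on
the support of the multiplicity matter; these are at most `2 ^ (j + 1)`, so their squares sum to at
most `2 ^ (j + 1) * 2m`. -/
theorem sum_length_lvl_sq_le {τ Λ : ℝ} (hΛ : 0 ≤ Λ) (hE : EdgeBound N nb τ Λ) (hNS : N < 2 ^ S)
    {W : Finset ℕ} (hW : ∀ v ∈ W, v < N) (hWc : ∀ v ∈ W, v % p = c 0)
    (hWτ : ∀ v ∈ W, ((nb v).length : ℝ) ≤ τ) {j : ℕ} (hWj : ∀ v ∈ W, (nb v).length < 2 ^ (j + 1))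
    (hinj : ∀ i ≤ k, ∀ j ≤ k, c i = c j → i = j)
    (hm : ∑ x ∈ Finset.range N, (nb x).length = 2 * m) {i : ℕ} (hi : i ≤ k) :
    ((∑ v ∈ W, ∑ x ∈ lvl N nb p v c i, (nb x).length : ℕ) : ℝ) ^ 2 ≤
      (16 * S ^ 2 * Λ) ^ i * W.card * (2 ^ (j + 1) * (2 * m)) := by
  rw [sum_length_lvl_eq hW]
  have h1 : ((∑ x ∈ Finset.range N, mult N nb p c W i x * (nb x).length : ℕ) : ℝ) =
      ∑ x ∈ Finset.range N, (mult N nb p c W i x : ℝ) *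
        (if mult N nb p c W i x = 0 then 0 else ((nb x).length : ℝ)) := by
    push_cast
    refine Finset.sum_congr rfl fun x _ => ?_
    split_ifs with h
    · simp [h]
    · rfl
  rw [h1]
  refine (Finset.sum_mul_sq_le_sq_mul_sq _ _ _).trans ?_
  refine mul_le_mul (sum_mult_sq_le hΛ hE hNS hW hWc hWτ hinj hi) ?_
    (Finset.sum_nonneg fun _ _ => by positivity) (by positivity)
  have h2 : (2 * m : ℝ) = ∑ x ∈ Finset.range N, ((nb x).length : ℝ) := by exact_mod_cast hm.symm
  rw [h2, Finset.mul_sum]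
  refine Finset.sum_le_sum fun x _ => ?_
  split_ifs with h
  · simp only [ne_eq, OfNat.ofNat_ne_zero, not_false_eq_true, zero_pow]; positivity
  · obtain ⟨v, hv, hx⟩ := mult_pos h
    have h3 : (nb x).length ≤ 2 ^ (j + 1) :=
      (length_le_of_mem_lvl (hW v hv) hx).trans (hWj v hv).le
    have h4 : ((nb x).length : ℝ) ≤ 2 ^ (j + 1) := by exact_mod_cast h3
    rw [sq]
    exact mul_le_mul_of_nonneg_right h4 (Nat.cast_nonneg _)

/-- Assumptions on a graph with `m` edges: `τ ^ k` bounds the number of cycles and of edges. -/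
structure GraphBound (N : ℕ) (nb : ℕ → List ℕ) (k S m : ℕ) (τ C : ℝ) : Prop where
  two_le : 2 ≤ k
  good : GoodNb N nb
  symm : ∀ x < N, ∀ y < N, y ∈ nb x ↔ x ∈ nb y
  sum : ∑ x ∈ Finset.range N, (nb x).length = 2 * m
  le : N ≤ m
  lt_pow : N < 2 ^ S
  one_le : 1 ≤ τ
  sq_le : (m : ℝ) ^ 2 ≤ τ ^ (k + 1)
  const : 1 ≤ C
  edge : EdgeBound N nb τ (C * τ)

/-- A class of top vertices of degree about `2 ^ j` has `O(m / 2 ^ j)` elements, so the factor `2 ^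
j` from the degrees cancels. The square of the cost is at most a constant times `(Y * τ) ^ (k - 1) *
m ^ 2`, where `m ^ 2 ≤ τ ^ (k + 1)` makes the exponents of `τ` add up to `2k`. -/
theorem GraphBound.class_le {τ C : ℝ} (h : GraphBound N nb k S m τ C) (hS : 1 ≤ S)
    (hinj : ∀ i ≤ k, ∀ j ≤ k, c i = c j → i = j) {i : ℕ} (hi : i < k) (j : ℕ) :
    ((∑ v ∈ ((Finset.range N).filter fun v => v % p = c 0).filter
      (fun v => ((nb v).length : ℝ) ≤ τ ∧ Nat.log 2 (nb v).length = j),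
      ∑ x ∈ lvl N nb p v c i, (nb x).length : ℕ) : ℝ) ≤ (16 * S ^ 2 * C) ^ k * τ ^ k := by
  set W := ((Finset.range N).filter fun v => v % p = c 0).filter
      (fun v => ((nb v).length : ℝ) ≤ τ ∧ Nat.log 2 (nb v).length = j) with hWdef
  have hW : ∀ v ∈ W, v < N ∧ v % p = c 0 ∧ ((nb v).length : ℝ) ≤ τ ∧
      Nat.log 2 (nb v).length = j := by
    intro v hv
    simpa only [hWdef, Finset.mem_filter, Finset.mem_range, and_assoc] using hv
  have hτ0 : 0 ≤ τ := zero_le_one.trans h.one_le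
  have hC0 : 0 ≤ C := zero_le_one.trans h.const
  have key := sum_length_lvl_sq_le (k := k) (p := p) (c := c) (i := i) (j := j)
    (mul_nonneg hC0 hτ0) h.edge h.lt_pow
    (fun v hv => (hW v hv).1) (fun v hv => (hW v hv).2.1) (fun v hv => (hW v hv).2.2.1)
    (fun v hv => by
      rw [← (hW v hv).2.2.2]
      exact Nat.lt_pow_succ_log_self (by omega) _) hinj h.sum hi.le
  have hcard : W.card * 2 ^ j ≤ 3 * m := by
    -- The class `j = 0` also contains the isolated vertices, as the logarithm of 0 is 0. Hence the
    -- `+ 1`, whose sum `N ≤ m` turns `2m` into `3m`.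
    have h1 : ∀ v ∈ W, 2 ^ j ≤ (nb v).length + 1 := by
      intro v hv
      by_cases h0 : (nb v).length = 0
      · have := (hW v hv).2.2.2
        rw [h0, Nat.log_zero_right] at this
        rw [← this]; simp
      · rw [← (hW v hv).2.2.2]
        exact (Nat.pow_log_le_self 2 h0).trans (Nat.le_succ _)
    have h2 := Finset.card_nsmul_le_sum W _ _ h1
    have h3 : ∑ v ∈ W, ((nb v).length + 1) ≤ ∑ v ∈ Finset.range N, ((nb v).length + 1) :=
      Finset.sum_le_sum_of_subset fun v hv => Finset.mem_range.2 (hW v hv).1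
    have h4 : ∑ v ∈ Finset.range N, ((nb v).length + 1) = 2 * m + N := by
      rw [Finset.sum_add_distrib, h.sum]; simp
    rw [smul_eq_mul] at h2
    have := h.le
    omega
  have hcard' : (W.card : ℝ) * 2 ^ j ≤ 3 * m := by exact_mod_cast hcard
  set X : ℝ := ((∑ v ∈ W, ∑ x ∈ lvl N nb p v c i, (nb x).length : ℕ) : ℝ)
  have hX0 : 0 ≤ X := Nat.cast_nonneg _
  set Y : ℝ := 16 * S ^ 2 * C with hY
  have hSr : (1 : ℝ) ≤ S := by exact_mod_cast hS
  have hY16 : 16 ≤ Y := by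
    have h1 : (1 : ℝ) ≤ (S : ℝ) ^ 2 := one_le_pow₀ hSr
    have h2 : (1 : ℝ) ≤ (S : ℝ) ^ 2 * C := one_le_mul_of_one_le_of_one_le h1 h.const
    rw [hY, mul_assoc]; linarith
  have hYτ : 1 ≤ Y * τ := one_le_mul_of_one_le_of_one_le (by linarith) h.one_le
  have hm0 : (0 : ℝ) ≤ m := Nat.cast_nonneg _
  have hk := h.two_le
  refine le_of_pow_le_pow_left₀ two_ne_zero (by positivity) ?_
  calc X ^ 2 ≤ (Y * τ) ^ i * W.card * (2 ^ (j + 1) * (2 * m)) := by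
        refine key.trans (le_of_eq ?_); rw [hY]; ring
    _ = (Y * τ) ^ i * ((W.card * 2 ^ j) * (4 * m)) := by ring
    _ ≤ (Y * τ) ^ (k - 1) * (3 * m * (4 * m)) := by
        refine mul_le_mul (pow_le_pow_right₀ hYτ (by omega))
          (mul_le_mul_of_nonneg_right hcard' (by positivity)) (by positivity) (by positivity)
    _ = 12 * (Y * τ) ^ (k - 1) * m ^ 2 := by ring
    _ ≤ Y * (Y * τ) ^ (k - 1) * τ ^ (k + 1) := by
        refine mul_le_mul (mul_le_mul_of_nonneg_right (by linarith) (by positivity)) h.sq_le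
          (by positivity) (by positivity)
    _ = Y ^ k * (τ ^ k) ^ 2 := by
        obtain ⟨k, rfl⟩ : ∃ k', k = k' + 1 := ⟨k - 1, by omega⟩
        simp only [Nat.add_sub_cancel]; ring
    _ ≤ (Y ^ k) ^ 2 * (τ ^ k) ^ 2 := by
        refine mul_le_mul_of_nonneg_right ?_ (by positivity)
        exact le_self_pow₀ (one_le_pow₀ (by linarith)) two_ne_zero
    _ = (Y ^ k * τ ^ k) ^ 2 := by ring

/-- Top vertices of degree above `τ` number at most `2m / τ`, and a level costs each of them at most
`2m`; by `m ^ 2 ≤ τ ^ (k + 1)` this contributes `4 * τ ^ k`. The others fall into `S` dyadic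
classes, each treated by `GraphBound.class_le`. -/
theorem GraphBound.sum_lvl_le {τ C : ℝ} (h : GraphBound N nb k S m τ C) (hS : 1 ≤ S)
    (hinj : ∀ i ≤ k, ∀ j ≤ k, c i = c j → i = j) {i : ℕ} (hi : i < k) :
    ((∑ v ∈ (Finset.range N).filter (fun v => v % p = c 0),
      ∑ x ∈ lvl N nb p v c i, (nb x).length : ℕ) : ℝ) ≤
      (4 + S * (16 * S ^ 2 * C) ^ k) * τ ^ k := by
  set V := (Finset.range N).filter fun v => v % p = c 0 with hV
  have hVN : ∀ v ∈ V, v < N := fun v hv => Finset.mem_range.1 (Finset.mem_filter.1 hv).1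
  have hτ0 : 0 < τ := zero_lt_one.trans_le h.one_le
  rw [← Finset.sum_filter_add_sum_filter_not V (fun v => ((nb v).length : ℝ) ≤ τ), add_comm,
    Nat.cast_add, add_mul]
  refine add_le_add ?_ ?_
  · set H := V.filter fun v => ¬ ((nb v).length : ℝ) ≤ τ with hH
    have h1 : ∀ v ∈ H, ∑ x ∈ lvl N nb p v c i, (nb x).length ≤ 2 * m := by
      intro v hv
      rw [← h.sum]
      exact Finset.sum_le_sum_of_subset (lvl_subset (hVN v (Finset.mem_filter.1 hv).1))
    have h2 := Finset.sum_le_card_nsmul _ _ _ h1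
    have h3 : (H.card : ℝ) * τ ≤ 2 * m := by
      rw [← nsmul_eq_mul]
      have : (2 * m : ℝ) = ∑ x ∈ Finset.range N, ((nb x).length : ℝ) := by exact_mod_cast h.sum.symm
      rw [this]
      refine (Finset.card_nsmul_le_sum H (fun v => ((nb v).length : ℝ)) _ fun v hv =>
        (not_le.1 (Finset.mem_filter.1 hv).2).le).trans ?_
      refine Finset.sum_le_sum_of_subset_of_nonneg ?_ fun _ _ _ => Nat.cast_nonneg _
      intro v hv
      exact Finset.mem_range.2 (hVN v (Finset.mem_filter.1 hv).1)
    have h4 : ((∑ v ∈ H, ∑ x ∈ lvl N nb p v c i, (nb x).length : ℕ) : ℝ) ≤ H.card * (2 * m) := by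
      exact_mod_cast h2
    have h5 := h.sq_le
    have hm0 : (0 : ℝ) ≤ m := Nat.cast_nonneg _
    have h6 : (H.card : ℝ) * (2 * m) * τ ≤ 4 * τ ^ k * τ := by
      calc (H.card : ℝ) * (2 * m) * τ = H.card * τ * (2 * m) := by ring
        _ ≤ 2 * m * (2 * m) := mul_le_mul_of_nonneg_right h3 (by positivity)
        _ = 4 * (m : ℝ) ^ 2 := by ring
        _ ≤ 4 * τ ^ (k + 1) := by linarith
        _ = 4 * τ ^ k * τ := by ring
    exact h4.trans (le_of_mul_le_mul_right h6 hτ0)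
  · have hmaps : ∀ v ∈ V.filter (fun v => ((nb v).length : ℝ) ≤ τ),
        Nat.log 2 (nb v).length ∈ Finset.range S := by
      intro v hv
      have h1 := h.good.length_le (hVN v (Finset.mem_filter.1 hv).1)
      rw [Finset.mem_range]
      by_cases h0 : (nb v).length = 0
      · rw [h0, Nat.log_zero_right]; omega
      · exact Nat.log_lt_of_lt_pow h0 (lt_of_le_of_lt h1 h.lt_pow)
    rw [← Finset.sum_fiberwise_of_maps_to hmaps, Nat.cast_sum]
    have h1 : ∀ j ∈ Finset.range S, ((∑ v ∈ (V.filter (fun v => ((nb v).length : ℝ) ≤ τ)).filter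
        (fun v => Nat.log 2 (nb v).length = j), ∑ x ∈ lvl N nb p v c i, (nb x).length : ℕ) : ℝ) ≤
        (16 * S ^ 2 * C) ^ k * τ ^ k := by
      intro j _
      rw [Finset.filter_filter]
      exact h.class_le hS hinj hi j
    refine (Finset.sum_le_card_nsmul _ _ _ h1).trans (le_of_eq ?_)
    rw [Finset.card_range, nsmul_eq_mul]; ring

/-- Vertices beyond level 0 have a neighbour, so their constant cost is absorbed by their degree.
Only `v` itself may be isolated, which adds 3. -/
theorem exploreCost_le {v : ℕ} (hsymm : ∀ x < N, ∀ y < N, y ∈ nb x ↔ x ∈ nb y)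
    (hv : v < N) : exploreCost N nb p v c k ≤
      6 + 4 * k + 12 * ∑ i ∈ Finset.range k, ∑ x ∈ lvl N nb p v c i, (nb x).length := by
  have h1 : ∀ i ∈ Finset.range k, 4 + ∑ y ∈ lvl N nb p v c i, (3 + 9 * (nb y).length) ≤
      4 + 12 * (∑ x ∈ lvl N nb p v c i, (nb x).length) + if i = 0 then 3 else 0 := by
    intro i _
    cases i with
    | zero => simp only [lvl, Finset.sum_singleton, if_true]; omega
    | succ i =>
      rw [if_neg (by omega), Finset.mul_sum, add_zero]
      refine Nat.add_le_add_left (Finset.sum_le_sum fun x hx => ?_) _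
      obtain ⟨hxN, -, y, hy, hxy⟩ := mem_lvl_succ.1 hx
      have : 0 < (nb x).length :=
        List.length_pos_of_mem ((hsymm _ (lvl_lt hv hy) _ hxN).1 hxy)
      omega
  have h2 := Finset.sum_le_sum h1
  have h4 : ∑ i ∈ Finset.range k, (4 + 12 * (∑ x ∈ lvl N nb p v c i, (nb x).length) +
      if i = 0 then 3 else 0) = k * 4 + 12 * (∑ i ∈ Finset.range k, ∑ x ∈ lvl N nb p v c i,
      (nb x).length) + ∑ i ∈ Finset.range k, if i = 0 then 3 else 0 := by
    rw [Finset.sum_add_distrib, Finset.sum_add_distrib, ← Finset.mul_sum, Finset.sum_const,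
      Finset.card_range, smul_eq_mul]
  have h3 : ∑ i ∈ Finset.range k, (if i = 0 then 3 else 0) ≤ 3 := by
    rw [Finset.sum_ite_eq']; split_ifs <;> omega
  rw [exploreCost]
  omega

/-- Since `τ ≥ 1`, `m ^ 2 ≤ τ ^ (k + 1) ≤ τ ^ (2 * k)`. This absorbs the constant cost per vertex,
as `N ≤ m`. -/
theorem GraphBound.edges_le {τ C : ℝ} (h : GraphBound N nb k S m τ C) : (m : ℝ) ≤ τ ^ k := by
  have hk := h.two_le
  refine le_of_pow_le_pow_left₀ two_ne_zero (pow_nonneg (zero_le_one.trans h.one_le) _)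
    (h.sq_le.trans ?_)
  rw [← pow_mul]
  exact pow_le_pow_right₀ h.one_le (by omega)

theorem GraphBound.sum_exploreCost_le {τ C : ℝ} (h : GraphBound N nb k S m τ C) (hS : 1 ≤ S)
    (hinj : ∀ i ≤ k, ∀ j ≤ k, c i = c j → i = j) :
    ((∑ v ∈ (Finset.range N).filter (fun v => v % p = c 0), exploreCost N nb p v c k : ℕ) : ℝ) ≤
      (6 + 4 * k + 12 * k * (4 + S * (16 * S ^ 2 * C) ^ k)) * τ ^ k := by
  set V := (Finset.range N).filter fun v => v % p = c 0 with hV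
  have hVN : ∀ v ∈ V, v < N := fun v hv => Finset.mem_range.1 (Finset.mem_filter.1 hv).1
  have hVc : V.card ≤ N := by simpa using Finset.card_filter_le (Finset.range N) fun v => v % p = c 0
  have h1 : ∑ v ∈ V, exploreCost N nb p v c k ≤ V.card * (6 + 4 * k) +
      12 * ∑ i ∈ Finset.range k, ∑ v ∈ V, ∑ x ∈ lvl N nb p v c i, (nb x).length := by
    refine (Finset.sum_le_sum fun v hv => exploreCost_le h.symm (hVN v hv)).trans ?_
    rw [Finset.sum_add_distrib, Finset.sum_const, smul_eq_mul, ← Finset.mul_sum, Finset.sum_comm]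
  have h2 : ((∑ i ∈ Finset.range k, ∑ v ∈ V, ∑ x ∈ lvl N nb p v c i, (nb x).length : ℕ) : ℝ) ≤
      k * ((4 + S * (16 * S ^ 2 * C) ^ k) * τ ^ k) := by
    rw [Nat.cast_sum]
    refine (Finset.sum_le_card_nsmul _ _ _ fun i hi =>
      h.sum_lvl_le hS hinj (Finset.mem_range.1 hi)).trans (le_of_eq ?_)
    rw [Finset.card_range, nsmul_eq_mul]
  have h3 : (V.card : ℝ) ≤ τ ^ k := by
    refine le_trans ?_ h.edges_le
    exact_mod_cast hVc.trans h.le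
  have h4 : ((∑ v ∈ V, exploreCost N nb p v c k : ℕ) : ℝ) ≤ V.card * (6 + 4 * k) +
      12 * ((∑ i ∈ Finset.range k, ∑ v ∈ V, ∑ x ∈ lvl N nb p v c i, (nb x).length : ℕ) : ℝ) := by
    exact_mod_cast h1
  have h5 : (V.card : ℝ) * (6 + 4 * k) ≤ τ ^ k * (6 + 4 * k) :=
    mul_le_mul_of_nonneg_right h3 (by positivity)
  refine h4.trans ?_
  rw [add_mul]
  refine add_le_add (h5.trans (le_of_eq (mul_comm _ _))) ?_
  refine (mul_le_mul_of_nonneg_left h2 (by norm_num)).trans (le_of_eq ?_)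
  ring

end cost

end WordRAM

/-! ### Cycles as tuples -/

namespace SimpleGraph

theorem cycleGraph_adj_iff_val {ℓ : ℕ} (hℓ : 3 ≤ ℓ) (u v : Fin ℓ) : (cycleGraph ℓ).Adj u v ↔
    (u : ℕ) + 1 = v ∨ (v : ℕ) + 1 = u ∨ ((u : ℕ) = 0 ∧ (v : ℕ) + 1 = ℓ) ∨
      ((v : ℕ) = 0 ∧ (u : ℕ) + 1 = ℓ) := by
  have key : ∀ a b : Fin ℓ, ((a - b : Fin ℓ) : ℕ) = 1 ↔
      (b : ℕ) + 1 = a ∨ ((a : ℕ) = 0 ∧ (b : ℕ) + 1 = ℓ) := by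
    intro a b
    have ha := a.2
    have hb := b.2
    rw [Fin.val_sub]
    by_cases h : (b : ℕ) ≤ a
    · rw [show ℓ - (b : ℕ) + a = (a - b) + ℓ by omega, Nat.add_mod_right, Nat.mod_eq_of_lt (by omega)]
      omega
    · rw [Nat.mod_eq_of_lt (by omega)]
      omega
  rw [cycleGraph_adj', key, key]
  omega

section copies

variable {V : Type*} {G : SimpleGraph V}

theorem Copy.toSubgraph_adj {W : Type*} {F : SimpleGraph W} (c : Copy F G) {x : W} {b : V} :
    c.toSubgraph.Adj (c x) b ↔ ∃ y, F.Adj x y ∧ c y = b := by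
  simp only [Subgraph.map_adj, Relation.Map, Subgraph.top_adj, Copy.toHom_apply]
  constructor
  · rintro ⟨x', y, h, h1, h2⟩
    have : x' = x := c.injective h1
    subst this
    exact ⟨y, h, h2⟩
  · rintro ⟨y, h, h2⟩
    exact ⟨x, y, h, rfl, h2⟩

theorem Copy.mem_verts_toSubgraph {W : Type*} {F : SimpleGraph W} (c : Copy F G) {b : V} :
    b ∈ c.toSubgraph.verts ↔ ∃ x, c x = b := by
  simp

theorem Copy.toSubgraph_comp_iso {W : Type*} {F : SimpleGraph W} (c : Copy F G) (e : F ≃g F) :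
    (c.comp e.toCopy).toSubgraph = c.toSubgraph := by
  have hv : ∀ b, b ∈ (c.comp e.toCopy).toSubgraph.verts ↔ b ∈ c.toSubgraph.verts := by
    intro b
    rw [mem_verts_toSubgraph, mem_verts_toSubgraph]
    constructor
    · rintro ⟨x, rfl⟩; exact ⟨e x, by simp⟩
    · rintro ⟨x, rfl⟩
      refine ⟨e.symm x, ?_⟩
      rw [comp_apply]
      exact congrArg c (e.apply_symm_apply x)
  ext a b
  · exact hv a
  · simp only [Subgraph.map_adj, Relation.Map, Subgraph.top_adj, Copy.toHom_apply, comp_apply]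
    constructor
    · rintro ⟨x, y, h, rfl, rfl⟩
      exact ⟨e x, e y, e.map_adj_iff.2 h, rfl, rfl⟩
    · rintro ⟨x, y, h, rfl, rfl⟩
      refine ⟨e.symm x, e.symm y, e.symm.map_adj_iff.2 h, ?_, ?_⟩
      · exact congrArg c (e.apply_symm_apply x)
      · exact congrArg c (e.apply_symm_apply y)

/-- A rotation of a cycle. -/
def cycleRot (q : ℕ) (r : Fin (q + 3)) : cycleGraph (q + 3) ≃g cycleGraph (q + 3) where
  toEquiv := Equiv.addLeft r
  map_rel_iff' := by
    intro a b
    simp only [Equiv.coe_addLeft, cycleGraph_adj (n := q + 1), add_sub_add_left_eq_sub]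

/-- A reflection of a cycle. -/
def cycleRefl (q : ℕ) (r : Fin (q + 3)) : cycleGraph (q + 3) ≃g cycleGraph (q + 3) where
  toEquiv := Equiv.subLeft r
  map_rel_iff' := by
    intro a b
    simp only [Equiv.subLeft_apply, cycleGraph_adj (n := q + 1), sub_sub_sub_cancel_left]
    exact or_comm

theorem fin_two_ne_zero (q : ℕ) : (2 : Fin (q + 3)) ≠ 0 := by
  intro h
  have := congrArg Fin.val h
  simp at this
  rw [Nat.mod_eq_of_lt (by omega)] at this
  omega

theorem fin_one_add_one (q : ℕ) : (1 : Fin (q + 3)) + 1 = 2 := by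
  apply Fin.ext
  simp [Fin.val_add]

/-- Every copy of a cycle can be turned so that it begins at its greatest vertex. -/
theorem exists_canonical_copy {ℓ : ℕ} (hℓ : 3 ≤ ℓ) {α : Type*} [LinearOrder α] (f : V → α)
    {β : Type*} [LinearOrder β] {g : V → β} (hg : Function.Injective g)
    (c : Copy (cycleGraph ℓ) G) : ∃ c' : Copy (cycleGraph ℓ) G, c'.toSubgraph = c.toSubgraph ∧
      (∀ i, f (c' i) ≤ f (c' ⟨0, by omega⟩)) ∧
      g (c' ⟨1, by omega⟩) < g (c' ⟨ℓ - 1, by omega⟩) := by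
  obtain ⟨q, rfl⟩ : ∃ q, ℓ = q + 3 := ⟨ℓ - 3, by omega⟩
  obtain ⟨r, hr⟩ := Finite.exists_max fun i => f (c i)
  have h0 : (⟨0, by omega⟩ : Fin (q + 3)) = 0 := rfl
  have h1 : (⟨1, by omega⟩ : Fin (q + 3)) = 1 := rfl
  have hl : (⟨q + 3 - 1, by omega⟩ : Fin (q + 3)) = -1 := by
    rw [← add_eq_zero_iff_eq_neg]
    apply Fin.ext
    simp [Fin.val_add]
  -- The two neighbours of the greatest vertex differ because the length is at least 3.
  have hne : g (c (r + 1)) ≠ g (c (r - 1)) := by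
    intro h
    have h2 := c.injective (hg h)
    have h3 : (2 : Fin (q + 3)) = 0 := by
      have : r + 1 - (r - 1) = 0 := by rw [h2]; simp
      rw [← this, ← fin_one_add_one q]; abel
    exact fin_two_ne_zero q h3
  -- The rotation puts `r + 1` at position 1 and the reflection puts `r - 1` there; the one with the
  -- smaller value of `g` at position 1 is chosen.
  rcases lt_or_gt_of_ne hne with h | h
  · refine ⟨c.comp (cycleRot q r).toCopy, c.toSubgraph_comp_iso _, fun i => ?_, ?_⟩
    · rw [h0]
      have e : c.comp (cycleRot q r).toCopy 0 = c r := by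
        rw [Copy.comp_apply]; exact congrArg c (add_zero r)
      rw [e]; exact hr _
    · rw [h1, hl]
      have e1 : c.comp (cycleRot q r).toCopy 1 = c (r + 1) := Copy.comp_apply _ _ _
      have e2 : c.comp (cycleRot q r).toCopy (-1) = c (r - 1) := by
        rw [Copy.comp_apply]; exact congrArg c (sub_eq_add_neg r 1).symm
      rw [e1, e2]; exact h
  · refine ⟨c.comp (cycleRefl q r).toCopy, c.toSubgraph_comp_iso _, fun i => ?_, ?_⟩
    · rw [h0]
      have e : c.comp (cycleRefl q r).toCopy 0 = c r := by
        rw [Copy.comp_apply]; exact congrArg c (sub_zero r)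
      rw [e]; exact hr _
    · rw [h1, hl]
      have e1 : c.comp (cycleRefl q r).toCopy 1 = c (r - 1) := Copy.comp_apply _ _ _
      have e2 : c.comp (cycleRefl q r).toCopy (-1) = c (r + 1) := by
        rw [Copy.comp_apply]; exact congrArg c (sub_neg_eq_add r 1)
      rw [e1, e2]; exact h

open Fin.CommRing in
/-- A copy of a cycle is determined by its subgraph, its first vertex and its orientation. -/
theorem canonical_copy_unique {ℓ : ℕ} (hℓ : 3 ≤ ℓ) {β : Type*} [LinearOrder β] {g : V → β}
    {c c' : Copy (cycleGraph ℓ) G} (h : c.toSubgraph = c'.toSubgraph)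
    (h0 : c ⟨0, by omega⟩ = c' ⟨0, by omega⟩)
    (hc : g (c ⟨1, by omega⟩) < g (c ⟨ℓ - 1, by omega⟩))
    (hc' : g (c' ⟨1, by omega⟩) < g (c' ⟨ℓ - 1, by omega⟩)) : c = c' := by
  obtain ⟨q, rfl⟩ : ∃ q, ℓ = q + 3 := ⟨ℓ - 3, by omega⟩
  have hl : (⟨q + 3 - 1, by omega⟩ : Fin (q + 3)) = -1 := by
    rw [← add_eq_zero_iff_eq_neg]
    apply Fin.ext
    simp [Fin.val_add]
  change c 0 = c' 0 at h0
  rw [hl] at hc hc'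
  change g (c 1) < g (c (-1)) at hc
  change g (c' 1) < g (c' (-1)) at hc'
  have hadj : ∀ x : Fin (q + 3), (cycleGraph (q + 3)).Adj x (x + 1) := fun x =>
    (cycleGraph_adj (n := q + 1)).2 (Or.inr (by abel))
  have hnb : ∀ {x y : Fin (q + 3)}, (cycleGraph (q + 3)).Adj x y → y = x + 1 ∨ y = x - 1 := by
    intro x y hxy
    rcases (cycleGraph_adj (n := q + 1)).1 hxy with h | h
    · right; rw [← h]; abel
    · left; rw [← h]; abel
  have step : ∀ {x y : Fin (q + 3)}, c x = c' x → (cycleGraph (q + 3)).Adj x y →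
      c' y = c (x + 1) ∨ c' y = c (x - 1) := by
    intro x y hx hxy
    have h1 : c.toSubgraph.Adj (c x) (c' y) := by
      rw [h, hx]; exact c'.toSubgraph_adj.2 ⟨y, hxy, rfl⟩
    obtain ⟨z, hz, hz'⟩ := c.toSubgraph_adj.1 h1
    rcases hnb hz with rfl | rfl
    exacts [Or.inl hz'.symm, Or.inr hz'.symm]
  have h2 := fin_two_ne_zero q
  have h12 := fin_one_add_one q
  -- The neighbours of the common first vertex are the same in both copies; the orientation decides
  -- which of them is at position 1.
  have base : c 1 = c' 1 := by
    have e1 := step h0 (hadj 0)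
    have e2 := step h0 (x := 0) (y := -1) ((cycleGraph_adj (n := q + 1)).2 (Or.inl (by abel)))
    rw [zero_add, zero_sub] at e1 e2
    rcases e1 with e1 | e1
    · exact e1.symm
    · rcases e2 with e2 | e2
      · rw [e1, e2] at hc'
        exact (lt_asymm hc hc').elim
      · have h3 : (1 : Fin (q + 3)) = -1 := c'.injective (e1.trans e2.symm)
        exact (h2 (by rw [← h12]; nth_rw 1 [h3]; abel)).elim
  -- Two consecutive common vertices determine the next one, since it is the neighbour that has not
  -- just been visited.
  have all : ∀ i : ℕ, c (Nat.cast i : Fin (q + 3)) = c' (Nat.cast i : Fin (q + 3)) ∧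
      c ((Nat.cast i : Fin (q + 3)) + 1) = c' ((Nat.cast i : Fin (q + 3)) + 1) := by
    intro i
    induction i with
    | zero => simpa using ⟨h0, base⟩
    | succ i ih =>
      obtain ⟨ih1, ih2⟩ := ih
      push_cast
      refine ⟨ih2, ?_⟩
      rcases step ih2 (hadj _) with e | e
      · exact e.symm
      · rw [add_sub_cancel_right, ih1] at e
        have h3 := c'.injective e
        refine (h2 ?_).elim
        rw [← h12]
        have h4 : (Nat.cast i : Fin (q + 3)) + (1 + 1) = (Nat.cast i : Fin (q + 3)) + 0 := by rw [← add_assoc, add_zero]; exact h3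
        exact add_left_cancel h4
  ext i
  have := (all i).1
  simpa using this

end copies

end SimpleGraph

/-! ### Closed walks with distinct colours are copies of the cycle -/

namespace WordRAM

theorem tup_eq_ofFn {k : ℕ} {σ : ℕ → ℕ} : tup k σ = List.ofFn fun i : Fin k => σ i := by
  refine List.ext_getElem (by simp [tup]) fun i h1 h2 => by simp [tup]

open SimpleGraph

variable {n k p : ℕ} {G : SimpleGraph (Fin n)} {nb : ℕ → List ℕ}

/-- Different positions have different colours, so the walk visits different vertices. -/
theorem exists_copy (hk : 2 ≤ k) (hadj : ∀ x y : Fin n, (y : ℕ) ∈ nb x ↔ G.Adj x y)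
    {col σ : ℕ → ℕ} (h : LCyc n nb p k col σ)
    (hinj : ∀ i < 2 * k, ∀ j < 2 * k, col i = col j → i = j) :
    ∃ c : Copy (cycleGraph (2 * k)) G, ∀ i, (c i : ℕ) = σ i := by
  have hstep : ∀ i (hi : i + 1 < 2 * k), G.Adj ⟨σ i, h.lt i (by omega)⟩ ⟨σ (i + 1), h.lt _ hi⟩ :=
    fun i hi => (hadj _ _).1 (h.adj i hi)
  have hclose : G.Adj ⟨σ (2 * k - 1), h.lt _ (by omega)⟩ ⟨σ 0, h.lt 0 (by omega)⟩ :=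
    (hadj _ _).1 h.close
  refine ⟨⟨⟨fun i => ⟨σ i, h.lt i i.2⟩, ?_⟩, ?_⟩, fun i => rfl⟩
  · intro u v huv
    obtain ⟨u, hu⟩ := u
    obtain ⟨v, hv⟩ := v
    rcases (cycleGraph_adj_iff_val (by omega) _ _).1 huv with e | e | ⟨e1, e2⟩ | ⟨e1, e2⟩
    · dsimp only at e; subst e; exact hstep u hv
    · dsimp only at e; subst e; exact (hstep v hu).symm
    · dsimp only at e1 e2
      subst e1
      have : v = 2 * k - 1 := by omega
      subst this; exact hclose.symm
    · dsimp only at e1 e2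
      subst e1
      have : u = 2 * k - 1 := by omega
      subst this; exact hclose
  · intro u v huv
    have h1 : σ u = σ v := congrArg Fin.val huv
    refine Fin.ext (hinj u u.2 v v.2 ?_)
    rw [← h.col u u.2, ← h.col v v.2, h1]

theorem key_inj {N x y : ℕ} (hx : x < N) (hy : y < N) (h : key N nb x = key N nb y) : x = y := by
  have := congrArg (· % N) h
  simpa [key, Nat.mul_add_mod_self_right, Nat.mod_eq_of_lt hx, Nat.mod_eq_of_lt hy] using this

/-- Every cycle is found if its vertices have different residues. -/
theorem exists_lcyc (hk : 2 ≤ k) (hadj : ∀ x y : Fin n, (y : ℕ) ∈ nb x ↔ G.Adj x y)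
    {c : Copy (cycleGraph (2 * k)) G} (hc : ∀ i, key n nb (c i) ≤ key n nb (c ⟨0, by omega⟩))
    {σ col : ℕ → ℕ} (hσ : ∀ i, (c i : ℕ) = σ i) (hcol : ∀ i < 2 * k, σ i % p = col i) :
    LCyc n nb p k col σ := by
  have hlt : ∀ i < 2 * k, σ i < n := fun i hi => by
    have := (c ⟨i, hi⟩).2
    rwa [hσ] at this
  have hA : ∀ i j (hi : i < 2 * k) (hj : j < 2 * k), (cycleGraph (2 * k)).Adj ⟨i, hi⟩ ⟨j, hj⟩ →
      σ j ∈ nb (σ i) := by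
    intro i j hi hj h
    have := (hadj _ _).2 (c.toHom.map_adj h)
    simpa only [Copy.toHom_apply, hσ] using this
  refine ⟨hlt, hcol, fun i hi => hA i (i + 1) (by omega) hi ?_,
    hA (2 * k - 1) 0 (by omega) (by omega) ?_, fun i h1 h2 => ?_⟩
  · rw [cycleGraph_adj_iff_val (by omega)]; exact Or.inl rfl
  · rw [cycleGraph_adj_iff_val (by omega)]
    exact Or.inr (Or.inr (Or.inr ⟨rfl, by simp only; omega⟩))
  · have h3 := hc ⟨i, h2⟩
    rw [hσ, hσ] at h3
    refine lt_of_le_of_ne h3 fun h => ?_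
    have h4 := key_inj (hlt i h2) (hlt 0 (by omega)) h
    have h5 : c ⟨i, h2⟩ = c ⟨0, by omega⟩ := Fin.ext (by rw [hσ, hσ]; exact h4)
    have h6 := congrArg Fin.val (c.injective h5)
    simp only at h6
    omega

end WordRAM

/-! ### Colourings by residues -/

namespace WordRAM

/-- Every prime power in the factorization of `centralBinom m` is at most `2 * m`. If all numbers up
to `2 * m` divided `D`, so would `centralBinom m`; but `4 ^ m < m * centralBinom m`, which
contradicts `m * D ≤ 4 ^ m`. -/
theorem exists_prime_pow_not_dvd {m D : ℕ} (hm : 4 ≤ m) (hD0 : D ≠ 0) (hD : m * D ≤ 4 ^ m) :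
    ∃ p, 1 ≤ p ∧ p ≤ 2 * m ∧ ¬ p ∣ D := by
  by_contra! h
  have hdvd : m.centralBinom ∣ D := by
    refine (Nat.factorization_prime_le_iff_dvd (Nat.centralBinom_ne_zero m) hD0).1 fun q hq => ?_
    rw [← hq.pow_dvd_iff_le_factorization hD0]
    exact h _ (Nat.pow_pos hq.pos) (Nat.pow_factorization_choose_le (by omega))
  have h1 := Nat.four_pow_lt_mul_centralBinom m hm
  have h2 := Nat.mul_le_mul_left m (Nat.le_of_dvd (Nat.pos_of_ne_zero hD0) hdvd)
  omega

/-- Some small modulus separates any `2 * k` given numbers. -/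
theorem exists_modulus {n k : ℕ} (hk : 2 ≤ k) {σ : ℕ → ℕ} (hlt : ∀ i < 2 * k, σ i < n)
    (hinj : ∀ i < 2 * k, ∀ j < 2 * k, σ i = σ j → i = j) : ∃ p, 1 ≤ p ∧ p < modBound k n ∧
      ∀ i < 2 * k, ∀ j < 2 * k, σ i % p = σ j % p → i = j := by
  set b := Nat.log 2 n + 1 with hb
  have hn : n ≤ 2 ^ b := (Nat.lt_pow_succ_log_self one_lt_two n).le
  -- A modulus that divides some difference of the given numbers divides the product of all of them.
  -- Diagonal entries are replaced by 1 to keep the product nonzero.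
  set d : ℕ × ℕ → ℕ := fun e => if e.1 = e.2 then 1 else ((σ e.1 : ℤ) - σ e.2).natAbs with hd
  set s := Finset.range (2 * k) ×ˢ Finset.range (2 * k) with hs
  have hdle : ∀ e ∈ s, d e ≤ 2 ^ b := by
    rintro ⟨i, j⟩ he
    simp only [hs, Finset.mem_product, Finset.mem_range] at he
    have h1 := hlt i he.1
    have h2 := hlt j he.2
    simp only [hd]
    split_ifs
    · exact Nat.one_le_two_pow
    · omega
  have hd0 : ∀ e ∈ s, d e ≠ 0 := by
    rintro ⟨i, j⟩ he
    simp only [hs, Finset.mem_product, Finset.mem_range] at he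
    simp only [hd]
    split_ifs with h
    · exact one_ne_zero
    · intro h0
      exact h (hinj i he.1 j he.2 (by omega))
  have hprod : ∏ e ∈ s, d e ≤ 2 ^ (4 * k * k * b) := by
    refine (Finset.prod_le_pow_card s d _ hdle).trans (le_of_eq ?_)
    rw [← pow_mul, hs, Finset.card_product, Finset.card_range]
    congr 1; ring
  have hkk : 4 ≤ 4 * k * k * b := by nlinarith [Nat.zero_le (Nat.log 2 n), Nat.mul_le_mul hk hk]
  -- Taken with `m = 4 * k * k * b`: the product has `(2k) ^ 2` factors of at most `2 ^ b`, so it is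
  -- at most `2 ^ m`, and `m * 2 ^ m ≤ 4 ^ m`.
  obtain ⟨p, hp1, hp2, hp⟩ := exists_prime_pow_not_dvd hkk (Finset.prod_ne_zero_iff.2 hd0) (by
    calc _ ≤ 2 ^ (4 * k * k * b) * 2 ^ (4 * k * k * b) :=
          Nat.mul_le_mul Nat.lt_two_pow_self.le hprod
      _ = 4 ^ (4 * k * k * b) := by rw [← mul_pow]; norm_num)
  refine ⟨p, hp1, ?_, fun i hi j hj hij => ?_⟩
  · rw [modBound, ← hb]
    have : 2 * (4 * k * k * b) = 8 * k * k * b := by ring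
    omega
  · by_contra hne
    refine hp (Dvd.dvd.trans ?_ (Finset.dvd_prod_of_mem d (a := (i, j)) (by simp [hs, hi, hj])))
    simp only [hd, if_neg hne]
    rw [← Int.natCast_dvd]
    exact Int.ModEq.dvd (Int.natCast_modEq_iff.2 hij.symm)

theorem dig_succ {p code i : ℕ} : dig p code (i + 1) = dig p (code / p) i := by
  rw [dig, dig, pow_succ', Nat.div_div_eq_div_mul]

theorem exists_code {p : ℕ} (L : ℕ) (r : ℕ → ℕ) (hr : ∀ i < L, r i < p) :
    ∃ code < p ^ L, ∀ i < L, dig p code i = r i := by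
  induction L generalizing r with
  | zero => exact ⟨0, by simp, by simp⟩
  | succ L ih =>
    obtain ⟨code, hcode, h⟩ := ih (fun i => r (i + 1)) fun i hi => hr _ (by omega)
    have h0 := hr 0 (by omega)
    refine ⟨r 0 + p * code, ?_, fun i hi => ?_⟩
    · rw [pow_succ']
      calc r 0 + p * code < p + p * code := by omega
        _ = p * (code + 1) := by ring
        _ ≤ _ := Nat.mul_le_mul_left _ hcode
    · cases i with
      | zero => simp [dig, Nat.mod_eq_of_lt h0]
      | succ i =>
        rw [dig_succ, Nat.add_mul_div_left _ _ (by omega), Nat.div_eq_of_lt h0, zero_add]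
        exact h i (by omega)

/-! ### The cycles that are found -/

open SimpleGraph

variable {n k p : ℕ} {G : SimpleGraph (Fin n)} {nb : ℕ → List ℕ}

/-- The copies of the cycle that the program lists. -/
structure Canonical (nb : ℕ → List ℕ) (hk : 2 ≤ k) (c : Copy (cycleGraph (2 * k)) G) : Prop where
  key : ∀ i, key n nb (c i) ≤ WordRAM.key n nb (c ⟨0, by omega⟩)
  lt : (c ⟨1, by omega⟩ : ℕ) < c ⟨2 * k - 1, by omega⟩

/-- The vertices of a copy of the cycle. -/
def copyTup {ℓ : ℕ} (c : Copy (cycleGraph ℓ) G) : List ℕ := List.ofFn fun i : Fin ℓ => (c i : ℕ)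

/-- One direction is `exists_copy`. Conversely, the vertices of a copy are separated by some modulus
below `modBound`, and their residues are the digits of one of the numbers `code` that are tried. -/
theorem mem_foundBelow (hk : 2 ≤ k) (hadj : ∀ x y : Fin n, (y : ℕ) ∈ nb x ↔ G.Adj x y)
    {t : List ℕ} : t ∈ FoundBelow n nb k (modBound k n) ↔
      ∃ c : Copy (cycleGraph (2 * k)) G, Canonical nb hk c ∧ copyTup c = t := by
  constructor
  · rintro ⟨p, hp1, hp2, code, hcode, hinj, σ, rfl, hσ, ho⟩
    obtain ⟨c, hc⟩ := exists_copy hk hadj hσ hinj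
    refine ⟨c, ⟨fun i => ?_, ?_⟩, ?_⟩
    · rw [hc, hc]
      rcases Nat.eq_zero_or_pos (i : ℕ) with h | h
      · rw [h]
      · exact (hσ.key i h i.2).le
    · rw [hc, hc]; exact ho
    · rw [tup_eq_ofFn, copyTup]
      exact congrArg List.ofFn (funext hc)
  · rintro ⟨c, hc, rfl⟩
    set σ : ℕ → ℕ := fun i => if h : i < 2 * k then c ⟨i, h⟩ else 0 with hσd
    have hσ : ∀ i, (c i : ℕ) = σ i := fun i => by simp [hσd]
    have hlt : ∀ i < 2 * k, σ i < n := fun i hi => by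
      rw [← hσ ⟨i, hi⟩]; exact (c _).2
    have hinj : ∀ i < 2 * k, ∀ j < 2 * k, σ i = σ j → i = j := fun i hi j hj h => by
      rw [← hσ ⟨i, hi⟩, ← hσ ⟨j, hj⟩] at h
      exact congrArg Fin.val (c.injective (Fin.ext h))
    obtain ⟨p, hp1, hp2, hp⟩ := exists_modulus hk hlt hinj
    obtain ⟨code, hcode, hdig⟩ := exists_code (2 * k) (fun i => σ i % p) fun i _ =>
      Nat.mod_lt _ hp1
    refine ⟨p, hp1, hp2, code, hcode, fun i hi j hj h => ?_, σ, ?_, ?_, ?_⟩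
    · rw [hdig i hi, hdig j hj] at h
      exact hp i hi j hj h
    · rw [tup_eq_ofFn, copyTup]
      exact congrArg List.ofFn (funext hσ)
    · exact exists_lcyc hk hadj hc.key hσ fun i hi => (hdig i hi).symm
    · have := hc.lt
      rwa [hσ, hσ] at this

/-- Ranks are injective, so the vertex of highest rank is determined by the subgraph; orientation
and first vertex then determine the copy. -/
theorem Canonical.eq_of_toSubgraph {hk : 2 ≤ k} {c c' : Copy (cycleGraph (2 * k)) G}
    (hc : Canonical nb hk c) (hc' : Canonical nb hk c') (h : c.toSubgraph = c'.toSubgraph) :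
    c = c' := by
  refine canonical_copy_unique (g := Fin.val) (by omega) h ?_ hc.lt hc'.lt
  have h1 : ∃ i, c' i = c ⟨0, by omega⟩ := by
    rw [← Copy.mem_verts_toSubgraph, ← h, Copy.mem_verts_toSubgraph]; exact ⟨_, rfl⟩
  have h2 : ∃ i, c i = c' ⟨0, by omega⟩ := by
    rw [← Copy.mem_verts_toSubgraph, h, Copy.mem_verts_toSubgraph]; exact ⟨_, rfl⟩
  obtain ⟨i, hi⟩ := h1
  obtain ⟨j, hj⟩ := h2
  refine Fin.ext (key_inj (c _).2 (c' _).2 (le_antisymm ?_ ?_) (nb := nb))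
  · rw [← hi]; exact hc'.key i
  · rw [← hj]; exact hc.key j

/-- The tuples written are exactly those of the canonical copies, and every subgraph isomorphic to
the cycle arises from one canonical copy: existence by `exists_canonical_copy`, uniqueness by
`Canonical.eq_of_toSubgraph`. -/
theorem listsCycles_of_outIs (hk : 2 ≤ k) (hadj : ∀ x y : Fin n, (y : ℕ) ∈ nb x ↔ G.Adj x y)
    {s : St} (h : OutIs n (2 * k) (FoundBelow n nb k (modBound k n)) s) :
    ListsCycles G (2 * k) s.out := by
  obtain ⟨l, hl, hnd, hmem⟩ := h.out
  have key : ∀ l : List (List ℕ), (∀ t ∈ l, ∃ c : Copy (cycleGraph (2 * k)) G,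
      Canonical nb hk c ∧ copyTup c = t) → ∃ cs : List (Copy (cycleGraph (2 * k)) G),
        (∀ c ∈ cs, Canonical nb hk c) ∧ cs.map copyTup = l := by
    intro l
    induction l with
    | nil => exact fun _ => ⟨[], by simp, rfl⟩
    | cons t l ih =>
      intro h
      obtain ⟨c, hc, hct⟩ := h t (by simp)
      obtain ⟨cs, h1, h2⟩ := ih fun t ht => h t (by simp [ht])
      exact ⟨c :: cs, by simpa using ⟨hc, h1⟩, by simp [hct, h2]⟩
  obtain ⟨cs, hcs, rfl⟩ := key l fun t ht => (mem_foundBelow hk hadj).1 ((hmem t).1 ht)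
  refine ⟨cs, by rw [hl, List.flatMap_def]; rfl, ?_, fun H hH => ?_⟩
  · exact (hnd.of_map _).map_on fun c hc c' hc' e => (hcs c hc).eq_of_toSubgraph (hcs c' hc') e
  · obtain ⟨c, -, rfl⟩ := Copy.toSubgraph_surjOn hH
    obtain ⟨c', h1, h2, h3⟩ := exists_canonical_copy (by omega) (fun v : Fin n => WordRAM.key n nb v)
      Fin.val_injective c
    have hc' : Canonical nb hk c' := ⟨h2, h3⟩
    have : copyTup c' ∈ cs.map copyTup := (hmem _).2 ((mem_foundBelow hk hadj).2 ⟨c', hc', rfl⟩)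
    obtain ⟨c'', h4, h5⟩ := List.mem_map.1 this
    refine ⟨c'', h4, ?_⟩
    have h6 : c'' = c' := by
      ext i
      have := congrFun (List.ofFn_injective h5) i
      exact this
    rw [h6, h1]

/-- The sets `A v` are disjoint, and their union is injected into `S` by `F`. Finiteness of `U` also
follows from the injection. -/
theorem sum_ncard_le {α β : Type*} {A : ℕ → Set α} (hA : ∀ v v' t, t ∈ A v → t ∈ A v' → v = v')
    {F : α → β} {U : Set α} (hU : ∀ v, A v ⊆ U) (hF : Set.InjOn F U) {S : Finset β}
    (hFS : ∀ t ∈ U, F t ∈ S) (s : Finset ℕ) : ∑ v ∈ s, (A v).ncard ≤ S.card := by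
  classical
  have hUfin : U.Finite :=
    Set.Finite.of_finite_image (S.finite_toSet.subset (by rintro _ ⟨t, ht, rfl⟩; exact hFS t ht)) hF
  have hfin : ∀ v, (A v).Finite := fun v => hUfin.subset (hU v)
  have hcard : ∑ v ∈ s, (A v).ncard = (s.biUnion fun v => (hfin v).toFinset).card := by
    rw [Finset.card_biUnion]
    · exact Finset.sum_congr rfl fun v _ => Set.ncard_eq_toFinset_card _ (hfin v)
    · intro v _ v' _ hne
      rw [Function.onFun, Finset.disjoint_left]
      intro t h1 h2
      rw [Set.Finite.mem_toFinset] at h1 h2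
      exact hne (hA v v' t h1 h2)
  rw [hcard]
  refine Finset.card_le_card_of_injOn F ?_ ?_
  · intro t ht
    obtain ⟨v, -, hv⟩ := Finset.mem_biUnion.1 ht
    exact hFS t (hU v ((hfin v).mem_toFinset.1 hv))
  · intro t ht t' ht'
    obtain ⟨v, -, hv⟩ := Finset.mem_biUnion.1 ht
    obtain ⟨v', -, hv'⟩ := Finset.mem_biUnion.1 ht'
    exact hF (hU v ((hfin v).mem_toFinset.1 hv)) (hU v' ((hfin v').mem_toFinset.1 hv'))

/-- Altogether no more cycles are found for the same colours than there are. -/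
theorem sum_foundAt_le (hk : 2 ≤ k) (hadj : ∀ x y : Fin n, (y : ℕ) ∈ nb x ↔ G.Adj x y)
    {col : ℕ → ℕ} (hinj : ∀ i < 2 * k, ∀ j < 2 * k, col i = col j → i = j) (s : Finset ℕ) :
    ∑ v ∈ s, (FoundAt n nb k p col v).ncard ≤ G.copyCount (cycleGraph (2 * k)) := by
  set U : Set (List ℕ) := {t | ∃ σ, t = tup (2 * k) σ ∧ LCyc n nb p k col σ} with hU
  have hex : ∀ t, ∃ K : G.Subgraph, t ∈ U → ∃ c : Copy (cycleGraph (2 * k)) G, ∃ σ,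
      c.toSubgraph = K ∧ t = tup (2 * k) σ ∧ LCyc n nb p k col σ ∧ ∀ i, (c i : ℕ) = σ i := by
    intro t
    by_cases ht : t ∈ U
    · obtain ⟨σ, rfl, hσ⟩ := ht
      obtain ⟨c, hc⟩ := exists_copy hk hadj hσ hinj
      exact ⟨c.toSubgraph, fun _ => ⟨c, σ, rfl, rfl, hσ, hc⟩⟩
    · exact ⟨⊥, fun h => (ht h).elim⟩
  choose F hF using hex
  -- For fixed distinct colours the vertex at position `i` is the only one of the subgraph with
  -- colour `col i`. So the subgraph determines the walk, with no loss for rotations or reflections.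
  have hFinj : Set.InjOn F U := by
    intro t ht t' ht' h
    obtain ⟨c, σ, hcK, rfl, hσ, hcσ⟩ := hF t ht
    obtain ⟨c', σ', hcK', rfl, hσ', hcσ'⟩ := hF t' ht'
    rw [tup_inj]
    intro i hi
    have h1 : ∃ j, c' j = c ⟨i, hi⟩ := by
      rw [← Copy.mem_verts_toSubgraph, hcK', ← h, ← hcK, Copy.mem_verts_toSubgraph]
      exact ⟨_, rfl⟩
    obtain ⟨j, hj⟩ := h1
    have h2 : σ' j = σ i := by rw [← hcσ', hj, hcσ]
    have h3 : (j : ℕ) = i := hinj j j.2 i hi (by rw [← hσ'.col j j.2, ← hσ.col i hi, h2])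
    rw [← h2, h3]
  rw [copyCount]
  refine sum_ncard_le (U := U) (F := F) ?_ ?_ hFinj ?_ s
  · rintro v v' t ⟨σ, rfl, -, h3⟩ ⟨σ', h4, -, h5⟩
    rw [← h3, ← h5]
    exact tup_inj.1 h4 0 (by omega)
  · exact fun v t ⟨σ, h1, h2, _⟩ => ⟨σ, h1, h2⟩
  · intro t ht
    obtain ⟨c, σ, hcK, -⟩ := hF t ht
    simp only [Finset.mem_filter, Finset.mem_univ, true_and]
    rw [← hcK]
    exact ⟨c.isoToSubgraph⟩

end WordRAM

/-! ### The graph of an edge listing -/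

open SimpleGraph

theorem IsEdgeListing.length_eq {n : ℕ} {G : SimpleGraph (Fin n)} {E : List (Fin n × Fin n)}
    (h : IsEdgeListing G E) : E.length = G.edgeSet.ncard := by
  classical
  have h1 : G.edgeSet = ((E.map fun p => s(p.1, p.2)).toFinset : Set (Sym2 (Fin n))) := by
    ext e
    rw [List.coe_toFinset, Set.mem_ofPred_eq, h.2]
  rw [h1, Set.ncard_coe_finset, List.toFinset_card_of_nodup h.1, List.length_map]

namespace WordRAM

/-- The edges as pairs of natural numbers. -/
def edgePairs {n : ℕ} (E : List (Fin n × Fin n)) : List (ℕ × ℕ) :=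
  E.map fun p => ((p.1 : ℕ), (p.2 : ℕ))

section listing

variable {n : ℕ} {G : SimpleGraph (Fin n)} {E : List (Fin n × Fin n)}

theorem adj_iff_of_listing (h : IsEdgeListing G E) (x y : Fin n) :
    (y : ℕ) ∈ nbOf (edgePairs E) x ↔ G.Adj x y := by
  have key : ∀ x y : Fin n, ((x : ℕ), (y : ℕ)) ∈ edgePairs E ↔ (x, y) ∈ E := by
    intro x y
    simp only [edgePairs, List.mem_map, Prod.mk.injEq, Prod.exists]
    constructor
    · rintro ⟨a, b, hab, h1, h2⟩
      rwa [← Fin.ext h1, ← Fin.ext h2]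
    · exact fun h => ⟨x, y, h, rfl, rfl⟩
  rw [mem_nbOf, key, key, ← mem_edgeSet, ← h.2, List.mem_map]
  constructor
  · rintro (h1 | h1)
    exacts [⟨_, h1, rfl⟩, ⟨_, h1, Sym2.eq_swap⟩]
  · rintro ⟨⟨a, b⟩, h1, h2⟩
    rcases Sym2.eq_iff.1 h2 with ⟨h3, h4⟩ | ⟨h3, h4⟩
    · dsimp only at h3 h4; subst h3; subst h4; exact Or.inl h1
    · dsimp only at h3 h4; subst h3; subst h4; exact Or.inr h1

theorem goodEdges_of_listing (h : IsEdgeListing G E) : GoodEdges n (edgePairs E) := by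
  refine ⟨?_, fun e he => ?_⟩
  · have h1 : (edgePairs E).map (fun e => s(e.1, e.2)) =
        (E.map fun p => s(p.1, p.2)).map (Sym2.map Fin.val) := by
      simp [edgePairs]
    rw [h1]
    exact h.1.map (Sym2.map.injective Fin.val_injective)
  · obtain ⟨⟨a, b⟩, hab, rfl⟩ := List.mem_map.1 he
    have h1 : G.Adj a b := by
      rw [← mem_edgeSet, ← h.2]; exact List.mem_map.2 ⟨_, hab, rfl⟩
    exact ⟨a.2, b.2, fun h2 => h1.ne (Fin.ext h2)⟩

theorem sum_length_nbOf {N : ℕ} {es : List (ℕ × ℕ)} (h : ∀ e ∈ es, e.1 < N ∧ e.2 < N) :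
    ∑ x ∈ Finset.range N, (nbOf es x).length = 2 * es.length := by
  induction es with
  | nil => simp [nbOf]
  | cons e es ih =>
    have h1 : ∀ x, (nbOf (e :: es) x).length =
        (if x = e.1 then 1 else 0) + (if x = e.2 then 1 else 0) + (nbOf es x).length := by
      intro x
      simp only [nbOf, List.flatMap_cons, List.length_append]
      congr 2 <;> split_ifs <;> rfl
    obtain ⟨h2, h3⟩ := h e (by simp)
    simp only [h1, Finset.sum_add_distrib, Finset.sum_ite_eq', Finset.mem_range, h2, h3, if_true,
      ih fun e he => h e (by simp [he]), List.length_cons]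
    ring

theorem length_nbOf_eq_degree [DecidableRel G.Adj] (h : IsEdgeListing G E) (x : Fin n) :
    (nbOf (edgePairs E) x).length = G.degree x := by
  have hg := (goodEdges_of_listing h).goodNb
  rw [← List.toFinset_card_of_nodup (hg.nodup x x.2), ← card_neighborFinset_eq_degree]
  symm
  refine Finset.card_bij (fun y _ => (y : ℕ)) (fun y hy => ?_) (fun _ _ _ _ h => Fin.ext h)
    fun y hy => ?_
  · rw [List.mem_toFinset, adj_iff_of_listing h]
    simpa using hy
  · rw [List.mem_toFinset] at hy
    refine ⟨⟨y, hg.lt x x.2 y hy⟩, ?_, rfl⟩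
    rw [mem_neighborFinset, ← adj_iff_of_listing h]
    exact hy

theorem edgesBetween_eq [DecidableRel G.Adj] (h : IsEdgeListing G E) {A B : Finset ℕ}
    (hA : A ⊆ Finset.range n) (hB : B ⊆ Finset.range n) :
    edgesBetween (nbOf (edgePairs E)) A B =
      (G.interedges (Finset.univ.filter fun x : Fin n => (x : ℕ) ∈ A)
        (Finset.univ.filter fun x : Fin n => (x : ℕ) ∈ B)).card := by
  symm
  refine Finset.card_bij (fun e _ => ((e.1 : ℕ), (e.2 : ℕ))) (fun e he => ?_) (fun e _ e' _ h => ?_)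
    fun e he => ?_
  · rw [mem_interedges_iff] at he
    simp only [Finset.mem_filter, Finset.mem_univ, true_and] at he
    simp only [Finset.mem_filter, Finset.mem_product]
    exact ⟨⟨he.1, he.2.1⟩, (adj_iff_of_listing h _ _).2 he.2.2⟩
  · simp only [Prod.mk.injEq] at h
    exact Prod.ext (Fin.ext h.1) (Fin.ext h.2)
  · obtain ⟨x, y⟩ := e
    simp only [Finset.mem_filter, Finset.mem_product] at he
    have hx := Finset.mem_range.1 (hA he.1.1)
    have hy := Finset.mem_range.1 (hB he.1.2)
    refine ⟨(⟨x, hx⟩, ⟨y, hy⟩), ?_, rfl⟩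
    rw [mem_interedges_iff]
    simp only [Finset.mem_filter, Finset.mem_univ, true_and]
    exact ⟨he.1.1, he.1.2, (adj_iff_of_listing h _ _).1 he.2⟩

theorem card_filter_val_mem {A : Finset ℕ} (hA : A ⊆ Finset.range n) :
    (Finset.univ.filter fun x : Fin n => (x : ℕ) ∈ A).card = A.card := by
  refine Finset.card_bij (fun x _ => (x : ℕ)) (by simp) (fun _ _ _ _ h => Fin.ext h) fun x hx => ?_
  exact ⟨⟨x, Finset.mem_range.1 (hA hx)⟩, by simpa using hx, rfl⟩

/-- For `n ≥ 2` this leaves room for the `2m + 2` input words in the `n * n` cells of the input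
array. -/
theorem two_mul_ncard_le : 2 * G.edgeSet.ncard + n ≤ n * n := by
  classical
  have h1 := G.card_edgeFinset_le_card_choose_two
  rw [Fintype.card_fin, Nat.choose_two_right] at h1
  rw [Set.ncard_eq_toFinset_card', ← SimpleGraph.edgeFinset]
  have h2 : n * (n - 1) + n = n * n := by
    cases n with
    | zero => rfl
    | succ n => simp only [Nat.add_sub_cancel]; ring
  omega

theorem card_interedges_le [DecidableRel G.Adj] {A B : Finset (Fin n)} (hAB : Disjoint A B) :
    (G.interedges A B).card ≤ G.edgeSet.ncard := by
  rw [← Set.ncard_coe_finset]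
  refine Set.ncard_le_ncard_of_injOn (fun e => s(e.1, e.2)) ?_ ?_ (Set.toFinite _)
  · intro e he
    rw [mem_edgeSet]
    exact ((mem_interedges_iff G).1 (Finset.mem_coe.1 he)).2.2
  · rintro ⟨a, b⟩ he ⟨a', b'⟩ he' heq
    obtain ⟨h1, h2, -⟩ := (mem_interedges_iff G).1 (Finset.mem_coe.1 he)
    obtain ⟨h1', h2', -⟩ := (mem_interedges_iff G).1 (Finset.mem_coe.1 he')
    rcases Sym2.eq_iff.1 heq with ⟨h3, h4⟩ | ⟨h3, h4⟩
    · dsimp only at h3 h4; rw [h3, h4]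
    · dsimp only at h1 h2' h3
      rw [h3] at h1
      exact (Finset.disjoint_left.1 hAB h1 h2').elim

/-! ### The initial state -/

theorem length_graphInput : (graphInput n E).length = 2 * E.length + 2 := by
  have : (E.flatMap fun p => [(p.1 : ℕ), (p.2 : ℕ)]).length = 2 * E.length := by
    induction E with
    | nil => rfl
    | cons e E ih => simp only [List.flatMap_cons, List.length_append, ih, List.length_cons,
        List.length_nil]; ring
  simp only [graphInput, List.length_cons, this]

theorem getD_flatMap (E : List (Fin n × Fin n)) (i : ℕ) (h : i < (edgePairs E).length) :
    (E.flatMap fun p => [(p.1 : ℕ), (p.2 : ℕ)]).getD (2 * i) 0 = (edgePairs E)[i].1 ∧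
    (E.flatMap fun p => [(p.1 : ℕ), (p.2 : ℕ)]).getD (2 * i + 1) 0 = (edgePairs E)[i].2 := by
  induction E generalizing i with
  | nil => simp [edgePairs] at h
  | cons e E ih =>
    cases i with
    | zero => exact ⟨rfl, rfl⟩
    | succ i =>
      have h' : i < (edgePairs E).length := by
        simp only [edgePairs, List.map_cons, List.length_cons] at h ⊢; omega
      exact ih i h'

theorem initSt_mem {w a : ℕ} {input : List ℕ} (h : a < n * n) :
    (initSt n w input).mem 0 0 (a / n) (a % n) = input.getD a 0 % 2 ^ w := by
  have hn : 0 < n := by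
    rcases Nat.eq_zero_or_pos n with rfl | h'
    · simp at h
    · exact h'
  have e : addr n 0 0 (a / n) (a % n) = a := by
    simp only [addr, zero_mul, zero_add]
    rw [mul_comm]; exact Nat.div_add_mod a n
  simp only [initSt]
  rw [if_pos ⟨by omega, Nat.div_lt_of_lt_mul h, Nat.mod_lt _ hn⟩, e]

/-- An array with a nonzero number has addresses from `n * n` on, beyond the end of the input. -/
theorem initSt_mem_eq_zero {w : ℕ} (h : 2 * E.length + 2 ≤ n * n) {t r x y : ℕ} (ht : t ≠ 0) :
    (initSt n w (graphInput n E)).mem t r x y = 0 := by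
  simp only [initSt]
  split_ifs
  · rw [List.getD_eq_default, Nat.zero_mod]
    rw [length_graphInput]
    refine h.trans ?_
    simp only [addr]
    have h1 : n ≤ (r * 16 + t) * n + x :=
      (Nat.le_mul_of_pos_left n (by omega)).trans (Nat.le_add_right _ _)
    exact (Nat.mul_le_mul_right n h1).trans (Nat.le_add_right _ _)
  · rfl

theorem initSt_edges {w : ℕ} (h : 2 * E.length + 2 ≤ n * n) (hw : n * n ≤ 2 ^ w)
    (hE : GoodEdges n (edgePairs E)) :
    (initSt n w (graphInput n E)).mem 0 0 (1 / n) (1 % n) = (edgePairs E).length ∧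
      HasEdges n (edgePairs E) (initSt n w (graphInput n E)) := by
  have hlen : (edgePairs E).length = E.length := List.length_map _
  have hn : n ≤ n * n := Nat.le_mul_self n
  refine ⟨?_, ⟨fun i hi => ?_, fun i hi => ?_⟩⟩
  · rw [initSt_mem (by omega), hlen]
    exact Nat.mod_eq_of_lt (a := E.length) (by omega)
  · have h1 := (hE.lt _ (List.getElem_mem hi)).1
    rw [initSt_mem (by omega)]
    have h2 : (graphInput n E).getD (2 * i + 2) 0 = (edgePairs E)[i].1 := (getD_flatMap E i hi).1
    rw [h2, Nat.mod_eq_of_lt (by omega)]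
  · have h1 := (hE.lt _ (List.getElem_mem hi)).2.1
    rw [initSt_mem (by omega)]
    have h2 : (graphInput n E).getD (2 * i + 3) 0 = (edgePairs E)[i].2 := (getD_flatMap E i hi).2
    rw [h2, Nat.mod_eq_of_lt (by omega)]

/-- The program lists the cycles. -/
theorem haltsWith_listCmd {k w D : ℕ} (hk : 2 ≤ k) (h : IsEdgeListing G E) (hn : 2 ≤ n)
    (hB : 16 * n ^ (2 * k) < 2 ^ w)
    (hBr : 16 * (modBound k n * modBound k n ^ (2 * k) * n) * n * n ≤ 2 ^ w)
    (hD : CostLe n (nbOf (edgePairs E)) k D) :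
    ∃ T ys, HaltsWith w (listCmd k).program (graphInput n E) T ys ∧ ListsCycles G (2 * k) ys ∧
      T ≤ (listCmd k).size * (10 + 4 * n + 7 * E.length + modBound k n * (2 * k + 3 +
        modBound k n ^ (2 * k) * colourCost n k D)) + 1 := by
  have hlen : 2 * E.length + 2 ≤ n * n := by
    have := two_mul_ncard_le (G := G)
    rw [h.length_eq]; omega
  have hlen' : (edgePairs E).length = E.length := List.length_map _
  have hn2 : n ≤ n ^ (2 * k) := Nat.le_self_pow (by omega) n
  have hnn : n * n ≤ n ^ (2 * k) := by
    rw [← sq]; exact Nat.pow_le_pow_right (by omega) (by omega)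
  obtain ⟨h1, h2⟩ := initSt_edges (w := w) hlen (by omega) (goodEdges_of_listing h)
  obtain ⟨s, ⟨hs, ht⟩, hrun⟩ := Cmd.haltsWith (N := n) (w := w) (by omega) (listCmd k)
    (graphInput n E) (Nat.mod_eq_of_lt (a := n) (by omega))
    (wp_list_all hk hn hB hBr (goodEdges_of_listing h) (by omega) rfl h1 h2
      (fun t r x y ht => initSt_mem_eq_zero hlen ht) rfl rfl hD)
  refine ⟨_, _, hrun, listsCycles_of_outIs hk (adj_iff_of_listing h) hs, ?_⟩
  rw [hlen'] at ht
  exact Nat.succ_le_succ (Nat.mul_le_mul_left _ ht)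

end listing

end WordRAM

/-! ### The cost for a graph -/

open SimpleGraph

namespace WordRAM

variable {n k : ℕ} {G : SimpleGraph (Fin n)} {E : List (Fin n × Fin n)}

/-- The factor by which the cost for one colouring exceeds the number of cycles. -/
noncomputable def costFactor (k S : ℕ) (C : ℝ) : ℝ :=
  5 * (6 + 4 * k + 12 * k * (4 + S * (16 * S ^ 2 * C) ^ k)) + 10 * k

/-- Both search directions obey the same bound; their weights 1 and 4 add up to the 5 in
`costFactor`. The closed walks found number at most `t ≤ τ ^ k`. -/
theorem GraphBound.costLe {S m D : ℕ} {nb : ℕ → List ℕ} {τ C : ℝ} (h : GraphBound n nb k S m τ C)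
    (hS : 1 ≤ S) (hadj : ∀ x y : Fin n, (y : ℕ) ∈ nb x ↔ G.Adj x y)
    (ht : (G.copyCount (cycleGraph (2 * k)) : ℝ) ≤ τ ^ k) (hD : costFactor k S C * τ ^ k ≤ D) :
    CostLe n nb k D := by
  intro p col _ hinj
  have hk := h.two_le
  have h1 := h.sum_exploreCost_le hS (p := p) (c := col) fun i hi j hj =>
    hinj i (by omega) j (by omega)
  have h2 := h.sum_exploreCost_le hS (p := p) (c := col ∘ back k) fun i hi j hj hij => by
    have := hinj (back k i) (by unfold back; split_ifs <;> omega)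
      (back k j) (by unfold back; split_ifs <;> omega) hij
    unfold back at this
    split_ifs at this <;> omega
  have h3 := sum_foundAt_le (p := p) hk hadj hinj
    ((Finset.range n).filter fun v => v % p = col 0)
  have h4 : ((∑ v ∈ (Finset.range n).filter (fun v => v % p = col 0),
      (FoundAt n nb k p col v).ncard : ℕ) : ℝ) ≤ τ ^ k := le_trans (by exact_mod_cast h3) ht
  have hb : (col ∘ back k) 0 = col 0 := by simp [back]
  rw [hb] at h2
  have key : ((∑ v ∈ (Finset.range n).filter (fun v => v % p = col 0),
      vertexCost n nb k p col v : ℕ) : ℝ) ≤ D := by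
    simp only [vertexCost, Finset.sum_add_distrib, ← Finset.mul_sum]
    refine le_trans ?_ hD
    rw [Nat.cast_add, Nat.cast_add, Nat.cast_mul, Nat.cast_mul, Nat.cast_mul, Nat.cast_ofNat,
      Nat.cast_ofNat, costFactor]
    have h5 := mul_le_mul_of_nonneg_left h4 (by positivity : (0 : ℝ) ≤ 10 * k)
    linarith
  exact_mod_cast key

theorem edgeBound_of_listing {c τ : ℝ} (hk : 2 ≤ k) (hc0 : 0 < c)
    (hc : ∀ (V : Type) [Fintype V] [DecidableEq V] (G : SimpleGraph V) (A B : Finset V),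
      A ∪ B = Finset.univ → G.IsBipartiteWith (A : Set V) (B : Set V) →
      100 * (k : ℝ) * ((A.card : ℝ) + (B.card : ℝ)
          + ((A.card : ℝ) * (B.card : ℝ)) ^ (((k : ℝ) + 1) / (2 * (k : ℝ))))
        ≤ (G.edgeSet.ncard : ℝ) →
      c * ((G.edgeSet.ncard : ℝ) ^ (2 * k) / ((A.card : ℝ) ^ k * (B.card : ℝ) ^ k))
        ≤ (G.copyCount (cycleGraph (2 * k)) : ℝ))
    (h : IsEdgeListing G E) (hτ : 0 ≤ τ)
    (ht : (G.copyCount (cycleGraph (2 * k)) : ℝ) ≤ τ ^ k)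
    (hm : (G.edgeSet.ncard : ℝ) ^ 2 ≤ τ ^ (k + 1)) :
    EdgeBound n (nbOf (edgePairs E)) τ ((1 + 1 / c + (300 * k) ^ 2) * τ) := by
  classical
  intro A B hA hB hAB hdA hdB
  rw [edgesBetween_eq h hA hB, ← card_filter_val_mem hA, ← card_filter_val_mem hB]
  have hdisj : Disjoint (Finset.univ.filter fun x : Fin n => (x : ℕ) ∈ A)
      (Finset.univ.filter fun x : Fin n => (x : ℕ) ∈ B) := by
    rw [Finset.disjoint_left]
    intro x hx hx'
    exact Finset.disjoint_left.1 hAB (Finset.mem_filter.1 hx).2 (Finset.mem_filter.1 hx').2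
  refine interedges_sq_le hk hc0 G (fun h' => UnbalancedSupersaturation.interedges hc G hdisj h') hτ
    ht (by exact_mod_cast card_interedges_le hdisj) hm ?_ ?_
  · intro x hx
    rw [← length_nbOf_eq_degree h]
    exact hdA x (Finset.mem_filter.1 hx).2
  · intro x hx
    rw [← length_nbOf_eq_degree h]
    exact hdB x (Finset.mem_filter.1 hx).2

/-! ### Many edges give many cycles -/

/-- The vertices whose number has a given binary digit. -/
def bitSet (n j : ℕ) (b : Bool) : Finset (Fin n) :=
  Finset.univ.filter fun x => (x : ℕ).testBit j = b

theorem disjoint_bitSet (j : ℕ) : Disjoint (bitSet n j false) (bitSet n j true) := by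
  rw [Finset.disjoint_left]
  intro x hx hx'
  simp only [bitSet, Finset.mem_filter, Finset.mem_univ, true_and] at hx hx'
  simp [hx] at hx'

theorem card_bitSet_add (j : ℕ) : (bitSet n j false).card + (bitSet n j true).card = n := by
  have h := Finset.card_filter_add_card_filter_not (s := (Finset.univ : Finset (Fin n)))
    fun x : Fin n => (x : ℕ).testBit j = false
  simpa [bitSet] using h

/-- The endpoints of an edge differ in some binary digit, so `S` bipartitions together cover all
edges. This takes the place of a random bipartition, at the cost of a factor `S`. -/
theorem ncard_edgeSet_le_sum [DecidableRel G.Adj] {S : ℕ} (hS : n ≤ 2 ^ S) :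
    G.edgeSet.ncard ≤
      ∑ j ∈ Finset.range S, (G.interedges (bitSet n j false) (bitSet n j true)).card := by
  have h1 : G.edgeSet ⊆ (((Finset.range S).biUnion fun j =>
      (G.interedges (bitSet n j false) (bitSet n j true)).image fun e => s(e.1, e.2) :
        Finset (Sym2 (Fin n))) : Set (Sym2 (Fin n))) := by
    intro e he
    induction e using Sym2.ind with
    | _ x y =>
      rw [mem_edgeSet] at he
      obtain ⟨j, hj⟩ : ∃ j, (x : ℕ).testBit j ≠ (y : ℕ).testBit j := by
        by_contra! hcon
        exact he.ne (Fin.ext (Nat.eq_of_testBit_eq hcon))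
      have hjS : j < S := by
        by_contra hcon
        have hlt : ∀ z : Fin n, (z : ℕ) < 2 ^ j := fun z =>
          z.2.trans_le (hS.trans (Nat.pow_le_pow_right two_pos (by omega)))
        rw [Nat.testBit_eq_false_of_lt (hlt x), Nat.testBit_eq_false_of_lt (hlt y)] at hj
        exact hj rfl
      simp only [Finset.coe_biUnion, Set.mem_iUnion, Finset.mem_coe, Finset.mem_range,
        Finset.mem_image, exists_prop, mem_interedges_iff, bitSet, Finset.mem_filter,
        Finset.mem_univ, true_and]
      refine ⟨j, hjS, ?_⟩
      cases hx : (x : ℕ).testBit j with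
      | false =>
        refine ⟨(x, y), ⟨hx, ?_, he⟩, rfl⟩
        rw [hx] at hj; simpa using hj.symm
      | true =>
        refine ⟨(y, x), ⟨?_, hx, he.symm⟩, Sym2.eq_swap⟩
        rw [hx] at hj; simpa using hj.symm
  refine (Set.ncard_le_ncard h1 (Finset.finite_toSet _)).trans ?_
  rw [Set.ncard_coe_finset]
  exact Finset.card_biUnion_le.trans (Finset.sum_le_sum fun j _ => Finset.card_image_le)

/-- If the threshold is met, supersaturation bounds `e ^ (2k)` by `T * (a * b) ^ k / c`, and `a * b
≤ ν ^ 2 ≤ T`. If not, `e` is below the threshold, which is `O(ν ^ ((k + 1) / k))`, and its power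
`2k` is again `O(T ^ (k + 1))`. -/
theorem pow_le_of_supersaturation {c a b e t T ν : ℝ} (hk : 2 ≤ k) (hc0 : 0 < c) (ha : 0 ≤ a)
    (hb : 0 ≤ b) (he : 0 ≤ e) (hab : a + b = ν) (hν : 1 ≤ ν) (heab : e ≤ a * b)
    (h : 100 * (k : ℝ) * (a + b + (a * b) ^ (((k : ℝ) + 1) / (2 * (k : ℝ)))) ≤ e →
      c * (e ^ (2 * k) / (a ^ k * b ^ k)) ≤ t) (htT : t ≤ T) (hT : ν ^ 2 ≤ T) :
    e ^ (2 * k) ≤ (1 / c + (200 * k) ^ (2 * k)) * T ^ (k + 1) := by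
  have hT0 : 0 ≤ T := (sq_nonneg ν).trans hT
  have hkr : (2 : ℝ) ≤ k := by exact_mod_cast hk
  have hν0 : 0 ≤ ν := by linarith
  have habν : a * b ≤ ν ^ 2 := by rw [← hab]; nlinarith
  have hab0 : 0 ≤ a * b := mul_nonneg ha hb
  have hTk : 0 ≤ T ^ (k + 1) := by positivity
  rcases le_or_gt (100 * (k : ℝ) * (a + b + (a * b) ^ (((k : ℝ) + 1) / (2 * (k : ℝ))))) e with h1 | h1
  · have h2 := h h1
    have h3 : e ^ (2 * k) ≤ 1 / c * T ^ (k + 1) := by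
      -- For `a * b = 0` the quotient in the hypothesis is 0 by convention and carries no
      -- information; but then `e = 0` by `heab`.
      rcases hab0.eq_or_lt with h0 | h0
      · have : e = 0 := le_antisymm (by rw [h0]; exact heab) he
        rw [this, zero_pow (by omega)]; positivity
      · rw [← mul_pow, ← mul_div_assoc, div_le_iff₀ (by positivity)] at h2
        rw [div_mul_eq_mul_div, one_mul, le_div_iff₀ hc0, mul_comm, pow_succ']
        refine h2.trans (mul_le_mul htT (pow_le_pow_left₀ hab0 (habν.trans hT) k) (by positivity) hT0)
    refine h3.trans (mul_le_mul_of_nonneg_right ?_ hTk)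
    have : 0 ≤ (200 * (k : ℝ)) ^ (2 * k) := by positivity
    linarith
  · set R : ℝ := (ν ^ 2) ^ (((k : ℝ) + 1) / (2 * (k : ℝ))) with hR
    have hR0 : 0 ≤ R := by positivity
    have hRk : R ^ (2 * k) = (ν ^ 2) ^ (k + 1) := by
      have e : ((k : ℝ) + 1) / (2 * (k : ℝ)) * ((2 * k : ℕ) : ℝ) = ((k + 1 : ℕ) : ℝ) := by
        push_cast
        field_simp
      rw [hR, ← Real.rpow_mul_natCast (by positivity), e, Real.rpow_natCast]
    have h2 : (a * b) ^ (((k : ℝ) + 1) / (2 * (k : ℝ))) ≤ R :=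
      Real.rpow_le_rpow hab0 habν (by positivity)
    have h3 : ν ≤ R := by
      refine le_of_pow_le_pow_left₀ (n := 2 * k) (by omega) hR0 ?_
      rw [hRk, ← pow_mul]
      exact pow_le_pow_right₀ hν (by omega)
    have h4 : e ≤ 200 * k * R := by
      refine h1.le.trans ?_
      have : 100 * (k : ℝ) * (a + b + (a * b) ^ (((k : ℝ) + 1) / (2 * (k : ℝ)))) ≤
          100 * k * (R + R) := mul_le_mul_of_nonneg_left (by linarith) (by positivity)
      linarith
    calc e ^ (2 * k) ≤ (200 * k * R) ^ (2 * k) := pow_le_pow_left₀ he h4 _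
      _ = (200 * k) ^ (2 * k) * (ν ^ 2) ^ (k + 1) := by rw [mul_pow, hRk]
      _ ≤ (200 * k) ^ (2 * k) * T ^ (k + 1) :=
        mul_le_mul_of_nonneg_left (pow_le_pow_left₀ (by positivity) hT _) (by positivity)
      _ ≤ _ := mul_le_mul_of_nonneg_right (by have : 0 ≤ 1 / c := by positivity
                                              linarith) hTk

/-- By pigeonhole one binary digit separates the endpoints of at least a fraction `1 / S` of the
edges; supersaturation is applied to that bipartition. -/
theorem edges_pow_le {c T : ℝ} (hk : 2 ≤ k) (hc0 : 0 < c)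
    (hc : ∀ (V : Type) [Fintype V] [DecidableEq V] (G : SimpleGraph V) (A B : Finset V),
      A ∪ B = Finset.univ → G.IsBipartiteWith (A : Set V) (B : Set V) →
      100 * (k : ℝ) * ((A.card : ℝ) + (B.card : ℝ)
          + ((A.card : ℝ) * (B.card : ℝ)) ^ (((k : ℝ) + 1) / (2 * (k : ℝ))))
        ≤ (G.edgeSet.ncard : ℝ) →
      c * ((G.edgeSet.ncard : ℝ) ^ (2 * k) / ((A.card : ℝ) ^ k * (B.card : ℝ) ^ k))
        ≤ (G.copyCount (cycleGraph (2 * k)) : ℝ))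
    (hn : 1 ≤ n) {S : ℕ} (hS1 : 1 ≤ S) (hS : n ≤ 2 ^ S)
    (ht : (G.copyCount (cycleGraph (2 * k)) : ℝ) ≤ T) (hT : (n : ℝ) ^ 2 ≤ T) :
    (G.edgeSet.ncard : ℝ) ^ (2 * k) ≤
      (1 / c + (200 * k) ^ (2 * k)) * S ^ (2 * k) * T ^ (k + 1) := by
  classical
  obtain ⟨j, hj, hle⟩ : ∃ j ∈ Finset.range S, G.edgeSet.ncard ≤
      S * (G.interedges (bitSet n j false) (bitSet n j true)).card := by
    by_contra! hcon
    have h1 := Finset.sum_lt_sum_of_nonempty (Finset.nonempty_range_iff.2 (by omega)) hcon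
    rw [← Finset.mul_sum, Finset.sum_const, Finset.card_range, smul_eq_mul] at h1
    exact absurd (ncard_edgeSet_le_sum (G := G) hS) (not_le.2 (Nat.lt_of_mul_lt_mul_left h1))
  have hab : ((bitSet n j false).card : ℝ) + (bitSet n j true).card = n := by
    exact_mod_cast card_bitSet_add j
  have h2 := pow_le_of_supersaturation (e := ((G.interedges (bitSet n j false)
    (bitSet n j true)).card : ℝ)) hk hc0 (Nat.cast_nonneg _) (Nat.cast_nonneg _) (Nat.cast_nonneg _)
    hab (by exact_mod_cast hn) (by exact_mod_cast G.card_interedges_le_mul _ _)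
    (fun h' => UnbalancedSupersaturation.interedges hc G (disjoint_bitSet j) h') ht hT
  calc (G.edgeSet.ncard : ℝ) ^ (2 * k) ≤
        (S * ((G.interedges (bitSet n j false) (bitSet n j true)).card : ℝ)) ^ (2 * k) :=
        pow_le_pow_left₀ (Nat.cast_nonneg _) (by exact_mod_cast hle) _
    _ ≤ _ := by
      rw [mul_pow, mul_comm (1 / c + _), mul_assoc]
      exact mul_le_mul_of_nonneg_left h2 (by positivity)

end WordRAM

/-! ### The running time -/

open SimpleGraph

namespace WordRAM

variable {n k : ℕ} {G : SimpleGraph (Fin n)} {E : List (Fin n × Fin n)}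

/-- The time bound, up to logarithmic factors. -/
noncomputable def scale (k : ℕ) (G : SimpleGraph (Fin n)) : ℝ :=
  (G.copyCount (cycleGraph (2 * k)) : ℝ)
    + min ((G.edgeSet.ncard : ℝ) ^ (2 * (k : ℝ) / ((k : ℝ) + 1))) ((n : ℝ) ^ 2)

theorem copyCount_le_scale : (G.copyCount (cycleGraph (2 * k)) : ℝ) ≤ scale k G :=
  le_add_of_nonneg_right (le_min (by positivity) (by positivity))

/-- Both terms of the minimum are at least `m`: the exponent `2k / (k + 1)` is at least 1, and `m ≤
n ^ 2`. -/
theorem ncard_le_scale (hk : 2 ≤ k) (hm : 1 ≤ G.edgeSet.ncard) :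
    (G.edgeSet.ncard : ℝ) ≤ scale k G := by
  have hkr : (2 : ℝ) ≤ k := by exact_mod_cast hk
  refine le_trans (le_min ?_ ?_) (le_add_of_nonneg_left (Nat.cast_nonneg _))
  · conv_lhs => rw [← Real.rpow_one (G.edgeSet.ncard : ℝ)]
    refine Real.rpow_le_rpow_of_exponent_le (by exact_mod_cast hm) ?_
    rw [le_div_iff₀ (by linarith)]
    linarith
  · have := two_mul_ncard_le (G := G)
    have h2 : G.edgeSet.ncard ≤ n ^ 2 := by rw [sq]; omega
    exact_mod_cast h2

/-- The factor in the bound for the number of edges. -/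
noncomputable def edgeFactor (k : ℕ) (c : ℝ) : ℝ := 1 + 1 / c + (200 * k) ^ (2 * k)

theorem one_le_edgeFactor {c : ℝ} (hc0 : 0 < c) : 1 ≤ edgeFactor k c := by
  have h1 : 0 ≤ 1 / c := by positivity
  have h2 : 0 ≤ (200 * (k : ℝ)) ^ (2 * k) := by positivity
  unfold edgeFactor
  linarith

/-- If the minimum in `scale` is the power of `m`, the bound is its definition raised to the power
`k + 1`. If it is `n ^ 2`, then `scale` bounds both `t` and `n ^ 2`, and `edges_pow_le` applies. -/
theorem ncard_pow_le {c : ℝ} (hk : 2 ≤ k) (hc0 : 0 < c)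
    (hc : ∀ (V : Type) [Fintype V] [DecidableEq V] (G : SimpleGraph V) (A B : Finset V),
      A ∪ B = Finset.univ → G.IsBipartiteWith (A : Set V) (B : Set V) →
      100 * (k : ℝ) * ((A.card : ℝ) + (B.card : ℝ)
          + ((A.card : ℝ) * (B.card : ℝ)) ^ (((k : ℝ) + 1) / (2 * (k : ℝ))))
        ≤ (G.edgeSet.ncard : ℝ) →
      c * ((G.edgeSet.ncard : ℝ) ^ (2 * k) / ((A.card : ℝ) ^ k * (B.card : ℝ) ^ k))
        ≤ (G.copyCount (cycleGraph (2 * k)) : ℝ))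
    (hn : 1 ≤ n) {S : ℕ} (hS1 : 1 ≤ S) (hS : n ≤ 2 ^ S) :
    (G.edgeSet.ncard : ℝ) ^ (2 * k) ≤ edgeFactor k c * S ^ (2 * k) * scale k G ^ (k + 1) := by
  have hs0 : 0 ≤ scale k G := (Nat.cast_nonneg _).trans copyCount_le_scale
  have hS1r : (1 : ℝ) ≤ S := by exact_mod_cast hS1
  have hSk : (1 : ℝ) ≤ (S : ℝ) ^ (2 * k) := one_le_pow₀ hS1r
  rcases le_total ((n : ℝ) ^ 2) ((G.edgeSet.ncard : ℝ) ^ (2 * (k : ℝ) / ((k : ℝ) + 1))) with h | h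
  · refine (edges_pow_le hk hc0 hc hn hS1 hS copyCount_le_scale ?_).trans ?_
    · rw [scale, min_eq_right h]
      exact le_add_of_nonneg_left (Nat.cast_nonneg _)
    · refine mul_le_mul_of_nonneg_right (mul_le_mul_of_nonneg_right ?_ (by positivity))
        (by positivity)
      unfold edgeFactor
      linarith
  · have h1 : (G.edgeSet.ncard : ℝ) ^ (2 * (k : ℝ) / ((k : ℝ) + 1)) ≤ scale k G := by
      rw [scale, min_eq_left h]
      exact le_add_of_nonneg_left (Nat.cast_nonneg _)
    have e : 2 * (k : ℝ) / ((k : ℝ) + 1) * ((k + 1 : ℕ) : ℝ) = ((2 * k : ℕ) : ℝ) := by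
      push_cast
      field_simp
    calc (G.edgeSet.ncard : ℝ) ^ (2 * k) =
          ((G.edgeSet.ncard : ℝ) ^ (2 * (k : ℝ) / ((k : ℝ) + 1))) ^ (k + 1) := by
          rw [← Real.rpow_mul_natCast (Nat.cast_nonneg _), e, Real.rpow_natCast]
      _ ≤ scale k G ^ (k + 1) := pow_le_pow_left₀ (by positivity) h1 _
      _ ≤ _ := by
        refine le_mul_of_one_le_left (by positivity) ?_
        exact one_le_mul_of_one_le_of_one_le (one_le_edgeFactor hc0) hSk

/-- The cost for one colouring. -/
theorem costLe_of_listing {c : ℝ} (hk : 2 ≤ k) (hc0 : 0 < c)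
    (hc : ∀ (V : Type) [Fintype V] [DecidableEq V] (G : SimpleGraph V) (A B : Finset V),
      A ∪ B = Finset.univ → G.IsBipartiteWith (A : Set V) (B : Set V) →
      100 * (k : ℝ) * ((A.card : ℝ) + (B.card : ℝ)
          + ((A.card : ℝ) * (B.card : ℝ)) ^ (((k : ℝ) + 1) / (2 * (k : ℝ))))
        ≤ (G.edgeSet.ncard : ℝ) →
      c * ((G.edgeSet.ncard : ℝ) ^ (2 * k) / ((A.card : ℝ) ^ k * (B.card : ℝ) ^ k))
        ≤ (G.copyCount (cycleGraph (2 * k)) : ℝ))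
    (h : IsEdgeListing G E) (hn : 1 ≤ n) (hm : n ≤ G.edgeSet.ncard) {S D : ℕ} (hS1 : 1 ≤ S)
    (hS : n < 2 ^ S)
    (hD : costFactor k S (1 + 1 / c + (300 * k) ^ 2) *
      (edgeFactor k c * S ^ (2 * k) * scale k G) ≤ D) :
    CostLe n (nbOf (edgePairs E)) k D := by
  set T : ℝ := edgeFactor k c * S ^ (2 * k) * scale k G with hT
  have hS1r : (1 : ℝ) ≤ S := by exact_mod_cast hS1
  have hSk : (1 : ℝ) ≤ (S : ℝ) ^ (2 * k) := one_le_pow₀ hS1r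
  have hf : 1 ≤ edgeFactor k c * S ^ (2 * k) :=
    one_le_mul_of_one_le_of_one_le (one_le_edgeFactor hc0) hSk
  have hm1 : (1 : ℝ) ≤ G.edgeSet.ncard := by exact_mod_cast hn.trans hm
  have hs1 : 1 ≤ scale k G := hm1.trans (ncard_le_scale hk (hn.trans hm))
  have hsT : scale k G ≤ T := le_mul_of_one_le_left (by linarith) hf
  have hT1 : 1 ≤ T := hs1.trans hsT
  -- The degree threshold is chosen so that `τ ^ k = T`; the logarithmic factor in `T` is what makes
  -- `m ^ 2 ≤ τ ^ (k + 1)` true.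
  set τ : ℝ := T ^ ((k : ℝ)⁻¹) with hτ
  have hτk : τ ^ k = T := Real.rpow_inv_natCast_pow (by linarith) (by omega)
  have hτ1 : 1 ≤ τ := Real.one_le_rpow hT1 (by positivity)
  -- Raised to the power `k` this reads `m ^ (2k) ≤ T ^ (k + 1)`. It follows from `ncard_pow_le`, as
  -- the factor before `scale` is at least 1.
  have hmτ : (G.edgeSet.ncard : ℝ) ^ 2 ≤ τ ^ (k + 1) := by
    refine le_of_pow_le_pow_left₀ (n := k) (by omega) (by positivity) ?_
    rw [← pow_mul, ← pow_mul, mul_comm (k + 1) k, pow_mul τ k, hτk, mul_comm 2 k, mul_comm k 2]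
    refine (ncard_pow_le hk hc0 hc hn hS1 hS.le).trans ?_
    rw [hT, mul_pow]
    exact mul_le_mul_of_nonneg_right (le_self_pow₀ hf (by omega)) (by positivity)
  have ht : (G.copyCount (cycleGraph (2 * k)) : ℝ) ≤ τ ^ k := by
    rw [hτk]; exact copyCount_le_scale.trans hsT
  have hg := goodEdges_of_listing h
  have hC : 1 ≤ 1 + 1 / c + (300 * (k : ℝ)) ^ 2 := by
    have h1 : 0 ≤ 1 / c := by positivity
    have h2 := sq_nonneg (300 * (k : ℝ))
    linarith
  have hB : GraphBound n (nbOf (edgePairs E)) k S G.edgeSet.ncard τ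
      (1 + 1 / c + (300 * k) ^ 2) := by
    refine ⟨hk, hg.goodNb, fun x _ y _ => ?_, ?_, hm, hS, hτ1, hmτ, hC,
      edgeBound_of_listing hk hc0 hc h (by linarith) ht hmτ⟩
    · rw [mem_nbOf, mem_nbOf, or_comm]
    · rw [sum_length_nbOf fun e he => ⟨(hg.lt e he).1, (hg.lt e he).2.1⟩, edgePairs,
        List.length_map, h.length_eq]
  refine hB.costLe hS1 (adj_iff_of_listing h) ht ?_
  rw [hτk]; exact hD

theorem costFactor_le {S : ℕ} {C : ℝ} (hC : 0 ≤ C) (hS : 1 ≤ S) :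
    costFactor k S C ≤ costFactor k 1 C * S ^ (2 * k + 1) := by
  have hS1 : (1 : ℝ) ≤ S := by exact_mod_cast hS
  have h1 : (1 : ℝ) ≤ (S : ℝ) ^ (2 * k + 1) := one_le_pow₀ hS1
  have h2 : (S : ℝ) * (16 * S ^ 2 * C) ^ k = (16 * C) ^ k * S ^ (2 * k + 1) := by
    rw [mul_right_comm, mul_pow, ← pow_mul]
    ring
  unfold costFactor
  rw [h2]
  simp only [Nat.cast_one, one_pow, mul_one, one_mul]
  have h3 : (16 * C) ^ k ≥ 0 := by positivity
  have h4 : (6 : ℝ) + 4 * k ≤ (6 + 4 * k) * S ^ (2 * k + 1) :=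
    le_mul_of_one_le_right (by positivity) h1
  have h5 : 12 * (k : ℝ) * 4 ≤ (12 * k * 4) * S ^ (2 * k + 1) :=
    le_mul_of_one_le_right (by positivity) h1
  have h6 : 10 * (k : ℝ) ≤ (10 * k) * S ^ (2 * k + 1) := le_mul_of_one_le_right (by positivity) h1
  linarith

/-- The exponent `6k + 2` is `2k + 1` from the moduli and colourings plus `4k + 1` from the cost of
one colouring. All lower terms are absorbed, using `S ≥ 1` and `X ≥ 1`. -/
theorem time_le {N m D L κ : ℕ} {S Y X : ℝ} (hS : 1 ≤ S) (hX : 1 ≤ X) (hY : 0 ≤ Y)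
    (hN : (N : ℝ) ≤ X) (hm : (m : ℝ) ≤ X) (hL : (L : ℝ) ≤ κ * S)
    (hD : (D : ℝ) ≤ Y * S ^ (4 * k + 1) * X) :
    ((10 + 4 * N + 7 * m + L * (2 * k + 3 + L ^ (2 * k) * colourCost N k D) : ℕ) : ℝ) ≤
      (21 + κ * (2 * k + 3) + κ ^ (2 * k + 1) * (8 * k * k + 4 * k + 11 + Y)) *
        S ^ (6 * k + 2) * X := by
  have hL0 : (0 : ℝ) ≤ L := Nat.cast_nonneg _
  have hp : ∀ i, (1 : ℝ) ≤ S ^ i := fun i => one_le_pow₀ hS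
  have hSX : ∀ i, (1 : ℝ) ≤ S ^ i * X := fun i => one_le_mul_of_one_le_of_one_le (hp i) hX
  have hXS : ∀ i, X ≤ S ^ i * X := fun i => le_mul_of_one_le_left (by linarith) (hp i)
  have h1 : ((colourCost N k D : ℕ) : ℝ) ≤ (8 * k * k + 4 * k + 11 + Y) * (S ^ (4 * k + 1) * X) := by
    unfold colourCost
    push_cast
    have h2 : (8 * (k : ℝ) * k + 4 * k + 6) ≤ (8 * k * k + 4 * k + 6) * (S ^ (4 * k + 1) * X) :=
      le_mul_of_one_le_right (by positivity) (hSX _)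
    have h3 := hXS (4 * k + 1)
    have h4 : Y * S ^ (4 * k + 1) * X = Y * (S ^ (4 * k + 1) * X) := mul_assoc _ _ _
    linarith
  have h2 : (L : ℝ) * L ^ (2 * k) ≤ κ ^ (2 * k + 1) * S ^ (2 * k + 1) := by
    rw [← pow_succ', ← mul_pow]
    exact pow_le_pow_left₀ hL0 hL _
  have h3 : (L : ℝ) * L ^ (2 * k) * (colourCost N k D : ℕ) ≤
      κ ^ (2 * k + 1) * S ^ (2 * k + 1) * ((8 * k * k + 4 * k + 11 + Y) * (S ^ (4 * k + 1) * X)) :=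
    mul_le_mul h2 h1 (Nat.cast_nonneg _) (by positivity)
  have h4 : (κ : ℝ) ^ (2 * k + 1) * S ^ (2 * k + 1) *
      ((8 * k * k + 4 * k + 11 + Y) * (S ^ (4 * k + 1) * X)) =
      κ ^ (2 * k + 1) * (8 * k * k + 4 * k + 11 + Y) * (S ^ (6 * k + 2) * X) := by
    rw [show 6 * k + 2 = (2 * k + 1) + (4 * k + 1) by ring, pow_add S]; ring
  have h5 : (L : ℝ) * (2 * k + 3) ≤ κ * (2 * k + 3) * (S ^ (6 * k + 2) * X) := by
    have h6 : S ≤ S ^ (6 * k + 2) * X :=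
      (le_self_pow₀ hS (by omega)).trans (le_mul_of_one_le_right (by positivity) hX)
    calc (L : ℝ) * (2 * k + 3) ≤ κ * S * (2 * k + 3) :=
          mul_le_mul_of_nonneg_right hL (by positivity)
      _ = κ * (2 * k + 3) * S := by ring
      _ ≤ _ := mul_le_mul_of_nonneg_left h6 (by positivity)
  rw [h4] at h3
  have h7 := hXS (6 * k + 2)
  have h8 := hSX (6 * k + 2)
  push_cast
  have h9 : (L : ℝ) * (2 * k + 3 + L ^ (2 * k) * (colourCost N k D : ℕ)) =
      L * (2 * k + 3) + L * L ^ (2 * k) * (colourCost N k D : ℕ) := by ring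
  rw [h9, mul_assoc (21 + _ + _ : ℝ)]
  linarith

theorem modBound_le_pow (hn : 2 ≤ n) : modBound k n ≤ n ^ (8 * k * k + 2) := by
  have h1 : Nat.log 2 n + 1 ≤ n := Nat.log_lt_self 2 (by omega)
  calc modBound k n ≤ 8 * k * k * n + n := Nat.add_le_add (Nat.mul_le_mul_left _ h1) (by omega)
    _ = (8 * k * k + 1) * n := by ring
    _ ≤ 2 ^ (8 * k * k + 1) * n := Nat.mul_le_mul_right _ Nat.lt_two_pow_self.le
    _ ≤ n ^ (8 * k * k + 1) * n := Nat.mul_le_mul_right _ (Nat.pow_le_pow_left hn _)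
    _ = _ := (pow_succ _ _).symm

/-- The exponent in the bound for the number of words. -/
def wordExp (k : ℕ) : ℕ := (8 * k * k + 2) * (2 * k + 1) + 2 * k + 7

/-- Addresses have to cover the marks of all tuples, about `n ^ (2k)`, and the `L ^ (2k + 1) * n`
regions of `16 * n ^ 2` cells. For `n ≥ 2` the factor 16 is at most `n ^ 4`, and `L` is a polynomial
in `n`. -/
theorem word_bounds {B : ℕ} (hn : 2 ≤ n) (hB : n ^ wordExp k ≤ B) :
    16 * n ^ (2 * k) < B ∧
      16 * (modBound k n * modBound k n ^ (2 * k) * n) * n * n ≤ B := by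
  have h16 : 16 ≤ n ^ 4 := by
    calc 16 = 2 ^ 4 := rfl
      _ ≤ n ^ 4 := Nat.pow_le_pow_left hn 4
  constructor
  · refine lt_of_lt_of_le ?_ hB
    calc 16 * n ^ (2 * k) ≤ n ^ 4 * n ^ (2 * k) := Nat.mul_le_mul_right _ h16
      _ = n ^ (4 + 2 * k) := (pow_add _ _ _).symm
      _ < n ^ wordExp k := Nat.pow_lt_pow_right (by omega) (by unfold wordExp; omega)
  · refine le_trans ?_ hB
    calc 16 * (modBound k n * modBound k n ^ (2 * k) * n) * n * n =
          16 * modBound k n ^ (2 * k + 1) * n ^ 3 := by ring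
      _ ≤ n ^ 4 * (n ^ (8 * k * k + 2)) ^ (2 * k + 1) * n ^ 3 := by
        gcongr
        exact modBound_le_pow hn
      _ = n ^ ((8 * k * k + 2) * (2 * k + 1) + 7) := by
        rw [← pow_mul, ← pow_add, ← pow_add]; congr 1; ring
      _ ≤ _ := Nat.pow_le_pow_right (by omega) (by unfold wordExp; omega)

theorem nat_log_add_one_le (hn : 2 ≤ n) :
    ((Nat.log 2 n + 1 : ℕ) : ℝ) ≤ 2 * Real.logb 2 n := by
  have h9 : (1 : ℝ) ≤ Real.logb 2 n := by
    rw [Real.le_logb_iff_rpow_le one_lt_two (by positivity), Real.rpow_one]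
    exact_mod_cast hn
  have h10 : (Nat.log 2 n : ℝ) ≤ Real.logb 2 n := Real.natLog_le_logb n 2
  push_cast
  linarith

theorem total_time_le {T sz W e : ℕ} {Z S X l : ℝ} (hZ : 0 ≤ Z) (hS : 1 ≤ S) (hX : 1 ≤ X)
    (hl : S ≤ 2 * l) (hT : T ≤ sz * W + 1) (hW : (W : ℝ) ≤ Z * S ^ e * X) :
    (T : ℝ) ≤ (sz * Z + 1) * 2 ^ e * X * l ^ e := by
  have h1 : S ^ e ≤ 2 ^ e * l ^ e := by
    rw [← mul_pow]
    exact pow_le_pow_left₀ (by linarith) hl _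
  have h2 : 1 ≤ S ^ e * X := one_le_mul_of_one_le_of_one_le (one_le_pow₀ hS) hX
  have h3 : (T : ℝ) ≤ sz * W + 1 := by exact_mod_cast hT
  have h4 := mul_le_mul_of_nonneg_left hW (Nat.cast_nonneg (α := ℝ) sz)
  calc (T : ℝ) ≤ (sz * Z + 1) * (S ^ e * X) := by linarith
    _ ≤ (sz * Z + 1) * (2 ^ e * l ^ e * X) :=
      mul_le_mul_of_nonneg_left (mul_le_mul_of_nonneg_right h1 (by linarith)) (by positivity)
    _ = _ := by ring

theorem ceil_costFactor_le {S : ℕ} {C f X : ℝ} (hC : 0 ≤ C) (hS : 1 ≤ S) (hf : 0 ≤ f)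
    (hX : 1 ≤ X) : ((⌈costFactor k S C * (f * S ^ (2 * k) * X)⌉₊ : ℕ) : ℝ) ≤
      (costFactor k 1 C * f + 1) * S ^ (4 * k + 1) * X := by
  have hS1r : (1 : ℝ) ≤ S := by exact_mod_cast hS
  have h4 : costFactor k S C * (f * S ^ (2 * k) * X) ≤
      costFactor k 1 C * f * (S ^ (4 * k + 1) * X) := by
    refine (mul_le_mul_of_nonneg_right (costFactor_le hC hS) (by positivity)).trans (le_of_eq ?_)
    rw [show 4 * k + 1 = (2 * k + 1) + 2 * k by ring, pow_add]
    ring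
  have h5 : 0 ≤ costFactor k S C := by unfold costFactor; positivity
  have h6 : (1 : ℝ) ≤ S ^ (4 * k + 1) * X := one_le_mul_of_one_le_of_one_le (one_le_pow₀ hS1r) hX
  have h7 := (Nat.ceil_lt_add_one
    (by positivity : 0 ≤ costFactor k S C * (f * S ^ (2 * k) * X))).le
  rw [mul_assoc (costFactor k 1 C * f + 1), add_mul, one_mul]
  linarith

end WordRAM

/-! ### The theorem -/

open WordRAM in
theorem mainTheorem8 (k : ℕ) (hk : 2 ≤ k) (hconj : UnbalancedSupersaturation k) :
    ∃ (P : WordRAM.Program) (C : ℝ) (e a : ℕ),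
      ∀ (n : ℕ) (G : SimpleGraph (Fin n)) (E : List (Fin n × Fin n)) (w : ℕ),
        0 < n → n ≤ G.edgeSet.ncard → IsEdgeListing G E → n ^ a ≤ 2 ^ w →
        ∃ (T : ℕ) (ys : List ℕ),
          WordRAM.HaltsWith w P (graphInput n E) T ys ∧
          ListsCycles G (2 * k) ys ∧
          (T : ℝ) ≤ C * ((G.copyCount (SimpleGraph.cycleGraph (2 * k)) : ℝ)
              + min ((G.edgeSet.ncard : ℝ) ^ (2 * (k : ℝ) / ((k : ℝ) + 1))) ((n : ℝ) ^ 2))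
            * Real.logb 2 (n : ℝ) ^ e := by
  obtain ⟨c, hc0, hc⟩ := hconj
  set C₀ : ℝ := 1 + 1 / c + (300 * k) ^ 2 with hC₀
  have hC₀0 : 0 ≤ C₀ := by positivity
  have hY0 : 0 ≤ costFactor k 1 C₀ * edgeFactor k c := by
    have := one_le_edgeFactor (k := k) hc0
    refine mul_nonneg ?_ (by linarith)
    unfold costFactor
    positivity
  set Y : ℝ := costFactor k 1 C₀ * edgeFactor k c + 1
  set κ : ℕ := 8 * k * k + 1 with hκ
  set Z : ℝ := 21 + κ * (2 * k + 3) + κ ^ (2 * k + 1) * (8 * k * k + 4 * k + 11 + Y) with hZ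
  have hZ0 : 0 ≤ Z := by positivity
  obtain ⟨sz, hsz⟩ : ∃ sz, (listCmd k).size = sz := ⟨_, rfl⟩
  -- The size `sz` of the command converts ticks into machine steps, and `2 ^ (6 * k + 2)` pays for
  -- replacing the integer `S` by `2 * logb 2 n`.
  refine ⟨(listCmd k).program, (sz * Z + 1) * 2 ^ (6 * k + 2), 6 * k + 2, wordExp k,
    fun n G E w hn hm hE hw => ?_⟩
  -- A graph on one vertex has no edges, so `n ≤ m` excludes it; this keeps `logb 2 n` at least 1.
  have hn2 : 2 ≤ n := by
    have := two_mul_ncard_le (G := G)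
    by_contra hcon
    obtain rfl : n = 1 := by omega
    omega
  obtain ⟨hB, hBr⟩ := word_bounds hn2 hw
  set S : ℕ := Nat.log 2 n + 1 with hS
  have hnS : n < 2 ^ S := Nat.lt_pow_succ_log_self one_lt_two n
  have hS1 : 1 ≤ S := by omega
  have hS1r : (1 : ℝ) ≤ S := by exact_mod_cast hS1
  have hmX := ncard_le_scale hk (hn.trans_le hm)
  have hnX : (n : ℝ) ≤ scale k G := le_trans (by exact_mod_cast hm) hmX
  have hX1 : 1 ≤ scale k G := le_trans (by exact_mod_cast hn) hnX
  set D : ℕ := ⌈costFactor k S C₀ * (edgeFactor k c * S ^ (2 * k) * scale k G)⌉₊ with hD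
  obtain ⟨T, ys, h1, h2, h3⟩ := haltsWith_listCmd (w := w) (D := D) hk hE hn2 hB hBr
    (costLe_of_listing hk hc0 hc hE hn hm hS1 hnS (Nat.le_ceil _))
  rw [hsz] at h3
  refine ⟨T, ys, h1, h2, ?_⟩
  have hDle : (D : ℝ) ≤ Y * S ^ (4 * k + 1) * scale k G :=
    ceil_costFactor_le hC₀0 hS1 (by linarith [one_le_edgeFactor (k := k) hc0]) hX1
  have hLκ : ((modBound k n : ℕ) : ℝ) ≤ κ * S := by
    have : modBound k n ≤ κ * S := by
      rw [modBound, ← hS, hκ, add_mul (8 * k * k), one_mul]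
      exact Nat.add_le_add_left hS1 _
    exact_mod_cast this
  have hmE : (E.length : ℝ) ≤ scale k G := by rw [hE.length_eq]; exact hmX
  have h8 := time_le (k := k) hS1r hX1 (by linarith) hnX hmE hLκ hDle
  rw [← hZ] at h8
  have h9 := total_time_le hZ0 hS1r hX1 (nat_log_add_one_le hn2) h3 h8
  rw [scale] at h9
  exact h9
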